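/- **Setting.** Let $d\ge 1$. Global AdS$_{d+1}$ of unit radius has coordinates $(t,\rho,\Omega)$, $0\le\rho<\pi/2$, $\Omega\in S^{d-1}$, and metric $(\cos\rho)^{-2}(-dt^2+d\rho^2+\sin^2\!\rho\,d\Omega^2)$; its conformal boundary $\rho=\pi/2$ has points $(t,\Omega)$. Put $\Delta_\pm=\frac d2\pm\nu$, $m^2=\nu^2-\frac{d^2}4$, and, for $l\in\mathbb N_0$ and $\omega\in\mathbb R$, $a=\frac{l+\Delta_+-\omega}2$, $b=\frac{l+\Delta_++\omega}2$, $c=l+\frac d2$, $$\Phi_1=\sin^l\!\rho\,\cos^{\Delta_+}\!\rho\;{}_2F_1(a,b;c;\sin^2\!\rho),$$ $$\Phi_3=\sin^l\!\rho\,\cos^{\Delta_+}\!\rho\;{}_2F_1(a,b;a+b+1-c;\cos^2\!\rho),\qquad \Phi_4=\sin^l\!\rho\,\cos^{\Delta_-}\!\rho\;{}_2F_1(c-a,c-b;c-a-b+1;\cos^2\!\rho).$$ A superposition of modes is $\sum_i e^{-i\omega_i t}R_{l_i,\omega_i}(\rho)Y_i(\Omega)$, where $Y_i$ is a spherical harmonic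 of degree $l_i$; its boundary field is $\phi(t,\Omega)=\sum_i e^{-i\omega_i t}Y_i(\Omega)$. The Dirichlet field $\Phi_D(\nu)$ has $R=\Phi_3$ and frequencies $\pm(\Delta_++l+2n)$, the Neumann field $\Phi_N(\nu)$ has $R=\Phi_4$ and frequencies $\pm(\Delta_-+l+2n)$, $n,l\in\mathbb N_0$; the amplitudes are kept fixed as $\nu$ varies. A frequency $\omega$ is a Robin frequency for $\gamma\in[0,\pi)$ and $l$ if $\Phi_1=A\Phi_4+B\Phi_3$ on $(0,\pi/2)$ with $\tan\gamma=A/B$, that is, $A\cos\gamma=B\sin\gamma$. The Robin field $\Phi_R=\cos\gamma\,\Phi_D+\sin\gamma\,\Phi_N$ is, mode by mode, the superposition with $R=\cos\gamma\,\Phi_3+\sin\gamma\,\Phi_4$ and real Robin frequencies. **1. Fields (all $d\ge1$, $0<\nu<1$).** $\Phi_3$ and $\Phi_4$ solve the radial Klein–Gordon equation on $0<\rho<\pi/2$; the Dirichlet and Neumann frequencies are Robin frequencies for $\gamma=0$ and $\gamma=\pi/2$. The Neumann radial solution, frequencies and field as functions of $\nu$ are the Dirichlet ones at $-\nu$: $$\Phi_N(\nu)=\Phi_D(-\nu).$$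 **2. Kernels ($d$ odd).** For a bulk point $X'=(t',\rho',\Omega')$ let $$\hat\sigma(t,\Omega)=\lim_{\rho\to\pi/2}\sigma\cos\rho=\frac{\cos(t-t')-\sin\rho'\,\Omega\cdot\Omega'}{\cos\rho'},\qquad t^\pm(\Omega)=t'\pm\arccos(\sin\rho'\,\Omega\cdot\Omega');$$ a boundary point is spacelike separated from $X'$ when $t^-<t<t^+$. Let $$C(\Delta)=\frac{(-1)^{(d-1)/2}2^{\Delta-d-1}\Gamma(\Delta-\frac d2+1)}{\pi^{d/2}\,\Gamma(\Delta-d+1)},$$ with $1/\Gamma=0$ at the poles of $\Gamma$. For $\nu>\frac d2-1$ the Dirichlet kernel is $C(\Delta_+)\hat\sigma^{\Delta_+-d}$ at spacelike separation and $0$ elsewhere. Boundary functions are functions $f(t,\Omega)$ that are smooth in $t$ with all $t$-derivatives jointly continuous; the Dirichlet kernel is integrable against each of them. There is a family of functionals $K^\nu_{X'}$ on boundary functions such that, for each $X'$ and $f$, $\nu\mapsto K^\nu_{X'}[f]$ is analytic on $(-1,\infty)$ and equals the integral of $f$ against the Dirichlet kernel for $\nu>\frac d2-1$. For every such family put $K_D=K^\nu$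 and $K_N=K^{-\nu}$, and for $N\in\mathbb N_0$ $$I_N(\Delta)=C(\Delta)\int_{S^{d-1}}\!d\Omega\,\lim_{\epsilon\to0^+}\Big(\sum_{j=0}^{N-1}(b_j^++b_j^-)\frac{\epsilon^{\Delta-d+1+j}}{\Delta-d+1+j}+\int_{t^-+\epsilon}^{t^+-\epsilon}f(t,\Omega)\,\hat\sigma^{\Delta-d}\,dt\Big),$$ where $b_j^\pm$ are the Taylor coefficients at $u=0$ of $f(t^\pm\mp u,\Omega)\,\big(\hat\sigma(t^\pm\mp u,\Omega)/u\big)^{\Delta-d}$. Then, the limits existing and being integrable over the sphere: * $K_D[f]=I_{n_0}(\Delta_+)$ with $n_0=\frac{d-1}2$ for all $\nu>0$ for which no denominator $\Delta_+-d+1+j$, $j<n_0$, vanishes; * $K_N[f]=I_N(\Delta_-)$ for $0<\nu<1$, $\nu\ne\frac12$, and every $N\ge n_0+1$: one extra regulating term suffices, and further ones contribute nothing. (At $\nu=\frac12$ a denominator vanishes and $K_N$ is the analytic continuation.) * For every $\nu>-1$, $K^\nu_{X'}[f]=0$ if $f$ vanishes at all boundary points spacelike separated from $X'$. For amplitudes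 decreasing faster than any power of $1+n+l$, the mode sums converge, the boundary fields are boundary functions, and $$\phi=\lim_{\rho\to\pi/2}\frac{\Phi_D}{\cos^{\Delta_+}\!\rho},\quad \Phi_D(X')=K_D[\phi]\quad(\nu>0);\qquad \phi=\lim_{\rho\to\pi/2}\frac{\Phi_N}{\cos^{\Delta_-}\!\rho},\quad \Phi_N(X')=K_N[\phi]\quad(0<\nu<1).$$ **3. Robin ($d$ odd, $0<\nu<1$, $\gamma\in[0,\pi)$).** For every superposition with Robin frequencies whose amplitudes decrease faster than any power of $1+|\omega|+l$: the boundary field $\phi$ is a boundary function; wherever the sums of the $\Phi_3$-part and of the $\Phi_4$-part converge separately, $\Phi_R=\cos\gamma\,\Phi_D+\sin\gamma\,\Phi_N$; the boundary data are $\phi_-=\sin\gamma\,\phi$ and $\phi_+=\cos\gamma\,\phi$, i.e. $(\Phi_R-\sin\gamma\,\phi\cos^{\Delta_-}\!\rho)/\cos^{\Delta_+}\!\rho\to\cos\gamma\,\phi$ as $\rho\to\pi/2$; and, the mode sum converging for $0<\rho'<\pi/2$, $$\Phi_R(X')=K_R[\phi],\qquad K_R=\cos\gamma\,K_D+\sin\gamma\,K_N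 ,$$ with $K_D$ and $K_N$ as above, the same for all frequencies and amplitudes. At $\rho'=0$ this holds with $\Phi_R$ replaced by its limit for $\rho'\to0^+$. -/

import Mathlib

open Set Filter Topology MeasureTheory

noncomputable section

namespace AdS

/-! ### Global AdS with unit radius

Bulk points have coordinates `(t, ρ, Ω)` with `0 ≤ ρ < π / 2` and `Ω` on the unit sphere of `ℝ ^ d`;
the metric is `(cos ρ)⁻² (-dt² + dρ² + sin² ρ dΩ²)`. The boundary is `ρ = π / 2`, with
points `(t, Ω)` and metric `-dt² + dΩ²`. The mass is `m² = ν² - d² / 4`. -/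

/-- The unit sphere of `ℝ ^ d`. -/
abbrev Sph (d : ℕ) : Type := Metric.sphere (0 : EuclideanSpace ℝ (Fin d)) 1

/-- The standard (unnormalised) surface measure of the unit sphere; for `d = 1` it is the
counting measure on two points. -/
def sphereMeasure (d : ℕ) : Measure (Sph d) :=
  (volume : Measure (EuclideanSpace ℝ (Fin d))).toSphere

/-- `Y` is a spherical harmonic of degree `l`: the restriction to the unit sphere of a harmonic
homogeneous polynomial of degree `l`. -/
def IsSphericalHarmonic (d l : ℕ) (Y : Sph d → ℂ) : Prop :=
  ∃ p : MvPolynomial (Fin d) ℂ, p.IsHomogeneous l ∧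
    ∑ i, MvPolynomial.pderiv i (MvPolynomial.pderiv i p) = 0 ∧
    ∀ Ω : Sph d, Y Ω = MvPolynomial.eval (fun i => ((Ω.1 i : ℝ) : ℂ)) p

/-- The weight `Δ₊ = d / 2 + ν`; the weight `Δ₋ = d / 2 - ν` is `weight d (-ν)`. -/
def weight (d : ℕ) (ν : ℝ) : ℝ := (d : ℝ) / 2 + ν

/-! ### Radial solutions -/

/-- The parameter `a = (l + Δ₊ - ω) / 2`. -/
def paramA (d : ℕ) (ν : ℝ) (l : ℕ) (ω : ℝ) : ℝ := (l + weight d ν - ω) / 2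

/-- The parameter `b = (l + Δ₊ + ω) / 2`. -/
def paramB (d : ℕ) (ν : ℝ) (l : ℕ) (ω : ℝ) : ℝ := (l + weight d ν + ω) / 2

/-- The parameter `c = l + d / 2`. -/
def paramC (d l : ℕ) : ℝ := (l : ℝ) + (d : ℝ) / 2

/-- The radial solution regular at the origin `ρ = 0`. -/
def regularRadial (d : ℕ) (ν : ℝ) (l : ℕ) (ω ρ : ℝ) : ℝ :=
  Real.sin ρ ^ l * Real.cos ρ ^ weight d ν *
    ordinaryHypergeometric (paramA d ν l ω) (paramB d ν l ω) (paramC d l) (Real.sin ρ ^ 2)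

/-- The radial solution with Dirichlet decay `(cos ρ) ^ Δ₊` at the boundary. -/
def dirichletRadial (d : ℕ) (ν : ℝ) (l : ℕ) (ω ρ : ℝ) : ℝ :=
  Real.sin ρ ^ l * Real.cos ρ ^ weight d ν *
    ordinaryHypergeometric (paramA d ν l ω) (paramB d ν l ω)
      (paramA d ν l ω + paramB d ν l ω + 1 - paramC d l) (Real.cos ρ ^ 2)

/-- The radial solution with Neumann decay `(cos ρ) ^ Δ₋` at the boundary. -/
def neumannRadial (d : ℕ) (ν : ℝ) (l : ℕ) (ω ρ : ℝ) : ℝ :=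
  Real.sin ρ ^ l * Real.cos ρ ^ weight d (-ν) *
    ordinaryHypergeometric (paramC d l - paramA d ν l ω) (paramC d l - paramB d ν l ω)
      (paramC d l - paramA d ν l ω - paramB d ν l ω + 1) (Real.cos ρ ^ 2)

/-- The Robin combination `cos γ Φ₃ + sin γ Φ₄` of the Dirichlet and Neumann radial solutions. -/
def robinRadial (d : ℕ) (ν γ : ℝ) (l : ℕ) (ω ρ : ℝ) : ℝ :=
  Real.cos γ * dirichletRadial d ν l ω ρ + Real.sin γ * neumannRadial d ν l ω ρ

/-- `R` solves on `0 < ρ < π / 2` the radial part of the Klein-Gordon equation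
`(□ - m²) (e^{-iωt} R(ρ) Y(Ω)) = 0` with `m² = ν² - d² / 4` and `Y` of degree `l`. -/
def SolvesRadialKleinGordon (d : ℕ) (ν : ℝ) (l : ℕ) (ω : ℝ) (R : ℝ → ℝ) : Prop :=
  ContDiffOn ℝ 2 R (Ioo 0 (Real.pi / 2)) ∧
  ∀ ρ ∈ Ioo 0 (Real.pi / 2),
    deriv (deriv R) ρ + ((d : ℝ) - 1) / (Real.sin ρ * Real.cos ρ) * deriv R ρ +
      (ω ^ 2 - (l : ℝ) * ((l : ℝ) + (d : ℝ) - 2) / Real.sin ρ ^ 2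
        - (ν ^ 2 - (d : ℝ) ^ 2 / 4) / Real.cos ρ ^ 2) * R ρ = 0

/-- The Dirichlet frequencies `± (Δ₊ + l + 2 n)`. -/
def dirichletFrequency (d : ℕ) (ν : ℝ) (s : ℤˣ) (n l : ℕ) : ℝ :=
  ((s : ℤ) : ℝ) * (weight d ν + l + 2 * n)

/-- The Neumann frequencies `± (Δ₋ + l + 2 n)`. -/
def neumannFrequency (d : ℕ) (ν : ℝ) (s : ℤˣ) (n l : ℕ) : ℝ :=
  ((s : ℤ) : ℝ) * ((d : ℝ) / 2 - ν + l + 2 * n)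

/-- The frequencies allowed by the Robin boundary condition: with `Φ₁ = A Φ₄ + B Φ₃`, the condition
is `tan γ = A / B`, written without denominators so that `γ = π / 2` means `B = 0`. -/
def IsRobinFrequency (d : ℕ) (ν γ : ℝ) (l : ℕ) (ω : ℝ) : Prop :=
  ∃ A B : ℝ, (∀ ρ ∈ Ioo 0 (Real.pi / 2),
      regularRadial d ν l ω ρ = A * neumannRadial d ν l ω ρ + B * dirichletRadial d ν l ω ρ) ∧
    A * Real.cos γ = B * Real.sin γ

/-! ### Fields as superpositions of modes -/

/-- The bulk mode `e^{-iωt} R_{l,ω}(ρ) Y(Ω)`. -/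
def bulkMode {d : ℕ} (R : ℕ → ℝ → ℝ → ℝ) (l : ℕ) (ω : ℝ) (Y : Sph d → ℂ)
    (t ρ : ℝ) (Ω : Sph d) : ℂ :=
  Complex.exp (-Complex.I * (ω : ℂ) * (t : ℂ)) * ((R l ω ρ : ℝ) : ℂ) * Y Ω

/-- The boundary mode `e^{-iωt} Y(Ω)`. -/
def boundaryMode {d : ℕ} (ω : ℝ) (Y : Sph d → ℂ) (t : ℝ) (Ω : Sph d) : ℂ :=
  Complex.exp (-Complex.I * (ω : ℂ) * (t : ℂ)) * Y Ω

/-- The superposition of bulk modes with amplitudes `Y i`. The amplitude `Y i` is a spherical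
harmonic of degree `l i`: it comprises the sum over the magnetic quantum numbers. -/
def bulkField {d : ℕ} {ι : Type} (R : ℕ → ℝ → ℝ → ℝ) (l : ι → ℕ) (ω : ι → ℝ)
    (Y : ι → Sph d → ℂ) (t ρ : ℝ) (Ω : Sph d) : ℂ :=
  ∑' i, bulkMode R (l i) (ω i) (Y i) t ρ Ω

/-- The superposition of boundary modes with amplitudes `Y i`. -/
def boundaryField {d : ℕ} {ι : Type} (ω : ι → ℝ) (Y : ι → Sph d → ℂ) (t : ℝ) (Ω : Sph d) : ℂ :=
  ∑' i, boundaryMode (ω i) (Y i) t Ω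

/-- The amplitudes `Y i` decrease faster than any power of `1 + w i`. -/
def IsRapidlyDecreasing {d : ℕ} {ι : Type} (w : ι → ℝ) (Y : ι → Sph d → ℂ) : Prop :=
  ∀ k : ℕ, ∃ b : ι → ℝ, Summable b ∧ ∀ i Ω, (1 + w i) ^ k * ‖Y i Ω‖ ≤ b i

/-- Labels `(±, n, l)` of the Dirichlet and of the Neumann modes. -/
abbrev ModeLabel : Type := ℤˣ × ℕ × ℕ

/-- The frequency of the Dirichlet mode with label `(±, n, l)`. -/
def dirichletFreq (d : ℕ) (ν : ℝ) (i : ModeLabel) : ℝ := dirichletFrequency d ν i.1 i.2.1 i.2.2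

/-- The frequency of the Neumann mode with label `(±, n, l)`. -/
def neumannFreq (d : ℕ) (ν : ℝ) (i : ModeLabel) : ℝ := neumannFrequency d ν i.1 i.2.1 i.2.2

/-- The Dirichlet bulk field with fixed amplitudes `Y`, as a function of `ν`. -/
def dirichletField (d : ℕ) (Y : ModeLabel → Sph d → ℂ) (ν : ℝ) : ℝ → ℝ → Sph d → ℂ :=
  bulkField (dirichletRadial d ν) (fun i => i.2.2) (dirichletFreq d ν) Y

/-- The Neumann bulk field with fixed amplitudes `Y`, as a function of `ν`. -/
def neumannField (d : ℕ) (Y : ModeLabel → Sph d → ℂ) (ν : ℝ) : ℝ → ℝ → Sph d → ℂ :=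
  bulkField (neumannRadial d ν) (fun i => i.2.2) (neumannFreq d ν) Y

/-- Amplitudes of Dirichlet and Neumann fields: spherical harmonics of the right degree, decreasing
faster than any power of `1 + n + l`. -/
def IsAmplitude (d : ℕ) (Y : ModeLabel → Sph d → ℂ) : Prop :=
  (∀ i, IsSphericalHarmonic d i.2.2 (Y i)) ∧
    IsRapidlyDecreasing (fun i : ModeLabel => (i.2.1 : ℝ) + (i.2.2 : ℝ)) Y

/-- Amplitudes of a Robin field: modes with real frequencies allowed by the Robin condition, and
amplitudes decreasing faster than any power of `1 + |ω| + l`. -/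
def IsRobinAmplitude (d : ℕ) (ν γ : ℝ) {ι : Type} (l : ι → ℕ) (ω : ι → ℝ)
    (Y : ι → Sph d → ℂ) : Prop :=
  (∀ i, IsRobinFrequency d ν γ (l i) (ω i)) ∧ (∀ i, IsSphericalHarmonic d (l i) (Y i)) ∧
    IsRapidlyDecreasing (fun i => |ω i| + (l i : ℝ)) Y

/-! ### Causal structure and kernels -/

/-- The invariant `σ` of the bulk points `(t, ρ, Ω)` and `(t', ρ', Ω')`. -/
def sigma {d : ℕ} (t ρ : ℝ) (Ω : Sph d) (t' ρ' : ℝ) (Ω' : Sph d) : ℝ :=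
  (Real.cos (t - t') - Real.sin ρ' * Real.sin ρ * inner ℝ Ω.1 Ω'.1) / (Real.cos ρ * Real.cos ρ')

/-- The limit of `σ cos ρ` for `ρ → π / 2`. -/
def boundarySigma {d : ℕ} (t : ℝ) (Ω : Sph d) (t' ρ' : ℝ) (Ω' : Sph d) : ℝ :=
  (Real.cos (t - t') - Real.sin ρ' * inner ℝ Ω.1 Ω'.1) / Real.cos ρ'

theorem tendsto_sigma_mul_cos {d : ℕ} (t : ℝ) (Ω : Sph d) (t' ρ' : ℝ) (Ω' : Sph d) :
    Tendsto (fun ρ => sigma t ρ Ω t' ρ' Ω' * Real.cos ρ) (𝓝[<] (Real.pi / 2))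
      (𝓝 (boundarySigma t Ω t' ρ' Ω')) := by
  have h : Tendsto (fun ρ : ℝ => (Real.cos (t - t') - Real.sin ρ' * Real.sin ρ *
      inner ℝ Ω.1 Ω'.1) / Real.cos ρ') (𝓝[<] (Real.pi / 2))
      (𝓝 ((Real.cos (t - t') - Real.sin ρ' * Real.sin (Real.pi / 2) *
        inner ℝ Ω.1 Ω'.1) / Real.cos ρ')) := by
    refine Tendsto.mono_left ?_ nhdsWithin_le_nhds
    exact Continuous.tendsto (by fun_prop) _
  rw [Real.sin_pi_div_two, mul_one] at h
  refine h.congr' ?_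
  have h1 : ∀ᶠ ρ in 𝓝[<] (Real.pi / 2), ρ ∈ Ioo 0 (Real.pi / 2) :=
    Ioo_mem_nhdsLT (by positivity)
  filter_upwards [h1] with ρ hρ
  have hc : Real.cos ρ ≠ 0 :=
    (Real.cos_pos_of_mem_Ioo ⟨by linarith [hρ.1, Real.pi_pos], hρ.2⟩).ne'
  unfold sigma
  rw [div_mul_eq_mul_div, mul_comm (Real.cos ρ) (Real.cos ρ'), mul_div_mul_right _ _ hc]

/-- The time lag of light between the bulk point `(t', ρ', Ω')` and the boundary point of
direction `Ω`; null separated times are `t' ± lightLag`, where `boundarySigma` vanishes. -/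
def lightLag {d : ℕ} (Ω : Sph d) (ρ' : ℝ) (Ω' : Sph d) : ℝ :=
  Real.arccos (Real.sin ρ' * inner ℝ Ω.1 Ω'.1)

/-- The boundary point `(t, Ω)` is spacelike separated from the bulk point `(t', ρ', Ω')`. -/
def IsSpacelike {d : ℕ} (t : ℝ) (Ω : Sph d) (t' ρ' : ℝ) (Ω' : Sph d) : Prop :=
  |t - t'| < lightLag Ω ρ' Ω'

/-- The constant `C(Δ)` for odd `d`. The quotient is `0` at the poles of the Gamma function
in the denominator, as it should be. -/
def kernelConst (d : ℕ) (Δ : ℝ) : ℝ :=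
  (-1) ^ ((d - 1) / 2) * 2 ^ (Δ - d - 1) * Real.Gamma (Δ - (d : ℝ) / 2 + 1) /
    (Real.pi ^ ((d : ℝ) / 2) * Real.Gamma (Δ - d + 1))

open Classical in
/-- The Dirichlet kernel `K_D(t, Ω | t', ρ', Ω')` as a function, for odd `d`: it is
`C(Δ₊) lim (σ cos ρ) ^ (Δ₊ - d)` at spacelike separation and `0` elsewhere. -/
def dirichletKernel (d : ℕ) (ν : ℝ) (t : ℝ) (Ω : Sph d) (t' ρ' : ℝ) (Ω' : Sph d) : ℝ :=
  if IsSpacelike t Ω t' ρ' Ω' then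
    kernelConst d (weight d ν) * boundarySigma t Ω t' ρ' Ω' ^ (weight d ν - d)
  else 0

/-- Boundary functions on which kernels act: smooth in time, and all time derivatives are
continuous on the boundary. All smooth functions on the boundary are of this kind. -/
structure IsBoundaryFunction {d : ℕ} (f : ℝ → Sph d → ℂ) : Prop where
  smooth : ∀ Ω, ContDiff ℝ ((⊤ : ℕ∞) : WithTop ℕ∞) (fun t => f t Ω)
  continuous_deriv : ∀ k : ℕ, Continuous
    (fun p : ℝ × Sph d => iteratedDeriv k (fun t => f t p.2) p.1)

/-- A family of generalised kernels: `K ν t' ρ' Ω' f` is the value of the kernel with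
parameter `ν` and bulk point `(t', ρ', Ω')` on the boundary function `f`. -/
abbrev KernelFamily (d : ℕ) : Type := ℝ → ℝ → ℝ → Sph d → (ℝ → Sph d → ℂ) → ℂ

/-- `K` is the analytic continuation in `ν` of the Dirichlet kernel to `ν > -1`: for each
bulk point and boundary function the value is analytic in `ν > -1`, and for `ν > d / 2 - 1`
(that is, `Δ₊ > d - 1`) it is the integral against the function `dirichletKernel`. -/
def IsContinuedDirichletKernel (d : ℕ) (K : KernelFamily d) : Prop :=
  ∀ (t' ρ' : ℝ) (Ω' : Sph d), 0 ≤ ρ' → ρ' < Real.pi / 2 →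
    ∀ f : ℝ → Sph d → ℂ, IsBoundaryFunction f →
      AnalyticOnNhd ℝ (fun ν => K ν t' ρ' Ω' f) (Ioi (-1)) ∧
      ∀ ν : ℝ, (d : ℝ) / 2 - 1 < ν →
        K ν t' ρ' Ω' f = ∫ p : ℝ × Sph d,
          ((dirichletKernel d ν p.1 p.2 t' ρ' Ω' : ℝ) : ℂ) * f p.1 p.2
            ∂((volume : Measure ℝ).prod (sphereMeasure d))

/-- The Robin kernel `cos γ K_D + sin γ K_N`, where the Neumann kernel `K_N` is the continued
Dirichlet kernel at `-ν`. -/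
def robinKernel {d : ℕ} (K : KernelFamily d) (γ : ℝ) : KernelFamily d :=
  fun ν t' ρ' Ω' f =>
    (Real.cos γ : ℂ) * K ν t' ρ' Ω' f + (Real.sin γ : ℂ) * K (-ν) t' ρ' Ω' f

/-! ### The regulated integral -/

/-- For `s = 1` (`s = -1`) and `t^± = t' ± lightLag`, the `j`-th Taylor coefficient `b_j^±` at
`u = 0` of `f (t^± ∓ u, Ω) (boundarySigma (t^± ∓ u) / u) ^ (Δ - d)`. As `boundarySigma` vanishes at
`t^±`, `dslope` is this quotient, extended by its limit at `u = 0`. -/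
def taylorCoeff {d : ℕ} (Δ : ℝ) (s : ℤˣ) (j : ℕ) (t' ρ' : ℝ) (Ω' : Sph d)
    (f : ℝ → Sph d → ℂ) (Ω : Sph d) : ℂ :=
  iteratedDeriv j (fun u : ℝ =>
      f (t' + ((s : ℤ) : ℝ) * (lightLag Ω ρ' Ω' - u)) Ω *
        (((dslope (fun v : ℝ => boundarySigma (t' + ((s : ℤ) : ℝ) * (lightLag Ω ρ' Ω' - v))
          Ω t' ρ' Ω') 0 u) ^ (Δ - d) : ℝ) : ℂ)) 0 / (j.factorial : ℂ)

/-- The time integral with cutoff `ε` and the regulating terms `j = 0, …, N - 1`. -/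
def cutoffIntegral {d : ℕ} (Δ : ℝ) (N : ℕ) (t' ρ' : ℝ) (Ω' : Sph d)
    (f : ℝ → Sph d → ℂ) (Ω : Sph d) (ε : ℝ) : ℂ :=
  ∑ j ∈ Finset.range N, (taylorCoeff Δ 1 j t' ρ' Ω' f Ω + taylorCoeff Δ (-1) j t' ρ' Ω' f Ω) *
      ((ε ^ (Δ - d + 1 + j) / (Δ - d + 1 + j) : ℝ) : ℂ) +
    ∫ t in (t' - lightLag Ω ρ' Ω' + ε)..(t' + lightLag Ω ρ' Ω' - ε),
      f t Ω * ((boundarySigma t Ω t' ρ' Ω' ^ (Δ - d) : ℝ) : ℂ)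

/-- `v = C(Δ) ∫ dΩ lim_{ε → 0} (cutoffIntegral)` with `N` regulating terms; the limits exist and are
integrable over the sphere. -/
def IsRegulatedIntegral {d : ℕ} (Δ : ℝ) (N : ℕ) (t' ρ' : ℝ) (Ω' : Sph d)
    (f : ℝ → Sph d → ℂ) (v : ℂ) : Prop :=
  ∃ J : Sph d → ℂ,
    (∀ Ω, Tendsto (cutoffIntegral Δ N t' ρ' Ω' f Ω) (𝓝[>] 0) (𝓝 (J Ω))) ∧
    Integrable J (sphereMeasure d) ∧
    v = (kernelConst d Δ : ℂ) * ∫ Ω, J Ω ∂(sphereMeasure d)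

end AdS

end

/-! Fix a bulk point, put s = sin ρ' Ω·Ω' and λ = ν − d/2. Up to a constant and a power of cos ρ',
the Dirichlet kernel at time lag τ is (cos τ − s)^λ for |τ| < arccos s. Everything rests on the
functional G_λ(s)[f], the continuation in λ of the integral of f against this power, divided by Γ(λ
+ 1) (`gapFun`). Two integrations by parts (`cutGapIntegral_raise`) give (1 − s²) G_λ[f] =
G_{λ+2}[f''] + (2λ + 3) s G_{λ+1}[f] + (λ + 2)² G_{λ+2}[f], which defines G_λ for low λ; the
division by Γ(λ + 1) removes all poles. Its integral over the sphere gives `contKernel`, analytic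
for ν > −1. By the identity theorem every continuation of the kernel agrees with it, and the
spacelike support persists.

Regulated integrals: by the same recursion, the integral with cutoff ε is a constant plus ε^(λ+1)
times a smooth function, up to o(1). Subtracting Taylor terms at the light cones also yields a
limit. The two differ by ε^(λ+1) times a smooth function, which cannot have a nonzero limit when no
exponent λ + 1 + j vanishes (`eq_zero_of_tendsto_rpow_mul`). Counting the terms needed for λ + N >
−1 gives the numbers of regulators.

Action on modes: on f = exp(−iωτ) the recursion closes, and ∂_s G_λ = −G_{λ−1}. So G_λ solves a
linear second-order equation in s, and its Taylor series at s = 0 follows from the values G_λ(0),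
which are Cauchy's cosine integral (`modeGap_zero`). The moments of (Ω·Ω')^k against a spherical
harmonic, computed from Gaussian integrals, vanish unless k = l + 2m and turn this series into a
hypergeometric one. Hence the kernel maps a boundary mode to `kernelFactor` times the mode with the
regular radial solution Φ₁, at every frequency (`contKernel_boundaryMode`).

Normalisation: write k(ν) for the factor and Φ₁ = A Φ₄ + B Φ₃. Gauss' summation theorem gives A and
B, and the reflection formula together with sin πc = ±1 (d odd) gives B k(ν) + A k(−ν) = 1 at every
frequency (`connection_kernelFactor`). With A cos γ = B sin γ this says that cos γ k(ν) + sin γ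
k(−ν) turns Φ₁ into cos γ Φ₃ + sin γ Φ₄. At Dirichlet frequencies Φ₁ is a multiple of Φ₃ and the
kernel at ν reproduces Φ₃ for all ν > −1; the Neumann case is the same statement at −ν.

Sums: the kernel is bounded by finitely many time derivatives, with a power of 1/cos ρ'
(`norm_contKernel_le`), so it commutes with rapidly decreasing superpositions. The same bound
dominates mode sums near the boundary, where each radial solution approaches its leading power once
cos ρ is small compared with the inverse of frequency and degree (`tendsto_tsum_boundary`). -/

noncomputable section

namespace AdS

/-! ### Real power series on the unit interval -/

/-- The sum of the power series with coefficients `p`. -/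
def powSum (p : ℕ → ℝ) (z : ℝ) : ℝ := ∑' k, p k * z ^ k

/-- The power series with coefficients `p` converges absolutely on the open unit disc. -/
def UnitSummable (p : ℕ → ℝ) : Prop := ∀ r : ℝ, 0 ≤ r → r < 1 → Summable fun k => |p k| * r ^ k

/-- The coefficients of the derived power series. -/
def derivCoeff (p : ℕ → ℝ) (k : ℕ) : ℝ := (k + 1) * p (k + 1)

/-- A ratio test with stride `j`; stride 2 serves the recursion of `gapCoeff`. The eventual bound
for each `q > 1` avoids quotients, since coefficients may vanish. It makes `|p k| * r' ^ k` bounded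
for `r' < 1`, and a geometric series finishes. -/
theorem unitSummable_of_ratio {p : ℕ → ℝ} {j : ℕ} (hj : 0 < j)
    (h : ∀ q : ℝ, 1 < q → ∀ᶠ k in atTop, |p (k + j)| ≤ q * |p k|) : UnitSummable p := by
  intro r hr0 hr1
  obtain ⟨r', hr', hr'1⟩ := exists_between hr1
  have hr'0 : 0 < r' := lt_of_le_of_lt hr0 hr'
  have hq : 1 < (r' ^ j)⁻¹ := (one_lt_inv₀ (by positivity)).2 (pow_lt_one₀ hr'0.le hr'1 hj.ne')
  obtain ⟨K, hK⟩ := eventually_atTop.1 (h _ hq)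
  have hmono : ∀ k ≥ K, |p (k + j)| * r' ^ (k + j) ≤ |p k| * r' ^ k := by
    intro k hk
    have := mul_le_mul_of_nonneg_right (hK k hk) (by positivity : 0 ≤ r' ^ (k + j))
    refine this.trans (le_of_eq ?_)
    rw [pow_add]; field_simp
  set C := ∑ k ∈ Finset.range (K + j), |p k| * r' ^ k
  have hC : ∀ k, |p k| * r' ^ k ≤ C := by
    intro k
    induction k using Nat.strong_induction_on with
    | _ k ih =>
      rcases lt_or_ge k (K + j) with hk | hk
      · exact Finset.single_le_sum (f := fun k => |p k| * r' ^ k) (fun i _ => by positivity)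
          (Finset.mem_range.2 hk)
      · obtain ⟨i, rfl⟩ := Nat.exists_eq_add_of_le' (le_trans (Nat.le_add_left j K) hk)
        exact (hmono i (by omega)).trans (ih i (by omega))
  have hlt : r / r' < 1 := (div_lt_one hr'0).2 hr'
  refine Summable.of_nonneg_of_le (fun k => by positivity) (fun k => ?_)
    ((summable_geometric_of_lt_one (by positivity) hlt).mul_left C)
  have := mul_le_mul_of_nonneg_right (hC k) (by positivity : 0 ≤ (r / r') ^ k)
  refine le_trans (le_of_eq ?_) this
  rw [div_pow]; field_simp

theorem UnitSummable.derivCoeff {p : ℕ → ℝ} (hp : UnitSummable p) :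
    UnitSummable (derivCoeff p) := by
  intro r hr0 hr1
  obtain ⟨r', hr', hr'1⟩ := exists_between hr1
  have hr'0 : 0 < r' := lt_of_le_of_lt hr0 hr'
  have hlt : r / r' < 1 := (div_lt_one hr'0).2 hr'
  have hs := summable_pow_mul_geometric_of_norm_lt_one 1
    (show ‖r / r'‖ < 1 by rw [Real.norm_of_nonneg (by positivity)]; exact hlt)
  have ht := (hs.add (summable_geometric_of_lt_one (by positivity) hlt))
  obtain ⟨C, hC⟩ := ht.tendsto_atTop_zero.bddAbove_range
  have hb : ∀ k : ℕ, ((k : ℝ) + 1) * (r / r') ^ k ≤ C := fun k => by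
    have := hC ⟨k, rfl⟩
    simp only [pow_one] at this
    linarith
  have h1 := ((summable_nat_add_iff 1).2 (hp r' hr'0.le hr'1)).mul_left (C / r')
  refine Summable.of_nonneg_of_le (fun k => by positivity) (fun k => ?_) h1
  have := mul_le_mul_of_nonneg_right (hb k) (by positivity : 0 ≤ |p (k + 1)| * r' ^ k)
  unfold AdS.derivCoeff
  rw [abs_mul, abs_of_nonneg (by positivity : (0:ℝ) ≤ (k:ℝ) + 1)]
  refine le_trans (le_of_eq ?_) (this.trans (le_of_eq ?_))
  · rw [div_pow]; field_simp
  · rw [pow_succ]; field_simp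

theorem UnitSummable.summable {p : ℕ → ℝ} (hp : UnitSummable p) {z : ℝ} (hz : |z| < 1) :
    Summable fun k => p k * z ^ k :=
  (hp |z| (abs_nonneg z) hz).of_norm_bounded fun k => by
    rw [norm_mul, norm_pow, Real.norm_eq_abs, Real.norm_eq_abs]

theorem hasDerivAt_powSum {p : ℕ → ℝ} (hp : UnitSummable p) {z : ℝ} (hz : |z| < 1) :
    HasDerivAt (powSum p) (powSum (derivCoeff p) z) z := by
  obtain ⟨r, hr, hr1⟩ := exists_between hz
  have hr0 : 0 < r := lt_of_le_of_lt (abs_nonneg z) hr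
  have hs : Summable fun k : ℕ => |p k| * (k * r ^ (k - 1)) := by
    rw [← summable_nat_add_iff 1]
    refine (hp.derivCoeff r hr0.le hr1).congr fun k => ?_
    unfold derivCoeff
    rw [abs_mul, abs_of_nonneg (by positivity : (0:ℝ) ≤ (k:ℝ) + 1)]
    push_cast
    ring_nf
  have key := hasDerivAt_tsum_of_isPreconnected (g := fun k y => p k * y ^ k)
    (g' := fun k y => p k * (k * y ^ (k - 1))) hs isOpen_Ioo
    (isPreconnected_Ioo (a := -r) (b := r))
    (fun k y _ => (hasDerivAt_pow k y).const_mul (p k))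
    (fun k y hy => by
      rw [norm_mul, norm_mul, norm_pow, Real.norm_eq_abs, Real.norm_eq_abs, Real.norm_eq_abs,
        Nat.abs_cast]
      have : |y| ≤ r := abs_le.2 ⟨hy.1.le, hy.2.le⟩
      gcongr)
    (y₀ := 0) ⟨by linarith, hr0⟩ (hp.summable (by simp)) (abs_lt.1 hr)
  have hz' : Summable fun k : ℕ => p k * (k * z ^ (k - 1)) :=
    hs.of_norm_bounded fun k => by
      rw [norm_mul, norm_mul, norm_pow, Real.norm_eq_abs, Real.norm_eq_abs, Real.norm_eq_abs,
        Nat.abs_cast]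
      gcongr
  have he : ∑' k : ℕ, p k * (k * z ^ (k - 1)) = powSum (derivCoeff p) z := by
    rw [hz'.tsum_eq_zero_add]
    simp only [Nat.cast_zero, zero_mul, mul_zero, zero_add, add_tsub_cancel_right]
    unfold powSum derivCoeff
    exact tsum_congr fun k => by push_cast; ring
  rw [he] at key
  exact key

theorem hasSum_powSum {p : ℕ → ℝ} (hp : UnitSummable p) {z : ℝ} (hz : |z| < 1) :
    HasSum (fun k => p k * z ^ k) (powSum p z) := (hp.summable hz).hasSum

/-- The product of `z` and of a derived power series. -/
theorem hasSum_mul_powSum_derivCoeff {p : ℕ → ℝ} (hp : UnitSummable p) {z : ℝ} (hz : |z| < 1) :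
    HasSum (fun k : ℕ => k * p k * z ^ k) (z * powSum (derivCoeff p) z) := by
  have h := (hasSum_powSum hp.derivCoeff hz).mul_left z
  rw [← hasSum_nat_add_iff' 1]
  simp only [Finset.range_one, Finset.sum_singleton, Nat.cast_zero, zero_mul, sub_zero]
  have e : (fun k : ℕ => ((k + 1 : ℕ) : ℝ) * p (k + 1) * z ^ (k + 1)) =
      fun k => z * (derivCoeff p k * z ^ k) := by
    ext k
    unfold derivCoeff; push_cast; ring
  rw [e]
  exact h

theorem UnitSummable.analyticOnNhd {p : ℕ → ℝ} (hp : UnitSummable p) :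
    AnalyticOnNhd ℝ (powSum p) (Metric.ball 0 1) := by
  have hr : (1 : ENNReal) ≤ (FormalMultilinearSeries.ofScalars ℝ p).radius := by
    refine ENNReal.le_of_forall_nnreal_lt fun r hr => ?_
    have hr' : (r : ℝ) < 1 := by exact_mod_cast hr
    refine FormalMultilinearSeries.le_radius_of_summable_norm _ ?_
    refine (hp r r.2 hr').congr fun k => ?_
    rw [FormalMultilinearSeries.ofScalars_norm, Real.norm_eq_abs]
  have h := (FormalMultilinearSeries.ofScalars ℝ p).hasFPowerSeriesOnBall
    (lt_of_lt_of_le one_pos hr)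
  have he : (FormalMultilinearSeries.ofScalars ℝ p).sum = powSum p := by
    ext z
    simp [FormalMultilinearSeries.sum, powSum, mul_comm]
  rw [he] at h
  refine h.analyticOnNhd.mono fun z hz => ?_
  have : Metric.eball (0:ℝ) 1 ⊆ Metric.eball 0 (FormalMultilinearSeries.ofScalars ℝ p).radius :=
    Metric.eball_subset_eball hr
  exact this (by rw [← ENNReal.ofReal_one, Metric.eball_ofReal]; exact hz)

/-! ### The hypergeometric function -/

/-- The coefficients of the hypergeometric series. -/
def hypCoeff (a b c : ℝ) (n : ℕ) : ℝ := ordinaryHypergeometricCoefficient a b c n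

theorem ordinaryHypergeometric_eq_powSum (a b c : ℝ) :
    (ordinaryHypergeometric a b c : ℝ → ℝ) = powSum (hypCoeff a b c) := by
  rw [ordinaryHypergeometric_eq_tsum]
  rfl

@[simp] theorem hypCoeff_zero (a b c : ℝ) : hypCoeff a b c 0 = 1 := by
  simp [hypCoeff, ordinaryHypergeometricCoefficient]

/-- Written with inverses, the recursion needs no condition on `c`: if `c + n = 0`, both sides are 0
because `0⁻¹ = 0`. -/
theorem hypCoeff_succ' (a b c : ℝ) (n : ℕ) :
    hypCoeff a b c (n + 1) =
      hypCoeff a b c n * ((a + n) * (b + n) * ((n + 1 : ℝ))⁻¹ * (c + n)⁻¹) := by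
  unfold hypCoeff ordinaryHypergeometricCoefficient
  rw [ascPochhammer_succ_eval, ascPochhammer_succ_eval, ascPochhammer_succ_eval,
    Nat.factorial_succ]
  push_cast
  rw [mul_inv, mul_inv]
  ring

theorem hypCoeff_succ {c : ℝ} (hc : 0 < c) (a b : ℝ) (n : ℕ) :
    (n + 1) * (c + n) * hypCoeff a b c (n + 1) = (a + n) * (b + n) * hypCoeff a b c n := by
  rw [hypCoeff_succ']
  have h1 : (n : ℝ) + 1 ≠ 0 := by positivity
  have h2 : c + n ≠ 0 := by positivity
  field_simp

theorem hypCoeff_symm (a b c : ℝ) : hypCoeff a b c = hypCoeff b a c := by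
  ext n
  unfold hypCoeff ordinaryHypergeometricCoefficient
  ring

theorem unitSummable_hypCoeff (a b c : ℝ) : UnitSummable (hypCoeff a b c) := by
  refine unitSummable_of_ratio one_pos fun q hq => ?_
  have hlin : ∀ x : ℝ, Tendsto (fun n : ℕ => (x + n) / ((1 : ℝ) * n)) atTop (𝓝 1) := by
    intro x
    have := tendsto_add_mul_div_add_mul_atTop_nhds x 0 1 (one_ne_zero (α := ℝ))
    simpa using this
  have hlim : Tendsto (fun n : ℕ => |(a + n) * (b + n) * ((n + 1 : ℝ))⁻¹ * (c + n)⁻¹|)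
      atTop (𝓝 1) := by
    have h := ((((hlin a).mul (hlin b)).mul ((hlin 1).inv₀ one_ne_zero)).mul
      ((hlin c).inv₀ one_ne_zero)).abs
    simp only [mul_one, inv_one, abs_one] at h
    refine h.congr' ?_
    filter_upwards [eventually_gt_atTop 0] with n hn
    have : (n : ℝ) ≠ 0 := by exact_mod_cast hn.ne'
    congr 1
    have h1 : (1 : ℝ) + n ≠ 0 := by positivity
    rw [inv_div, inv_div, one_mul, add_comm (n : ℝ) 1]
    by_cases hcn : c + n = 0
    · simp [hcn]
    · field_simp
  filter_upwards [hlim.eventually_lt_const hq] with n hn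
  rw [hypCoeff_succ', abs_mul, mul_comm]
  gcongr

/-- The hypergeometric function, as a power series. -/
abbrev hyp (a b c : ℝ) : ℝ → ℝ := powSum (hypCoeff a b c)

/-- Its derivative. -/
abbrev hypD (a b c : ℝ) : ℝ → ℝ := powSum (derivCoeff (hypCoeff a b c))

/-- Its second derivative. -/
abbrev hypDD (a b c : ℝ) : ℝ → ℝ := powSum (derivCoeff (derivCoeff (hypCoeff a b c)))

theorem powSum_zero (p : ℕ → ℝ) : powSum p 0 = p 0 := by
  unfold powSum
  rw [tsum_eq_single 0 (fun k hk => by simp [hk])]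
  simp

theorem hyp_zero (a b c : ℝ) : hyp a b c 0 = 1 := by
  rw [hyp, powSum_zero, hypCoeff_zero]

theorem hasDerivAt_hyp (a b c : ℝ) {z : ℝ} (hz : |z| < 1) :
    HasDerivAt (hyp a b c) (hypD a b c z) z := hasDerivAt_powSum (unitSummable_hypCoeff a b c) hz

theorem hasDerivAt_hypD (a b c : ℝ) {z : ℝ} (hz : |z| < 1) :
    HasDerivAt (hypD a b c) (hypDD a b c z) z :=
  hasDerivAt_powSum (unitSummable_hypCoeff a b c).derivCoeff hz

/-- The hypergeometric differential equation. -/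
theorem hyp_equation {c : ℝ} (hc : 0 < c) (a b : ℝ) {z : ℝ} (hz : |z| < 1) :
    z * (1 - z) * hypDD a b c z + (c - (a + b + 1) * z) * hypD a b c z
      - a * b * hyp a b c z = 0 := by
  have hp := unitSummable_hypCoeff a b c
  have h0 := hasSum_powSum hp hz
  have h1 := hasSum_powSum hp.derivCoeff hz
  have h1z := hasSum_mul_powSum_derivCoeff hp hz
  have h2z := hasSum_mul_powSum_derivCoeff hp.derivCoeff hz
  have h2zz : HasSum (fun k : ℕ => k * (k - 1) * hypCoeff a b c k * z ^ k)
      (z * (z * hypDD a b c z)) := by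
    have h := h2z.mul_left z
    rw [← hasSum_nat_add_iff' 1]
    simp only [Finset.range_one, Finset.sum_singleton, Nat.cast_zero, zero_mul, sub_zero]
    have e : (fun k : ℕ => ((k + 1 : ℕ) : ℝ) * (((k + 1 : ℕ) : ℝ) - 1) *
        hypCoeff a b c (k + 1) * z ^ (k + 1)) =
        fun k => z * (k * derivCoeff (hypCoeff a b c) k * z ^ k) := by
      ext k
      unfold derivCoeff; push_cast; ring
    rw [e]
    exact h
  have key := ((((h2z.sub h2zz).add (h1.mul_left c)).sub (h1z.mul_left (a + b + 1))).sub
    (h0.mul_left (a * b)))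
  have hzero : ∀ k : ℕ, (k * derivCoeff (hypCoeff a b c) k * z ^ k
      - k * (k - 1) * hypCoeff a b c k * z ^ k) + c * (derivCoeff (hypCoeff a b c) k * z ^ k)
      - (a + b + 1) * (k * hypCoeff a b c k * z ^ k) - a * b * (hypCoeff a b c k * z ^ k) = 0 := by
    intro k
    have := hypCoeff_succ hc a b k
    unfold derivCoeff
    linear_combination z ^ k * this
  simp only [hzero] at key
  have := key.unique hasSum_zero
  linear_combination this

/-- An analytic solution of the hypergeometric equation that vanishes at `0` vanishes. -/
theorem eqOn_zero_of_hyp_equation {a b c : ℝ} (hc : 0 < c) {D : ℝ → ℝ}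
    (hD : AnalyticOnNhd ℝ D (Metric.ball 0 1))
    (hode : ∀ z ∈ Metric.ball (0 : ℝ) 1, z * (1 - z) * deriv (deriv D) z +
      (c - (a + b + 1) * z) * deriv D z - a * b * D z = 0) (h0 : D 0 = 0) :
    EqOn D 0 (Metric.ball 0 1) := by
  have h0m : (0 : ℝ) ∈ Metric.ball (0 : ℝ) 1 := by simp
  refine hD.eqOn_zero_of_preconnected_of_eventuallyEq_zero
    (convex_ball (0 : ℝ) 1).isPreconnected h0m ?_
  by_contra hne
  -- A solution not locally zero is z^m e(z) with e(0) ≠ 0 and m ≥ 1. The lowest order of the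
  -- equation is then the indicial polynomial m (m − 1 + c) times e(0), which is nonzero for c > 0.
  obtain ⟨m, e, he, he0, hDe⟩ := (hD 0 h0m).exists_eventuallyEq_pow_smul_nonzero_iff.2 hne
  replace hDe : D =ᶠ[𝓝 0] fun z => z ^ m * e z := by
    filter_upwards [hDe] with z hz
    simpa using hz
  have hm : m ≠ 0 := by
    rintro rfl
    have := hDe.eq_of_nhds
    simp only [pow_zero, one_mul] at this
    exact he0 (this ▸ h0)
  obtain ⟨n, rfl⟩ := Nat.exists_eq_succ_of_ne_zero hm
  set E := fun z => ((n + 1 : ℕ) : ℝ) * e z + z * deriv e z with hE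
  have hEa : AnalyticAt ℝ E 0 := (analyticAt_const.mul he).add (analyticAt_id.mul he.deriv)
  have hev : ∀ᶠ z in 𝓝 (0:ℝ), AnalyticAt ℝ e z := he.eventually_analyticAt
  have hEev : ∀ᶠ z in 𝓝 (0:ℝ), AnalyticAt ℝ E z := hEa.eventually_analyticAt
  have hd1 : deriv D =ᶠ[𝓝 0] fun z => z ^ n * E z := by
    filter_upwards [hDe.eventuallyEq_nhds, hev] with z hz hez
    rw [hz.deriv_eq]
    have := ((hasDerivAt_pow (n + 1) z).mul hez.differentiableAt.hasDerivAt).deriv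
    refine this.trans ?_
    simp only [hE, add_tsub_cancel_right]
    ring
  have hd2 : ∀ᶠ z in 𝓝 (0:ℝ), z * deriv (deriv D) z = z ^ n * (n * E z + z * deriv E z) := by
    filter_upwards [hd1.eventuallyEq_nhds, hEev] with z hz hez
    rw [hz.deriv_eq]
    have := ((hasDerivAt_pow n z).mul hez.differentiableAt.hasDerivAt).deriv
    have h' : deriv (fun z => z ^ n * E z) z = n * z ^ (n - 1) * E z + z ^ n * deriv E z := this
    rw [h']
    rcases n with _ | n
    · simp
    · simp only [add_tsub_cancel_right]; ring
  -- `B` is the left side of the equation divided by z^n, with m = n + 1. It vanishes for small z ≠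
  -- 0, hence at 0 by continuity, where its value is (n + c)(n + 1) e(0).
  set B := fun z => (1 - z) * (n * E z + z * deriv E z) + (c - (a + b + 1) * z) * E z
    - a * b * z * e z with hB
  have hBc : ContinuousAt B 0 := by
    have h1 := he.continuousAt
    have h2 := hEa.continuousAt
    have h3 := hEa.deriv.continuousAt
    fun_prop
  have hB0 : ∀ᶠ z in 𝓝[≠] (0:ℝ), B z = 0 := by
    have hball : ∀ᶠ z in 𝓝 (0:ℝ), z ∈ Metric.ball (0:ℝ) 1 := Metric.ball_mem_nhds _ one_pos
    filter_upwards [nhdsWithin_le_nhds hd1, nhdsWithin_le_nhds hd2, nhdsWithin_le_nhds hDe,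
      nhdsWithin_le_nhds hball, self_mem_nhdsWithin] with z h1 h2 h3 h4 h5
    have h := hode z h4
    rw [h1, h3] at h
    have hz : z ^ n ≠ 0 := pow_ne_zero _ h5
    refine (mul_eq_zero.1 (?_ : z ^ n * B z = 0)).resolve_left hz
    simp only [hB]
    rw [pow_succ] at h
    linear_combination h - (1 - z) * h2
  have hlim : Tendsto B (𝓝[≠] 0) (𝓝 (B 0)) := hBc.tendsto.mono_left nhdsWithin_le_nhds
  have : B 0 = 0 := tendsto_nhds_unique hlim (tendsto_const_nhds.congr' (hB0.mono fun z hz => hz.symm))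
  simp only [hB, hE] at this
  have h' : (n + c) * ((n + 1) * e 0) = 0 := by push_cast at this; linear_combination this
  have : (n + c) * ((n + 1) * e 0) ≠ 0 := by positivity
  exact this h'

/-- The exponents at 0 are 0 and 1 − c, so for c > 0 the solution analytic at 0 is unique up to
scale. This is how Euler's transformation and the terminating connection formula are obtained. -/
theorem eqOn_const_mul_hyp {a b c : ℝ} (hc : 0 < c) {g : ℝ → ℝ}
    (hg : AnalyticOnNhd ℝ g (Metric.ball 0 1))
    (hode : ∀ z ∈ Metric.ball (0 : ℝ) 1, z * (1 - z) * deriv (deriv g) z +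
      (c - (a + b + 1) * z) * deriv g z - a * b * g z = 0) {z : ℝ} (hz : |z| < 1) :
    g z = g 0 * hyp a b c z := by
  have hF := (unitSummable_hypCoeff a b c).analyticOnNhd
  set D := fun z => g z - g 0 * hyp a b c z with hDdef
  have hDa : AnalyticOnNhd ℝ D (Metric.ball 0 1) := hg.sub (analyticOnNhd_const.mul hF)
  have hmem : ∀ z : ℝ, z ∈ Metric.ball (0:ℝ) 1 ↔ |z| < 1 := by simp
  have hd : ∀ z ∈ Metric.ball (0:ℝ) 1, deriv D z = deriv g z - g 0 * hypD a b c z := fun z hz =>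
    ((hg z hz).differentiableAt.hasDerivAt.sub
      ((hasDerivAt_hyp a b c ((hmem z).1 hz)).const_mul _)).deriv
  have hdd : ∀ z ∈ Metric.ball (0:ℝ) 1, deriv (deriv D) z =
      deriv (deriv g) z - g 0 * hypDD a b c z := fun z hz => by
    have : deriv D =ᶠ[𝓝 z] fun z => deriv g z - g 0 * hypD a b c z :=
      eventually_of_mem (Metric.isOpen_ball.mem_nhds hz) hd
    rw [this.deriv_eq]
    exact ((hg.deriv z hz).differentiableAt.hasDerivAt.sub
      ((hasDerivAt_hypD a b c ((hmem z).1 hz)).const_mul _)).deriv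
  have := eqOn_zero_of_hyp_equation (a := a) (b := b) hc hDa (fun z hz => by
    rw [hd z hz, hdd z hz]
    have h1 := hode z hz
    have h2 := hyp_equation hc a b ((hmem z).1 hz)
    simp only [hDdef]
    linear_combination h1 - g 0 * h2) (by simp only [hDdef, hyp_zero]; ring)
  have := this ((hmem z).2 hz)
  simp only [hDdef, Pi.zero_apply] at this
  linarith

/-- Euler's transformation. -/
theorem hyp_euler {c : ℝ} (hc : 0 < c) (a b : ℝ) {z : ℝ} (hz : |z| < 1) :
    (1 - z) ^ (a + b - c) * hyp a b c z = hyp (c - a) (c - b) c z := by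
  set s := a + b - c
  have hmem : ∀ z : ℝ, z ∈ Metric.ball (0:ℝ) 1 ↔ |z| < 1 := by simp
  have hpos : ∀ z ∈ Metric.ball (0:ℝ) 1, 0 < 1 - z := fun z hz => by
    have := (abs_lt.1 ((hmem z).1 hz)).2; linarith
  have hP : ∀ (s : ℝ), ∀ z ∈ Metric.ball (0:ℝ) 1, HasDerivAt (fun z : ℝ => (1 - z) ^ s)
      (-(s * (1 - z) ^ s / (1 - z))) z := fun s z hz => by
    have h := ((hasDerivAt_id z).const_sub 1).rpow_const (p := s) (Or.inl (hpos z hz).ne')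
    refine h.congr_deriv ?_
    rw [show (1 - id z) ^ (s - 1) = (1 - z) ^ s / (1 - z) from Real.rpow_sub_one (hpos z hz).ne' s]
    ring
  have hF := (unitSummable_hypCoeff a b c).analyticOnNhd
  have hPa : AnalyticOnNhd ℝ (fun z : ℝ => (1 - z) ^ s) (Metric.ball 0 1) := fun z hz =>
    analyticWithinAt_univ.1 (contDiffWithinAt_omega_iff_analyticWithinAt.1
      ((contDiffAt_const.sub contDiffAt_id).rpow_const_of_ne (hpos z hz).ne').contDiffWithinAt)
  have hga := hPa.mul hF
  set g := fun z : ℝ => (1 - z) ^ s * hyp a b c z with hgdef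
  have hd : ∀ z ∈ Metric.ball (0:ℝ) 1, deriv g z =
      (1 - z) ^ s * (hypD a b c z - s / (1 - z) * hyp a b c z) := fun z hz => by
    have := ((hP s z hz).mul (hasDerivAt_hyp a b c ((hmem z).1 hz))).deriv
    refine this.trans ?_
    ring
  have hdd : ∀ z ∈ Metric.ball (0:ℝ) 1, deriv (deriv g) z =
      (1 - z) ^ s * (hypDD a b c z - 2 * s / (1 - z) * hypD a b c z
        + s * (s - 1) / (1 - z) ^ 2 * hyp a b c z) := fun z hz => by
    have he : deriv g =ᶠ[𝓝 z] fun z => (1 - z) ^ s *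
        (hypD a b c z - s / (1 - z) * hyp a b c z) :=
      eventually_of_mem (Metric.isOpen_ball.mem_nhds hz) hd
    rw [he.deriv_eq]
    have hz1 := (hpos z hz).ne'
    have hq : HasDerivAt (fun z : ℝ => s / (1 - z)) (s / (1 - z) ^ 2) z := by
      have := (hasDerivAt_const z s).div ((hasDerivAt_id z).const_sub 1) hz1
      refine this.congr_deriv ?_
      simp only [id_eq]
      ring
    have := ((hP s z hz).mul ((hasDerivAt_hypD a b c ((hmem z).1 hz)).sub
      (hq.mul (hasDerivAt_hyp a b c ((hmem z).1 hz))))).deriv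
    refine this.trans ?_
    simp only [Pi.sub_apply, Pi.mul_apply]
    field_simp
    ring
  -- The product (1 − z)^s F solves the hypergeometric equation with parameters c − a, c − b and has
  -- value 1 at 0, so uniqueness identifies it.
  have := eqOn_const_mul_hyp (a := c - a) (b := c - b) hc hga (fun z hz => by
    have h1 := hd z hz
    have h2 := hdd z hz
    change z * (1 - z) * deriv (deriv g) z + _ * deriv g z - _ * g z = 0
    rw [h1, h2]
    have hz1 := (hpos z hz).ne'
    have h3 := hyp_equation hc a b ((hmem z).1 hz)
    simp only [hgdef]
    have h4 : z * (1 - z) * (hypDD a b c z - 2 * s / (1 - z) * hypD a b c z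
        + s * (s - 1) / (1 - z) ^ 2 * hyp a b c z) + (c - (c - a + (c - b) + 1) * z) *
        (hypD a b c z - s / (1 - z) * hyp a b c z) - (c - a) * (c - b) * hyp a b c z = 0 := by
      have : z * (1 - z) * (hypDD a b c z - 2 * s / (1 - z) * hypD a b c z
        + s * (s - 1) / (1 - z) ^ 2 * hyp a b c z) + (c - (c - a + (c - b) + 1) * z) *
        (hypD a b c z - s / (1 - z) * hyp a b c z) - (c - a) * (c - b) * hyp a b c z =
        z * (1 - z) * hypDD a b c z + (c - (a + b + 1) * z) * hypD a b c z
          - a * b * hyp a b c z := by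
        simp only [s]
        field_simp
        ring
      rw [this, h3]
    linear_combination (1 - z) ^ s * h4) hz
  refine this.trans ?_
  have h0 : g 0 = 1 := by
    have := hyp_zero a b c
    simp only [hgdef, sub_zero, Real.one_rpow, one_mul]
    exact this
  rw [h0, one_mul]

/-! ### Values at `1` and connection coefficients -/

/-- No exception at `x = 0`: `Real.Gamma` is 0 at its poles, so its inverse is the entire function
1/Γ. All later formulas are written with such inverses for this reason. -/
theorem Gamma_inv_eq (x : ℝ) : (Real.Gamma x)⁻¹ = x * (Real.Gamma (x + 1))⁻¹ := by
  rcases eq_or_ne x 0 with rfl | h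
  · simp [Real.Gamma_zero]
  · rw [Real.Gamma_add_one h, mul_inv, mul_inv_cancel_left₀ h]

theorem ascPochhammer_eval_eq_prod (a : ℝ) (n : ℕ) :
    (ascPochhammer ℝ n).eval a = ∏ j ∈ Finset.range n, (a + j) := by
  induction n with
  | zero => simp
  | succ n ih => rw [ascPochhammer_succ_eval, Finset.prod_range_succ, ih]

/-- Euler's limit, in reciprocal form so that it includes the poles of Γ: there a factor of the
Pochhammer product is 0 from some `n` on. -/
theorem tendsto_ascPochhammer_div (a : ℝ) :
    Tendsto (fun n : ℕ => (ascPochhammer ℝ (n + 1)).eval a / ((n : ℝ) ^ a * n.factorial)) atTop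
      (𝓝 (Real.Gamma a)⁻¹) := by
  by_cases h : ∀ m : ℕ, a ≠ -m
  · refine ((Real.GammaSeq_tendsto_Gamma a).inv₀ (Real.Gamma_ne_zero h)).congr fun n => ?_
    rw [Real.GammaSeq, inv_div, ascPochhammer_eval_eq_prod]
  · push Not at h
    obtain ⟨m, rfl⟩ := h
    rw [Real.Gamma_neg_nat_eq_zero, inv_zero]
    refine tendsto_const_nhds.congr' ?_
    filter_upwards [eventually_ge_atTop m] with n hn
    rw [ascPochhammer_eval_eq_prod, Finset.prod_eq_zero (i := m) (Finset.mem_range.2 (by omega))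
      (by ring), zero_div]

/-- Four applications of Euler's limit. The index `n + 1` occurs because that limit has `n + 1`
factors. -/
theorem hypCoeff_isBigO (a b : ℝ) {c : ℝ} (hc : 0 < c) :
    (fun n : ℕ => hypCoeff a b c (n + 1)) =O[atTop] fun n : ℕ => (n : ℝ) ^ (a + b - c - 1) := by
  have h := (((tendsto_ascPochhammer_div a).mul (tendsto_ascPochhammer_div b)).mul
    ((tendsto_ascPochhammer_div c).inv₀ (inv_ne_zero (Real.Gamma_pos_of_pos hc).ne'))).mul
    ((tendsto_ascPochhammer_div 1).inv₀ (inv_ne_zero (Real.Gamma_pos_of_pos one_pos).ne'))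
  have h2 := h.isBigO_one ℝ
  have h3 := h2.mul (Asymptotics.isBigO_refl (fun n : ℕ => (n : ℝ) ^ (a + b - c - 1)) atTop)
  simp only [one_mul] at h3
  refine h3.congr' ?_ EventuallyEq.rfl
  filter_upwards [eventually_gt_atTop 0] with n hn
  have hn' : (0 : ℝ) < n := by exact_mod_cast hn
  have hf : (n.factorial : ℝ) ≠ 0 := by positivity
  have hcp : (ascPochhammer ℝ (n + 1)).eval c ≠ 0 := (ascPochhammer_pos _ _ hc).ne'
  unfold hypCoeff ordinaryHypergeometricCoefficient
  rw [ascPochhammer_eval_one, Real.rpow_sub hn', Real.rpow_sub hn', Real.rpow_add hn',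
    Nat.factorial_succ]
  have := Real.rpow_pos_of_pos hn'
  have h1 := (this a).ne'
  have h2 := (this b).ne'
  have h3 := (this c).ne'
  push_cast
  field_simp

theorem summable_hypCoeff (a b : ℝ) {c : ℝ} (hc : 0 < c) (h : 0 < c - a - b) :
    Summable (hypCoeff a b c) := by
  rw [← summable_nat_add_iff 1]
  exact summable_of_isBigO_nat (Real.summable_nat_rpow.2 (by linarith)) (hypCoeff_isBigO a b hc)

theorem tendsto_mul_hypCoeff (a b : ℝ) {c : ℝ} (hc : 0 < c) (h : 0 < c - a - b) :
    Tendsto (fun n : ℕ => n * hypCoeff a b c n) atTop (𝓝 0) := by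
  rw [← tendsto_add_atTop_iff_nat 1]
  have h1 : (fun n : ℕ => ((n + 1 : ℕ) : ℝ)) =O[atTop] fun n : ℕ => (n : ℝ) := by
    refine Asymptotics.IsBigO.of_bound 2 ?_
    filter_upwards [eventually_ge_atTop 1] with n hn
    have : (1 : ℝ) ≤ n := by exact_mod_cast hn
    rw [Real.norm_of_nonneg (by positivity), Real.norm_of_nonneg (by positivity)]
    push_cast; linarith
  refine (h1.mul (hypCoeff_isBigO a b hc)).trans_tendsto ?_
  have h2 := (tendsto_rpow_neg_atTop h).comp tendsto_natCast_atTop_atTop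
  refine h2.congr' ?_
  filter_upwards [eventually_gt_atTop 0] with n hn
  have hn' : (0 : ℝ) < n := by exact_mod_cast hn
  simp only [Function.comp_apply]
  rw [← Real.rpow_one_add' hn'.le (by linarith)]
  congr 1; ring

theorem hypCoeff_add_one {c : ℝ} (hc : 0 < c) (a b : ℝ) (n : ℕ) :
    hypCoeff a b (c + 1) n = hypCoeff a b c n * (c / (c + n)) := by
  induction n with
  | zero => simp [hc.ne']
  | succ n ih =>
    have h1 := hypCoeff_succ (by linarith : 0 < c + 1) a b n
    have h2 := hypCoeff_succ hc a b n
    have h3 : c + n ≠ 0 := by positivity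
    have h4 : c + 1 + n ≠ 0 := by positivity
    have h5 : c + (n + 1) ≠ 0 := by positivity
    have h6 : (n : ℝ) + 1 ≠ 0 := by positivity
    rw [ih] at h1
    push_cast
    have h7 : hypCoeff a b (c + 1) (n + 1) =
      (a + n) * (b + n) * (hypCoeff a b c n * (c / (c + n))) / ((n + 1) * (c + 1 + n)) := by
      rw [← h1]; field_simp
    have h8 : hypCoeff a b c (n + 1) = (a + n) * (b + n) * hypCoeff a b c n / ((n + 1) * (c + n)) := by
      rw [← h2]; field_simp
    rw [h7, h8]
    field_simp
    ring

/-- Gauss' contiguous relation at z = 1. The difference of the two series telescopes, with partial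
sums −c N times the N-th coefficient, which tend to 0 when c > a + b. -/
theorem tsum_hypCoeff_add_one (a b : ℝ) {c : ℝ} (hc : 0 < c) (h : 0 < c - a - b) :
    c * (c - a - b) * ∑' n, hypCoeff a b c n =
      (c - a) * (c - b) * ∑' n, hypCoeff a b (c + 1) n := by
  have h1 := ((summable_hypCoeff a b hc h).hasSum.mul_left (c * (c - a - b))).sub
    ((summable_hypCoeff a b (by linarith : 0 < c + 1) (by linarith)).hasSum.mul_left
      ((c - a) * (c - b)))
  have hT := (tendsto_mul_hypCoeff a b hc h).const_mul c
  have hpart : ∀ N, ∑ n ∈ Finset.range N, (c * (c - a - b) * hypCoeff a b c n -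
      (c - a) * (c - b) * hypCoeff a b (c + 1) n) = - (c * (N * hypCoeff a b c N)) := by
    intro N
    induction N with
    | zero => simp
    | succ N ih =>
      rw [Finset.sum_range_succ, ih, hypCoeff_add_one hc]
      have h2 := hypCoeff_succ hc a b N
      have h3 : c + N ≠ 0 := by positivity
      have h6 : (N : ℝ) + 1 ≠ 0 := by positivity
      have h8 : hypCoeff a b c (N + 1) =
          (a + N) * (b + N) * hypCoeff a b c N / ((N + 1) * (c + N)) := by
        rw [← h2]; field_simp
      rw [h8]
      push_cast
      field_simp
      ring
  have h2 := h1.tendsto_sum_nat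
  simp only [hpart] at h2
  have h3 := tendsto_nhds_unique h2 hT.neg
  linarith

/-- Gives at once the majorant and the decay needed to see that the series at z = 1 tends to its
zeroth term when `c` is raised to infinity. -/
theorem abs_hypCoeff_add_nat_le (a b : ℝ) {c : ℝ} (hc : 0 < c) {n : ℕ} (hn : 1 ≤ n) (m : ℕ) :
    |hypCoeff a b (c + m) n| ≤ |hypCoeff a b c n| * (c / (c + m)) := by
  induction m with
  | zero => simp [hc.ne']
  | succ m ih =>
    have h1 := hypCoeff_add_one (by positivity : 0 < c + m) a b n
    push_cast
    rw [← add_assoc, h1, abs_mul, abs_of_nonneg (by positivity : 0 ≤ (c + m) / (c + m + n))]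
    have hn' : (1 : ℝ) ≤ n := by exact_mod_cast hn
    have h2 : (c + m) / (c + m + n) ≤ (c + m) / (c + m + 1) := by gcongr
    refine (mul_le_mul ih h2 (by positivity) (by positivity)).trans (le_of_eq ?_)
    have : c + m ≠ 0 := by positivity
    field_simp

/-- Gauss' summation theorem. -/
theorem tsum_hypCoeff (a b : ℝ) {c : ℝ} (hc : 0 < c) (h : 0 < c - a - b) :
    ∑' n, hypCoeff a b c n = Real.Gamma c * Real.Gamma (c - a - b) *
      ((Real.Gamma (c - a))⁻¹ * (Real.Gamma (c - b))⁻¹) := by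
  have hS : Tendsto (fun m : ℕ => ∑' n, hypCoeff a b (c + m) n) atTop
      (𝓝 (∑' n : ℕ, if n = 0 then 1 else 0)) := by
    refine tendsto_tsum_of_dominated_convergence (summable_hypCoeff a b hc h).abs
      (fun n => ?_) (Eventually.of_forall fun m n => ?_)
    · rcases Nat.eq_zero_or_pos n with rfl | hn
      · simp
      · simp only [hn.ne', if_false]
        refine squeeze_zero_norm (fun m => abs_hypCoeff_add_nat_le a b hc hn m) ?_
        have h1 : Tendsto (fun m : ℕ => c / (c + m)) atTop (𝓝 0) :=
          tendsto_const_nhds.div_atTop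
            (tendsto_atTop_add_const_left _ _ tendsto_natCast_atTop_atTop)
        simpa using h1.const_mul |hypCoeff a b c n|
    · rcases Nat.eq_zero_or_pos n with rfl | hn
      · simp
      · refine (abs_hypCoeff_add_nat_le a b hc hn m).trans
          (mul_le_of_le_one_right (abs_nonneg _) ?_)
        rw [div_le_one (by positivity)]
        linarith [Nat.cast_nonneg (α := ℝ) m]
  simp only [tsum_ite_eq] at hS
  -- The contiguous relation iterated `m` times. As m → ∞ the raised series tends to 1 and the
  -- Pochhammer quotient to the Gamma quotient; the powers of m cancel because (c − a) + (c − b) = c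
  -- + (c − a − b).
  have hprod : ∀ m : ℕ, ∑' n, hypCoeff a b c n =
      (ascPochhammer ℝ m).eval (c - a) * (ascPochhammer ℝ m).eval (c - b) /
      ((ascPochhammer ℝ m).eval c * (ascPochhammer ℝ m).eval (c - a - b)) *
        ∑' n, hypCoeff a b (c + m) n := by
    intro m
    induction m with
    | zero => simp
    | succ m ih =>
      have h1 := tsum_hypCoeff_add_one a b (c := c + m) (by positivity)
        (by linarith [Nat.cast_nonneg (α := ℝ) m])
      have h2 : c + m ≠ 0 := by positivity
      have h3 : c - a - b + m ≠ 0 := by positivity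
      have h4 := (ascPochhammer_pos m c hc).ne'
      have h5 := (ascPochhammer_pos m _ h).ne'
      rw [ih, ascPochhammer_succ_eval, ascPochhammer_succ_eval, ascPochhammer_succ_eval,
        ascPochhammer_succ_eval]
      push_cast
      rw [← add_assoc]
      have h6 : ∑' n, hypCoeff a b (c + m) n = (c + m - a) * (c + m - b) *
          ∑' n, hypCoeff a b (c + m + 1) n / ((c + m) * (c - a - b + m)) := by
        rw [tsum_div_const, mul_div_assoc', ← h1]
        rw [eq_div_iff (mul_ne_zero h2 h3)]
        ring
      rw [h6, tsum_div_const]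
      field_simp
      ring
  have hlim := (((tendsto_ascPochhammer_div (c - a)).mul (tendsto_ascPochhammer_div (c - b))).div
    ((tendsto_ascPochhammer_div c).mul (tendsto_ascPochhammer_div (c - a - b)))
    (mul_ne_zero (inv_ne_zero (Real.Gamma_pos_of_pos hc).ne')
      (inv_ne_zero (Real.Gamma_pos_of_pos h).ne'))).mul
    ((tendsto_add_atTop_iff_nat 1).2 hS)
  have hconst : Tendsto (fun _ : ℕ => ∑' n, hypCoeff a b c n) atTop
      (𝓝 (∑' n, hypCoeff a b c n)) := tendsto_const_nhds
  refine (tendsto_nhds_unique (hconst.congr' ?_) hlim).trans ?_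
  · filter_upwards [eventually_gt_atTop 0] with n hn
    have hn' : (0 : ℝ) < n := by exact_mod_cast hn
    refine (hprod (n + 1)).trans ?_
    congr 1
    have := Real.rpow_pos_of_pos hn'
    have h1 := (this (c - a)).ne'
    have h2 := (this (c - b)).ne'
    have h3 := (this c).ne'
    have h4 := (this (c - a - b)).ne'
    have h5 := (ascPochhammer_pos (n + 1) c hc).ne'
    have h6 := (ascPochhammer_pos (n + 1) _ h).ne'
    have h7 : (n : ℝ) ^ (c - a) * (n : ℝ) ^ (c - b) = (n : ℝ) ^ c * (n : ℝ) ^ (c - a - b) := by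
      rw [← Real.rpow_add hn', ← Real.rpow_add hn']; congr 1; ring
    have hf : (n.factorial : ℝ) ≠ 0 := by positivity
    simp only [Pi.div_apply]
    rw [div_mul_div_comm, div_mul_div_comm, div_div_div_eq]
    have h8 : (n : ℝ) ^ (c - a) * n.factorial * ((n : ℝ) ^ (c - b) * n.factorial) =
      (n : ℝ) ^ c * n.factorial * ((n : ℝ) ^ (c - a - b) * n.factorial) := by
      linear_combination (n.factorial : ℝ) ^ 2 * h7
    rw [h8]
    field_simp
  · have h1 := (Real.Gamma_pos_of_pos hc).ne'
    have h2 := (Real.Gamma_pos_of_pos h).ne'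
    rw [mul_one, div_eq_mul_inv, mul_inv, inv_inv, inv_inv]
    ring

theorem tendsto_hyp_one (a b : ℝ) {c : ℝ} (hc : 0 < c) (h : 0 < c - a - b) :
    Tendsto (hyp a b c) (𝓝[<] 1) (𝓝 (Real.Gamma c * Real.Gamma (c - a - b) *
      ((Real.Gamma (c - a))⁻¹ * (Real.Gamma (c - b))⁻¹))) := by
  rw [← tsum_hypCoeff a b hc h]
  exact Real.tendsto_tsum_powerSeries_nhdsWithin_lt
    (summable_hypCoeff a b hc h).hasSum.tendsto_sum_nat

theorem hypD_eq {c : ℝ} (hc : 0 < c) (a b z : ℝ) :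
    hypD a b c z = a * b / c * hyp (a + 1) (b + 1) (c + 1) z := by
  have : derivCoeff (hypCoeff a b c) = fun n => a * b / c * hypCoeff (a + 1) (b + 1) (c + 1) n := by
    ext n
    induction n with
    | zero =>
      have := hypCoeff_succ hc a b 0
      simp only [derivCoeff, Nat.cast_zero, zero_add, add_zero, hypCoeff_zero, one_mul, mul_one]
        at this ⊢
      rw [← this]; field_simp
    | succ n ih =>
      have h1 := hypCoeff_succ hc a b (n + 1)
      have h2 := hypCoeff_succ (by linarith : 0 < c + 1) (a + 1) (b + 1) n
      unfold derivCoeff at ih ⊢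
      push_cast at h1 ⊢
      have h3 : (n : ℝ) + 1 ≠ 0 := by positivity
      have h4 : c + 1 + n ≠ 0 := by positivity
      have h5 : (n + 1 : ℝ) * (c + 1 + n) ≠ 0 := mul_ne_zero h3 h4
      apply mul_left_cancel₀ h5
      linear_combination (n + 1) * h1 + (a + 1 + n) * (b + 1 + n) * ih - a * b / c * h2
  unfold hypD hyp powSum
  rw [this, ← tsum_mul_left]
  exact tsum_congr fun n => by ring

/-- A relation of this form is assumed, and its coefficients are read off at z → 1. Multiplication
by (1 − z)^ν and Euler's transformation make all terms finite there: the limit gives A. The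
derivative times (1 − z)^(1−ν) has limit −νB. Both use 0 < ν < 1 and Gauss' theorem. -/
theorem connection_coeff {a b c ν A B : ℝ} (hc : 0 < c) (hν : a + b - c = ν) (h0 : 0 < ν)
    (h1 : ν < 1)
    (h : ∀ z ∈ Ioo (0 : ℝ) 1, hyp a b c z =
      A * ((1 - z) ^ (-ν) * hyp (c - a) (c - b) (1 - ν) (1 - z)) + B * hyp a b (1 + ν) (1 - z)) :
    A = Real.Gamma c * Real.Gamma ν * ((Real.Gamma a)⁻¹ * (Real.Gamma b)⁻¹) ∧
    B = Real.Gamma c * Real.Gamma (-ν) * ((Real.Gamma (c - a))⁻¹ * (Real.Gamma (c - b))⁻¹) := by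
  have hIoo : ∀ᶠ z in 𝓝[<] (1 : ℝ), z ∈ Ioo (0 : ℝ) 1 := Ioo_mem_nhdsLT one_pos
  have hsub : Tendsto (fun z : ℝ => 1 - z) (𝓝[<] 1) (𝓝 0) := by
    have : Tendsto (fun z : ℝ => 1 - z) (𝓝 1) (𝓝 (1 - 1)) := by
      exact (continuous_const.sub continuous_id).tendsto 1
    rw [sub_self] at this
    exact this.mono_left nhdsWithin_le_nhds
  have hpow : ∀ s : ℝ, 0 < s → Tendsto (fun z : ℝ => (1 - z) ^ s) (𝓝[<] 1) (𝓝 0) := by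
    intro s hs
    have := hsub.rpow_const (p := s) (Or.inr hs.le)
    rwa [Real.zero_rpow hs.ne'] at this
  have hF : ∀ a b c : ℝ, Tendsto (fun z => hyp a b c (1 - z)) (𝓝[<] 1) (𝓝 1) := by
    intro a b c
    have := (hasDerivAt_hyp a b c (z := 0) (by simp)).continuousAt.tendsto.comp hsub
    rwa [hyp_zero] at this
  have hFD : ∀ a b c : ℝ, Tendsto (fun z => hypD a b c (1 - z)) (𝓝[<] 1)
      (𝓝 (hypD a b c 0)) := by
    intro a b c
    exact (hasDerivAt_hypD a b c (z := 0) (by simp)).continuousAt.tendsto.comp hsub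
  have hg : ∀ z ∈ Ioo (0 : ℝ) 1, hyp (c - a) (c - b) c z =
      A * hyp (c - a) (c - b) (1 - ν) (1 - z) + B * ((1 - z) ^ ν * hyp a b (1 + ν) (1 - z)) := by
    intro z hz
    have hz1 : 0 < 1 - z := by linarith [hz.2]
    rw [← hyp_euler hc a b (abs_lt.2 ⟨by linarith [hz.1], hz.2⟩), h z hz, hν, mul_add]
    have : (1 - z) ^ ν * (1 - z) ^ (-ν) = 1 := by rw [← Real.rpow_add hz1]; simp
    linear_combination (A * hyp (c - a) (c - b) (1 - ν) (1 - z)) * this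
  constructor
  · have l1 := tendsto_hyp_one (c - a) (c - b) hc (by linarith)
    have l2 := ((hF (c - a) (c - b) (1 - ν)).const_mul A).add
      (((hpow ν h0).mul (hF a b (1 + ν))).const_mul B)
    have := tendsto_nhds_unique (l1.congr' (hIoo.mono hg)) l2
    have e : c - (c - a) - (c - b) = ν := by linarith
    rw [e, sub_sub_cancel, sub_sub_cancel] at this
    linarith
  · have hd : ∀ z ∈ Ioo (0 : ℝ) 1, hypD (c - a) (c - b) c z =
        A * (-hypD (c - a) (c - b) (1 - ν) (1 - z)) +
        B * (-(ν * (1 - z) ^ (ν - 1)) * hyp a b (1 + ν) (1 - z)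
          + (1 - z) ^ ν * (-hypD a b (1 + ν) (1 - z))) := by
      intro z hz
      have hz1 : 0 < 1 - z := by linarith [hz.2]
      have habs : |1 - z| < 1 := abs_lt.2 ⟨by linarith, by linarith [hz.1]⟩
      have hs : HasDerivAt (fun z : ℝ => 1 - z) (-1) z := (hasDerivAt_id z).const_sub 1
      have hc1 : ∀ a b c : ℝ, HasDerivAt (fun z => hyp a b c (1 - z)) (-hypD a b c (1 - z)) z := by
        intro a b c
        have := (hasDerivAt_hyp a b c habs).comp z hs
        exact this.congr_deriv (by ring)
      have hp : HasDerivAt (fun z : ℝ => (1 - z) ^ ν) (-(ν * (1 - z) ^ (ν - 1))) z := by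
        refine (hs.rpow_const (Or.inl hz1.ne')).congr_deriv ?_
        ring
      have hr := ((hc1 (c - a) (c - b) (1 - ν)).const_mul A).add
        ((hp.mul (hc1 a b (1 + ν))).const_mul B)
      have hl := hasDerivAt_hyp (c - a) (c - b) c (z := z) (abs_lt.2 ⟨by linarith [hz.1], hz.2⟩)
      exact hl.unique (hr.congr_of_eventuallyEq
        (eventually_of_mem (isOpen_Ioo.mem_nhds hz) fun y hy => hg y hy))
    -- The derivative is hypergeometric with all parameters raised by one. Euler's transformation
    -- extracts the factor (1 − z)^(ν−1) and leaves parameters a, b; c + 1, for which Gauss' theorem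
    -- applies because c + 1 − a − b = 1 − ν > 0.
    have hl : ∀ z ∈ Ioo (0 : ℝ) 1, (1 - z) ^ (1 - ν) * hypD (c - a) (c - b) c z =
        (c - a) * (c - b) / c * hyp a b (c + 1) z := by
      intro z hz
      have hz1 : 0 < 1 - z := by linarith [hz.2]
      have he := hyp_euler (by linarith : 0 < c + 1) a b (z := z)
        (abs_lt.2 ⟨by linarith [hz.1], hz.2⟩)
      rw [hypD_eq hc, show c - a + 1 = c + 1 - a by ring, show c - b + 1 = c + 1 - b by ring, ← he,
        show a + b - (c + 1) = -(1 - ν) by linarith]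
      have : (1 - z) ^ (1 - ν) * (1 - z) ^ (-(1 - ν)) = 1 := by rw [← Real.rpow_add hz1]; simp
      linear_combination ((c - a) * (c - b) / c * hyp a b (c + 1) z) * this
    have hr : ∀ z ∈ Ioo (0 : ℝ) 1, (1 - z) ^ (1 - ν) * hypD (c - a) (c - b) c z =
        A * ((1 - z) ^ (1 - ν) * (-hypD (c - a) (c - b) (1 - ν) (1 - z))) +
        B * (-ν * hyp a b (1 + ν) (1 - z) + (1 - z) ^ (1 : ℝ) * (-hypD a b (1 + ν) (1 - z))) := by
      intro z hz
      have hz1 : 0 < 1 - z := by linarith [hz.2]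
      have e1 : (1 - z) ^ (1 - ν) * (1 - z) ^ (ν - 1) = 1 := by rw [← Real.rpow_add hz1]; simp
      have e2 : (1 - z) ^ (1 - ν) * (1 - z) ^ ν = (1 - z) ^ (1 : ℝ) := by
        rw [← Real.rpow_add hz1]; congr 1; ring
      rw [hd z hz]
      linear_combination (-B * ν * hyp a b (1 + ν) (1 - z)) * e1
        + (-B * hypD a b (1 + ν) (1 - z)) * e2
    have l1 := (tendsto_hyp_one a b (by linarith : 0 < c + 1) (by linarith)).const_mul
      ((c - a) * (c - b) / c)
    have l2 := (((hpow (1 - ν) (by linarith)).mul (hFD (c - a) (c - b) (1 - ν)).neg).const_mul A).add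
      ((((hF a b (1 + ν)).const_mul (-ν)).add
        ((hpow 1 one_pos).mul (hFD a b (1 + ν)).neg)).const_mul B)
    have := tendsto_nhds_unique
      (l1.congr' (hIoo.mono fun z hz => (hl z hz).symm.trans (hr z hz))) l2
    rw [show c + 1 - a - b = 1 - ν by linarith, Real.Gamma_add_one hc.ne'] at this
    have g1 := Gamma_inv_eq (c - a)
    have g2 := Gamma_inv_eq (c - b)
    rw [show c - a + 1 = c + 1 - a by ring] at g1
    rw [show c - b + 1 = c + 1 - b by ring] at g2
    have g3 := Real.Gamma_add_one (s := -ν) (by linarith)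
    rw [show -ν + 1 = 1 - ν by ring] at g3
    rw [g3] at this
    rw [g1, g2]
    have h2 : (-ν) * B = (-ν) * (Real.Gamma c * Real.Gamma (-ν) * (((c - a) * (Real.Gamma (c + 1 - a))⁻¹) *
        ((c - b) * (Real.Gamma (c + 1 - b))⁻¹))) := by
      have h3 : (c - a) * (c - b) / c * (c * Real.Gamma c * (-ν * Real.Gamma (-ν)) *
        ((Real.Gamma (c + 1 - a))⁻¹ * (Real.Gamma (c + 1 - b))⁻¹)) =
        (-ν) * (Real.Gamma c * Real.Gamma (-ν) * (((c - a) * (Real.Gamma (c + 1 - a))⁻¹) *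
        ((c - b) * (Real.Gamma (c + 1 - b))⁻¹))) := by field_simp
      rw [← h3]
      linarith
    exact mul_left_cancel₀ (by linarith) h2

/-! ### The terminating case -/

open Polynomial in
/-- The hypergeometric polynomial with `a = -n`. -/
def hypPoly (n : ℕ) (b c : ℝ) : ℝ[X] :=
  ∑ k ∈ Finset.range (n + 1), C (hypCoeff (-n) b c k) * X ^ k

theorem hypCoeff_neg_nat_eq_zero {n k : ℕ} (h : n < k) (b c : ℝ) : hypCoeff (-n) b c k = 0 := by
  unfold hypCoeff ordinaryHypergeometricCoefficient
  rw [ascPochhammer_eval_neg_coe_nat_of_lt h]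
  simp

theorem hyp_eq_eval_hypPoly (n : ℕ) (b c z : ℝ) : hyp (-n) b c z = (hypPoly n b c).eval z := by
  unfold hyp powSum hypPoly
  rw [tsum_eq_sum (s := Finset.range (n + 1)) fun k hk => by
    rw [hypCoeff_neg_nat_eq_zero (by simpa using hk), zero_mul]]
  simp [Polynomial.eval_finsetSum]

theorem coeff_hypPoly (n : ℕ) (b c : ℝ) (k : ℕ) :
    (hypPoly n b c).coeff k = hypCoeff (-n) b c k := by
  unfold hypPoly
  simp only [Polynomial.finsetSum_coeff, Polynomial.coeff_C_mul, Polynomial.coeff_X_pow,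
    mul_ite, mul_one, mul_zero]
  rw [Finset.sum_ite_eq]
  split_ifs with h
  · rfl
  · rw [hypCoeff_neg_nat_eq_zero (by simpa using h)]

theorem polynomial_eq_of_eqOn_Ioo {p q : Polynomial ℝ}
    (h : ∀ z ∈ Ioo (0 : ℝ) 1, p.eval z = q.eval z) : p = q :=
  Polynomial.eq_of_infinite_eval_eq p q ((Ioo_infinite one_pos).mono h)

open Polynomial in
-- As a polynomial identity the equation is available outside the unit disc; `hyp_terminating` needs
-- it at 1 − z for all |z| < 1.
theorem hypPoly_equation {e : ℝ} (he : 0 < e) (n : ℕ) (b : ℝ) :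
    X * (1 - X) * derivative (derivative (hypPoly n b e)) +
      (C e - C (-n + b + 1) * X) * derivative (hypPoly n b e) - C (-n * b) * hypPoly n b e = 0 := by
  refine polynomial_eq_of_eqOn_Ioo fun z hz => ?_
  have hf : hyp (-n) b e = fun z => (hypPoly n b e).eval z := by
    ext z; exact hyp_eq_eval_hypPoly n b e z
  have habs : ∀ z ∈ Ioo (0 : ℝ) 1, |z| < 1 := fun z hz => abs_lt.2 ⟨by linarith [hz.1], hz.2⟩
  have h1 : ∀ z ∈ Ioo (0 : ℝ) 1, (derivative (hypPoly n b e)).eval z = hypD (-n) b e z := by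
    intro z hz
    have h := hasDerivAt_hyp (-n) b e (habs z hz)
    rw [hf] at h
    exact ((hypPoly n b e).hasDerivAt z).unique h
  have h2 : (derivative (derivative (hypPoly n b e))).eval z = hypDD (-n) b e z := by
    have h := hasDerivAt_hypD (-n) b e (habs z hz)
    have h' := h.congr_of_eventuallyEq (eventually_of_mem (isOpen_Ioo.mem_nhds hz) h1)
    exact ((derivative (hypPoly n b e)).hasDerivAt z).unique h'
  have := hyp_equation he (-n) b (habs z hz)
  simp only [eval_sub, eval_add, eval_mul, eval_X, eval_C, eval_one, h1 z hz, h2,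
    ← hyp_eq_eval_hypPoly, eval_zero]
  exact this

open Polynomial in
/-- The connection formula for a terminating series. -/
theorem hyp_terminating {c e : ℝ} (hc : 0 < c) (he : 0 < e) (n : ℕ) (z : ℝ) :
    hyp (-n) (c + e - 1 + n) c z = (-1) ^ n * (ascPochhammer ℝ n).eval e /
      (ascPochhammer ℝ n).eval c * hyp (-n) (c + e - 1 + n) e (1 - z) := by
  set b := c + e - 1 + n with hb
  set Q := hypPoly n b e with hQ
  set P := hypPoly n b c with hP
  have hode := hypPoly_equation he n b
  have hlin : HasDerivAt (fun z : ℝ => 1 - z) (-1) z := (hasDerivAt_id z).const_sub 1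
  -- Under z ↦ 1 − z the equation keeps a and b and exchanges c with a + b + 1 − c, here `e`. So Q(1
  -- − z) is an analytic solution at 0 of the equation of `P`.
  have hcomp : Q.comp (1 - X) = C (Q.eval 1) * P := by
    refine polynomial_eq_of_eqOn_Ioo fun z hz => ?_
    have hd : ∀ R : ℝ[X], deriv (fun z => R.eval (1 - z)) = fun z => -(derivative R).eval (1 - z) := by
      intro R; ext z
      have := (R.hasDerivAt (1 - z)).comp z ((hasDerivAt_id z).const_sub 1)
      exact (this.congr_deriv (by ring)).deriv
    have hg : AnalyticOnNhd ℝ (fun z => Q.eval (1 - z)) (Metric.ball 0 1) := by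
      have : (fun z => Q.eval (1 - z)) = fun z => (Q.comp (1 - X)).eval z := by
        ext z; simp
      rw [this]
      exact fun z _ => AnalyticOnNhd.eval_polynomial _ z (mem_univ z)
    have := eqOn_const_mul_hyp (a := -n) (b := b) hc hg (fun z _ => by
      rw [hd]
      have h2 : deriv (fun z => -(derivative Q).eval (1 - z)) z =
          (derivative (derivative Q)).eval (1 - z) := by
        rw [deriv.fun_neg, hd, neg_neg]
      rw [h2]
      have h3 := congrArg (Polynomial.eval (1 - z)) hode
      simp only [eval_sub, eval_add, eval_mul, eval_X, eval_C, eval_one, eval_zero] at h3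
      simp only [hb] at h3 ⊢
      linear_combination h3) (z := z) (abs_lt.2 ⟨by linarith [hz.1], hz.2⟩)
    simp only [eval_comp, eval_sub, eval_one, eval_X, eval_mul, eval_C, hP]
    rw [this, sub_zero, hyp_eq_eval_hypPoly]
  have hbn : (ascPochhammer ℝ n).eval b ≠ 0 := by
    rcases Nat.eq_zero_or_pos n with h | h
    · simp [h]
    · have : (1 : ℝ) ≤ n := by exact_mod_cast h
      exact (ascPochhammer_pos n b (by linarith)).ne'
  have hnn : (ascPochhammer ℝ n).eval (-(n : ℝ)) ≠ 0 := by
    rw [ascPochhammer_eval_eq_prod, Finset.prod_ne_zero_iff]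
    intro j hj
    have : (j : ℝ) < n := by exact_mod_cast Finset.mem_range.1 hj
    linarith
  have hcn := (ascPochhammer_pos n c hc).ne'
  have hen := (ascPochhammer_pos n e he).ne'
  have hfn : (n.factorial : ℝ) ≠ 0 := by positivity
  have hlead : ∀ x : ℝ, hypCoeff (-n) b x n = ((n.factorial : ℝ))⁻¹ * (ascPochhammer ℝ n).eval (-(n : ℝ)) *
      (ascPochhammer ℝ n).eval b * ((ascPochhammer ℝ n).eval x)⁻¹ := fun x => rfl
  have hQdeg : Q.natDegree = n := by
    refine Polynomial.natDegree_eq_of_le_of_coeff_ne_zero ?_ ?_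
    · refine Polynomial.natDegree_le_iff_coeff_eq_zero.2 fun k hk => ?_
      rw [coeff_hypPoly, hypCoeff_neg_nat_eq_zero hk]
    · rw [coeff_hypPoly, hlead]
      exact mul_ne_zero (mul_ne_zero (mul_ne_zero (inv_ne_zero hfn) hnn) hbn) (inv_ne_zero hen)
  have hX : (1 - X : ℝ[X]) = C (-1) * X + C 1 := by simp; ring
  have hXdeg : (1 - X : ℝ[X]).natDegree = 1 := by
    rw [hX]; exact natDegree_linear (by norm_num)
  have hXlead : (1 - X : ℝ[X]).leadingCoeff = -1 := by
    rw [hX]; exact leadingCoeff_linear (by norm_num)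
  -- The constant Q(1), a Chu–Vandermonde sum, is found by comparing leading coefficients.
  have hcoef := coeff_comp_degree_mul_degree (p := Q) (q := 1 - X) (by rw [hXdeg]; exact one_ne_zero)
  rw [hQdeg, hXdeg, hXlead, mul_one, leadingCoeff, hQdeg, hcomp, coeff_C_mul, hQ, hP, coeff_hypPoly,
    coeff_hypPoly, hlead, hlead] at hcoef
  have hq1 : eval 1 Q * (ascPochhammer ℝ n).eval e = (-1) ^ n * (ascPochhammer ℝ n).eval c := by
    field_simp at hcoef
    linear_combination hcoef
  have hz := congrArg (Polynomial.eval z) hcomp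
  simp only [eval_comp, eval_sub, eval_one, eval_X, eval_mul, eval_C] at hz
  rw [hyp_eq_eval_hypPoly, hyp_eq_eval_hypPoly, hz]
  have h1 : (-1 : ℝ) ^ n * (-1) ^ n = 1 := by rw [← mul_pow]; norm_num
  field_simp
  linear_combination (-(-1) ^ n * eval z P) * hq1 - (ascPochhammer ℝ n).eval c * eval z P * h1

/-! ### Radial solutions -/

theorem hyp_symm (a b c z : ℝ) : hyp a b c z = hyp b a c z := by
  unfold hyp
  rw [hypCoeff_symm]

theorem paramC_pos {d : ℕ} (hd : 1 ≤ d) (l : ℕ) : 0 < paramC d l := by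
  have : (1 : ℝ) ≤ d := by exact_mod_cast hd
  unfold paramC; positivity

theorem paramA_neg (d : ℕ) (ν : ℝ) (l : ℕ) (ω : ℝ) :
    paramA d (-ν) l ω = paramC d l - paramB d ν l ω := by
  unfold paramA paramB paramC weight; ring

theorem paramB_neg (d : ℕ) (ν : ℝ) (l : ℕ) (ω : ℝ) :
    paramB d (-ν) l ω = paramC d l - paramA d ν l ω := by
  unfold paramA paramB paramC weight; ring

theorem paramA_add_paramB_sub (d : ℕ) (ν : ℝ) (l : ℕ) (ω : ℝ) :
    paramA d ν l ω + paramB d ν l ω - paramC d l = ν := by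
  unfold paramA paramB paramC weight; ring

theorem dirichletRadial_eq (d : ℕ) (ν : ℝ) (l : ℕ) (ω ρ : ℝ) :
    dirichletRadial d ν l ω ρ = Real.sin ρ ^ l * Real.cos ρ ^ weight d ν *
      hyp (paramA d ν l ω) (paramB d ν l ω) (1 + ν) (Real.cos ρ ^ 2) := by
  unfold dirichletRadial
  rw [ordinaryHypergeometric_eq_powSum,
    show paramA d ν l ω + paramB d ν l ω + 1 - paramC d l = 1 + ν by
      linarith [paramA_add_paramB_sub d ν l ω]]

/-- Under ν ↦ −ν the parameters (a, b) become (c − b, c − a), and the series is symmetric in its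
first two parameters. All Neumann statements are reduced to Dirichlet ones by this. -/
theorem neumannRadial_eq (d : ℕ) (ν : ℝ) (l : ℕ) (ω ρ : ℝ) :
    neumannRadial d ν l ω ρ = dirichletRadial d (-ν) l ω ρ := by
  rw [dirichletRadial_eq]
  unfold neumannRadial
  rw [ordinaryHypergeometric_eq_powSum, hypCoeff_symm, ← paramA_neg, ← paramB_neg,
    show paramB d (-ν) l ω - paramB d ν l ω + 1 = 1 + -ν by
      unfold paramB weight; ring]

theorem regularRadial_eq (d : ℕ) (ν : ℝ) (l : ℕ) (ω ρ : ℝ) :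
    regularRadial d ν l ω ρ = Real.sin ρ ^ l * Real.cos ρ ^ weight d ν *
      hyp (paramA d ν l ω) (paramB d ν l ω) (paramC d l) (Real.sin ρ ^ 2) := by
  unfold regularRadial
  rw [ordinaryHypergeometric_eq_powSum]

theorem neumannFrequency_eq (d : ℕ) (ν : ℝ) (s : ℤˣ) (n l : ℕ) :
    neumannFrequency d ν s n l = dirichletFrequency d (-ν) s n l := by
  unfold neumannFrequency dirichletFrequency weight; ring

/-- The ansatz sin^l cos^Δ F(cos²) turns the radial equation into the hypergeometric one with third
parameter 1 + ν. The condition ν > −1 keeps that parameter positive and includes the Neumann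
solution. -/
theorem solvesRadialKleinGordon_dirichletRadial (d : ℕ) {ν : ℝ} (hν : -1 < ν) (l : ℕ) (ω : ℝ) :
    SolvesRadialKleinGordon d ν l ω (dirichletRadial d ν l ω) := by
  set a := paramA d ν l ω with ha
  set b := paramB d ν l ω with hb
  set Δ := weight d ν with hΔ
  have hfun : dirichletRadial d ν l ω = fun ρ => Real.sin ρ ^ l * Real.cos ρ ^ Δ *
      hyp a b (1 + ν) (Real.cos ρ ^ 2) := by
    ext ρ; exact dirichletRadial_eq d ν l ω ρ
  have hsin : ∀ ρ ∈ Ioo 0 (Real.pi / 2), 0 < Real.sin ρ := fun ρ hρ =>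
    Real.sin_pos_of_pos_of_lt_pi hρ.1 (by linarith [hρ.2, Real.pi_pos])
  have hcos : ∀ ρ ∈ Ioo 0 (Real.pi / 2), 0 < Real.cos ρ := fun ρ hρ =>
    Real.cos_pos_of_mem_Ioo ⟨by linarith [hρ.1, Real.pi_pos], hρ.2⟩
  have habs : ∀ ρ ∈ Ioo 0 (Real.pi / 2), |Real.cos ρ ^ 2| < 1 := fun ρ hρ => by
    rw [abs_of_nonneg (by positivity)]
    nlinarith [hsin ρ hρ, Real.sin_sq_add_cos_sq ρ]
  have hD : ∀ ρ ∈ Ioo 0 (Real.pi / 2), HasDerivAt (fun ρ => Real.sin ρ ^ l * Real.cos ρ ^ Δ)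
      (Real.sin ρ ^ l * Real.cos ρ ^ Δ *
        (l * Real.cos ρ / Real.sin ρ - Δ * Real.sin ρ / Real.cos ρ)) ρ := by
    intro ρ hρ
    have h1 := (Real.hasDerivAt_sin ρ).pow l
    have h2 := (Real.hasDerivAt_cos ρ).rpow_const (p := Δ) (Or.inl (hcos ρ hρ).ne')
    have hs := (hsin ρ hρ).ne'
    have hc := (hcos ρ hρ).ne'
    refine (h1.mul h2).congr_deriv ?_
    rw [Real.rpow_sub_one hc]
    rcases l with _ | l
    · simp; field_simp
    · simp only [add_tsub_cancel_right, Pi.pow_apply]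
      push_cast
      rw [pow_succ]
      field_simp
      ring
  have hw : ∀ ρ, HasDerivAt (fun ρ => Real.cos ρ ^ 2) (-(2 * Real.cos ρ * Real.sin ρ)) ρ := by
    intro ρ
    refine ((Real.hasDerivAt_cos ρ).pow 2).congr_deriv ?_
    simp
  have hF : ∀ ρ ∈ Ioo 0 (Real.pi / 2), HasDerivAt (fun ρ => hyp a b (1 + ν) (Real.cos ρ ^ 2))
      (hypD a b (1 + ν) (Real.cos ρ ^ 2) * -(2 * Real.cos ρ * Real.sin ρ)) ρ := fun ρ hρ =>
    HasDerivAt.comp ρ (hasDerivAt_hyp a b (1 + ν) (habs ρ hρ)) (hw ρ)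
  have hFD : ∀ ρ ∈ Ioo 0 (Real.pi / 2), HasDerivAt (fun ρ => hypD a b (1 + ν) (Real.cos ρ ^ 2))
      (hypDD a b (1 + ν) (Real.cos ρ ^ 2) * -(2 * Real.cos ρ * Real.sin ρ)) ρ := fun ρ hρ =>
    HasDerivAt.comp ρ (hasDerivAt_hypD a b (1 + ν) (habs ρ hρ)) (hw ρ)
  have hR : ∀ ρ ∈ Ioo 0 (Real.pi / 2), HasDerivAt (dirichletRadial d ν l ω)
      (Real.sin ρ ^ l * Real.cos ρ ^ Δ *
        ((l * Real.cos ρ / Real.sin ρ - Δ * Real.sin ρ / Real.cos ρ) *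
          hyp a b (1 + ν) (Real.cos ρ ^ 2)
          - 2 * Real.cos ρ * Real.sin ρ * hypD a b (1 + ν) (Real.cos ρ ^ 2))) ρ := by
    intro ρ hρ
    rw [hfun]
    exact ((hD ρ hρ).mul (hF ρ hρ)).congr_deriv (by ring)
  refine ⟨?_, fun ρ hρ => ?_⟩
  · rw [hfun]
    intro ρ hρ
    refine ContDiffAt.contDiffWithinAt ?_
    have h1 : ContDiffAt ℝ 2 (hyp a b (1 + ν)) (Real.cos ρ ^ 2) :=
      ((unitSummable_hypCoeff a b (1 + ν)).analyticOnNhd _ (by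
        rw [mem_ball_zero_iff, Real.norm_eq_abs]; exact habs ρ hρ)).contDiffAt
    have h2 : ContDiffAt ℝ 2 (fun ρ => Real.cos ρ ^ 2) ρ := (Real.contDiff_cos.pow 2).contDiffAt
    exact (((Real.contDiff_sin.pow l).contDiffAt).mul
      (Real.contDiff_cos.contDiffAt.rpow_const_of_ne (hcos ρ hρ).ne')).mul
      (h1.comp (f := fun ρ => Real.cos ρ ^ 2) ρ h2)
  · have hs := (hsin ρ hρ).ne'
    have hc := (hcos ρ hρ).ne'
    have he : deriv (dirichletRadial d ν l ω) =ᶠ[𝓝 ρ] fun ρ => Real.sin ρ ^ l * Real.cos ρ ^ Δ *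
        ((l * Real.cos ρ / Real.sin ρ - Δ * Real.sin ρ / Real.cos ρ) *
          hyp a b (1 + ν) (Real.cos ρ ^ 2)
          - 2 * Real.cos ρ * Real.sin ρ * hypD a b (1 + ν) (Real.cos ρ ^ 2)) :=
      eventually_of_mem (isOpen_Ioo.mem_nhds hρ) fun x hx => (hR x hx).deriv
    have hq : HasDerivAt (fun ρ => l * Real.cos ρ / Real.sin ρ - Δ * Real.sin ρ / Real.cos ρ)
        (-(l / Real.sin ρ ^ 2) - Δ / Real.cos ρ ^ 2) ρ := by
      have h1 := ((Real.hasDerivAt_cos ρ).const_mul (l : ℝ)).div (Real.hasDerivAt_sin ρ) hs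
      have h2 := ((Real.hasDerivAt_sin ρ).const_mul Δ).div (Real.hasDerivAt_cos ρ) hc
      refine (h1.sub h2).congr_deriv ?_
      have := Real.sin_sq_add_cos_sq ρ
      field_simp
      linear_combination (-(l : ℝ) * Real.cos ρ ^ 2 - Real.sin ρ ^ 2 * Δ) * this
    have hcs : HasDerivAt (fun ρ => 2 * Real.cos ρ * Real.sin ρ)
        (2 * (Real.cos ρ ^ 2 - Real.sin ρ ^ 2)) ρ := by
      refine (((Real.hasDerivAt_cos ρ).const_mul 2).mul (Real.hasDerivAt_sin ρ)).congr_deriv ?_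
      ring
    have h2 := ((hD ρ hρ).mul ((hq.mul (hF ρ hρ)).sub (hcs.mul (hFD ρ hρ)))).deriv
    have h2' : deriv (deriv (dirichletRadial d ν l ω)) ρ = _ := he.deriv_eq.trans h2
    rw [h2', (hR ρ hρ).deriv]
    rw [dirichletRadial_eq]
    rw [← ha, ← hb, ← hΔ]
    have hode := hyp_equation (by linarith : 0 < 1 + ν) a b (habs ρ hρ)
    have hab : a + b = l + Δ := by simp only [ha, hb, paramA, paramB]; ring
    have hab' : a * b = ((l + Δ) ^ 2 - ω ^ 2) / 4 := by simp only [ha, hb, paramA, paramB]; ring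
    have hd : (d : ℝ) = 2 * (Δ - ν) := by simp only [hΔ, weight]; ring
    rw [hab, hab'] at hode
    rw [hd]
    simp only [Pi.mul_apply, Pi.sub_apply]
    generalize hyp a b (1 + ν) (Real.cos ρ ^ 2) = F at *
    generalize hypD a b (1 + ν) (Real.cos ρ ^ 2) = F1 at *
    generalize hypDD a b (1 + ν) (Real.cos ρ ^ 2) = F2 at *
    have hs2 : Real.sin ρ ^ 2 = 1 - Real.cos ρ ^ 2 := by rw [← Real.sin_sq_add_cos_sq ρ]; ring
    generalize hS : Real.sin ρ = s at *
    generalize hC : Real.cos ρ = c at *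
    generalize s ^ l = S
    generalize c ^ Δ = P
    -- After clearing denominators and eliminating sin², the expression is a multiple of the
    -- hypergeometric equation at cos² ρ.
    have key : s ^ 2 * c ^ 2 * (((l * c / s - Δ * s / c) * ((l * c / s - Δ * s / c) * F - 2 * c * s * F1) +
        ((-(l / s ^ 2) - Δ / c ^ 2) * F + (l * c / s - Δ * s / c) * (F1 * -(2 * c * s))
        - (2 * (c ^ 2 - s ^ 2) * F1 + 2 * c * s * (F2 * -(2 * c * s))))) +
        (2 * (Δ - ν) - 1) / (s * c) * ((l * c / s - Δ * s / c) * F - 2 * c * s * F1) +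
        (ω ^ 2 - l * (l + 2 * (Δ - ν) - 2) / s ^ 2 - (ν ^ 2 - (2 * (Δ - ν)) ^ 2 / 4) / c ^ 2) * F) = 0 := by
      have hs4 : s ^ 4 = (1 - c ^ 2) ^ 2 := by rw [← hs2]; ring
      field_simp
      ring_nf
      simp only [hs2, hs4]
      linear_combination (16 * c ^ 2 * (1 - c ^ 2)) * hode
    have hsc : s ^ 2 * c ^ 2 ≠ 0 := by positivity
    have key2 := (mul_eq_zero.1 key).resolve_left hsc
    linear_combination S * P * key2

/-- Euler's transformation at z = sin² ρ, where (1 − z)^ν = cos^(2ν) ρ accounts for the change of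
weight. The regular solution depends on the mass only. -/
theorem regularRadial_neg {d : ℕ} (hd : 1 ≤ d) (ν : ℝ) (l : ℕ) (ω : ℝ) {ρ : ℝ} (h0 : 0 ≤ ρ)
    (h1 : ρ < Real.pi / 2) : regularRadial d ν l ω ρ = regularRadial d (-ν) l ω ρ := by
  have hc : 0 < Real.cos ρ := Real.cos_pos_of_mem_Ioo ⟨by linarith [Real.pi_pos], h1⟩
  have hs2 : 1 - Real.sin ρ ^ 2 = Real.cos ρ ^ 2 := by rw [← Real.sin_sq_add_cos_sq ρ]; ring
  have habs : |Real.sin ρ ^ 2| < 1 := by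
    rw [abs_of_nonneg (by positivity)]; nlinarith [pow_pos hc 2]
  rw [regularRadial_eq, regularRadial_eq, paramA_neg, paramB_neg, hyp_symm (paramC d l - _),
    ← hyp_euler (paramC_pos hd l) _ _ habs, paramA_add_paramB_sub, hs2, ← Real.rpow_natCast (Real.cos ρ) 2,
    ← Real.rpow_mul hc.le]
  have : Real.cos ρ ^ weight d ν =
      Real.cos ρ ^ weight d (-ν) * Real.cos ρ ^ (((2 : ℕ) : ℝ) * ν) := by
    rw [← Real.rpow_add hc]; congr 1; unfold weight; push_cast; ring
  rw [this]
  ring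

/-- The ratio of the regular and the Dirichlet radial solution at a Dirichlet frequency. -/
def dirichletRatio (d : ℕ) (ν : ℝ) (n l : ℕ) : ℝ :=
  (-1) ^ n * (ascPochhammer ℝ n).eval (1 + ν) / (ascPochhammer ℝ n).eval (paramC d l)

/-- At these frequencies a = −n or b = −n, according to the sign. Both series terminate, and the
connection formula has a single term. -/
theorem regularRadial_dirichletFrequency {d : ℕ} (hd : 1 ≤ d) {ν : ℝ} (hν : -1 < ν) (s : ℤˣ)
    (n l : ℕ) (ρ : ℝ) :
    regularRadial d ν l (dirichletFrequency d ν s n l) ρ =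
      dirichletRatio d ν n l * dirichletRadial d ν l (dirichletFrequency d ν s n l) ρ := by
  rw [regularRadial_eq, dirichletRadial_eq]
  have h := hyp_terminating (paramC_pos hd l) (by linarith : 0 < 1 + ν) n (Real.sin ρ ^ 2)
  have hs2 : 1 - Real.sin ρ ^ 2 = Real.cos ρ ^ 2 := by rw [← Real.sin_sq_add_cos_sq ρ]; ring
  rw [hs2] at h
  have key : ∀ e z : ℝ, hyp (paramA d ν l (dirichletFrequency d ν s n l))
      (paramB d ν l (dirichletFrequency d ν s n l)) e z =
      hyp (-n) (paramC d l + (1 + ν) - 1 + n) e z := by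
    intro e z
    rcases Int.units_eq_one_or s with rfl | rfl
    · have h1 : paramA d ν l (dirichletFrequency d ν 1 n l) = -n := by
        unfold paramA dirichletFrequency; push_cast; ring
      have h2 : paramB d ν l (dirichletFrequency d ν 1 n l) = paramC d l + (1 + ν) - 1 + n := by
        unfold paramB dirichletFrequency paramC weight; push_cast; ring
      rw [h1, h2]
    · have h1 : paramB d ν l (dirichletFrequency d ν (-1) n l) = -n := by
        unfold paramB dirichletFrequency; push_cast; ring
      have h2 : paramA d ν l (dirichletFrequency d ν (-1) n l) = paramC d l + (1 + ν) - 1 + n := by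
        unfold paramA dirichletFrequency paramC weight; push_cast; ring
      rw [h1, h2, hyp_symm]
  rw [key, key, h]
  unfold dirichletRatio
  ring

theorem isRobinFrequency_dirichlet {d : ℕ} (hd : 1 ≤ d) {ν : ℝ} (hν : 0 < ν) (s : ℤˣ) (n l : ℕ) :
    IsRobinFrequency d ν 0 l (dirichletFrequency d ν s n l) :=
  ⟨0, dirichletRatio d ν n l, fun ρ _ => by
    rw [regularRadial_dirichletFrequency hd (by linarith)]; ring, by simp⟩

theorem isRobinFrequency_neumann {d : ℕ} (hd : 1 ≤ d) {ν : ℝ} (hν : ν < 1) (s : ℤˣ) (n l : ℕ) :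
    IsRobinFrequency d ν (Real.pi / 2) l (neumannFrequency d ν s n l) :=
  ⟨dirichletRatio d (-ν) n l, 0, fun ρ hρ => by
    rw [regularRadial_neg hd _ _ _ hρ.1.le hρ.2, neumannRadial_eq, neumannFrequency_eq,
      regularRadial_dirichletFrequency hd (by linarith)]; ring, by simp⟩

/-- The connection coefficients of a mode. -/
theorem radial_connection {d : ℕ} (hd : 1 ≤ d) {ν : ℝ} (h0 : 0 < ν) (h1 : ν < 1) (l : ℕ) (ω : ℝ)
    {A B : ℝ} (h : ∀ ρ ∈ Ioo 0 (Real.pi / 2),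
      regularRadial d ν l ω ρ = A * neumannRadial d ν l ω ρ + B * dirichletRadial d ν l ω ρ) :
    A = Real.Gamma (paramC d l) * Real.Gamma ν *
        ((Real.Gamma (paramA d ν l ω))⁻¹ * (Real.Gamma (paramB d ν l ω))⁻¹) ∧
    B = Real.Gamma (paramC d l) * Real.Gamma (-ν) *
        ((Real.Gamma (paramC d l - paramA d ν l ω))⁻¹ *
          (Real.Gamma (paramC d l - paramB d ν l ω))⁻¹) := by
  refine connection_coeff (paramC_pos hd l) (paramA_add_paramB_sub d ν l ω) h0 h1 fun z hz => ?_
  set ρ := Real.arcsin (√z) with hρ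
  have hz0 : 0 < √z := Real.sqrt_pos.2 hz.1
  have hz1 : √z < 1 := by rw [Real.sqrt_lt' one_pos]; linarith [hz.2]
  have hsin : Real.sin ρ = √z := Real.sin_arcsin (by linarith) hz1.le
  have hρm : ρ ∈ Ioo 0 (Real.pi / 2) := ⟨Real.arcsin_pos.2 hz0, Real.arcsin_lt_pi_div_two.2 hz1⟩
  have hc : 0 < Real.cos ρ := Real.cos_pos_of_mem_Ioo ⟨by linarith [hρm.1, Real.pi_pos], hρm.2⟩
  have hs2 : Real.sin ρ ^ 2 = z := by rw [hsin, Real.sq_sqrt hz.1.le]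
  have hc2 : Real.cos ρ ^ 2 = 1 - z := by rw [← hs2, ← Real.sin_sq_add_cos_sq ρ]; ring
  have hh := h ρ hρm
  rw [neumannRadial_eq, dirichletRadial_eq, dirichletRadial_eq, regularRadial_eq, hs2, hc2,
    hyp_symm (paramA d (-ν) l ω), paramA_neg, paramB_neg] at hh
  have hp : Real.cos ρ ^ weight d (-ν) = Real.cos ρ ^ weight d ν * (1 - z) ^ (-ν) := by
    rw [← hc2, ← Real.rpow_natCast, ← Real.rpow_mul hc.le, ← Real.rpow_add hc]
    congr 1; unfold weight; push_cast; ring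
  rw [hp] at hh
  have hne : Real.sin ρ ^ l * Real.cos ρ ^ weight d ν ≠ 0 := by
    rw [hsin]; exact mul_ne_zero (pow_ne_zero _ hz0.ne') (Real.rpow_pos_of_pos hc _).ne'
  apply mul_left_cancel₀ hne
  rw [hh, show 1 + -ν = 1 - ν by ring]
  ring

/-! ### Bounds on the radial solutions near the boundary -/

theorem abs_ascPochhammer_le {a M : ℝ} (hM : 1 ≤ M) (ha : |a| ≤ M) (k : ℕ) :
    |(ascPochhammer ℝ k).eval a| ≤ M ^ k * (ascPochhammer ℝ k).eval 1 := by
  induction k with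
  | zero => simp
  | succ k ih =>
    rw [ascPochhammer_succ_eval, ascPochhammer_succ_eval, abs_mul, pow_succ]
    have h1 : |a + k| ≤ M * (1 + k) := by
      refine (abs_add_le _ _).trans ?_
      rw [Nat.abs_cast]
      nlinarith [Nat.cast_nonneg (α := ℝ) k]
    calc _ ≤ (M ^ k * (ascPochhammer ℝ k).eval 1) * (M * (1 + k)) :=
          mul_le_mul ih h1 (abs_nonneg _) (by have := ascPochhammer_pos k (1:ℝ) one_pos; positivity)
      _ = _ := by ring

theorem abs_hypCoeff_le {a b e M : ℝ} (he : 0 < e) (hM : 1 ≤ M) (ha : |a| ≤ M) (hb : |b| ≤ M)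
    (k : ℕ) : |hypCoeff a b e k| ≤ (M ^ 2) ^ k * hypCoeff 1 1 e k := by
  unfold hypCoeff ordinaryHypergeometricCoefficient
  have h1 := ascPochhammer_pos k (1 : ℝ) one_pos
  have h2 := ascPochhammer_pos k e he
  rw [abs_mul, abs_mul, abs_mul, abs_of_pos (inv_pos.2 h2), abs_of_nonneg (by positivity :
    (0:ℝ) ≤ (k.factorial : ℝ)⁻¹)]
  calc _ ≤ (k.factorial : ℝ)⁻¹ * (M ^ k * (ascPochhammer ℝ k).eval 1) *
        (M ^ k * (ascPochhammer ℝ k).eval 1) * ((ascPochhammer ℝ k).eval e)⁻¹ := by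
        gcongr
        · exact abs_ascPochhammer_le hM ha k
        · exact abs_ascPochhammer_le hM hb k
    _ = _ := by ring

theorem hypCoeff_one_one_nonneg {e : ℝ} (he : 0 < e) (k : ℕ) : 0 ≤ hypCoeff 1 1 e k := by
  unfold hypCoeff ordinaryHypergeometricCoefficient
  have h1 := ascPochhammer_pos k (1 : ℝ) one_pos
  have h2 := ascPochhammer_pos k e he
  positivity

/-- The coefficients are at most M^(2k) times those with a = b = 1, so the variable that matters is
M² x. The constant is uniform in a and b, hence in frequency and degree. -/
theorem abs_hyp_sub_one_le {a b e M x : ℝ} (he : 0 < e) (hM : 1 ≤ M) (ha : |a| ≤ M) (hb : |b| ≤ M)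
    (hx : 0 ≤ x) (hMx : M ^ 2 * x ≤ 1 / 2) :
    |hyp a b e x - 1| ≤ 2 * hyp 1 1 e (1 / 2) * (M ^ 2 * x) := by
  have hx1 : |x| < 1 := by rw [abs_of_nonneg hx]; nlinarith
  have h := hasSum_powSum (unitSummable_hypCoeff a b e) hx1
  have h' := (hasSum_nat_add_iff' 1).2 h
  simp only [Finset.range_one, Finset.sum_singleton, hypCoeff_zero, pow_zero, mul_one] at h'
  have hs := hasSum_powSum (unitSummable_hypCoeff 1 1 e) (z := 1 / 2)
    (by rw [abs_of_pos] <;> norm_num)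
  have hs' := ((hasSum_nat_add_iff' 1).2 hs).mul_left (2 * (M ^ 2 * x))
  have hb' := tsum_of_norm_bounded hs' (f := fun k => hypCoeff a b e (k + 1) * x ^ (k + 1))
    fun k => by
    rw [norm_mul, Real.norm_eq_abs, Real.norm_of_nonneg (by positivity)]
    have h1 := abs_hypCoeff_le he hM ha hb (k + 1)
    have h2 := hypCoeff_one_one_nonneg he (k + 1)
    have hy : 0 ≤ M ^ 2 * x := by positivity
    calc _ ≤ (M ^ 2) ^ (k + 1) * hypCoeff 1 1 e (k + 1) * x ^ (k + 1) := by gcongr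
      _ = (M ^ 2 * x) * (M ^ 2 * x) ^ k * hypCoeff 1 1 e (k + 1) := by rw [mul_pow]; ring
      _ ≤ (M ^ 2 * x) * (1 / 2) ^ k * hypCoeff 1 1 e (k + 1) := by gcongr
      _ = _ := by rw [pow_succ (1 / 2 : ℝ)]; ring
  rw [h'.tsum_eq, Real.norm_eq_abs] at hb'
  refine hb'.trans ?_
  simp only [Finset.range_one, Finset.sum_singleton, hypCoeff_zero, pow_zero, mul_one]
  have : 0 ≤ M ^ 2 * x := by positivity
  change 2 * (M ^ 2 * x) * (hyp 1 1 e (1 / 2) - 1) ≤ _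
  nlinarith

theorem one_le_hyp_one_one {e : ℝ} (he : 0 < e) : 1 ≤ hyp 1 1 e (1 / 2) := by
  have hs := hasSum_powSum (unitSummable_hypCoeff 1 1 e) (z := 1 / 2)
    (by rw [abs_of_pos] <;> norm_num)
  have := le_hasSum hs 0 fun k _ => mul_nonneg (hypCoeff_one_one_nonneg he k) (by positivity)
  simpa using this

/-- Near the boundary, with scale set by the parameters, the Dirichlet solution is
`(cos ρ) ^ Δ₊` up to a controlled error. -/
theorem abs_dirichletRadial_div_sub_one_le {d : ℕ} {ν : ℝ} (hν : -1 < ν) {l : ℕ} {ω M ρ : ℝ}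
    (hρ0 : 0 ≤ ρ) (hρ1 : ρ < Real.pi / 2)
    (hM : 1 ≤ M) (ha : |paramA d ν l ω| ≤ M) (hb : |paramB d ν l ω| ≤ M) (hl : (l : ℝ) ≤ M)
    (hMx : M ^ 2 * Real.cos ρ ^ 2 ≤ 1 / 2) :
    |dirichletRadial d ν l ω ρ / Real.cos ρ ^ weight d ν - 1| ≤
      3 * hyp 1 1 (1 + ν) (1 / 2) * (M ^ 2 * Real.cos ρ ^ 2) := by
  have hc : 0 < Real.cos ρ := Real.cos_pos_of_mem_Ioo ⟨by linarith [Real.pi_pos], hρ1⟩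
  have hs0 : 0 ≤ Real.sin ρ := Real.sin_nonneg_of_nonneg_of_le_pi hρ0 (by linarith [Real.pi_pos])
  have hs1 := Real.sin_le_one ρ
  have hs2 : Real.cos ρ ^ 2 = 1 - Real.sin ρ ^ 2 := by rw [← Real.sin_sq_add_cos_sq ρ]; ring
  have h1 := abs_hyp_sub_one_le (by linarith : 0 < 1 + ν) hM ha hb (sq_nonneg (Real.cos ρ)) hMx
  have h2 := one_le_hyp_one_one (by linarith : 0 < 1 + ν)
  have hpow0 : 0 ≤ Real.sin ρ ^ l := by positivity
  have hpow1 : Real.sin ρ ^ l ≤ 1 := pow_le_one₀ hs0 hs1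
  -- Bernoulli's inequality gives 1 − sin^l ≤ l (1 − sin), and 1 − sin ≤ 1 − sin² on this range.
  have hpow : 1 - Real.sin ρ ^ l ≤ M ^ 2 * Real.cos ρ ^ 2 := by
    have hb := one_add_mul_le_pow (a := Real.sin ρ - 1) (by linarith) l
    rw [add_sub_cancel] at hb
    have h3 : 1 - Real.sin ρ ≤ Real.cos ρ ^ 2 := by rw [hs2]; nlinarith
    have h4 : (l : ℝ) * (1 - Real.sin ρ) ≤ M * Real.cos ρ ^ 2 :=
      mul_le_mul hl h3 (by linarith) (by linarith)
    have h5 : M * Real.cos ρ ^ 2 ≤ M ^ 2 * Real.cos ρ ^ 2 := by gcongr; nlinarith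
    nlinarith
  rw [dirichletRadial_eq]
  have hcp := (Real.rpow_pos_of_pos hc (weight d ν)).ne'
  rw [mul_right_comm, mul_div_assoc, div_self hcp, mul_one]
  have : Real.sin ρ ^ l * hyp (paramA d ν l ω) (paramB d ν l ω) (1 + ν) (Real.cos ρ ^ 2) - 1 =
    Real.sin ρ ^ l * (hyp (paramA d ν l ω) (paramB d ν l ω) (1 + ν) (Real.cos ρ ^ 2) - 1) -
      (1 - Real.sin ρ ^ l) := by ring
  rw [this]
  refine (abs_sub _ _).trans ?_
  rw [abs_mul, abs_of_nonneg hpow0, abs_of_nonneg (by linarith : 0 ≤ 1 - Real.sin ρ ^ l)]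
  have h6 := mul_le_mul hpow1 h1 (abs_nonneg _) one_pos.le
  have h7 : 0 ≤ M ^ 2 * Real.cos ρ ^ 2 := by positivity
  nlinarith

/-! ### Finite parts -/

/-- Taylor expansion at `0`. -/
theorem taylor_isBigO_zero {q : ℝ → ℂ} (hq : ContDiffAt ℝ ((⊤ : ℕ∞) : WithTop ℕ∞) q 0) (N : ℕ) :
    (fun x : ℝ => q x - ∑ j ∈ Finset.range N, (x ^ j : ℝ) * (iteratedDeriv j q 0 / j.factorial))
      =O[𝓝 0] fun x => x ^ N := by
  have hqN : ContDiffAt ℝ (N : WithTop ℕ∞) q 0 := hq.of_le (by exact_mod_cast le_top)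
  obtain ⟨u, hu, hqu⟩ := hqN.contDiffOn le_rfl (by simp)
  obtain ⟨δ, hδ, hδu⟩ := Metric.mem_nhds_iff.1 hu
  have hb := taylor_isLittleO (convex_ball (0 : ℝ) δ) (Metric.mem_ball_self hδ)
    (hqu.mono hδu)
  rw [Metric.isOpen_ball.nhdsWithin_eq (Metric.mem_ball_self hδ)] at hb
  have e : ∀ x, taylorWithinEval q N (Metric.ball 0 δ) 0 x =
      ∑ j ∈ Finset.range (N + 1), (x ^ j : ℝ) * (iteratedDeriv j q 0 / j.factorial) := by
    intro x
    rw [taylor_within_apply]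
    refine Finset.sum_congr rfl fun j _ => ?_
    rw [iteratedDerivWithin_of_isOpen Metric.isOpen_ball (Metric.mem_ball_self hδ), sub_zero,
      Complex.real_smul]
    push_cast
    ring
  simp only [e, sub_zero] at hb
  have h1 := hb.isBigO
  have h2 : (fun x : ℝ => ((x ^ N : ℝ) : ℂ) * (iteratedDeriv N q 0 / N.factorial)) =O[𝓝 0]
      fun x : ℝ => x ^ N := by
    refine Asymptotics.IsBigO.of_bound ‖iteratedDeriv N q 0 / N.factorial‖
      (Eventually.of_forall fun x => ?_)
    rw [norm_mul, Complex.norm_real, mul_comm]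
  refine (h1.add h2).congr_left fun x => ?_
  rw [Finset.sum_range_succ]
  ring

theorem tendsto_rpow_nhdsGT_zero {L : ℝ} (hL : 0 < L) :
    Tendsto (fun x : ℝ => x ^ L) (𝓝[>] 0) (𝓝 0) := by
  have := (Real.continuousAt_rpow_const 0 L (Or.inr hL.le)).tendsto
  rw [Real.zero_rpow hL.ne'] at this
  exact this.mono_left nhdsWithin_le_nhds

/-- If L > 0, the sum tends to 0. If L < 0, multiplication by x^(−L) shows that the lowest
coefficient vanishes, and the same argument applies with L + 1. An exponent 0 would permit any
constant, which `hL` excludes. -/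
theorem eq_zero_of_tendsto_sum_rpow {N : ℕ} {L : ℝ} {p : ℕ → ℂ} {J : ℂ}
    (hL : ∀ j : ℕ, L + j ≠ 0) (hN : 0 < L + N)
    (h : Tendsto (fun x : ℝ => ((x ^ L : ℝ) : ℂ) * ∑ j ∈ Finset.range N, ((x ^ j : ℝ) : ℂ) * p j)
      (𝓝[>] 0) (𝓝 J)) : J = 0 := by
  have hid : Tendsto (fun x : ℝ => x) (𝓝[>] 0) (𝓝 0) := nhdsWithin_le_nhds
  have hpoly : ∀ (N : ℕ) (p : ℕ → ℂ),
      Tendsto (fun x : ℝ => ∑ j ∈ Finset.range N, ((x ^ j : ℝ) : ℂ) * p j) (𝓝[>] 0)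
        (𝓝 (∑ j ∈ Finset.range N, (((0 : ℝ) ^ j : ℝ) : ℂ) * p j)) := fun N p => by
    have : Continuous fun x : ℝ => ∑ j ∈ Finset.range N, ((x ^ j : ℝ) : ℂ) * p j := by fun_prop
    exact (this.tendsto 0).mono_left nhdsWithin_le_nhds
  have hof : ∀ {r : ℝ}, 0 < r → Tendsto (fun x : ℝ => ((x ^ r : ℝ) : ℂ)) (𝓝[>] 0) (𝓝 0) := by
    intro r hr
    have := (Complex.continuous_ofReal.tendsto 0).comp (tendsto_rpow_nhdsGT_zero hr)
    rw [Complex.ofReal_zero] at this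
    exact this
  have hposcase : ∀ {N : ℕ} {L : ℝ} {p : ℕ → ℂ}, 0 < L →
      Tendsto (fun x : ℝ => ((x ^ L : ℝ) : ℂ) * ∑ j ∈ Finset.range N, ((x ^ j : ℝ) : ℂ) * p j)
      (𝓝[>] 0) (𝓝 J) → J = 0 := by
    intro N L p hL h
    have h2 := (hof hL).mul (hpoly N p)
    rw [zero_mul] at h2
    exact tendsto_nhds_unique h h2
  induction N generalizing L p with
  | zero => exact hposcase (by simpa using hN) h
  | succ N ih =>
    have h0 := hL 0
    rw [Nat.cast_zero, add_zero] at h0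
    rcases lt_or_gt_of_ne h0 with hneg | hpos
    · have h1 := (hof (by linarith : 0 < -L)).mul h
      rw [zero_mul] at h1
      have h2 : (fun x : ℝ => ((x ^ (-L) : ℝ) : ℂ) * (((x ^ L : ℝ) : ℂ) *
          ∑ j ∈ Finset.range (N + 1), ((x ^ j : ℝ) : ℂ) * p j)) =ᶠ[𝓝[>] 0]
          fun x : ℝ => ∑ j ∈ Finset.range (N + 1), ((x ^ j : ℝ) : ℂ) * p j := by
        filter_upwards [self_mem_nhdsWithin] with x hx
        rw [← mul_assoc, ← Complex.ofReal_mul, ← Real.rpow_add hx]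
        simp
      have h3 := tendsto_nhds_unique (h1.congr' h2) (hpoly (N + 1) p)
      rw [Finset.sum_range_succ'] at h3
      have hp0 : p 0 = 0 := by simpa using h3.symm
      refine ih (L := L + 1) (p := fun j => p (j + 1)) (fun j => ?_) ?_ (h.congr' ?_)
      · have := hL (j + 1)
        push_cast at this
        rwa [add_assoc, add_comm 1]
      · push_cast at hN; linarith
      · filter_upwards [self_mem_nhdsWithin] with x hx
        rw [Finset.sum_range_succ', hp0, mul_zero, add_zero, Real.rpow_add_one (ne_of_gt hx),
          Finset.mul_sum, Finset.mul_sum]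
        refine Finset.sum_congr rfl fun j _ => ?_
        push_cast
        ring
    · exact hposcase hpos h

/-- Uniqueness of finite parts: two finite parts of the same divergent expression differ by a limit
of this form. The Taylor remainder of order `N` is harmless once L + N > 0. -/
theorem eq_zero_of_tendsto_rpow_mul {L : ℝ} {q : ℝ → ℂ} {J : ℂ}
    (hq : ContDiffAt ℝ ((⊤ : ℕ∞) : WithTop ℕ∞) q 0) (hL : ∀ j : ℕ, L + j ≠ 0)
    (h : Tendsto (fun x : ℝ => ((x ^ L : ℝ) : ℂ) * q x) (𝓝[>] 0) (𝓝 J)) : J = 0 := by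
  obtain ⟨N, hN⟩ := exists_nat_gt (-L)
  have hN' : 0 < L + N := by linarith
  refine eq_zero_of_tendsto_sum_rpow (N := N) (p := fun j => iteratedDeriv j q 0 / j.factorial)
    hL hN' ?_
  have h1 := (taylor_isBigO_zero hq N).mono (nhdsWithin_le_nhds (s := Ioi 0))
  have h2 : (fun x : ℝ => ((x ^ L : ℝ) : ℂ) * (q x - ∑ j ∈ Finset.range N,
      (x ^ j : ℝ) * (iteratedDeriv j q 0 / j.factorial))) =O[𝓝[>] 0] fun x : ℝ => x ^ (L + N) := by
    have h3 : (fun x : ℝ => ((x ^ L : ℝ) : ℂ)) =O[𝓝[>] 0] fun x : ℝ => x ^ L :=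
      Asymptotics.IsBigO.of_bound 1 (Eventually.of_forall fun x => by
        rw [Complex.norm_real, one_mul])
    refine (h3.mul h1).congr' EventuallyEq.rfl ?_
    filter_upwards [self_mem_nhdsWithin] with x hx
    rw [Real.rpow_add hx, Real.rpow_natCast]
  have h3 := h2.trans_tendsto (tendsto_rpow_nhdsGT_zero hN')
  have h4 := h.sub h3
  rw [sub_zero] at h4
  refine h4.congr fun x => ?_
  ring

/-! ### The gap function near the light cone -/

/-- The function `cos τ - s` at distance `u` from its zero `τ = arccos s`. -/
def edge (s u : ℝ) : ℝ := Real.cos (Real.arccos s - u) - s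

/-- The quotient of `edge s u` and `u`. -/
def edgeSlope (s : ℝ) : ℝ → ℝ := dslope (edge s) 0

theorem edge_zero {s : ℝ} (h1 : -1 ≤ s) (h2 : s ≤ 1) : edge s 0 = 0 := by
  unfold edge; rw [sub_zero, Real.cos_arccos h1 h2, sub_self]

theorem edge_eq {s : ℝ} (h1 : -1 ≤ s) (h2 : s ≤ 1) (u : ℝ) : edge s u = u * edgeSlope s u := by
  have := sub_smul_dslope (edge s) 0 u
  rw [edge_zero h1 h2, sub_zero, sub_zero, smul_eq_mul] at this
  exact this.symm

theorem analyticAt_edge (s u : ℝ) : AnalyticAt ℝ (edge s) u := by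
  unfold edge
  exact (Real.analyticAt_cos.comp (analyticAt_const.sub analyticAt_id)).sub analyticAt_const

theorem analyticAt_dslope_self {f : ℝ → ℝ} {x : ℝ} (hf : AnalyticAt ℝ f x) :
    AnalyticAt ℝ (dslope f x) x := by
  obtain ⟨p, hp⟩ := hf
  exact ⟨_, hp.has_fpower_series_dslope_fslope⟩

theorem contDiffAt_edgeSlope (s : ℝ) {n : WithTop ℕ∞} : ContDiffAt ℝ n (edgeSlope s) 0 :=
  (analyticAt_dslope_self (analyticAt_edge s 0)).contDiffAt

theorem edgeSlope_zero (s : ℝ) : edgeSlope s 0 = Real.sin (Real.arccos s) := by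
  unfold edgeSlope
  rw [dslope_same]
  have h := (((Real.hasDerivAt_cos (Real.arccos s - 0)).comp (0 : ℝ)
    ((hasDerivAt_id (0 : ℝ)).const_sub (Real.arccos s))).sub_const s)
  have := h.deriv
  simp only [sub_zero, mul_neg, mul_one, neg_neg] at this
  exact this

theorem arccos_mem_Ioo {s : ℝ} (hs : s ∈ Ioo (-1 : ℝ) 1) : Real.arccos s ∈ Ioo 0 Real.pi :=
  ⟨Real.arccos_pos.2 hs.2, lt_of_le_of_ne (Real.arccos_le_pi s)
    (fun h => by have := Real.arccos_eq_pi.1 h; linarith [hs.1])⟩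

theorem edgeSlope_zero_pos {s : ℝ} (hs : s ∈ Ioo (-1 : ℝ) 1) : 0 < edgeSlope s 0 := by
  rw [edgeSlope_zero]
  exact Real.sin_pos_of_pos_of_lt_pi (arccos_mem_Ioo hs).1 (arccos_mem_Ioo hs).2

theorem eventually_edgeSlope_pos {s : ℝ} (hs : s ∈ Ioo (-1 : ℝ) 1) :
    ∀ᶠ u in 𝓝 0, 0 < edgeSlope s u :=
  (contDiffAt_edgeSlope s (n := 1)).continuousAt.eventually_const_lt (edgeSlope_zero_pos hs)

theorem contDiffAt_edgeSlope_rpow {s : ℝ} (hs : s ∈ Ioo (-1 : ℝ) 1) (l : ℝ) :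
    ContDiffAt ℝ ((⊤ : ℕ∞) : WithTop ℕ∞) (fun u => ((edgeSlope s u ^ l : ℝ) : ℂ)) 0 :=
  Complex.ofRealCLM.contDiff.contDiffAt.comp (0 : ℝ)
    ((contDiffAt_edgeSlope s).rpow_const_of_ne (edgeSlope_zero_pos hs).ne')

theorem cos_sub_nonneg {s τ : ℝ} (hs : s ∈ Ioo (-1 : ℝ) 1) (hτ : |τ| ≤ Real.arccos s) :
    0 ≤ Real.cos τ - s := by
  have h1 := Real.cos_le_cos_of_nonneg_of_le_pi (abs_nonneg τ) (arccos_mem_Ioo hs).2.le hτ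
  rw [Real.cos_abs, Real.cos_arccos hs.1.le hs.2.le] at h1
  linarith

theorem cos_sub_pos {s τ : ℝ} (hs : s ∈ Ioo (-1 : ℝ) 1) (hτ : |τ| < Real.arccos s) :
    0 < Real.cos τ - s := by
  have h1 := Real.cos_lt_cos_of_nonneg_of_le_pi (abs_nonneg τ) (arccos_mem_Ioo hs).2.le hτ
  rw [Real.cos_abs, Real.cos_arccos hs.1.le hs.2.le] at h1
  linarith

theorem cos_sub_nonpos {s τ : ℝ} (hs : s ∈ Ioo (-1 : ℝ) 1) (hτ : Real.arccos s ≤ |τ|)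
    (hτ' : |τ| ≤ Real.pi) : Real.cos τ - s ≤ 0 := by
  have h1 := Real.cos_le_cos_of_nonneg_of_le_pi (arccos_mem_Ioo hs).1.le hτ' hτ
  rw [Real.cos_abs, Real.cos_arccos hs.1.le hs.2.le] at h1
  linarith

/-- A linear lower bound of the gap. -/
theorem le_cos_sub {s τ : ℝ} (hs : s ∈ Ioo (-1 : ℝ) 1) (hτ : |τ| ≤ Real.arccos s) :
    Real.sin (Real.arccos s) / Real.pi * (Real.arccos s - |τ|) ≤ Real.cos τ - s := by
  set τ0 := Real.arccos s with hτ0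
  obtain ⟨h0, h1⟩ := arccos_mem_Ioo hs
  rw [← hτ0] at h0 h1
  -- In this product the first factor is linear from below by Jordan's inequality. The second has
  -- its argument between τ0/2 and τ0, where concavity bounds it by the values at the ends.
  have hcos : Real.cos τ - s = 2 * Real.sin ((τ0 - |τ|) / 2) * Real.sin (τ0 - (τ0 - |τ|) / 2) := by
    have hc0 : s = Real.cos τ0 := (Real.cos_arccos hs.1.le hs.2.le).symm
    rw [← Real.cos_abs τ, hc0, Real.cos_sub_cos,
      show (|τ| - τ0) / 2 = -((τ0 - |τ|) / 2) by ring, Real.sin_neg,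
      show (|τ| + τ0) / 2 = τ0 - (τ0 - |τ|) / 2 by ring]
    ring
  set u := τ0 - |τ| with hu
  have hu0 : 0 ≤ u := by linarith
  have hu1 : u ≤ τ0 := by linarith [abs_nonneg τ]
  have hsin1 : u / Real.pi ≤ Real.sin (u / 2) := by
    have := Real.mul_le_sin (x := u / 2) (by linarith) (by linarith)
    refine le_trans (le_of_eq ?_) this
    field_simp
  have hsin0 : 0 < Real.sin τ0 := Real.sin_pos_of_pos_of_lt_pi h0 h1
  have hhalf : Real.sin τ0 / 2 ≤ Real.sin (τ0 / 2) := by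
    have h2 := Real.sin_two_mul (τ0 / 2)
    rw [mul_div_cancel₀ _ (two_ne_zero)] at h2
    have h3 := Real.cos_le_one (τ0 / 2)
    have h4 : 0 < Real.sin (τ0 / 2) := Real.sin_pos_of_pos_of_lt_pi (by linarith) (by linarith)
    nlinarith
  have hsin2 : Real.sin τ0 / 2 ≤ Real.sin (τ0 - u / 2) := by
    have hconc := strictConcaveOn_sin_Icc.concaveOn
    have h5 := hconc.min_le_of_mem_Icc (x := τ0 / 2) (y := τ0) (z := τ0 - u / 2)
      ⟨by linarith, by linarith⟩ ⟨h0.le, h1.le⟩ ⟨by linarith, by linarith⟩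
    refine le_trans (le_min hhalf (by linarith)) h5
  rw [hcos]
  have hup : 0 ≤ u / Real.pi := by positivity
  calc _ = 2 * (u / Real.pi) * (Real.sin τ0 / 2) := by ring
    _ ≤ _ := mul_le_mul (by linarith) hsin2 (by linarith) (by linarith)

/-- An integrable majorant of the powers of the gap. -/
def gapMajorant (l s τ : ℝ) : ℝ :=
  2 ^ l + (Real.sin (Real.arccos s) / Real.pi) ^ l *
    ((Real.arccos s - τ) ^ l + (Real.arccos s + τ) ^ l)

/-- For l ≥ 0 the constant term suffices, as the gap is at most 2. For l < 0 the linear lower bound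
applies; adding the singularities of both ends covers either sign of τ. -/
theorem abs_gap_rpow_le {s τ : ℝ} (hs : s ∈ Ioo (-1 : ℝ) 1) (l : ℝ)
    (hτ : |τ| < Real.arccos s) : |(Real.cos τ - s) ^ l| ≤ gapMajorant l s τ := by
  have hpos := cos_sub_pos hs hτ
  have h1 : 0 < Real.arccos s - τ := by linarith [le_abs_self τ]
  have h2 : 0 < Real.arccos s + τ := by linarith [neg_abs_le τ]
  have hsin : 0 < Real.sin (Real.arccos s) / Real.pi := by
    rw [← edgeSlope_zero]; exact div_pos (edgeSlope_zero_pos hs) Real.pi_pos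
  have p1 := Real.rpow_pos_of_pos h1 l
  have p2 := Real.rpow_pos_of_pos h2 l
  have p3 := Real.rpow_pos_of_pos hsin l
  rw [abs_of_pos (Real.rpow_pos_of_pos hpos l)]
  unfold gapMajorant
  rcases le_or_gt 0 l with hl | hl
  · have : (Real.cos τ - s) ^ l ≤ 2 ^ l :=
      Real.rpow_le_rpow hpos.le (by linarith [Real.cos_le_one τ, hs.1]) hl
    nlinarith [mul_pos p3 p1, mul_pos p3 p2]
  · have h3 := le_cos_sub hs hτ.le
    have h4 : 0 < Real.arccos s - |τ| := by linarith
    have h5 := Real.rpow_le_rpow_of_nonpos (mul_pos hsin h4) h3 hl.le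
    rw [Real.mul_rpow hsin.le h4.le] at h5
    have p0 := Real.rpow_pos_of_pos (two_pos (α := ℝ)) l
    rcases abs_cases τ with ⟨h, _⟩ | ⟨h, _⟩
    · rw [h] at h5; nlinarith [mul_pos p3 p2]
    · rw [h, sub_neg_eq_add] at h5; nlinarith [mul_pos p3 p1]

theorem intervalIntegrable_gapMajorant {l : ℝ} (hl : -1 < l) (s a b : ℝ) :
    IntervalIntegrable (gapMajorant l s) volume a b := by
  have h1 := (intervalIntegral.intervalIntegrable_rpow' hl (a := Real.arccos s - a)
    (b := Real.arccos s - b)).comp_sub_left (Real.arccos s)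
  have h2 := (intervalIntegral.intervalIntegrable_rpow' hl (a := Real.arccos s + a)
    (b := Real.arccos s + b)).comp_add_left (Real.arccos s)
  simp only [sub_sub_cancel, add_sub_cancel_left] at h1 h2
  exact intervalIntegrable_const.add ((h1.add h2).const_mul _)

theorem intervalIntegrable_gap {l s : ℝ} (hl : -1 < l) (hs : s ∈ Ioo (-1 : ℝ) 1) :
    IntervalIntegrable (fun τ => (Real.cos τ - s) ^ l) volume (-Real.arccos s) (Real.arccos s) := by
  have h0 := (arccos_mem_Ioo hs).1
  rw [intervalIntegrable_iff_integrableOn_Ioo_of_le (by linarith)]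
  have hm := (intervalIntegrable_iff_integrableOn_Ioo_of_le (by linarith)).1
    (intervalIntegrable_gapMajorant hl s (-Real.arccos s) (Real.arccos s))
  refine Integrable.mono' hm ?_ ?_
  · exact (Measurable.pow_const (by fun_prop) l).aestronglyMeasurable
  · filter_upwards [ae_restrict_mem measurableSet_Ioo] with τ hτ
    exact abs_gap_rpow_le hs l (abs_lt.2 hτ)

/-! ### Continued powers of the gap as functionals of a function of time -/

/-- Smooth functions of time. -/
abbrev IsSmooth (f : ℝ → ℂ) : Prop := ContDiff ℝ ((⊤ : ℕ∞) : WithTop ℕ∞) f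

theorem IsSmooth.deriv {f : ℝ → ℂ} (hf : IsSmooth f) : IsSmooth (deriv f) :=
  ContDiff.deriv' (n := ((⊤ : ℕ∞) : WithTop ℕ∞)) hf

theorem IsSmooth.hasDerivAt {f : ℝ → ℂ} (hf : IsSmooth f) (x : ℝ) :
    HasDerivAt f (_root_.deriv f x) x :=
  (hf.differentiable (by simp) x).hasDerivAt

/-- The integral of `f` against the power `l` of `cos τ - s` with distance `ε` from its zeros. -/
def cutGapIntegral (l s : ℝ) (f : ℝ → ℂ) (ε : ℝ) : ℂ :=
  ∫ τ in (-(Real.arccos s - ε))..(Real.arccos s - ε), (((Real.cos τ - s) ^ l : ℝ) : ℂ) * f τ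

/-- For `l > - n - 1`, the analytic continuation in `l` of the integral of `f` against
`(cos τ - s) ^ l / Γ (l + 1)`. -/
def gapFun : ℕ → ℝ → ℝ → (ℝ → ℂ) → ℂ
  | 0, l, s, f => ((Real.Gamma (l + 1))⁻¹ : ℝ) * cutGapIntegral l s f 0
  | n + 1, l, s, f => ((1 - s ^ 2)⁻¹ : ℝ) * (gapFun n (l + 2) s (deriv (deriv f)) +
      (((2 * l + 3) * s : ℝ) : ℂ) * gapFun n (l + 1) s f +
      (((l + 2) ^ 2 : ℝ) : ℂ) * gapFun n (l + 2) s f)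

theorem one_sub_sq_pos {s : ℝ} (hs : s ∈ Ioo (-1 : ℝ) 1) : 0 < 1 - s ^ 2 := by
  nlinarith [hs.1, hs.2]

theorem intervalIntegrable_gap_mul {l s : ℝ} (hl : -1 < l) (hs : s ∈ Ioo (-1 : ℝ) 1) {f : ℝ → ℂ}
    (hf : Continuous f) {a b : ℝ} (ha : a ∈ Icc (-Real.arccos s) (Real.arccos s))
    (hb : b ∈ Icc (-Real.arccos s) (Real.arccos s)) :
    IntervalIntegrable (fun τ => (((Real.cos τ - s) ^ l : ℝ) : ℂ) * f τ) volume a b := by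
  have h1 := ((intervalIntegrable_gap hl hs).mono_set
    (by rw [uIcc_of_le (a := -Real.arccos s) (by linarith [(arccos_mem_Ioo hs).1])]
        exact uIcc_subset_Icc ha hb) : IntervalIntegrable (fun τ => (Real.cos τ - s) ^ l) volume a b)
  have h2 : IntervalIntegrable (fun τ => (((Real.cos τ - s) ^ l : ℝ) : ℂ)) volume a b :=
    ⟨h1.1.ofReal, h1.2.ofReal⟩
  exact h2.mul_continuousOn hf.continuousOn

theorem abs_lt_of_mem_uIcc_cut {T ε τ : ℝ} (hε : ε ∈ Ioc 0 T)
    (h : τ ∈ uIcc (-(T - ε)) (T - ε)) : |τ| < T := by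
  rw [uIcc_of_le (by linarith [hε.2])] at h
  rw [abs_lt]
  exact ⟨by linarith [h.1, hε.1], by linarith [h.2, hε.1]⟩

theorem continuousOn_gap_rpow (l : ℝ) {s : ℝ} (hs : s ∈ Ioo (-1 : ℝ) 1) :
    ContinuousOn (fun τ => (((Real.cos τ - s) ^ l : ℝ) : ℂ)) {τ | |τ| < Real.arccos s} :=
  Complex.continuous_ofReal.comp_continuousOn
    (ContinuousOn.rpow_const (by fun_prop) fun _ hτ => Or.inl (cos_sub_pos hs hτ).ne')

theorem intervalIntegrable_gap_cut (l : ℝ) {s : ℝ} (hs : s ∈ Ioo (-1 : ℝ) 1) {f : ℝ → ℂ}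
    (hf : Continuous f) {a b : ℝ} (ha : |a| < Real.arccos s) (hb : |b| < Real.arccos s) :
    IntervalIntegrable (fun τ => (((Real.cos τ - s) ^ l : ℝ) : ℂ) * f τ) volume a b := by
  refine ContinuousOn.intervalIntegrable (((continuousOn_gap_rpow l hs).mono ?_).mul
    hf.continuousOn)
  intro τ hτ
  rw [Set.mem_ofPred_eq, abs_lt]
  rcases mem_uIcc.1 hτ with h | h
  · exact ⟨by linarith [h.1, (abs_lt.1 ha).1], by linarith [h.2, (abs_lt.1 hb).2]⟩
  · exact ⟨by linarith [h.1, (abs_lt.1 hb).1], by linarith [h.2, (abs_lt.1 ha).2]⟩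

theorem cut_abs_lt {s ε : ℝ} (hε : ε ∈ Ioc 0 (Real.arccos s)) :
    |Real.arccos s - ε| < Real.arccos s ∧ |-(Real.arccos s - ε)| < Real.arccos s := by
  rw [abs_neg, and_self, abs_of_nonneg (by linarith [hε.2])]
  linarith [hε.1]

theorem eventually_cut {s : ℝ} (hs : s ∈ Ioo (-1 : ℝ) 1) :
    ∀ᶠ ε in 𝓝[>] (0 : ℝ), ε ∈ Ioc 0 (Real.arccos s) :=
  Ioc_mem_nhdsGT (arccos_mem_Ioo hs).1

/-- The boundary term of the integration by parts that raises the power of the gap. -/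
def cutBoundary (l s : ℝ) (f : ℝ → ℂ) (ε : ℝ) : ℂ :=
  ((edgeSlope s ε ^ (l + 1) : ℝ) : ℂ) *
    (-(((l + 2) * Real.sin (Real.arccos s - ε) : ℝ) : ℂ) *
        (f (Real.arccos s - ε) + f (-(Real.arccos s - ε))) +
      ((ε * edgeSlope s ε : ℝ) : ℂ) *
        (deriv f (-(Real.arccos s - ε)) - deriv f (Real.arccos s - ε)))

theorem contDiffAt_cutBoundary (l : ℝ) {s : ℝ} (hs : s ∈ Ioo (-1 : ℝ) 1) {f : ℝ → ℂ}
    (hf : IsSmooth f) : ContDiffAt ℝ ((⊤ : ℕ∞) : WithTop ℕ∞) (cutBoundary l s f) 0 := by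
  have hs1 : ContDiff ℝ ((⊤ : ℕ∞) : WithTop ℕ∞) fun ε : ℝ => Real.arccos s - ε :=
    contDiff_const.sub contDiff_id
  have hs2 : ContDiff ℝ ((⊤ : ℕ∞) : WithTop ℕ∞) fun ε : ℝ => -(Real.arccos s - ε) := hs1.neg
  have h1 : ContDiff ℝ ((⊤ : ℕ∞) : WithTop ℕ∞)
      fun ε : ℝ => (((l + 2) * Real.sin (Real.arccos s - ε) : ℝ) : ℂ) :=
    Complex.ofRealCLM.contDiff.comp (contDiff_const.mul (Real.contDiff_sin.comp hs1))
  have h2 : ContDiffAt ℝ ((⊤ : ℕ∞) : WithTop ℕ∞)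
      (fun ε : ℝ => ((ε * edgeSlope s ε : ℝ) : ℂ)) 0 :=
    Complex.ofRealCLM.contDiff.contDiffAt.comp (0 : ℝ)
      (contDiffAt_id.mul (contDiffAt_edgeSlope s))
  exact (contDiffAt_edgeSlope_rpow hs (l + 1)).mul
    ((h1.contDiffAt.neg.mul ((hf.comp hs1).add (hf.comp hs2)).contDiffAt).add
      (h2.mul ((hf.deriv.comp hs2).sub (hf.deriv.comp hs1)).contDiffAt))

/-- With x = cos τ − s, so that sin² τ = 1 − s² − 2 s x − x², (x^(l+2))'' = (l+1)(l+2)(1−s²) x^l −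
(l+2)(2l+3) s x^(l+1) − (l+2)² x^(l+2). Integrating against f and moving both derivatives to f
expresses the power l by higher ones. The boundary term is ε^(l+1) times a function smooth at ε = 0,
for every real l. -/
theorem cutGapIntegral_raise (l : ℝ) {s : ℝ} (hs : s ∈ Ioo (-1 : ℝ) 1) {f : ℝ → ℂ}
    (hf : IsSmooth f) {ε : ℝ} (hε : ε ∈ Ioc 0 (Real.arccos s)) (hw : 0 < edgeSlope s ε) :
    (((l + 1) * (l + 2) * (1 - s ^ 2) : ℝ) : ℂ) * cutGapIntegral l s f ε =
      ((ε ^ (l + 1) : ℝ) : ℂ) * cutBoundary l s f ε +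
      cutGapIntegral (l + 2) s (deriv (deriv f)) ε +
      (((l + 2) * (2 * l + 3) * s : ℝ) : ℂ) * cutGapIntegral (l + 1) s f ε +
      (((l + 2) ^ 2 : ℝ) : ℂ) * cutGapIntegral (l + 2) s f ε := by
  have hc := cut_abs_lt hε
  have hd2 : Continuous (deriv (deriv f)) := hf.deriv.deriv.continuous
  have i0 := intervalIntegrable_gap_cut l hs hf.continuous hc.2 hc.1
  have i1 := intervalIntegrable_gap_cut (l + 1) hs hf.continuous hc.2 hc.1
  have i2 := intervalIntegrable_gap_cut (l + 2) hs hf.continuous hc.2 hc.1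
  have i3 := intervalIntegrable_gap_cut (l + 2) hs hd2 hc.2 hc.1
  -- The two integrations by parts are done at once with the antiderivative (x^(l+2))' f − x^(l+2)
  -- f'.
  have hder : ∀ τ ∈ uIcc (-(Real.arccos s - ε)) (Real.arccos s - ε),
      HasDerivAt (fun τ => (((l + 2) * (Real.cos τ - s) ^ (l + 1) * (-Real.sin τ) : ℝ) : ℂ) * f τ -
        (((Real.cos τ - s) ^ (l + 2) : ℝ) : ℂ) * deriv f τ)
      ((((l + 1) * (l + 2) * (1 - s ^ 2) : ℝ) : ℂ) * ((((Real.cos τ - s) ^ l : ℝ) : ℂ) * f τ) -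
        (((Real.cos τ - s) ^ (l + 2) : ℝ) : ℂ) * deriv (deriv f) τ -
        (((l + 2) * (2 * l + 3) * s : ℝ) : ℂ) * ((((Real.cos τ - s) ^ (l + 1) : ℝ) : ℂ) * f τ) -
        (((l + 2) ^ 2 : ℝ) : ℂ) * ((((Real.cos τ - s) ^ (l + 2) : ℝ) : ℂ) * f τ)) τ := by
    intro τ hτ
    have hpos := cos_sub_pos hs (abs_lt_of_mem_uIcc_cut hε hτ)
    have hg : HasDerivAt (fun τ => Real.cos τ - s) (-Real.sin τ) τ :=
      (Real.hasDerivAt_cos τ).sub_const s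
    have g1 := hg.rpow_const (p := l + 1) (Or.inl hpos.ne')
    have g2 := hg.rpow_const (p := l + 2) (Or.inl hpos.ne')
    have g3 := (((g1.const_mul (l + 2)).mul (Real.hasDerivAt_sin τ).neg).ofReal_comp.mul
      (hf.hasDerivAt τ)).sub (g2.ofReal_comp.mul (hf.deriv.hasDerivAt τ))
    refine (g3.congr_deriv ?_)
    have e1 : (Real.cos τ - s) ^ (l + 1) = (Real.cos τ - s) ^ l * (Real.cos τ - s) :=
      Real.rpow_add_one hpos.ne' l
    have e2 : (Real.cos τ - s) ^ (l + 2) = (Real.cos τ - s) ^ l * (Real.cos τ - s) ^ 2 := by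
      rw [show l + 2 = l + (2 : ℕ) by norm_num, Real.rpow_add_natCast hpos.ne']
    simp only [Pi.neg_apply, Pi.mul_apply]
    rw [show l + 2 - 1 = l + 1 by ring, show l + 1 - 1 = l by ring, e1, e2]
    have hsin : (Real.sin τ : ℂ) ^ 2 = 1 - (Real.cos τ : ℂ) ^ 2 := by
      exact_mod_cast Real.sin_sq τ
    push_cast at hsin ⊢
    linear_combination ((l : ℂ) + 1) * (l + 2) * ((Real.cos τ - s) ^ l : ℝ) * f τ * hsin
  have hint := intervalIntegral.integral_eq_sub_of_hasDerivAt hder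
    ((((i0.const_mul _).sub i3).sub (i1.const_mul _)).sub (i2.const_mul _))
  rw [intervalIntegral.integral_sub (((i0.const_mul _).sub i3).sub (i1.const_mul _))
      (i2.const_mul _),
    intervalIntegral.integral_sub ((i0.const_mul _).sub i3) (i1.const_mul _),
    intervalIntegral.integral_sub (i0.const_mul _) i3,
    intervalIntegral.integral_const_mul, intervalIntegral.integral_const_mul,
    intervalIntegral.integral_const_mul] at hint
  have hedge : Real.cos (Real.arccos s - ε) - s = ε * edgeSlope s ε :=
    edge_eq hs.1.le hs.2.le ε
  have e1 : (ε * edgeSlope s ε) ^ (l + 2) =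
      ε ^ (l + 1) * edgeSlope s ε ^ (l + 1) * (ε * edgeSlope s ε) := by
    rw [show l + 2 = l + 1 + 1 by ring, Real.rpow_add_one (mul_pos hε.1 hw).ne',
      Real.mul_rpow hε.1.le hw.le]
  rw [Real.cos_neg, Real.sin_neg, hedge, e1, Real.mul_rpow hε.1.le hw.le] at hint
  unfold cutGapIntegral cutBoundary
  push_cast at hint ⊢
  linear_combination hint

theorem tendsto_cutGapIntegral {l s : ℝ} (hl : -1 < l) (hs : s ∈ Ioo (-1 : ℝ) 1) {f : ℝ → ℂ}
    (hf : Continuous f) :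
    Tendsto (cutGapIntegral l s f) (𝓝[>] 0) (𝓝 (cutGapIntegral l s f 0)) := by
  have h0 := (arccos_mem_Ioo hs).1
  have hi := intervalIntegrable_gap_mul hl hs hf (a := -Real.arccos s) (b := Real.arccos s)
    ⟨le_rfl, by linarith⟩ ⟨by linarith, le_rfl⟩
  have hII : IntegrableOn (fun τ => (((Real.cos τ - s) ^ l : ℝ) : ℂ) * f τ)
      (uIcc (-Real.arccos s) (Real.arccos s)) volume := by
    rw [uIcc_of_le (by linarith)]
    exact (intervalIntegrable_iff_integrableOn_Icc_of_le (by linarith)).1 hi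
  have hcont := intervalIntegral.continuousOn_primitive_interval hII
  have e : ∀ ε ∈ Icc 0 (Real.arccos s), cutGapIntegral l s f ε =
      (∫ τ in (-Real.arccos s)..(Real.arccos s - ε), (((Real.cos τ - s) ^ l : ℝ) : ℂ) * f τ) -
      ∫ τ in (-Real.arccos s)..(-(Real.arccos s - ε)), (((Real.cos τ - s) ^ l : ℝ) : ℂ) * f τ := by
    intro ε hε
    rw [intervalIntegral.integral_interval_sub_left]
    · rfl
    · exact intervalIntegrable_gap_mul hl hs hf ⟨le_rfl, by linarith⟩
        ⟨by linarith [hε.2], by linarith [hε.1]⟩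
    · exact intervalIntegrable_gap_mul hl hs hf ⟨le_rfl, by linarith⟩
        ⟨by linarith [hε.1], by linarith [hε.2]⟩
  have hc : ContinuousOn (cutGapIntegral l s f) (Icc 0 (Real.arccos s)) := by
    refine ContinuousOn.congr ?_ e
    rw [uIcc_of_le (by linarith)] at hcont
    refine ContinuousOn.sub (hcont.comp (by fun_prop) ?_) (hcont.comp (by fun_prop) ?_)
    · intro ε hε; exact ⟨by linarith [hε.2], by linarith [hε.1]⟩
    · intro ε hε; exact ⟨by linarith [hε.1], by linarith [hε.2]⟩
  have := (hc 0 ⟨le_rfl, h0.le⟩).tendsto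
  refine this.mono_left (nhdsWithin_le_iff.2 ?_)
  exact mem_of_superset (Ioc_mem_nhdsGT h0) Ioc_subset_Icc_self

/-- For l > −1 the boundary term vanishes with the cutoff, and Γ(l+3) = (l+2)(l+1) Γ(l+1) absorbs
the prefactor. So the recursive clause is consistent with the integral. -/
theorem gapFun_one {l s : ℝ} (hl : -1 < l) (hs : s ∈ Ioo (-1 : ℝ) 1) {f : ℝ → ℂ}
    (hf : IsSmooth f) : gapFun 1 l s f = gapFun 0 l s f := by
  have hd2 : Continuous (deriv (deriv f)) := hf.deriv.deriv.continuous
  have h1 := (tendsto_cutGapIntegral hl hs hf.continuous).const_mul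
    (((l + 1) * (l + 2) * (1 - s ^ 2) : ℝ) : ℂ)
  have hb : Tendsto (fun ε : ℝ => ((ε ^ (l + 1) : ℝ) : ℂ) * cutBoundary l s f ε) (𝓝[>] 0)
      (𝓝 (0 * cutBoundary l s f 0)) := by
    refine Tendsto.mul ?_
      ((contDiffAt_cutBoundary l hs hf).continuousAt.tendsto.mono_left nhdsWithin_le_nhds)
    have := (Complex.continuous_ofReal.tendsto 0).comp
      (tendsto_rpow_nhdsGT_zero (L := l + 1) (by linarith))
    rwa [Complex.ofReal_zero] at this
  rw [zero_mul] at hb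
  have h2 := ((hb.add (tendsto_cutGapIntegral (by linarith : -1 < l + 2) hs hd2)).add
    ((tendsto_cutGapIntegral (by linarith : -1 < l + 1) hs hf.continuous).const_mul
      (((l + 2) * (2 * l + 3) * s : ℝ) : ℂ))).add
    ((tendsto_cutGapIntegral (by linarith : -1 < l + 2) hs hf.continuous).const_mul
      (((l + 2) ^ 2 : ℝ) : ℂ))
  have h3 := tendsto_nhds_unique_of_eventuallyEq h1 h2 (by
    filter_upwards [eventually_cut hs,
      nhdsWithin_le_nhds (eventually_edgeSlope_pos hs)] with ε hε hw
    exact cutGapIntegral_raise l hs hf hε hw)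
  have hs2 := one_sub_sq_pos hs
  have g1 : Real.Gamma (l + 2 + 1) = (l + 2) * ((l + 1) * Real.Gamma (l + 1)) := by
    rw [Real.Gamma_add_one (by linarith), show l + 2 = l + 1 + 1 by ring,
      Real.Gamma_add_one (by linarith)]
  have g2 : Real.Gamma (l + 1 + 1) = (l + 1) * Real.Gamma (l + 1) :=
    Real.Gamma_add_one (by linarith)
  have hG := (Real.Gamma_pos_of_pos (by linarith : 0 < l + 1)).ne'
  have hl1 : l + 1 ≠ 0 := by linarith
  have hl2 : l + 2 ≠ 0 := by linarith
  simp only [gapFun]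
  rw [g1, g2]
  have hG' : (Real.Gamma (l + 1) : ℂ) ≠ 0 := by exact_mod_cast hG
  have hl1' : (l : ℂ) + 1 ≠ 0 := by exact_mod_cast hl1
  have hl2' : (l : ℂ) + 2 ≠ 0 := by exact_mod_cast hl2
  have hs2' : (1 : ℂ) - (s : ℂ) ^ 2 ≠ 0 := by exact_mod_cast hs2.ne'
  push_cast at h3 ⊢
  field_simp
  linear_combination -h3

/-- The depth of the recursion only enlarges the range of `l`; where a depth suffices, greater depth
changes nothing. -/
theorem gapFun_succ_eq {n : ℕ} {l s : ℝ} (hl : -(n + 1) < l) (hs : s ∈ Ioo (-1 : ℝ) 1)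
    {f : ℝ → ℂ} (hf : IsSmooth f) : gapFun (n + 1) l s f = gapFun n l s f := by
  induction n generalizing l f with
  | zero => exact gapFun_one (by simpa using hl) hs hf
  | succ n ih =>
    push_cast at hl
    rw [gapFun, ih (by linarith) hf.deriv.deriv, ih (by linarith) hf, ih (by linarith) hf]
    rfl

theorem gapFun_eq_of_le {n m : ℕ} (h : n ≤ m) {l s : ℝ} (hl : -(n + 1) < l)
    (hs : s ∈ Ioo (-1 : ℝ) 1) {f : ℝ → ℂ} (hf : IsSmooth f) : gapFun m l s f = gapFun n l s f := by
  induction m, h using Nat.le_induction with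
  | base => rfl
  | succ m hm ih =>
    have : (n : ℝ) ≤ m := by exact_mod_cast hm
    rw [gapFun_succ_eq (by linarith) hs hf, ih]

/-- `q` is smooth at `0` and `cutGapIntegral l s f ε - ε ^ (l + 1) * q ε` tends to `J`. -/
def IsFinitePart (l s : ℝ) (f : ℝ → ℂ) (J : ℂ) : Prop :=
  ∃ q : ℝ → ℂ, ContDiffAt ℝ ((⊤ : ℕ∞) : WithTop ℕ∞) q 0 ∧
    Tendsto (fun ε : ℝ => cutGapIntegral l s f ε - ((ε ^ (l + 1) : ℝ) : ℂ) * q ε)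
      (𝓝[>] 0) (𝓝 J)

/-- Induction along the raising identity: the divergent parts at l + 1 and l + 2 are ε^(l+1) times ε
q and ε² q, and the boundary term has the same form. `hl'` keeps l + 1 and l + 2 away from 0 at each
step, and Γ away from its poles. -/
theorem isFinitePart_gapFun {n : ℕ} {l s : ℝ} (hl : -(n + 1) < l) (hs : s ∈ Ioo (-1 : ℝ) 1)
    (hl' : ∀ j : ℕ, l + 1 + j ≠ 0) {f : ℝ → ℂ} (hf : IsSmooth f) :
    IsFinitePart l s f ((Real.Gamma (l + 1) : ℂ) * gapFun n l s f) := by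
  have hGne : ∀ {l : ℝ}, (∀ j : ℕ, l + 1 + j ≠ 0) → Real.Gamma (l + 1) ≠ 0 := fun h =>
    Real.Gamma_ne_zero fun m hm => h m (by rw [hm]; ring)
  induction n generalizing l f with
  | zero =>
    refine ⟨0, contDiffAt_const, ?_⟩
    have hG : (Real.Gamma (l + 1) : ℂ) ≠ 0 := by exact_mod_cast hGne hl'
    have := tendsto_cutGapIntegral (by simpa using hl) hs hf.continuous
    simp only [gapFun, Pi.zero_apply, mul_zero, sub_zero]
    push_cast
    rwa [mul_inv_cancel_left₀ hG]
  | succ n ih =>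
    push_cast at hl
    have hl1 : ∀ j : ℕ, l + 1 + 1 + j ≠ 0 := fun j => by
      have := hl' (j + 1); push_cast at this; contrapose! this; linarith
    have hl2 : ∀ j : ℕ, l + 2 + 1 + j ≠ 0 := fun j => by
      have := hl' (j + 2); push_cast at this; contrapose! this; linarith
    obtain ⟨q3, hq3, t3⟩ := ih (by linarith : -((n : ℝ) + 1) < l + 2) hl2 hf.deriv.deriv
    obtain ⟨q2, hq2, t2⟩ := ih (by linarith : -((n : ℝ) + 1) < l + 2) hl2 hf
    obtain ⟨q1, hq1, t1⟩ := ih (by linarith : -((n : ℝ) + 1) < l + 1) hl1 hf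
    have c1 : l + 1 ≠ 0 := by simpa using hl' 0
    have c2 : l + 2 ≠ 0 := by
      have := hl' 1; push_cast at this; contrapose! this; linarith
    have c3 := (one_sub_sq_pos hs).ne'
    have g2 : Real.Gamma (l + 1 + 1) = (l + 1) * Real.Gamma (l + 1) := Real.Gamma_add_one c1
    have g1 : Real.Gamma (l + 2 + 1) = (l + 2) * ((l + 1) * Real.Gamma (l + 1)) := by
      rw [Real.Gamma_add_one c2, show l + 2 = l + 1 + 1 by ring, g2]
    have c1' : (l : ℂ) + 1 ≠ 0 := by exact_mod_cast c1
    have c2' : (l : ℂ) + 2 ≠ 0 := by exact_mod_cast c2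
    have c3' : (1 : ℂ) - (s : ℂ) ^ 2 ≠ 0 := by exact_mod_cast c3
    have hx : ContDiffAt ℝ ((⊤ : ℕ∞) : WithTop ℕ∞) (fun ε : ℝ => (ε : ℂ)) 0 :=
      Complex.ofRealCLM.contDiff.contDiffAt
    have hsum := ((t3.add (t1.const_mul (((l + 2) * (2 * l + 3) * s : ℝ) : ℂ))).add
      (t2.const_mul (((l + 2) ^ 2 : ℝ) : ℂ))).const_mul
      ((((l + 1) * (l + 2) * (1 - s ^ 2))⁻¹ : ℝ) : ℂ)
    refine ⟨fun ε => ((((l + 1) * (l + 2) * (1 - s ^ 2))⁻¹ : ℝ) : ℂ) * (cutBoundary l s f ε +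
      (ε : ℂ) ^ 2 * q3 ε + (((l + 2) * (2 * l + 3) * s : ℝ) : ℂ) * ((ε : ℂ) * q1 ε) +
      (((l + 2) ^ 2 : ℝ) : ℂ) * ((ε : ℂ) ^ 2 * q2 ε)), ?_, ?_⟩
    · exact contDiffAt_const.mul ((((contDiffAt_cutBoundary l hs hf).add
        ((hx.pow 2).mul hq3)).add (contDiffAt_const.mul (hx.mul hq1))).add
        (contDiffAt_const.mul ((hx.pow 2).mul hq2)))
    · refine (hsum.congr' ?_).trans_eq ?_
      · filter_upwards [eventually_cut hs, nhdsWithin_le_nhds (eventually_edgeSlope_pos hs)]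
          with ε hε hw
        have h := cutGapIntegral_raise l hs hf hε hw
        have e1 : ε ^ (l + 1 + 1) = ε ^ (l + 1) * ε := Real.rpow_add_one hε.1.ne' _
        have e2 : ε ^ (l + 2 + 1) = ε ^ (l + 1) * ε ^ 2 := by
          rw [show l + 2 + 1 = l + 1 + (2 : ℕ) by push_cast; ring,
            Real.rpow_add_natCast hε.1.ne']
        rw [e1, e2]
        push_cast at h ⊢
        field_simp
        linear_combination -h
      · rw [g1, g2, gapFun]
        congr 1
        push_cast
        field_simp

/-! ### Regulated integrals -/

theorem continuous_edgeSlope (s : ℝ) : Continuous (edgeSlope s) := by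
  have h : Continuous (edge s) := by unfold edge; fun_prop
  rw [← continuousOn_univ]
  exact (continuousOn_dslope univ_mem).2
    ⟨h.continuousOn, (analyticAt_edge s 0).differentiableAt⟩

/-- The sum over both light cones of `f` times the power `l` of the slope of the gap. -/
def edgeDensity (l s : ℝ) (f : ℝ → ℂ) (u : ℝ) : ℂ :=
  ((edgeSlope s u ^ l : ℝ) : ℂ) * (f (Real.arccos s - u) + f (-(Real.arccos s - u)))

theorem contDiffAt_edgeDensity (l : ℝ) {s : ℝ} (hs : s ∈ Ioo (-1 : ℝ) 1) {f : ℝ → ℂ}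
    (hf : IsSmooth f) : ContDiffAt ℝ ((⊤ : ℕ∞) : WithTop ℕ∞) (edgeDensity l s f) 0 := by
  have hs1 : ContDiff ℝ ((⊤ : ℕ∞) : WithTop ℕ∞) fun ε : ℝ => Real.arccos s - ε :=
    contDiff_const.sub contDiff_id
  exact (contDiffAt_edgeSlope_rpow hs l).mul
    (((hf.comp hs1).add (hf.comp hs1.neg)).contDiffAt)

/-- The pieces near the two ends are parametrised by the distance u to the end. The gap is even in
τ, so both carry the factor u^l times the same power of the slope and combine into one integral. -/
theorem cutGapIntegral_eq_add (l : ℝ) {s : ℝ} (hs : s ∈ Ioo (-1 : ℝ) 1) {f : ℝ → ℂ}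
    (hf : Continuous f) {ε δ : ℝ} (hε : 0 < ε) (h : ε ≤ δ) (hδ : δ ≤ Real.arccos s)
    (hw : ∀ u ∈ Icc ε δ, 0 < edgeSlope s u) :
    cutGapIntegral l s f ε = cutGapIntegral l s f δ +
      ∫ u in ε..δ, ((u ^ l : ℝ) : ℂ) * edgeDensity l s f u := by
  set T := Real.arccos s with hT
  have c1 := cut_abs_lt (s := s) ⟨hε, h.trans hδ⟩
  have c2 := cut_abs_lt (s := s) ⟨hε.trans_le h, hδ⟩
  rw [← hT] at c1 c2
  have i1 := intervalIntegrable_gap_cut l hs hf c1.2 c2.2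
  have i2 := intervalIntegrable_gap_cut l hs hf c2.2 c2.1
  have i3 := intervalIntegrable_gap_cut l hs hf c2.1 c1.1
  have key : ∀ u ∈ uIcc ε δ, (((Real.cos (T - u) - s) ^ l : ℝ) : ℂ) =
      ((u ^ l : ℝ) : ℂ) * ((edgeSlope s u ^ l : ℝ) : ℂ) := by
    intro u hu
    rw [uIcc_of_le h] at hu
    have := edge_eq hs.1.le hs.2.le u
    unfold edge at this
    rw [hT, this, Real.mul_rpow (hε.le.trans hu.1) (hw u hu).le, Complex.ofReal_mul]
  have e1 : (∫ τ in (T - δ)..(T - ε), (((Real.cos τ - s) ^ l : ℝ) : ℂ) * f τ) =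
      ∫ u in ε..δ, ((u ^ l : ℝ) : ℂ) * (((edgeSlope s u ^ l : ℝ) : ℂ) * f (T - u)) := by
    rw [← intervalIntegral.integral_comp_sub_left
      (fun τ => (((Real.cos τ - s) ^ l : ℝ) : ℂ) * f τ) T]
    exact intervalIntegral.integral_congr fun u hu => by simp only [key u hu, mul_assoc]
  have e2 : (∫ τ in (-(T - ε))..(-(T - δ)), (((Real.cos τ - s) ^ l : ℝ) : ℂ) * f τ) =
      ∫ u in ε..δ, ((u ^ l : ℝ) : ℂ) * (((edgeSlope s u ^ l : ℝ) : ℂ) * f (-(T - u))) := by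
    have := intervalIntegral.integral_comp_sub_right (a := ε) (b := δ)
      (fun τ => (((Real.cos τ - s) ^ l : ℝ) : ℂ) * f τ) T
    rw [neg_sub, neg_sub, ← this]
    refine intervalIntegral.integral_congr fun u hu => ?_
    rw [← neg_sub T u]
    simp only [Real.cos_neg, key u hu, mul_assoc]
  have hcw : ContinuousOn (fun u => ((u ^ l : ℝ) : ℂ) * ((edgeSlope s u ^ l : ℝ) : ℂ))
      (uIcc ε δ) := by
    rw [uIcc_of_le h]
    refine (Complex.continuous_ofReal.comp_continuousOn (ContinuousOn.rpow_const
      continuousOn_id fun u hu => Or.inl (hε.trans_le hu.1).ne')).mul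
      (Complex.continuous_ofReal.comp_continuousOn (ContinuousOn.rpow_const
      (continuous_edgeSlope s).continuousOn fun u hu => Or.inl (hw u hu).ne'))
  have j1 : IntervalIntegrable (fun u => ((u ^ l : ℝ) : ℂ) *
      (((edgeSlope s u ^ l : ℝ) : ℂ) * f (T - u))) volume ε δ := by
    simp only [← mul_assoc]
    exact (hcw.mul (by fun_prop)).intervalIntegrable
  have j2 : IntervalIntegrable (fun u => ((u ^ l : ℝ) : ℂ) *
      (((edgeSlope s u ^ l : ℝ) : ℂ) * f (-(T - u)))) volume ε δ := by
    simp only [← mul_assoc]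
    exact (hcw.mul (by fun_prop)).intervalIntegrable
  unfold edgeDensity
  simp only [mul_add]
  rw [intervalIntegral.integral_add j1 j2, ← e1, ← e2]
  unfold cutGapIntegral
  rw [← hT, ← intervalIntegral.integral_add_adjacent_intervals i1 (i2.trans i3),
    ← intervalIntegral.integral_add_adjacent_intervals i2 i3]
  ring

/-- The integral with cutoff `ε`, regulated by `N` terms. -/
def regGapIntegral (l s : ℝ) (f : ℝ → ℂ) (N : ℕ) (ε : ℝ) : ℂ :=
  ∑ j ∈ Finset.range N, iteratedDeriv j (edgeDensity l s f) 0 / j.factorial *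
    ((ε ^ (l + 1 + j) / (l + 1 + j) : ℝ) : ℂ) + cutGapIntegral l s f ε

/-- After removal of `N` Taylor terms the density near the ends is O(u^(l+N)), integrable for l + N
> −1. The removed powers integrate explicitly, and their values at ε cancel the regulating terms. -/
theorem exists_tendsto_regGapIntegral {l s : ℝ} (hs : s ∈ Ioo (-1 : ℝ) 1) {f : ℝ → ℂ}
    (hf : IsSmooth f) {N : ℕ} (hN : -1 < l + N) (hl : ∀ j < N, l + 1 + (j : ℝ) ≠ 0) :
    ∃ J, Tendsto (regGapIntegral l s f N) (𝓝[>] 0) (𝓝 J) := by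
  set b : ℕ → ℂ := fun j => iteratedDeriv j (edgeDensity l s f) 0 / j.factorial with hb
  set R : ℝ → ℂ := fun u => ((u ^ l : ℝ) : ℂ) *
    (edgeDensity l s f u - ∑ j ∈ Finset.range N, ((u ^ j : ℝ) : ℂ) * b j) with hR
  obtain ⟨C, hC⟩ := (taylor_isBigO_zero (contDiffAt_edgeDensity l hs hf) N).bound
  obtain ⟨η, hη, hηs⟩ := Metric.eventually_nhds_iff.1 (hC.and (eventually_edgeSlope_pos hs))
  have h0 := (arccos_mem_Ioo hs).1
  -- Small enough for the Taylor estimate and a positive slope on [0, δ], and for the end pieces not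
  -- to overlap.
  set δ := min (η / 2) (Real.arccos s) with hδ
  have hδ0 : 0 < δ := lt_min (by linarith) h0
  have hδη : δ < η := lt_of_le_of_lt (min_le_left _ _) (by linarith)
  have hδT : δ ≤ Real.arccos s := min_le_right _ _
  have hmem : ∀ u ∈ Icc 0 δ, dist u 0 < η := fun u hu => by
    rw [Real.dist_eq, sub_zero, abs_of_nonneg hu.1]; linarith [hu.2]
  have hmeas : Measurable R := by
    have h1 : Measurable (edgeSlope s) := (continuous_edgeSlope s).measurable
    have h2 : Continuous f := hf.continuous
    have h3 : Measurable fun u : ℝ => f (Real.arccos s - u) + f (-(Real.arccos s - u)) :=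
      (by fun_prop : Continuous fun u : ℝ =>
        f (Real.arccos s - u) + f (-(Real.arccos s - u))).measurable
    have h4 : Measurable fun u : ℝ => ∑ j ∈ Finset.range N, ((u ^ j : ℝ) : ℂ) * b j :=
      (by fun_prop : Continuous fun u : ℝ =>
        ∑ j ∈ Finset.range N, ((u ^ j : ℝ) : ℂ) * b j).measurable
    exact (Complex.measurable_ofReal.comp (measurable_id.pow_const l)).mul
      (((Complex.measurable_ofReal.comp (h1.pow_const l)).mul h3).sub h4)
  have hRint : IntegrableOn R (Icc 0 δ) volume := by
    rw [integrableOn_Icc_iff_integrableOn_Ioc]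
    have hm : IntegrableOn (fun u : ℝ => C * u ^ (l + N)) (Ioc 0 δ) volume :=
      (intervalIntegrable_iff_integrableOn_Ioc_of_le hδ0.le).1
        ((intervalIntegral.intervalIntegrable_rpow' hN).const_mul C)
    refine Integrable.mono' hm hmeas.aestronglyMeasurable ?_
    filter_upwards [ae_restrict_mem measurableSet_Ioc] with u hu
    have h1 := (hηs (hmem u ⟨hu.1.le, hu.2⟩)).1
    rw [hR]
    simp only [norm_mul, Complex.norm_real, Real.norm_eq_abs]
    rw [abs_of_pos (Real.rpow_pos_of_pos hu.1 l), Real.rpow_add hu.1, Real.rpow_natCast]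
    have h2 : ‖u ^ N‖ = u ^ N := by rw [Real.norm_eq_abs, abs_of_pos (pow_pos hu.1 N)]
    rw [h2] at h1
    calc _ ≤ u ^ l * (C * u ^ N) :=
          mul_le_mul_of_nonneg_left h1 (Real.rpow_nonneg hu.1.le l)
      _ = _ := by ring
  set J0 : ℂ := ∑ j ∈ Finset.range N, b j * ((δ ^ (l + 1 + j) / (l + 1 + j) : ℝ) : ℂ) +
    cutGapIntegral l s f δ with hJ0
  refine ⟨J0 + ∫ u in (0 : ℝ)..δ, R u, ?_⟩
  have hcont := intervalIntegral.continuousOn_primitive_interval_left (f := R) (a := 0) (b := δ)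
    (μ := volume) (by rwa [uIcc_of_le hδ0.le])
  have ht := (hcont 0 left_mem_uIcc).tendsto
  have ht2 : Tendsto (fun ε : ℝ => ∫ u in ε..δ, R u) (𝓝[>] 0) (𝓝 (∫ u in (0 : ℝ)..δ, R u)) := by
    refine ht.mono_left (nhdsWithin_le_iff.2 ?_)
    rw [uIcc_of_le hδ0.le]
    exact mem_of_superset (Ioc_mem_nhdsGT hδ0) Ioc_subset_Icc_self
  refine (ht2.const_add J0).congr' ?_
  filter_upwards [Ioc_mem_nhdsGT hδ0] with ε hε
  have hw : ∀ u ∈ Icc ε δ, 0 < edgeSlope s u := fun u hu =>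
    (hηs (hmem u ⟨hε.1.le.trans hu.1, hu.2⟩)).2
  unfold regGapIntegral
  rw [cutGapIntegral_eq_add l hs hf.continuous hε.1 hε.2 hδT hw]
  have hz : (0 : ℝ) ∉ uIcc ε δ := by
    rw [uIcc_of_le hε.2]; exact fun h => absurd h.1 (not_le.2 hε.1)
  have hterm : ∀ j ∈ Finset.range N, (∫ u in ε..δ, ((u ^ l : ℝ) : ℂ) * (((u ^ j : ℝ) : ℂ) * b j)) =
      b j * ((δ ^ (l + 1 + j) / (l + 1 + j) : ℝ) : ℂ) -
      b j * ((ε ^ (l + 1 + j) / (l + 1 + j) : ℝ) : ℂ) := by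
    intro j hj
    have h1 : ∀ u ∈ uIcc ε δ, ((u ^ l : ℝ) : ℂ) * (((u ^ j : ℝ) : ℂ) * b j) =
        ((u ^ (l + j) : ℝ) : ℂ) * b j := by
      intro u hu
      rw [uIcc_of_le hε.2] at hu
      rw [Real.rpow_add_natCast (hε.1.trans_le hu.1).ne']
      push_cast; ring
    have hj' := hl j (Finset.mem_range.1 hj)
    rw [intervalIntegral.integral_congr h1, intervalIntegral.integral_mul_const,
      intervalIntegral.integral_ofReal, integral_rpow (Or.inr ⟨fun h => hj' (by linarith), hz⟩),
      show l + j + 1 = l + 1 + j by ring]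
    push_cast
    ring
  have hpowint : ∀ j ∈ Finset.range N, IntervalIntegrable
      (fun u : ℝ => ((u ^ l : ℝ) : ℂ) * (((u ^ j : ℝ) : ℂ) * b j)) volume ε δ := by
    intro j _
    refine ContinuousOn.intervalIntegrable (ContinuousOn.mul ?_ (by fun_prop))
    exact Complex.continuous_ofReal.comp_continuousOn (ContinuousOn.rpow_const
      continuousOn_id fun u hu => Or.inl (ne_of_mem_of_not_mem hu hz))
  have hG : IntervalIntegrable (fun u => ((u ^ l : ℝ) : ℂ) * edgeDensity l s f u) volume ε δ := by
    have h2 : Continuous f := hf.continuous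
    refine ContinuousOn.intervalIntegrable (ContinuousOn.mul ?_ (ContinuousOn.mul ?_
      (by fun_prop)))
    · exact Complex.continuous_ofReal.comp_continuousOn (ContinuousOn.rpow_const
        continuousOn_id fun u hu => Or.inl (ne_of_mem_of_not_mem hu hz))
    · rw [uIcc_of_le hε.2]
      exact Complex.continuous_ofReal.comp_continuousOn (ContinuousOn.rpow_const
        (continuous_edgeSlope s).continuousOn fun u hu => Or.inl (hw u hu).ne')
  have hsplit : (∫ u in ε..δ, R u) = (∫ u in ε..δ, ((u ^ l : ℝ) : ℂ) * edgeDensity l s f u) -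
      ∑ j ∈ Finset.range N, (b j * ((δ ^ (l + 1 + j) / (l + 1 + j) : ℝ) : ℂ) -
      b j * ((ε ^ (l + 1 + j) / (l + 1 + j) : ℝ) : ℂ)) := by
    rw [hR]
    simp only [mul_sub, Finset.mul_sum]
    have hsi : IntervalIntegrable (fun u => ∑ j ∈ Finset.range N,
        ((u ^ l : ℝ) : ℂ) * (((u ^ j : ℝ) : ℂ) * b j)) volume ε δ := by
      have := IntervalIntegrable.sum _ hpowint
      rwa [Finset.sum_fn] at this
    rw [intervalIntegral.integral_sub hG hsi,
      intervalIntegral.integral_finsetSum hpowint, Finset.sum_congr rfl hterm]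
  rw [hsplit, Finset.sum_sub_distrib, hJ0]
  ring

/-- The Taylor-regulated limit and the finite part differ by the limit of ε^(l+1) times a smooth
function, which is 0. In particular, all sufficiently large `N` give the same value. -/
theorem tendsto_regGapIntegral {n : ℕ} {l s : ℝ} (hs : s ∈ Ioo (-1 : ℝ) 1) {f : ℝ → ℂ}
    (hf : IsSmooth f) {N : ℕ} (hn : -(n + 1) < l) (hN : -1 < l + N)
    (hl : ∀ j : ℕ, l + 1 + (j : ℝ) ≠ 0) :
    Tendsto (regGapIntegral l s f N) (𝓝[>] 0) (𝓝 ((Real.Gamma (l + 1) : ℂ) * gapFun n l s f)) := by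
  obtain ⟨J, hJ⟩ := exists_tendsto_regGapIntegral hs hf hN fun j _ => hl j
  obtain ⟨q, hq, ht⟩ := isFinitePart_gapFun hn hs hl hf
  suffices h : J - (Real.Gamma (l + 1) : ℂ) * gapFun n l s f = 0 by
    rwa [sub_eq_zero.1 h] at hJ
  have hx : ContDiffAt ℝ ((⊤ : ℕ∞) : WithTop ℕ∞) (fun ε : ℝ => (ε : ℂ)) 0 :=
    Complex.ofRealCLM.contDiff.contDiffAt
  refine eq_zero_of_tendsto_rpow_mul (L := l + 1) (q := fun ε => q ε + ∑ j ∈ Finset.range N,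
    iteratedDeriv j (edgeDensity l s f) 0 / j.factorial * ((ε : ℂ) ^ j / ((l + 1 + j : ℝ) : ℂ)))
    (hq.add (ContDiffAt.sum fun j _ => contDiffAt_const.mul
      ((hx.pow j).div_const _))) (fun j => hl j) ((hJ.sub ht).congr' ?_)
  filter_upwards [self_mem_nhdsWithin] with ε hε
  unfold regGapIntegral
  rw [mul_add, Finset.mul_sum]
  have : ∀ j ∈ Finset.range N, ((ε ^ (l + 1) : ℝ) : ℂ) *
      (iteratedDeriv j (edgeDensity l s f) 0 / j.factorial * ((ε : ℂ) ^ j / ((l + 1 + j : ℝ) : ℂ))) =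
      iteratedDeriv j (edgeDensity l s f) 0 / j.factorial *
        ((ε ^ (l + 1 + j) / (l + 1 + j) : ℝ) : ℂ) := by
    intro j _
    rw [Real.rpow_add_natCast (ne_of_gt hε)]
    push_cast
    ring
  rw [Finset.sum_congr rfl this]
  ring

/-! ### Comparison with the cutoff integrals of the boundary -/

/-- The cosine of the angle of the light cone of the bulk point `(t', ρ', Ω')`. -/
def coneCos {d : ℕ} (ρ' : ℝ) (Ω' Ω : Sph d) : ℝ := Real.sin ρ' * inner ℝ Ω.1 Ω'.1

theorem abs_coneCos_le {d : ℕ} (ρ' : ℝ) (Ω' Ω : Sph d) : |coneCos ρ' Ω' Ω| ≤ |Real.sin ρ'| := by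
  unfold coneCos
  rw [abs_mul]
  have h := abs_real_inner_le_norm Ω.1 Ω'.1
  have h1 : ‖Ω.1‖ = 1 := by simp
  have h2 : ‖Ω'.1‖ = 1 := by simp
  rw [h1, h2, one_mul] at h
  exact mul_le_of_le_one_right (abs_nonneg _) h

theorem sin_mem_Ico {ρ' : ℝ} (h0 : 0 ≤ ρ') (h1 : ρ' < Real.pi / 2) :
    Real.sin ρ' ∈ Ico (0 : ℝ) 1 := by
  refine ⟨Real.sin_nonneg_of_nonneg_of_le_pi h0 (by linarith [Real.pi_pos]), ?_⟩
  rw [← Real.sin_pi_div_two]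
  exact Real.sin_lt_sin_of_lt_of_le_pi_div_two (by linarith) le_rfl h1

theorem cos_pos_of_bulk {ρ' : ℝ} (h0 : 0 ≤ ρ') (h1 : ρ' < Real.pi / 2) : 0 < Real.cos ρ' :=
  Real.cos_pos_of_mem_Ioo ⟨by linarith [Real.pi_pos], h1⟩

theorem coneCos_mem {d : ℕ} {ρ' : ℝ} (h0 : 0 ≤ ρ') (h1 : ρ' < Real.pi / 2) (Ω' Ω : Sph d) :
    coneCos ρ' Ω' Ω ∈ Ioo (-1 : ℝ) 1 := by
  have hs := sin_mem_Ico h0 h1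
  have := abs_coneCos_le ρ' Ω' Ω
  rw [abs_of_nonneg hs.1] at this
  exact abs_lt.1 (this.trans_lt hs.2)

theorem boundarySigma_add {d : ℕ} (t' τ ρ' : ℝ) (Ω' Ω : Sph d) :
    boundarySigma (t' + τ) Ω t' ρ' Ω' = (Real.cos τ - coneCos ρ' Ω' Ω) / Real.cos ρ' := by
  unfold boundarySigma coneCos
  rw [add_sub_cancel_left]

/-- Cosine is even, so the slope is the same on the future and the past light cone. -/
theorem dslope_boundarySigma {d : ℕ} (s : ℤˣ) (t' ρ' : ℝ) (Ω' Ω : Sph d) (u : ℝ) :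
    dslope (fun v : ℝ => boundarySigma (t' + ((s : ℤ) : ℝ) * (lightLag Ω ρ' Ω' - v)) Ω t' ρ' Ω') 0 u
      = edgeSlope (coneCos ρ' Ω' Ω) u / Real.cos ρ' := by
  have e : (fun v : ℝ => boundarySigma (t' + ((s : ℤ) : ℝ) * (lightLag Ω ρ' Ω' - v)) Ω t' ρ' Ω') =
      fun v => (Real.cos ρ')⁻¹ * edge (coneCos ρ' Ω' Ω) v := by
    funext v
    rw [boundarySigma_add, div_eq_inv_mul]
    unfold edge lightLag coneCos
    rcases Int.units_eq_one_or s with h | h <;> subst h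
    · simp
    · rw [← Real.cos_neg]; simp [← Real.cos_neg (v - _)]
  rw [e, div_eq_inv_mul]
  unfold edgeSlope
  rcases eq_or_ne u 0 with rfl | hu
  · rw [dslope_same, dslope_same, deriv_const_mul _ (analyticAt_edge _ 0).differentiableAt]
  · rw [dslope_of_ne _ hu, dslope_of_ne _ hu, slope_def_field, slope_def_field]
    ring

/-- Here `ν` stands for the weight Δ. Both cones share the slope, so their coefficients add up to
one of `edgeDensity`. The power of cos ρ' splits off where the slope is positive; a neighbourhood of
0 is enough for derivatives at 0. -/
theorem taylorCoeff_add {d : ℕ} {ν : ℝ} (j : ℕ) {t' ρ' : ℝ} (h0 : 0 ≤ ρ') (h1 : ρ' < Real.pi / 2)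
    (Ω' Ω : Sph d) {f : ℝ → Sph d → ℂ} (hf : IsSmooth fun t => f t Ω) :
    taylorCoeff ν 1 j t' ρ' Ω' f Ω + taylorCoeff ν (-1) j t' ρ' Ω' f Ω =
      ((Real.cos ρ' ^ (-(ν - d)) : ℝ) : ℂ) *
        (iteratedDeriv j (edgeDensity (ν - d) (coneCos ρ' Ω' Ω) fun τ => f (t' + τ) Ω) 0 /
          j.factorial) := by
  have hs := coneCos_mem h0 h1 Ω' Ω
  have hc := cos_pos_of_bulk h0 h1
  set s := coneCos ρ' Ω' Ω with hsdef
  have hcd : ∀ a b : ℝ, ContDiffAt ℝ ((⊤ : ℕ∞) : WithTop ℕ∞) (fun u : ℝ =>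
      f (t' + (a * (b - u))) Ω * ((edgeSlope s u ^ (ν - d) : ℝ) : ℂ)) 0 := by
    intro a b
    have : ContDiff ℝ ((⊤ : ℕ∞) : WithTop ℕ∞) fun u : ℝ => t' + (a * (b - u)) :=
      contDiff_const.add (contDiff_const.mul (contDiff_const.sub contDiff_id))
    exact (hf.comp this).contDiffAt.mul (contDiffAt_edgeSlope_rpow hs _)
  have key : ∀ σ : ℤˣ, taylorCoeff ν σ j t' ρ' Ω' f Ω =
      ((Real.cos ρ' ^ (-(ν - d)) : ℝ) : ℂ) * (iteratedDeriv j (fun u : ℝ =>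
        f (t' + (((σ : ℤ) : ℝ) * (Real.arccos s - u))) Ω *
          ((edgeSlope s u ^ (ν - d) : ℝ) : ℂ)) 0 / j.factorial) := by
    intro σ
    unfold taylorCoeff
    rw [← mul_div_assoc]
    congr 1
    rw [← iteratedDeriv_const_mul_field]
    refine Filter.EventuallyEq.iteratedDeriv_eq _ ?_
    filter_upwards [eventually_edgeSlope_pos hs] with u hu
    rw [dslope_boundarySigma, Real.div_rpow hu.le hc.le, Real.rpow_neg hc.le]
    simp only [lightLag, hsdef, coneCos]
    push_cast
    ring
  rw [key, key, ← mul_add, ← add_div, ← iteratedDeriv_fun_add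
    ((hcd _ _).of_le (by exact_mod_cast le_top)) ((hcd _ _).of_le (by exact_mod_cast le_top))]
  congr 3
  funext u
  unfold edgeDensity
  simp
  ring

theorem cutoffIntegral_eventuallyEq {d : ℕ} (Δ : ℝ) (N : ℕ) (t' : ℝ) {ρ' : ℝ} (h0 : 0 ≤ ρ')
    (h1 : ρ' < Real.pi / 2) (Ω' Ω : Sph d) {f : ℝ → Sph d → ℂ} (hf : IsSmooth fun t => f t Ω) :
    cutoffIntegral Δ N t' ρ' Ω' f Ω =ᶠ[𝓝[>] 0] fun ε =>
      ((Real.cos ρ' ^ (-(Δ - d)) : ℝ) : ℂ) *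
        regGapIntegral (Δ - d) (coneCos ρ' Ω' Ω) (fun τ => f (t' + τ) Ω) N ε := by
  have hs := coneCos_mem h0 h1 Ω' Ω
  have hc := cos_pos_of_bulk h0 h1
  filter_upwards [eventually_cut hs] with ε hε
  unfold cutoffIntegral regGapIntegral
  rw [mul_add, Finset.mul_sum]
  congr 1
  · refine Finset.sum_congr rfl fun j _ => ?_
    rw [taylorCoeff_add j h0 h1 Ω' Ω hf, mul_assoc]
  · unfold cutGapIntegral
    have e : ∀ τ ∈ uIcc (-(Real.arccos (coneCos ρ' Ω' Ω) - ε)) (Real.arccos (coneCos ρ' Ω' Ω) - ε),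
        f (t' + τ) Ω * ((boundarySigma (t' + τ) Ω t' ρ' Ω' ^ (Δ - d) : ℝ) : ℂ) =
        ((Real.cos ρ' ^ (-(Δ - d)) : ℝ) : ℂ) *
          ((((Real.cos τ - coneCos ρ' Ω' Ω) ^ (Δ - d) : ℝ) : ℂ) * f (t' + τ) Ω) := by
      intro τ hτ
      have hpos := cos_sub_pos hs (abs_lt_of_mem_uIcc_cut hε hτ)
      rw [boundarySigma_add, Real.div_rpow hpos.le hc.le, Real.rpow_neg hc.le]
      push_cast
      ring
    rw [← intervalIntegral.integral_const_mul, ← intervalIntegral.integral_congr e,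
      intervalIntegral.integral_comp_add_left
        (fun t => f t Ω * ((boundarySigma t Ω t' ρ' Ω' ^ (Δ - d) : ℝ) : ℂ)) t']
    unfold lightLag coneCos
    congr 1 <;> ring

/-! ### Linearity and bounds -/

theorem deriv_deriv_add {f g : ℝ → ℂ} (hf : IsSmooth f) (hg : IsSmooth g) :
    deriv (deriv fun τ => f τ + g τ) = fun τ => deriv (deriv f) τ + deriv (deriv g) τ := by
  have h1 : deriv (fun τ => f τ + g τ) = fun τ => deriv f τ + deriv g τ := by
    funext τ; exact ((hf.hasDerivAt τ).add (hg.hasDerivAt τ)).deriv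
  rw [h1]
  funext τ
  exact ((hf.deriv.hasDerivAt τ).add (hg.deriv.hasDerivAt τ)).deriv

theorem deriv_deriv_const_mul (c : ℂ) (f : ℝ → ℂ) :
    deriv (deriv fun τ => c * f τ) = fun τ => c * deriv (deriv f) τ := by
  have h1 : deriv (fun τ => c * f τ) = fun τ => c * deriv f τ := by
    funext τ; exact deriv_const_mul_field c
  rw [h1]
  funext τ
  exact deriv_const_mul_field c

theorem gapFun_add {n : ℕ} {l s : ℝ} (hl : -(n + 1) < l) (hs : s ∈ Ioo (-1 : ℝ) 1) {f g : ℝ → ℂ}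
    (hf : IsSmooth f) (hg : IsSmooth g) :
    gapFun n l s (fun τ => f τ + g τ) = gapFun n l s f + gapFun n l s g := by
  induction n generalizing l f g with
  | zero =>
    have h0 := (arccos_mem_Ioo hs).1
    have hl' : -1 < l := by simpa using hl
    simp only [gapFun, cutGapIntegral, sub_zero, mul_add]
    rw [intervalIntegral.integral_add
      (intervalIntegrable_gap_mul hl' hs hf.continuous ⟨le_rfl, by linarith⟩ ⟨by linarith, le_rfl⟩)
      (intervalIntegrable_gap_mul hl' hs hg.continuous ⟨le_rfl, by linarith⟩ ⟨by linarith, le_rfl⟩)]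
    ring
  | succ n ih =>
    push_cast at hl
    simp only [gapFun]
    rw [deriv_deriv_add hf hg, ih (by linarith) hf.deriv.deriv hg.deriv.deriv,
      ih (by linarith) hf hg, ih (by linarith) hf hg]
    ring

theorem gapFun_const_mul (n : ℕ) (l s : ℝ) (c : ℂ) (f : ℝ → ℂ) :
    gapFun n l s (fun τ => c * f τ) = c * gapFun n l s f := by
  induction n generalizing l f with
  | zero =>
    simp only [gapFun, cutGapIntegral, sub_zero]
    simp only [mul_left_comm _ c, intervalIntegral.integral_const_mul]
  | succ n ih =>
    simp only [gapFun]
    rw [deriv_deriv_const_mul, ih, ih, ih]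
    ring

/-- The positive part of the gap. -/
def posGap (s τ : ℝ) : ℝ := max (Real.cos τ - s) 0

theorem posGap_nonneg (s τ : ℝ) : 0 ≤ posGap s τ := le_max_right _ _

theorem posGap_le {s : ℝ} (hs : s ∈ Ioo (-1 : ℝ) 1) (τ : ℝ) : posGap s τ ≤ 2 :=
  max_le (by linarith [Real.cos_le_one τ, hs.1]) zero_le_two

/-- For l > 0 extension by zero is continuous. The limits of integration no longer depend on s, so
continuity in Ω and differentiation in s can take place under the integral. -/
theorem cutGapIntegral_eq_posGap {l : ℝ} (hl : 0 < l) {s : ℝ} (hs : s ∈ Ioo (-1 : ℝ) 1)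
    {f : ℝ → ℂ} (hf : Continuous f) :
    cutGapIntegral l s f 0 = ∫ τ in (-Real.pi)..Real.pi, ((posGap s τ ^ l : ℝ) : ℂ) * f τ := by
  have hcont : Continuous fun τ => ((posGap s τ ^ l : ℝ) : ℂ) * f τ := by
    refine (Complex.continuous_ofReal.comp ?_).mul hf
    exact Continuous.rpow_const (by unfold posGap; fun_prop) fun _ => Or.inr hl.le
  obtain ⟨h0, h1⟩ := arccos_mem_Ioo hs
  set T := Real.arccos s with hT
  have hzero : ∀ τ, T ≤ |τ| → |τ| ≤ Real.pi → ((posGap s τ ^ l : ℝ) : ℂ) * f τ = 0 := by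
    intro τ h2 h3
    rw [posGap, max_eq_right (cos_sub_nonpos hs h2 h3), Real.zero_rpow hl.ne']
    simp
  have e1 : (∫ τ in (-Real.pi)..(-T), ((posGap s τ ^ l : ℝ) : ℂ) * f τ) = 0 := by
    rw [intervalIntegral.integral_congr (g := fun _ => (0 : ℂ)), intervalIntegral.integral_zero]
    intro τ hτ
    rw [uIcc_of_le (by linarith)] at hτ
    refine hzero τ ?_ ?_ <;> rw [abs_of_nonpos (by linarith [hτ.2])] <;> linarith [hτ.1, hτ.2]
  have e2 : (∫ τ in T..Real.pi, ((posGap s τ ^ l : ℝ) : ℂ) * f τ) = 0 := by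
    rw [intervalIntegral.integral_congr (g := fun _ => (0 : ℂ)), intervalIntegral.integral_zero]
    intro τ hτ
    rw [uIcc_of_le (by linarith)] at hτ
    refine hzero τ ?_ ?_ <;> rw [abs_of_nonneg (by linarith [hτ.1])] <;> linarith [hτ.1, hτ.2]
  have hi : ∀ a b, IntervalIntegrable (fun τ => ((posGap s τ ^ l : ℝ) : ℂ) * f τ) volume a b :=
    fun a b => hcont.intervalIntegrable a b
  rw [← intervalIntegral.integral_add_adjacent_intervals (hi _ (-T)) (hi _ _),
    ← intervalIntegral.integral_add_adjacent_intervals (hi (-T) T) (hi _ _), e1, e2, zero_add,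
    add_zero]
  unfold cutGapIntegral
  rw [sub_zero]
  refine intervalIntegral.integral_congr fun τ hτ => ?_
  rw [uIcc_of_le (by linarith)] at hτ
  simp only [posGap, max_eq_left (cos_sub_nonneg hs (abs_le.2 hτ))]

theorem iteratedDeriv_deriv_deriv (k : ℕ) (f : ℝ → ℂ) :
    iteratedDeriv k (deriv (deriv f)) = iteratedDeriv (k + 2) f := by
  rw [← iteratedDeriv_succ', ← iteratedDeriv_succ']

/-- Each step of the recursion costs a factor 1/(1 − s²) and two derivatives, hence the power `n`
and the derivatives of even order. At the bottom the exponent is positive and the integrand bounded.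
The constant does not depend on s. -/
theorem norm_gapFun_le (n : ℕ) {l : ℝ} (hl : 0 < l + n) :
    ∃ C : ℝ, 0 ≤ C ∧ ∀ s ∈ Ioo (-1 : ℝ) 1, ∀ f : ℝ → ℂ, IsSmooth f → ∀ B : ℝ,
      (∀ k ≤ n, ∀ τ : ℝ, |τ| ≤ Real.pi → ‖iteratedDeriv (2 * k) f τ‖ ≤ B) →
      ‖gapFun n l s f‖ ≤ C * ((1 - s ^ 2)⁻¹) ^ n * B := by
  induction n generalizing l with
  | zero =>
    have hl' : 0 < l := by simpa using hl
    refine ⟨|(Real.Gamma (l + 1))⁻¹| * (2 ^ l * (2 * Real.pi)), by positivity, ?_⟩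
    intro s hs f hf B hB
    have hB' : ∀ τ : ℝ, |τ| ≤ Real.pi → ‖f τ‖ ≤ B := fun τ hτ => by
      simpa using hB 0 le_rfl τ hτ
    simp only [gapFun, pow_zero, mul_one]
    rw [cutGapIntegral_eq_posGap hl' hs hf.continuous, norm_mul, Complex.norm_real,
      Real.norm_eq_abs, mul_assoc]
    refine mul_le_mul_of_nonneg_left ?_ (abs_nonneg _)
    have := intervalIntegral.norm_integral_le_of_norm_le_const (a := -Real.pi) (b := Real.pi)
      (f := fun τ => ((posGap s τ ^ l : ℝ) : ℂ) * f τ) (C := 2 ^ l * B) (fun τ hτ => ?_)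
    · refine this.trans (le_of_eq ?_)
      rw [abs_of_pos (by linarith [Real.pi_pos])]; ring
    · rw [uIoc_of_le (by linarith [Real.pi_pos])] at hτ
      rw [norm_mul, Complex.norm_real, Real.norm_eq_abs,
        abs_of_nonneg (Real.rpow_nonneg (posGap_nonneg s τ) l)]
      exact mul_le_mul (Real.rpow_le_rpow (posGap_nonneg s τ) (posGap_le hs τ) hl'.le)
        (hB' τ (abs_le.2 ⟨hτ.1.le, hτ.2⟩)) (norm_nonneg _) (by positivity)
  | succ n ih =>
    push_cast at hl
    obtain ⟨C2, hC2, h2⟩ := ih (l := l + 2) (by linarith)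
    obtain ⟨C1, hC1, h1⟩ := ih (l := l + 1) (by linarith)
    refine ⟨C2 + |2 * l + 3| * C1 + (l + 2) ^ 2 * C2, by positivity, ?_⟩
    intro s hs f hf B hB
    have hsp := one_sub_sq_pos hs
    have b3 := h2 s hs _ hf.deriv.deriv B fun k hk τ hτ => by
      rw [iteratedDeriv_deriv_deriv]; exact hB (k + 1) (by omega) τ hτ
    have b2 := h2 s hs f hf B fun k hk => hB k (by omega)
    have b1 := h1 s hs f hf B fun k hk => hB k (by omega)
    have hs1 : |s| ≤ 1 := abs_le.2 ⟨hs.1.le, hs.2.le⟩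
    have b1nn := (norm_nonneg _).trans b1
    simp only [gapFun]
    rw [norm_mul, Complex.norm_real, Real.norm_eq_abs, abs_of_pos (inv_pos.2 hsp), pow_succ]
    calc _ ≤ (1 - s ^ 2)⁻¹ * (C2 * ((1 - s ^ 2)⁻¹) ^ n * B +
          |2 * l + 3| * (C1 * ((1 - s ^ 2)⁻¹) ^ n * B) +
          (l + 2) ^ 2 * (C2 * ((1 - s ^ 2)⁻¹) ^ n * B)) := by
          refine mul_le_mul_of_nonneg_left ?_ (inv_pos.2 hsp).le
          refine (norm_add_le _ _).trans (add_le_add ((norm_add_le _ _).trans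
            (add_le_add b3 ?_)) ?_)
          · rw [norm_mul, Complex.norm_real, Real.norm_eq_abs, abs_mul]
            refine mul_le_mul ?_ b1 (norm_nonneg _) (abs_nonneg _)
            exact mul_le_of_le_one_right (abs_nonneg _) hs1
          · rw [norm_mul, Complex.norm_real, Real.norm_eq_abs, abs_of_nonneg (sq_nonneg _)]
            exact mul_le_mul_of_nonneg_left b2 (sq_nonneg _)
      _ = _ := by ring

/-! ### Boundary functions -/

instance (d : ℕ) : IsFiniteMeasure (sphereMeasure d) := by
  unfold sphereMeasure; infer_instance

namespace IsBoundaryFunction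

variable {d : ℕ} {f g : ℝ → Sph d → ℂ}

theorem isSmooth (hf : IsBoundaryFunction f) (Ω : Sph d) : IsSmooth fun t => f t Ω := hf.smooth Ω

theorem continuous (hf : IsBoundaryFunction f) : Continuous fun p : ℝ × Sph d => f p.1 p.2 := by
  simpa using hf.continuous_deriv 0

theorem deriv_deriv (hf : IsBoundaryFunction f) :
    IsBoundaryFunction fun t Ω => deriv (deriv fun t => f t Ω) t := by
  refine ⟨fun Ω => (hf.isSmooth Ω).deriv.deriv, fun k => ?_⟩
  simp only [iteratedDeriv_deriv_deriv]
  exact hf.continuous_deriv (k + 2)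

theorem const_mul (hf : IsBoundaryFunction f) {c : Sph d → ℂ} (hc : Continuous c) :
    IsBoundaryFunction fun t Ω => c Ω * f t Ω := by
  refine ⟨fun Ω => contDiff_const.mul (hf.smooth Ω), fun k => ?_⟩
  simp only [iteratedDeriv_const_mul_field]
  exact (hc.comp continuous_snd).mul (hf.continuous_deriv k)

theorem add (hf : IsBoundaryFunction f) (hg : IsBoundaryFunction g) :
    IsBoundaryFunction fun t Ω => f t Ω + g t Ω := by
  refine ⟨fun Ω => (hf.smooth Ω).add (hg.smooth Ω), fun k => ?_⟩
  refine ((hf.continuous_deriv k).add (hg.continuous_deriv k)).congr fun p => ?_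
  exact (iteratedDeriv_fun_add ((hf.smooth p.2).contDiffAt.of_le (by exact_mod_cast le_top))
    ((hg.smooth p.2).contDiffAt.of_le (by exact_mod_cast le_top))).symm

theorem shift (hf : IsBoundaryFunction f) (t' : ℝ) :
    IsBoundaryFunction fun τ Ω => f (t' + τ) Ω := by
  refine ⟨fun Ω => (hf.smooth Ω).comp (contDiff_const.add contDiff_id), fun k => ?_⟩
  have : ∀ Ω : Sph d, iteratedDeriv k (fun τ => f (t' + τ) Ω) =
      fun τ => iteratedDeriv k (fun t => f t Ω) (t' + τ) := fun Ω =>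
    iteratedDeriv_comp_const_add k (fun t => f t Ω) t'
  simp only [this]
  exact (hf.continuous_deriv k).comp (f := fun p : ℝ × Sph d => (t' + p.1, p.2)) (by fun_prop)

end IsBoundaryFunction

theorem continuous_gapFun {d n : ℕ} {l : ℝ} (hl : 0 < l + n) {σ : Sph d → ℝ} (hσ : Continuous σ)
    (hσ' : ∀ Ω, σ Ω ∈ Ioo (-1 : ℝ) 1) {f : ℝ → Sph d → ℂ} (hf : IsBoundaryFunction f) :
    Continuous fun Ω => gapFun n l (σ Ω) fun τ => f τ Ω := by
  induction n generalizing l f with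
  | zero =>
    have hl' : 0 < l := by simpa using hl
    simp only [gapFun]
    have e : ∀ Ω, cutGapIntegral l (σ Ω) (fun τ => f τ Ω) 0 =
        ∫ τ in (-Real.pi)..Real.pi, ((posGap (σ Ω) τ ^ l : ℝ) : ℂ) * f τ Ω := fun Ω =>
      cutGapIntegral_eq_posGap hl' (hσ' Ω) (hf.isSmooth Ω).continuous
    simp only [e]
    refine continuous_const.mul
      (intervalIntegral.continuous_parametric_intervalIntegral_of_continuous' ?_ _ _)
    refine (Complex.continuous_ofReal.comp ?_).mul
      (hf.continuous.comp (f := fun p : Sph d × ℝ => (p.2, p.1)) (by fun_prop))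
    exact Continuous.rpow_const (by unfold posGap; fun_prop) fun _ => Or.inr hl'.le
  | succ n ih =>
    push_cast at hl
    have c3 := ih (l := l + 2) (by linarith) hf.deriv_deriv
    have c2 := ih (l := l + 2) (by linarith) hf
    have c1 := ih (l := l + 1) (by linarith) hf
    have hinv : Continuous fun Ω => (((1 - σ Ω ^ 2)⁻¹ : ℝ) : ℂ) :=
      Complex.continuous_ofReal.comp (Continuous.inv₀ (by fun_prop)
        fun Ω => (one_sub_sq_pos (hσ' Ω)).ne')
    simp only [gapFun]
    exact hinv.mul ((c3.add ((by fun_prop : Continuous fun Ω => (((2 * l + 3) * σ Ω : ℝ) : ℂ)).mul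
      c1)).add (continuous_const.mul c2))

theorem integrable_gapFun {d n : ℕ} {l : ℝ} (hl : 0 < l + n) {σ : Sph d → ℝ} (hσ : Continuous σ)
    (hσ' : ∀ Ω, σ Ω ∈ Ioo (-1 : ℝ) 1) {f : ℝ → Sph d → ℂ} (hf : IsBoundaryFunction f) :
    Integrable (fun Ω => gapFun n l (σ Ω) fun τ => f τ Ω) (sphereMeasure d) :=
  (continuous_gapFun hl hσ hσ' hf).integrable_of_hasCompactSupport
    (HasCompactSupport.of_compactSpace _)

/-! ### Analyticity in the power -/

/-- Dominates the derivative of x^z in z for all z with δ ≤ Re z ≤ 3δ, as on the disc of radius δ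
about a point with real part 2δ. -/
theorem abs_rpow_mul_log_le {x r δ : ℝ} (hx : 0 < x) (hx2 : x ≤ 2) (hδ : 0 < δ) (h1 : δ ≤ r)
    (h2 : r ≤ 3 * δ) : x ^ r * |Real.log x| ≤ 1 / δ + 2 ^ (3 * δ) * 2 := by
  have hp : (0 : ℝ) < 2 ^ (3 * δ) := by positivity
  rcases le_or_gt x 1 with h | h
  · have h3 := Real.abs_log_mul_self_rpow_lt x δ hx h hδ
    rw [abs_mul, abs_of_pos (Real.rpow_pos_of_pos hx δ), mul_comm] at h3
    have h4 : x ^ r ≤ x ^ δ := Real.rpow_le_rpow_of_exponent_ge hx h h1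
    have := mul_le_mul_of_nonneg_right h4 (abs_nonneg (Real.log x))
    linarith
  · have h3 : |Real.log x| ≤ 2 := by
      rw [abs_of_nonneg (Real.log_nonneg h.le)]
      linarith [Real.log_le_sub_one_of_pos hx]
    have h4 : x ^ r ≤ 2 ^ (3 * δ) :=
      (Real.rpow_le_rpow_of_exponent_le h.le h2).trans (Real.rpow_le_rpow hx.le hx2 (by linarith))
    have h5 : 0 < 1 / δ := by positivity
    have := mul_le_mul h4 h3 (abs_nonneg _) hp.le
    linarith

/-- Pass to complex exponents: differentiation under the integral gives a holomorphic function on Re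
z > 0, whose restriction to the reals is analytic. Zeros of φ are harmless since the power vanishes
there for Re z > 0. -/
theorem analyticOnNhd_integral_rpow {X : Type*} [MeasurableSpace X] {μ : Measure X} {φ : X → ℝ}
    (hφ : Measurable φ) (h0 : ∀ x, 0 ≤ φ x) (h2 : ∀ x, φ x ≤ 2) {F : X → ℂ}
    (hF : Integrable F μ) :
    AnalyticOnNhd ℝ (fun l : ℝ => ∫ x, ((φ x ^ l : ℝ) : ℂ) * F x ∂μ) (Ioi 0) := by
  have hm : ∀ z : ℂ, Measurable fun x => (φ x : ℂ) ^ z := fun z =>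
    (Complex.measurable_ofReal.comp hφ).pow_const z
  have hnorm : ∀ (z : ℂ) (x : X), 0 < z.re → ‖(φ x : ℂ) ^ z‖ ≤ 2 ^ z.re := by
    intro z x hz
    rcases (h0 x).eq_or_lt with h | h
    · rw [← h, Complex.ofReal_zero, Complex.zero_cpow (fun h => by simp [h] at hz), norm_zero]
      positivity
    · rw [Complex.norm_cpow_eq_rpow_re_of_pos h]
      exact Real.rpow_le_rpow h.le (h2 x) hz.le
  have hd : DifferentiableOn ℂ (fun z : ℂ => ∫ x, (φ x : ℂ) ^ z * F x ∂μ) {z | 0 < z.re} := by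
    intro z hz
    have hz' : 0 < z.re := hz
    set δ := z.re / 2 with hδ
    have hδ0 : 0 < δ := by positivity
    have hre : ∀ w ∈ Metric.ball z δ, δ ≤ w.re ∧ w.re ≤ 3 * δ := by
      intro w hw
      rw [Metric.mem_ball, Complex.dist_eq] at hw
      have h3 := (Complex.abs_re_le_norm (w - z)).trans_lt hw
      rw [Complex.sub_re, abs_lt] at h3
      constructor <;> linarith [h3.1, h3.2]
    refine (hasDerivAt_integral_of_dominated_loc_of_deriv_le (F := fun z x => (φ x : ℂ) ^ z * F x)
      (F' := fun z x => (φ x : ℂ) ^ z * Complex.log (φ x) * F x)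
      (bound := fun x => (1 / δ + 2 ^ (3 * δ) * 2) * ‖F x‖)
      (Metric.ball_mem_nhds z hδ0) (Eventually.of_forall fun w =>
        (hm w).aestronglyMeasurable.mul hF.aestronglyMeasurable) ?_ ?_ ?_
      (hF.norm.const_mul _) ?_).2.differentiableAt.differentiableWithinAt
    · exact hF.bdd_mul (hm z).aestronglyMeasurable (Eventually.of_forall fun x => hnorm z x hz')
    · exact ((hm z).mul (Complex.measurable_log.comp
        (Complex.measurable_ofReal.comp hφ))).aestronglyMeasurable.mul hF.aestronglyMeasurable
    · refine Eventually.of_forall fun x w hw => ?_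
      have hw' := hre w hw
      rw [norm_mul]
      refine mul_le_mul_of_nonneg_right ?_ (norm_nonneg _)
      rcases (h0 x).eq_or_lt with h | h
      · rw [← h]; simp; positivity
      · rw [norm_mul, Complex.norm_cpow_eq_rpow_re_of_pos h, ← Complex.ofReal_log h.le,
          Complex.norm_real, Real.norm_eq_abs]
        exact abs_rpow_mul_log_le h (h2 x) hδ0 hw'.1 hw'.2
    · refine Eventually.of_forall fun x w hw => ?_
      have hw' := hre w hw
      have := ((hasDerivAt_id w).const_cpow (c := (φ x : ℂ))
        (Or.inr (fun h => by simp only [id] at h; rw [h, Complex.zero_re] at hw'; linarith [hw'.1])))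
      simpa using this.mul_const (F x)
  have ho : IsOpen {z : ℂ | 0 < z.re} := isOpen_lt continuous_const Complex.continuous_re
  intro l hl
  have ha : AnalyticAt ℝ (fun z : ℂ => ∫ x, (φ x : ℂ) ^ z * F x ∂μ) (Complex.ofRealCLM l) :=
    ((hd.analyticOnNhd ho) (l : ℂ) (by simpa using hl)).restrictScalars
  refine (ha.comp (Complex.ofRealCLM.analyticAt l)).congr (Eventually.of_forall fun r => ?_)
  simp only [Function.comp_apply, Complex.ofRealCLM_apply]
  congr 1
  funext x
  rw [Complex.ofReal_cpow (h0 x)]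

theorem analyticAt_inv_Gamma (x : ℝ) : AnalyticAt ℝ (fun x : ℝ => (Real.Gamma x)⁻¹) x := by
  have h1 : AnalyticAt ℝ (fun z : ℂ => (Complex.Gamma z)⁻¹) (Complex.ofRealCLM x) :=
    (Complex.differentiable_one_div_Gamma.analyticAt (x : ℂ)).restrictScalars
  have h2 := (Complex.reCLM.analyticAt _).comp (h1.comp (Complex.ofRealCLM.analyticAt x))
  refine h2.congr (Eventually.of_forall fun r => ?_)
  simp only [Function.comp_apply, Complex.ofRealCLM_apply, Complex.reCLM_apply,
    Complex.Gamma_ofReal, ← Complex.ofReal_inv, Complex.ofReal_re]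

theorem analyticAt_ofReal {f : ℝ → ℝ} {x : ℝ} (hf : AnalyticAt ℝ f x) :
    AnalyticAt ℝ (fun x => (f x : ℂ)) x :=
  (Complex.ofRealCLM.analyticAt (f x)).comp hf

/-- The integral over the sphere of the continued powers of the gap. -/
def sphereGap {d : ℕ} (n : ℕ) (l : ℝ) (σ : Sph d → ℝ) (f : ℝ → Sph d → ℂ) : ℂ :=
  ∫ Ω, gapFun n l (σ Ω) (fun τ => f τ Ω) ∂(sphereMeasure d)

/-- The factors that depend on Ω are absorbed into the boundary function, so only polynomials in `l`
remain outside. An induction over all boundary functions then carries analyticity down to l > −n. -/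
theorem sphereGap_succ {d n : ℕ} {l : ℝ} (hl : 0 < l + (n + 1)) {σ : Sph d → ℝ}
    (hσ : Continuous σ) (hσ' : ∀ Ω, σ Ω ∈ Ioo (-1 : ℝ) 1) {f : ℝ → Sph d → ℂ}
    (hf : IsBoundaryFunction f) :
    sphereGap (n + 1) l σ f =
      sphereGap n (l + 2) σ (fun τ Ω => (((1 - σ Ω ^ 2)⁻¹ : ℝ) : ℂ) *
        deriv (deriv fun t => f t Ω) τ) +
      ((2 * l + 3 : ℝ) : ℂ) * sphereGap n (l + 1) σ (fun τ Ω =>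
        (((1 - σ Ω ^ 2)⁻¹ * σ Ω : ℝ) : ℂ) * f τ Ω) +
      (((l + 2) ^ 2 : ℝ) : ℂ) * sphereGap n (l + 2) σ (fun τ Ω =>
        (((1 - σ Ω ^ 2)⁻¹ : ℝ) : ℂ) * f τ Ω) := by
  have hinv' : Continuous fun Ω => (1 - σ Ω ^ 2)⁻¹ := Continuous.inv₀ (by fun_prop)
        fun Ω => (one_sub_sq_pos (hσ' Ω)).ne'
  have hinv : Continuous fun Ω => (((1 - σ Ω ^ 2)⁻¹ : ℝ) : ℂ) := by fun_prop
  have hinvσ : Continuous fun Ω => (((1 - σ Ω ^ 2)⁻¹ * σ Ω : ℝ) : ℂ) := by fun_prop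
  have i3 := integrable_gapFun (l := l + 2) (n := n) (by linarith) hσ hσ'
    (hf.deriv_deriv.const_mul hinv)
  have i2 := integrable_gapFun (l := l + 2) (n := n) (by linarith) hσ hσ' (hf.const_mul hinv)
  have i1 := integrable_gapFun (l := l + 1) (n := n) (by linarith) hσ hσ' (hf.const_mul hinvσ)
  unfold sphereGap
  have i1' := i1.const_mul ((2 * l + 3 : ℝ) : ℂ)
  have i2' := i2.const_mul (((l + 2) ^ 2 : ℝ) : ℂ)
  rw [← integral_const_mul, ← integral_const_mul, ← integral_add i3 i1']
  refine Eq.trans ?_ (integral_add (i3.add i1') i2')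
  congr 1
  funext Ω
  simp only [gapFun, gapFun_const_mul]
  push_cast
  ring

theorem analyticOnNhd_sphereGap {d : ℕ} (n : ℕ) {σ : Sph d → ℝ} (hσ : Continuous σ)
    (hσ' : ∀ Ω, σ Ω ∈ Ioo (-1 : ℝ) 1) {f : ℝ → Sph d → ℂ} (hf : IsBoundaryFunction f) :
    AnalyticOnNhd ℝ (fun l => sphereGap n l σ f) (Ioi (-(n : ℝ))) := by
  induction n generalizing f with
  | zero =>
    set μ := (sphereMeasure d).prod ((volume : Measure ℝ).restrict (Ioc (-Real.pi) Real.pi)) with hμ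
    have hfc : Continuous fun p : Sph d × ℝ => f p.2 p.1 :=
      hf.continuous.comp (f := fun p : Sph d × ℝ => (p.2, p.1)) (by fun_prop)
    have hF : Integrable (fun p : Sph d × ℝ => f p.2 p.1) μ := by
      have : IntegrableOn (fun p : Sph d × ℝ => f p.2 p.1)
          (univ ×ˢ Icc (-Real.pi) Real.pi) ((sphereMeasure d).prod volume) :=
        hfc.continuousOn.integrableOn_compact (isCompact_univ.prod isCompact_Icc)
      have h2 := this.mono_set (prod_mono_right Ioc_subset_Icc_self)
      rwa [IntegrableOn, ← Measure.prod_restrict, Measure.restrict_univ] at h2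
    have hφ : Continuous fun p : Sph d × ℝ => posGap (σ p.1) p.2 := by unfold posGap; fun_prop
    have hA := analyticOnNhd_integral_rpow hφ.measurable (fun p => posGap_nonneg _ _)
      (fun p => posGap_le (hσ' p.1) _) hF
    intro l hl
    have hl0 : 0 < l := by simpa using hl
    refine ((analyticAt_ofReal ((analyticAt_inv_Gamma (l + 1)).comp_of_eq
      (analyticAt_id.add analyticAt_const) rfl)).mul (hA l hl0)).congr ?_
    filter_upwards [Ioi_mem_nhds hl0] with r hr
    have hr0 : 0 < r := hr
    simp only [sphereGap, gapFun, Function.comp_apply, id, Pi.mul_apply, Pi.add_apply]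
    rw [integral_const_mul]
    congr 1
    rw [integral_prod]
    · congr 1
      funext Ω
      rw [cutGapIntegral_eq_posGap hr0 (hσ' Ω) (hf.isSmooth Ω).continuous,
        intervalIntegral.integral_of_le (by linarith [Real.pi_pos])]
    · refine hF.bdd_mul (c := 2 ^ r) (Complex.measurable_ofReal.comp
        (hφ.measurable.pow_const r)).aestronglyMeasurable (Eventually.of_forall fun p => ?_)
      rw [Complex.norm_real, Real.norm_eq_abs,
        abs_of_nonneg (Real.rpow_nonneg (posGap_nonneg _ _) r)]
      exact Real.rpow_le_rpow (posGap_nonneg _ _) (posGap_le (hσ' p.1) _) hr0.le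
  | succ n ih =>
    have hinv' : Continuous fun Ω => (1 - σ Ω ^ 2)⁻¹ := Continuous.inv₀ (by fun_prop)
        fun Ω => (one_sub_sq_pos (hσ' Ω)).ne'
    have hinv : Continuous fun Ω => (((1 - σ Ω ^ 2)⁻¹ : ℝ) : ℂ) := by fun_prop
    have hinvσ : Continuous fun Ω => (((1 - σ Ω ^ 2)⁻¹ * σ Ω : ℝ) : ℂ) := by fun_prop
    intro l hl
    have hl0 : -((n : ℝ) + 1) < l := by simpa using hl
    have a3 := (ih (hf.deriv_deriv.const_mul hinv) (l + 2)
      (by simp only [mem_Ioi]; linarith)).comp_of_eq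
      (analyticAt_id.add analyticAt_const : AnalyticAt ℝ (fun l : ℝ => l + 2) l) rfl
    have a2 := (ih (hf.const_mul hinv) (l + 2) (by simp only [mem_Ioi]; linarith)).comp_of_eq
      (analyticAt_id.add analyticAt_const : AnalyticAt ℝ (fun l : ℝ => l + 2) l) rfl
    have a1 := (ih (hf.const_mul hinvσ) (l + 1) (by simp only [mem_Ioi]; linarith)).comp_of_eq
      (analyticAt_id.add analyticAt_const : AnalyticAt ℝ (fun l : ℝ => l + 1) l) rfl
    have p1 : AnalyticAt ℝ (fun l : ℝ => ((2 * l + 3 : ℝ) : ℂ)) l :=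
      analyticAt_ofReal ((analyticAt_const.mul analyticAt_id).add analyticAt_const)
    have p2 : AnalyticAt ℝ (fun l : ℝ => (((l + 2) ^ 2 : ℝ) : ℂ)) l :=
      analyticAt_ofReal ((analyticAt_id.add analyticAt_const).pow 2)
    refine ((a3.add (p1.mul a1)).add (p2.mul a2)).congr ?_
    filter_upwards [Ioi_mem_nhds hl0] with r hr
    have hr0 : -((n : ℝ) + 1) < r := hr
    rw [sphereGap_succ (by linarith) hσ hσ' hf]
    simp only [Pi.add_apply, Pi.mul_apply, Function.comp_apply, id]

/-! ### The continued Dirichlet kernel -/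

theorem continuous_coneCos {d : ℕ} (ρ' : ℝ) (Ω' : Sph d) : Continuous (coneCos ρ' Ω') := by
  unfold coneCos; fun_prop

/-- The positive power of the cone function, continued by zero to separations not spacelike. -/
def conePower {d : ℕ} (l t' ρ' : ℝ) (Ω' : Sph d) (t : ℝ) (Ω : Sph d) : ℝ :=
  indicator (Ioo (-Real.arccos (coneCos ρ' Ω' Ω)) (Real.arccos (coneCos ρ' Ω' Ω)))
    (fun τ => ((Real.cos τ - coneCos ρ' Ω' Ω) / Real.cos ρ') ^ l) (t - t')

theorem dirichletKernel_eq {d : ℕ} (ν t' ρ' : ℝ) (Ω' : Sph d) (t : ℝ) (Ω : Sph d) :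
    dirichletKernel d ν t Ω t' ρ' Ω' =
      kernelConst d (weight d ν) * conePower (weight d ν - d) t' ρ' Ω' t Ω := by
  unfold dirichletKernel conePower IsSpacelike
  rw [show lightLag Ω ρ' Ω' = Real.arccos (coneCos ρ' Ω' Ω) from rfl]
  by_cases h : |t - t'| < Real.arccos (coneCos ρ' Ω' Ω)
  · rw [if_pos h, indicator_of_mem (mem_Ioo.2 (abs_lt.1 h))]
    rfl
  · rw [if_neg h, indicator_of_notMem (fun h' => h (abs_lt.2 (mem_Ioo.1 h'))), mul_zero]

theorem conePower_nonneg {d : ℕ} (l t' : ℝ) {ρ' : ℝ} (h0 : 0 ≤ ρ') (h1 : ρ' < Real.pi / 2)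
    (Ω' : Sph d) (t : ℝ) (Ω : Sph d) : 0 ≤ conePower l t' ρ' Ω' t Ω := by
  unfold conePower
  refine indicator_apply_nonneg fun h => Real.rpow_nonneg (div_nonneg ?_
    (cos_pos_of_bulk h0 h1).le) l
  exact cos_sub_nonneg (coneCos_mem h0 h1 Ω' Ω) (abs_le.2 ⟨h.1.le, h.2.le⟩)

theorem measurable_conePower {d : ℕ} (l t' ρ' : ℝ) (Ω' : Sph d) :
    Measurable fun p : ℝ × Sph d => conePower l t' ρ' Ω' p.1 p.2 := by
  have hc : Continuous fun p : ℝ × Sph d => coneCos ρ' Ω' p.2 :=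
    (continuous_coneCos ρ' Ω').comp continuous_snd
  have hT : Continuous fun p : ℝ × Sph d => Real.arccos (coneCos ρ' Ω' p.2) :=
    Real.continuous_arccos.comp hc
  have hset : MeasurableSet {p : ℝ × Sph d | p.1 - t' ∈
      Ioo (-Real.arccos (coneCos ρ' Ω' p.2)) (Real.arccos (coneCos ρ' Ω' p.2))} :=
    ((isOpen_lt hT.neg (by fun_prop : Continuous fun p : ℝ × Sph d => p.1 - t')).inter
      (isOpen_lt (by fun_prop : Continuous fun p : ℝ × Sph d => p.1 - t') hT)).measurableSet
  have hg : Measurable fun p : ℝ × Sph d =>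
      ((Real.cos (p.1 - t') - coneCos ρ' Ω' p.2) / Real.cos ρ') ^ l :=
    ((by fun_prop : Continuous fun p : ℝ × Sph d =>
      (Real.cos (p.1 - t') - coneCos ρ' Ω' p.2) / Real.cos ρ').measurable).pow_const l
  exact hg.indicator hset

theorem integrable_conePower_mul {d : ℕ} {l : ℝ} (hl : -1 < l) (t' : ℝ) {ρ' : ℝ} (h0 : 0 ≤ ρ')
    (h1 : ρ' < Real.pi / 2) (Ω' Ω : Sph d) {f : ℝ → ℂ} (hf : Continuous f) :
    Integrable (fun t => (conePower l t' ρ' Ω' t Ω : ℂ) * f t) ∧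
    ∫ t, (conePower l t' ρ' Ω' t Ω : ℂ) * f t = ((Real.cos ρ' ^ (-l) : ℝ) : ℂ) *
      cutGapIntegral l (coneCos ρ' Ω' Ω) (fun τ => f (t' + τ)) 0 := by
  have hs := coneCos_mem h0 h1 Ω' Ω
  have hc := cos_pos_of_bulk h0 h1
  set s := coneCos ρ' Ω' Ω with hsdef
  have hT0 := (arccos_mem_Ioo hs).1
  set T := Real.arccos s with hT
  have hf' : Continuous fun τ => f (t' + τ) := by fun_prop
  have hi := (intervalIntegrable_gap_mul hl hs hf' (a := -T) (b := T) ⟨le_rfl, by linarith⟩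
    ⟨by linarith, le_rfl⟩).const_mul ((Real.cos ρ' ^ (-l) : ℝ) : ℂ)
  have e : (fun τ => (conePower l t' ρ' Ω' (t' + τ) Ω : ℂ) * f (t' + τ)) =
      indicator (Ioo (-T) T) fun τ => ((Real.cos ρ' ^ (-l) : ℝ) : ℂ) *
        ((((Real.cos τ - s) ^ l : ℝ) : ℂ) * f (t' + τ)) := by
    funext τ
    unfold conePower
    rw [add_sub_cancel_left, ← hsdef, ← hT]
    by_cases h : τ ∈ Ioo (-T) T
    · rw [indicator_of_mem h, indicator_of_mem h,
        Real.div_rpow (cos_sub_nonneg hs (abs_le.2 ⟨h.1.le, h.2.le⟩)) hc.le, Real.rpow_neg hc.le]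
      push_cast
      ring
    · rw [indicator_of_notMem h, indicator_of_notMem h, Complex.ofReal_zero, zero_mul]
  have hI : Integrable fun τ => (conePower l t' ρ' Ω' (t' + τ) Ω : ℂ) * f (t' + τ) := by
    rw [e, integrable_indicator_iff measurableSet_Ioo]
    exact (intervalIntegrable_iff_integrableOn_Ioo_of_le (by linarith)).1 hi
  refine ⟨by simpa using hI.comp_add_left (-t'), ?_⟩
  rw [← integral_add_left_eq_self _ t', e, integral_indicator measurableSet_Ioo,
    ← integral_Ioc_eq_integral_Ioo, ← intervalIntegral.integral_of_le (by linarith),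
    intervalIntegral.integral_const_mul]
  unfold cutGapIntegral
  rw [sub_zero]

theorem isBoundaryFunction_one (d : ℕ) : IsBoundaryFunction fun (_ : ℝ) (_ : Sph d) => (1 : ℂ) := by
  refine ⟨fun _ => contDiff_const, fun k => ?_⟩
  simp only [iteratedDeriv_const]
  split_ifs <;> exact continuous_const

theorem cutGapIntegral_eq_gapFun (n : ℕ) {l s : ℝ} (hl : -1 < l) (hs : s ∈ Ioo (-1 : ℝ) 1)
    {f : ℝ → ℂ} (hf : IsSmooth f) :
    cutGapIntegral l s f 0 = (Real.Gamma (l + 1) : ℂ) * gapFun n l s f := by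
  have hG : (Real.Gamma (l + 1) : ℂ) ≠ 0 := by
    exact_mod_cast (Real.Gamma_pos_of_pos (by linarith : 0 < l + 1)).ne'
  rw [gapFun_eq_of_le (Nat.zero_le n) (by simpa using hl) hs hf, gapFun, Complex.ofReal_inv,
    mul_inv_cancel_left₀ hG]

/-- On the support |t − t'| < π the function f is bounded by compactness. The time integral of the
power itself is the functional of the constant 1, which depends continuously on Ω. -/
theorem integrable_conePower_prod {d : ℕ} {l : ℝ} (hl : -1 < l) (t' : ℝ) {ρ' : ℝ} (h0 : 0 ≤ ρ')
    (h1 : ρ' < Real.pi / 2) (Ω' : Sph d) {f : ℝ → Sph d → ℂ} (hf : IsBoundaryFunction f) :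
    Integrable (fun p : ℝ × Sph d => (conePower l t' ρ' Ω' p.1 p.2 : ℂ) * f p.1 p.2)
      ((volume : Measure ℝ).prod (sphereMeasure d)) := by
  have hmeas : AEStronglyMeasurable
      (fun p : ℝ × Sph d => (conePower l t' ρ' Ω' p.1 p.2 : ℂ) * f p.1 p.2)
      ((volume : Measure ℝ).prod (sphereMeasure d)) :=
    (Complex.measurable_ofReal.comp (measurable_conePower l t' ρ' Ω')).aestronglyMeasurable.mul
      hf.continuous.aestronglyMeasurable
  rw [integrable_prod_iff' hmeas]
  refine ⟨Eventually.of_forall fun Ω =>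
    (integrable_conePower_mul hl t' h0 h1 Ω' Ω (hf.isSmooth Ω).continuous).1, ?_⟩
  obtain ⟨B, hB⟩ := (isCompact_Icc.prod (isCompact_univ (X := Sph d))).exists_bound_of_continuousOn
    (s := Icc (t' - Real.pi) (t' + Real.pi) ×ˢ (univ : Set (Sph d))) hf.continuous.continuousOn
  obtain ⟨n, hn⟩ := exists_nat_gt (-l)
  have hg := ((integrable_gapFun (l := l) (n := n) (by linarith) (continuous_coneCos ρ' Ω')
    (coneCos_mem h0 h1 Ω') (isBoundaryFunction_one d)).const_mul
    (((Real.cos ρ' ^ (-l) : ℝ) : ℂ) * (Real.Gamma (l + 1) : ℂ))).norm.const_mul B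
  refine Integrable.mono' hg hmeas.norm.prod_swap.integral_prod_right'
    (Eventually.of_forall fun Ω => ?_)
  have h2 := integrable_conePower_mul hl t' h0 h1 Ω' Ω (continuous_const (y := (1 : ℂ)))
  have h3 : (∫ t, ‖(conePower l t' ρ' Ω' t Ω : ℂ) * f t Ω‖) ≤
      ∫ t, B * conePower l t' ρ' Ω' t Ω := by
    have h4 : Integrable fun t => conePower l t' ρ' Ω' t Ω := by
      simpa using h2.1.re
    refine integral_mono
      (integrable_conePower_mul hl t' h0 h1 Ω' Ω (hf.isSmooth Ω).continuous).1.norm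
      (h4.const_mul B) fun t => ?_
    simp only [norm_mul, Complex.norm_real, Real.norm_eq_abs,
      abs_of_nonneg (conePower_nonneg l t' h0 h1 Ω' t Ω)]
    by_cases h : t - t' ∈ Ioo (-Real.arccos (coneCos ρ' Ω' Ω)) (Real.arccos (coneCos ρ' Ω' Ω))
    · rw [mul_comm]
      refine mul_le_mul_of_nonneg_right (hB (t, Ω) ⟨⟨?_, ?_⟩, mem_univ _⟩)
        (conePower_nonneg l t' h0 h1 Ω' t Ω)
      · linarith [h.1, Real.arccos_le_pi (coneCos ρ' Ω' Ω)]
      · linarith [h.2, Real.arccos_le_pi (coneCos ρ' Ω' Ω)]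
    · unfold conePower
      rw [indicator_of_notMem h]; simp
  have h5 : (∫ t, conePower l t' ρ' Ω' t Ω) ≤ ‖((Real.cos ρ' ^ (-l) : ℝ) : ℂ) *
      (Real.Gamma (l + 1) : ℂ) * gapFun n l (coneCos ρ' Ω' Ω) fun _ => 1‖ := by
    rw [mul_assoc, ← cutGapIntegral_eq_gapFun n hl (coneCos_mem h0 h1 Ω' Ω) contDiff_const, ← h2.2]
    simp only [mul_one]
    rw [integral_complex_ofReal, Complex.norm_real]
    exact le_abs_self _
  have hB0 : 0 ≤ B := (norm_nonneg _).trans (hB (t', Ω)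
    ⟨⟨by linarith [Real.pi_pos], by linarith [Real.pi_pos]⟩, mem_univ _⟩)
  rw [Real.norm_eq_abs, abs_of_nonneg (integral_nonneg fun _ => norm_nonneg _)]
  refine h3.trans ?_
  rw [integral_const_mul]
  exact mul_le_mul_of_nonneg_left h5 hB0

/-- The constant `C(Δ₊) Γ(ν - d / 2 + 1)`. -/
def kernelScale (d : ℕ) (ν : ℝ) : ℝ :=
  (-1) ^ ((d - 1) / 2) * 2 ^ (ν - d / 2 - 1) * Real.Gamma (ν + 1) / Real.pi ^ ((d : ℝ) / 2)

theorem weight_sub (d : ℕ) (ν : ℝ) : weight d ν - d = ν - d / 2 := by unfold weight; ring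

theorem kernelConst_weight (d : ℕ) (ν : ℝ) :
    kernelConst d (weight d ν) = kernelScale d ν * (Real.Gamma (ν - d / 2 + 1))⁻¹ := by
  unfold kernelConst kernelScale
  rw [weight_sub, show weight d ν - d / 2 + 1 = ν + 1 by unfold weight; ring]
  field_simp

/-- The continued Dirichlet kernel. -/
def contKernel (d : ℕ) : KernelFamily d := fun ν t' ρ' Ω' f =>
  ((kernelScale d ν * Real.cos ρ' ^ (-(ν - d / 2)) : ℝ) : ℂ) *
    sphereGap (d + 2) (ν - d / 2) (coneCos ρ' Ω') fun τ Ω => f (t' + τ) Ω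

theorem analyticAt_const_rpow {a : ℝ} (ha : 0 < a) {g : ℝ → ℝ} {x : ℝ} (hg : AnalyticAt ℝ g x) :
    AnalyticAt ℝ (fun x => a ^ g x) x := by
  have : (fun x => a ^ g x) = Real.exp ∘ fun x => Real.log a * g x := by
    funext y; simp [Real.rpow_def_of_pos ha]
  rw [this]
  exact (analyticAt_const.mul hg).rexp

theorem analyticAt_kernelScale (d : ℕ) {ν : ℝ} (hν : -1 < ν) : AnalyticAt ℝ (kernelScale d) ν := by
  have hG : AnalyticAt ℝ (fun ν : ℝ => Real.Gamma (ν + 1)) ν := by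
    have := ((analyticAt_inv_Gamma (ν + 1)).comp_of_eq
      (analyticAt_id.add analyticAt_const : AnalyticAt ℝ (fun x : ℝ => x + 1) ν) rfl).inv
      (by simpa using (Real.Gamma_pos_of_pos (by linarith : 0 < ν + 1)).ne')
    refine this.congr (Eventually.of_forall fun r => ?_)
    simp
  unfold kernelScale
  exact ((analyticAt_const.mul (analyticAt_const_rpow two_pos
    ((analyticAt_id.sub analyticAt_const).sub analyticAt_const))).mul hG).div analyticAt_const
    (Real.rpow_pos_of_pos Real.pi_pos _).ne'

/-- Depth d + 2 suffices for all ν > −1 at once, since then ν − d/2 + d + 2 > 0. The bound −1 is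
forced by the factor Γ(ν + 1) in `kernelScale`. -/
theorem analyticOnNhd_contKernel (d : ℕ) (t' : ℝ) {ρ' : ℝ} (h0 : 0 ≤ ρ') (h1 : ρ' < Real.pi / 2)
    (Ω' : Sph d) {f : ℝ → Sph d → ℂ} (hf : IsBoundaryFunction f) :
    AnalyticOnNhd ℝ (fun ν => contKernel d ν t' ρ' Ω' f) (Ioi (-1)) := by
  intro ν hν
  have hν' : -1 < ν := hν
  have hg := (analyticOnNhd_sphereGap (d + 2) (continuous_coneCos ρ' Ω') (coneCos_mem h0 h1 Ω')
    (hf.shift t') (ν - d / 2) (by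
      have : (0 : ℝ) ≤ d := by positivity
      rw [mem_Ioi]; push_cast; linarith)).comp_of_eq
    (analyticAt_id.sub analyticAt_const : AnalyticAt ℝ (fun x : ℝ => x - d / 2) ν) rfl
  exact (analyticAt_ofReal ((analyticAt_kernelScale d hν').mul
    (analyticAt_const_rpow (cos_pos_of_bulk h0 h1)
      (analyticAt_id.sub analyticAt_const).neg))).mul hg

/-- Here the exponent exceeds −1, so Fubini applies and the recursion gives the plain integral. The
Γ(ν − d/2 + 1) of the functional cancels the inverse one in the constant. -/
theorem contKernel_eq_integral {d : ℕ} {ν : ℝ} (hν : (d : ℝ) / 2 - 1 < ν) (t' : ℝ) {ρ' : ℝ}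
    (h0 : 0 ≤ ρ') (h1 : ρ' < Real.pi / 2) (Ω' : Sph d) {f : ℝ → Sph d → ℂ}
    (hf : IsBoundaryFunction f) :
    Integrable (fun p : ℝ × Sph d => ((dirichletKernel d ν p.1 p.2 t' ρ' Ω' : ℝ) : ℂ) * f p.1 p.2)
      ((volume : Measure ℝ).prod (sphereMeasure d)) ∧
    contKernel d ν t' ρ' Ω' f = ∫ p : ℝ × Sph d,
      ((dirichletKernel d ν p.1 p.2 t' ρ' Ω' : ℝ) : ℂ) * f p.1 p.2
        ∂((volume : Measure ℝ).prod (sphereMeasure d)) := by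
  have hl : -1 < ν - d / 2 := by linarith
  have hI := integrable_conePower_prod hl t' h0 h1 Ω' hf
  simp only [dirichletKernel_eq, weight_sub, Complex.ofReal_mul, mul_assoc]
  refine ⟨hI.const_mul _, ?_⟩
  rw [integral_const_mul, integral_prod_symm _ hI]
  have e : ∀ Ω, (∫ t, (conePower (ν - d / 2) t' ρ' Ω' t Ω : ℂ) * f t Ω) =
      (((Real.cos ρ' ^ (-(ν - d / 2)) : ℝ) : ℂ) * (Real.Gamma (ν - d / 2 + 1) : ℂ)) *
        gapFun (d + 2) (ν - d / 2) (coneCos ρ' Ω' Ω) fun τ => f (t' + τ) Ω := fun Ω => by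
    rw [(integrable_conePower_mul hl t' h0 h1 Ω' Ω (hf.isSmooth Ω).continuous).2,
      cutGapIntegral_eq_gapFun (d + 2) hl (coneCos_mem h0 h1 Ω' Ω) ((hf.shift t').isSmooth Ω),
      mul_assoc]
  simp only [e]
  rw [integral_const_mul, kernelConst_weight]
  have hG : (Real.Gamma (ν - d / 2 + 1) : ℂ) ≠ 0 := by
    exact_mod_cast (Real.Gamma_pos_of_pos (by linarith : 0 < ν - d / 2 + 1)).ne'
  unfold contKernel sphereGap
  generalize Real.Gamma (ν - d / 2 + 1) = G at hG ⊢
  simp only [Complex.ofReal_mul, Complex.ofReal_inv]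
  linear_combination (-(kernelScale d ν : ℂ) * ((Real.cos ρ' ^ (-(ν - d / 2)) : ℝ) : ℂ) *
    ∫ Ω, gapFun (d + 2) (ν - d / 2) (coneCos ρ' Ω' Ω) (fun τ => f (t' + τ) Ω)
      ∂(sphereMeasure d)) * mul_inv_cancel₀ hG

theorem isContinuedDirichletKernel_contKernel (d : ℕ) :
    IsContinuedDirichletKernel d (contKernel d) := fun t' _ Ω' h0 h1 _ hf =>
  ⟨analyticOnNhd_contKernel d t' h0 h1 Ω' hf,
    fun _ hν => (contKernel_eq_integral hν t' h0 h1 Ω' hf).2⟩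

/-- The identity theorem on the half-line, started near d/2, where both families are the same
integral. Every assertion about an arbitrary family thus reduces to `contKernel`. -/
theorem IsContinuedDirichletKernel.eq {d : ℕ} {K₁ K₂ : KernelFamily d}
    (hK₁ : IsContinuedDirichletKernel d K₁) (hK₂ : IsContinuedDirichletKernel d K₂) {ν : ℝ}
    (hν : -1 < ν) (t' : ℝ) {ρ' : ℝ} (h0 : 0 ≤ ρ') (h1 : ρ' < Real.pi / 2) (Ω' : Sph d)
    {f : ℝ → Sph d → ℂ} (hf : IsBoundaryFunction f) :
    K₁ ν t' ρ' Ω' f = K₂ ν t' ρ' Ω' f := by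
  obtain ⟨a1, e1⟩ := hK₁ t' ρ' Ω' h0 h1 f hf
  obtain ⟨a2, e2⟩ := hK₂ t' ρ' Ω' h0 h1 f hf
  have hd : (0 : ℝ) ≤ d := by positivity
  refine a1.eqOn_of_preconnected_of_eventuallyEq a2 isPreconnected_Ioi
    (z₀ := (d : ℝ) / 2) (by rw [mem_Ioi]; linarith) ?_ hν
  filter_upwards [Ioi_mem_nhds (by linarith : (d : ℝ) / 2 - 1 < (d : ℝ) / 2)] with μ hμ
  rw [e1 μ hμ, e2 μ hμ]

/-- For large ν the integrand vanishes identically, and analytic continuation of zero is zero: the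
support does not grow. -/
theorem IsContinuedDirichletKernel.eq_zero {d : ℕ} {K : KernelFamily d}
    (hK : IsContinuedDirichletKernel d K) (t' : ℝ) {ρ' : ℝ} (h0 : 0 ≤ ρ')
    (h1 : ρ' < Real.pi / 2) (Ω' : Sph d) {f : ℝ → Sph d → ℂ} (hf : IsBoundaryFunction f)
    (h : ∀ (t : ℝ) (Ω : Sph d), IsSpacelike t Ω t' ρ' Ω' → f t Ω = 0) {ν : ℝ} (hν : -1 < ν) :
    K ν t' ρ' Ω' f = 0 := by
  obtain ⟨a1, e1⟩ := hK t' ρ' Ω' h0 h1 f hf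
  have hd : (0 : ℝ) ≤ d := by positivity
  refine a1.eqOn_of_preconnected_of_eventuallyEq
    (analyticOnNhd_const : AnalyticOnNhd ℝ (fun _ : ℝ => (0 : ℂ)) (Ioi (-1))) isPreconnected_Ioi
    (z₀ := (d : ℝ) / 2) (by rw [mem_Ioi]; linarith) ?_ hν
  filter_upwards [Ioi_mem_nhds (by linarith : (d : ℝ) / 2 - 1 < (d : ℝ) / 2)] with μ hμ
  rw [e1 μ hμ]
  refine integral_eq_zero_of_ae (Eventually.of_forall fun p => ?_)
  simp only [Pi.zero_apply]
  by_cases hp : IsSpacelike p.1 p.2 t' ρ' Ω'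
  · rw [h _ _ hp, mul_zero]
  · unfold dirichletKernel
    rw [if_neg hp, Complex.ofReal_zero, zero_mul]

theorem isRegulatedIntegral_contKernel {d : ℕ} {ν : ℝ} (hν : -1 < ν) {N : ℕ}
    (hN : -1 < ν - d / 2 + N) (hl : ∀ j : ℕ, ν - d / 2 + 1 + (j : ℝ) ≠ 0) (t' : ℝ) {ρ' : ℝ}
    (h0 : 0 ≤ ρ') (h1 : ρ' < Real.pi / 2) (Ω' : Sph d) {f : ℝ → Sph d → ℂ}
    (hf : IsBoundaryFunction f) :
    IsRegulatedIntegral (weight d ν) N t' ρ' Ω' f (contKernel d ν t' ρ' Ω' f) := by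
  have hd : (0 : ℝ) ≤ d := by positivity
  refine ⟨fun Ω => ((Real.cos ρ' ^ (-(ν - d / 2)) : ℝ) : ℂ) *
    ((Real.Gamma (ν - d / 2 + 1) : ℂ) *
      gapFun (d + 2) (ν - d / 2) (coneCos ρ' Ω' Ω) fun τ => f (t' + τ) Ω), fun Ω => ?_, ?_, ?_⟩
  · refine Tendsto.congr' (cutoffIntegral_eventuallyEq (weight d ν) N t' h0 h1 Ω' Ω
      (hf.isSmooth Ω)).symm ?_
    rw [weight_sub]
    refine Tendsto.const_mul _ ?_
    exact tendsto_regGapIntegral (coneCos_mem h0 h1 Ω' Ω) ((hf.shift t').isSmooth Ω)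
      (by push_cast; linarith) hN hl
  · exact ((integrable_gapFun (by push_cast; linarith) (continuous_coneCos ρ' Ω')
      (coneCos_mem h0 h1 Ω') (hf.shift t')).const_mul _).const_mul _
  · rw [integral_const_mul, integral_const_mul, kernelConst_weight]
    have hG : Real.Gamma (ν - d / 2 + 1) ≠ 0 :=
      Real.Gamma_ne_zero fun m hm => hl m (by rw [hm]; ring)
    have hG' : (Real.Gamma (ν - d / 2 + 1) : ℂ) ≠ 0 := by exact_mod_cast hG
    unfold contKernel sphereGap
    generalize Real.Gamma (ν - d / 2 + 1) = G at hG' ⊢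
    simp only [Complex.ofReal_mul, Complex.ofReal_inv]
    linear_combination (-(kernelScale d ν : ℂ) * ((Real.cos ρ' ^ (-(ν - d / 2)) : ℝ) : ℂ) *
      ∫ Ω, gapFun (d + 2) (ν - d / 2) (coneCos ρ' Ω' Ω) (fun τ => f (t' + τ) Ω)
        ∂(sphereMeasure d)) * mul_inv_cancel₀ hG'

/-- With d = 2m + 1 the exponent is ν − m − 1/2. So m terms raise it to ν − 1/2 > −1, and the
denominators with j ≥ m are positive anyway. -/
theorem isRegulatedIntegral_dirichlet {d : ℕ} (hd : Odd d) {K : KernelFamily d}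
    (hK : IsContinuedDirichletKernel d K) (t' : ℝ) {ρ' : ℝ}
    (h0 : 0 ≤ ρ') (h1 : ρ' < Real.pi / 2) (Ω' : Sph d) {f : ℝ → Sph d → ℂ}
    (hf : IsBoundaryFunction f) {ν : ℝ} (hν : 0 < ν)
    (hne : ∀ j < (d - 1) / 2, weight d ν - d + 1 + (j : ℝ) ≠ 0) :
    IsRegulatedIntegral (weight d ν) ((d - 1) / 2) t' ρ' Ω' f (K ν t' ρ' Ω' f) := by
  rw [hK.eq (isContinuedDirichletKernel_contKernel d) (by linarith) t' h0 h1 Ω' hf]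
  obtain ⟨m, rfl⟩ := hd
  rw [weight_sub] at hne
  rw [show (2 * m + 1 - 1) / 2 = m by omega] at hne ⊢
  push_cast at hne
  refine isRegulatedIntegral_contKernel (by linarith) (by push_cast; linarith) (fun j => ?_)
    t' h0 h1 Ω' hf
  push_cast
  rcases lt_or_ge j m with h | h
  · exact hne j h
  · have : (m : ℝ) ≤ j := by exact_mod_cast h
    linarith

/-- With d = 2m + 1 the exponent is −ν − m − 1/2, and m + 1 terms raise it to 1/2 − ν > −1. A
denominator vanishes only if ν − 1/2 is the integer j − m, which for 0 < ν < 1 means ν = 1/2. -/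
theorem isRegulatedIntegral_neumann {d : ℕ} (hd : Odd d) {K : KernelFamily d}
    (hK : IsContinuedDirichletKernel d K) (t' : ℝ) {ρ' : ℝ}
    (h0 : 0 ≤ ρ') (h1 : ρ' < Real.pi / 2) (Ω' : Sph d) {f : ℝ → Sph d → ℂ}
    (hf : IsBoundaryFunction f) {ν : ℝ} (hν : 0 < ν) (hν1 : ν < 1) (hν2 : ν ≠ 1 / 2) {N : ℕ}
    (hN : (d - 1) / 2 + 1 ≤ N) :
    IsRegulatedIntegral (weight d (-ν)) N t' ρ' Ω' f (K (-ν) t' ρ' Ω' f) := by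
  rw [hK.eq (isContinuedDirichletKernel_contKernel d) (by linarith) t' h0 h1 Ω' hf]
  obtain ⟨m, rfl⟩ := hd
  rw [show (2 * m + 1 - 1) / 2 = m by omega] at hN
  have hN' : (m : ℝ) + 1 ≤ N := by exact_mod_cast hN
  refine isRegulatedIntegral_contKernel (by linarith) (by push_cast; linarith) (fun j h => ?_)
    t' h0 h1 Ω' hf
  push_cast at h
  have h3 : ν = 1 / 2 + ((j : ℤ) - (m : ℤ) : ℤ) := by push_cast; linarith
  have h4 : ((0 : ℤ) : ℝ) - 1 < (((j : ℤ) - (m : ℤ) : ℤ) : ℝ) := by push_cast at h3 ⊢; linarith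
  have h5 : (((j : ℤ) - (m : ℤ) : ℤ) : ℝ) < 1 := by push_cast at h3 ⊢; linarith
  have h6 : (j : ℤ) - (m : ℤ) < 1 := by exact_mod_cast h5
  have h7 : (0 : ℤ) - 1 < (j : ℤ) - (m : ℤ) := by exact_mod_cast h4
  have h8 : (j : ℤ) - (m : ℤ) = 0 := by omega
  rw [h8] at h3
  exact hν2 (by simpa using h3)

/-! ### The continued powers of the gap on exponentials -/

/-- The exponential of frequency `ω`. -/
def expMode (ω τ : ℝ) : ℂ := Complex.exp (-Complex.I * (ω : ℂ) * (τ : ℂ))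

theorem isSmooth_expMode (ω : ℝ) : IsSmooth (expMode ω) := by
  unfold expMode
  exact (contDiff_const.mul Complex.ofRealCLM.contDiff).cexp

theorem hasDerivAt_expMode (ω τ : ℝ) :
    HasDerivAt (expMode ω) (-Complex.I * ω * expMode ω τ) τ := by
  have h : HasDerivAt (fun τ : ℝ => -Complex.I * (ω : ℂ) * (τ : ℂ)) (-Complex.I * ω * 1) τ :=
    (Complex.ofRealCLM.hasDerivAt (x := τ)).const_mul _
  exact h.cexp.congr_deriv (by unfold expMode; ring)

theorem iteratedDeriv_expMode (k : ℕ) (ω : ℝ) :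
    iteratedDeriv k (expMode ω) = fun τ => (-Complex.I * ω) ^ k * expMode ω τ := by
  induction k with
  | zero => simp
  | succ k ih =>
    rw [iteratedDeriv_succ, ih]
    funext τ
    rw [((hasDerivAt_expMode ω τ).const_mul _).deriv]
    ring

theorem deriv_deriv_expMode (ω : ℝ) :
    deriv (deriv (expMode ω)) = fun τ => -((ω ^ 2 : ℝ) : ℂ) * expMode ω τ := by
  have h := iteratedDeriv_expMode 2 ω
  rw [iteratedDeriv_succ, iteratedDeriv_one] at h
  rw [h]
  funext τ
  rw [mul_pow, neg_sq, Complex.I_sq]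
  push_cast
  ring

theorem norm_expMode (ω τ : ℝ) : ‖expMode ω τ‖ = 1 := by
  unfold expMode
  rw [show -Complex.I * (ω : ℂ) * (τ : ℂ) = ((-(ω * τ) : ℝ) : ℂ) * Complex.I by push_cast; ring]
  exact Complex.norm_exp_ofReal_mul_I _

theorem expMode_zero (τ : ℝ) : expMode 0 τ = 1 := by simp [expMode]

theorem expMode_add (ω t τ : ℝ) : expMode ω (t + τ) = expMode ω t * expMode ω τ := by
  unfold expMode
  rw [← Complex.exp_add]
  congr 1
  push_cast; ring

/-- The continued power `l` of the gap on the exponential of frequency `ω`. -/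
def modeGap (ω l s : ℝ) : ℂ := gapFun ⌈-l⌉₊ l s (expMode ω)

theorem modeGap_eq {n : ℕ} {l s : ℝ} (hl : -(n + 1) < l) (hs : s ∈ Ioo (-1 : ℝ) 1) (ω : ℝ) :
    modeGap ω l s = gapFun n l s (expMode ω) := by
  have h := Nat.le_ceil (-l)
  unfold modeGap
  rw [← gapFun_eq_of_le (le_max_left n ⌈-l⌉₊) hl hs (isSmooth_expMode ω),
    ← gapFun_eq_of_le (le_max_right n ⌈-l⌉₊) (by linarith) hs (isSmooth_expMode ω)]

/-- On an exponential the second time derivative is multiplication by −ω², so the recursion closes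
at fixed frequency. -/
theorem modeGap_lower (ω l : ℝ) {s : ℝ} (hs : s ∈ Ioo (-1 : ℝ) 1) :
    modeGap ω l s = ((1 - s ^ 2)⁻¹ : ℝ) * ((((l + 2) ^ 2 - ω ^ 2 : ℝ) : ℂ) * modeGap ω (l + 2) s +
      (((2 * l + 3) * s : ℝ) : ℂ) * modeGap ω (l + 1) s) := by
  obtain ⟨n, hn⟩ := exists_nat_gt (-l)
  rw [modeGap_eq (n := n + 1) (by push_cast; linarith) hs,
    modeGap_eq (n := n) (by linarith) hs, modeGap_eq (n := n) (by linarith) hs, gapFun,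
    deriv_deriv_expMode, gapFun_const_mul]
  push_cast
  ring

theorem modeGap_eq_integral {l : ℝ} (hl : 0 < l) {s : ℝ} (hs : s ∈ Ioo (-1 : ℝ) 1) (ω : ℝ) :
    modeGap ω l s = ((Real.Gamma (l + 1))⁻¹ : ℝ) *
      ∫ τ in (-Real.pi)..Real.pi, ((posGap s τ ^ l : ℝ) : ℂ) * expMode ω τ := by
  rw [modeGap_eq (n := 0) (by push_cast; linarith) hs, gapFun,
    cutGapIntegral_eq_posGap hl hs (isSmooth_expMode ω).continuous]

theorem hasDerivAt_max_zero_rpow {l : ℝ} (hl : 1 < l) (x : ℝ) :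
    HasDerivAt (fun x : ℝ => max x 0 ^ l) (l * max x 0 ^ (l - 1)) x := by
  rcases lt_trichotomy x 0 with h | rfl | h
  · rw [max_eq_right h.le, Real.zero_rpow (by linarith), mul_zero]
    refine (hasDerivAt_const x (0 : ℝ)).congr_of_eventuallyEq ?_
    filter_upwards [Iio_mem_nhds h] with y hy
    rw [max_eq_right (le_of_lt hy), Real.zero_rpow (by linarith)]
  · have h1 : HasDerivWithinAt (fun x : ℝ => max x 0 ^ l) 0 (Iic 0) 0 := by
      refine (hasDerivWithinAt_const (0 : ℝ) (Iic 0) (0 : ℝ)).congr (fun y hy => ?_) ?_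
      · rw [max_eq_right hy, Real.zero_rpow (by linarith)]
      · rw [max_self, Real.zero_rpow (by linarith)]
    have h2 : HasDerivWithinAt (fun x : ℝ => max x 0 ^ l) 0 (Ici 0) 0 := by
      have := (Real.hasDerivAt_rpow_const (x := 0) (p := l) (Or.inr hl.le)).hasDerivWithinAt
        (s := Ici 0)
      rw [Real.zero_rpow (by linarith : l - 1 ≠ 0), mul_zero] at this
      exact this.congr (fun y hy => by rw [max_eq_left hy]) (by rw [max_self])
    have h3 := h1.union h2
    rw [Iic_union_Ici, hasDerivWithinAt_univ] at h3
    rwa [max_self, Real.zero_rpow (by linarith : l - 1 ≠ 0), mul_zero]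
  · rw [max_eq_left h.le]
    refine (Real.hasDerivAt_rpow_const (Or.inl h.ne')).congr_of_eventuallyEq ?_
    filter_upwards [Ioi_mem_nhds h] with y hy
    rw [max_eq_left (le_of_lt hy)]

theorem continuous_posGap_rpow_mul {l : ℝ} (hl : 0 ≤ l) (s ω : ℝ) :
    Continuous fun τ => ((posGap s τ ^ l : ℝ) : ℂ) * expMode ω τ :=
  (Complex.continuous_ofReal.comp (Continuous.rpow_const (by unfold posGap; fun_prop)
    fun _ => Or.inr hl)).mul (isSmooth_expMode ω).continuous

theorem hasDerivAt_modeGap_of_one_lt {l : ℝ} (hl : 1 < l) (ω : ℝ) {s : ℝ}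
    (hs : s ∈ Ioo (-1 : ℝ) 1) : HasDerivAt (modeGap ω l) (-modeGap ω (l - 1) s) s := by
  have hU : Ioo (-1 : ℝ) 1 ∈ 𝓝 s := isOpen_Ioo.mem_nhds hs
  have hd := intervalIntegral.hasDerivAt_integral_of_dominated_loc_of_deriv_le (μ := volume)
    (a := -Real.pi) (b := Real.pi) (x₀ := s)
    (F := fun s τ => ((posGap s τ ^ l : ℝ) : ℂ) * expMode ω τ)
    (F' := fun s τ => ((-(l * posGap s τ ^ (l - 1)) : ℝ) : ℂ) * expMode ω τ)
    (bound := fun _ => l * 2 ^ (l - 1)) hU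
    (Eventually.of_forall fun y =>
      (continuous_posGap_rpow_mul (by linarith) y ω).aestronglyMeasurable)
    ((continuous_posGap_rpow_mul (by linarith) s ω).intervalIntegrable _ _)
    (by
      have hc : Continuous fun τ => -(l : ℂ) * (((posGap s τ ^ (l - 1) : ℝ) : ℂ) * expMode ω τ) :=
        continuous_const.mul (continuous_posGap_rpow_mul (by linarith : 0 ≤ l - 1) s ω)
      have := hc.aestronglyMeasurable (μ := volume.restrict (uIoc (-Real.pi) Real.pi))
      refine this.congr (Eventually.of_forall fun τ => ?_)
      push_cast; ring)
    (Eventually.of_forall fun τ _ y hy => by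
      rw [norm_mul, norm_expMode, mul_one, Complex.norm_real, Real.norm_eq_abs, abs_neg,
        abs_of_nonneg (mul_nonneg (by linarith) (Real.rpow_nonneg (posGap_nonneg _ _) _))]
      exact mul_le_mul_of_nonneg_left (Real.rpow_le_rpow (posGap_nonneg _ _) (posGap_le hy τ)
        (by linarith)) (by linarith))
    intervalIntegrable_const
    (Eventually.of_forall fun τ _ y _ => by
      have h1 := (hasDerivAt_max_zero_rpow hl (Real.cos τ - y)).comp y
        ((hasDerivAt_id y).const_sub (Real.cos τ))
      rw [mul_neg_one] at h1
      exact h1.ofReal_comp.mul_const _)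
  have h2 := hd.2.const_mul (((Real.Gamma (l + 1))⁻¹ : ℝ) : ℂ)
  have hG : Real.Gamma (l + 1) = l * Real.Gamma (l - 1 + 1) := by
    rw [Real.Gamma_add_one (by linarith), sub_add_cancel]
  refine HasDerivAt.congr_of_eventuallyEq (h2.congr_deriv ?_) ?_
  · rw [modeGap_eq_integral (by linarith) hs, hG]
    have e : ∀ τ, ((-(l * posGap s τ ^ (l - 1)) : ℝ) : ℂ) * expMode ω τ =
        -(l : ℂ) * (((posGap s τ ^ (l - 1) : ℝ) : ℂ) * expMode ω τ) := fun τ => by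
      push_cast; ring
    simp only [e]
    rw [intervalIntegral.integral_const_mul]
    have hl0 : (l : ℂ) ≠ 0 := by exact_mod_cast (by linarith : l ≠ 0)
    push_cast
    rw [mul_inv]
    field_simp
  · filter_upwards [hU] with y hy
    rw [modeGap_eq_integral (by linarith) hy]

/-- The normalisation by Γ(l + 1) makes ∂_s a pure shift of l. For l > 1 this is differentiation
under the integral; the lowering relation passes it from l + 1 and l + 2 to l. -/
theorem hasDerivAt_modeGap (l ω : ℝ) {s : ℝ} (hs : s ∈ Ioo (-1 : ℝ) 1) :
    HasDerivAt (modeGap ω l) (-modeGap ω (l - 1) s) s := by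
  obtain ⟨n, hn⟩ := exists_nat_gt (1 - l)
  have hn : 1 - (n : ℝ) < l := by linarith
  clear * - hn hs
  induction n generalizing l with
  | zero => exact hasDerivAt_modeGap_of_one_lt (by simpa using hn) ω hs
  | succ n ih =>
    push_cast at hn
    have d2 := ih (l + 2) (by linarith)
    have d1 := ih (l + 1) (by linarith)
    rw [show l + 2 - 1 = l + 1 by ring] at d2
    rw [show l + 1 - 1 = l by ring] at d1
    have hsp := one_sub_sq_pos hs
    have hx : HasDerivAt (fun s : ℝ => (s : ℂ)) 1 s := Complex.ofRealCLM.hasDerivAt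
    have hq : HasDerivAt (fun s : ℝ => ((1 - s ^ 2)⁻¹ : ℝ)) (2 * s / (1 - s ^ 2) ^ 2) s := by
      have := (((hasDerivAt_id s).pow 2).const_sub 1).inv (by simpa using hsp.ne')
      refine this.congr_deriv ?_
      simp
    have hr : HasDerivAt (fun s : ℝ => (((2 * l + 3) * s : ℝ) : ℂ)) ((2 * l + 3 : ℝ) : ℂ) s := by
      have := ((hasDerivAt_id s).const_mul (2 * l + 3)).ofReal_comp
      rwa [mul_one] at this
    have h := hq.ofReal_comp.mul ((d2.const_mul (((l + 2) ^ 2 - ω ^ 2 : ℝ) : ℂ)).add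
      (hr.mul d1))
    refine HasDerivAt.congr_of_eventuallyEq (h.congr_deriv ?_) ?_
    · have e0 := modeGap_lower ω l hs
      have e1 := modeGap_lower ω (l - 1) hs
      rw [show l - 1 + 2 = l + 1 by ring, show l - 1 + 1 = l by ring] at e1
      have hsp' : (1 : ℂ) - (s : ℂ) ^ 2 ≠ 0 := by exact_mod_cast hsp.ne'
      simp only [Pi.add_apply, Pi.mul_apply]
      rw [e1]
      push_cast at e0 ⊢
      field_simp at e0 ⊢
      linear_combination (-2 * (s : ℂ)) * e0
    · filter_upwards [isOpen_Ioo.mem_nhds hs] with y hy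
      rw [modeGap_lower ω l hy]
      rfl

/-! ### The value at zero -/

/-- The substitution x = (1 + sin τ)/2 gives the Beta integral with both parameters (l + 1)/2. For l
≥ 1 its integrand is continuous up to the ends. -/
theorem integral_cos_rpow {l : ℝ} (hl : 1 ≤ l) :
    ∫ τ in (-(Real.pi / 2))..(Real.pi / 2), Real.cos τ ^ l =
      2 ^ l * Real.Gamma ((l + 1) / 2) ^ 2 / Real.Gamma (l + 1) := by
  set u := (l + 1) / 2 with hu
  have hu0 : 0 < u := by rw [hu]; linarith
  have hsub := intervalIntegral.integral_comp_mul_deriv (a := -(Real.pi / 2)) (b := Real.pi / 2)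
    (f := fun τ => (1 + Real.sin τ) / 2) (f' := fun τ => Real.cos τ / 2)
    (g := fun x => 2 ^ l * (x * (1 - x)) ^ (u - 1))
    (fun τ _ => ((Real.hasDerivAt_sin τ).const_add 1).div_const 2) (by fun_prop)
    (continuous_const.mul (Continuous.rpow_const (by fun_prop)
      fun _ => Or.inr (by rw [hu]; linarith)))
  have e1 : ∀ τ ∈ uIcc (-(Real.pi / 2)) (Real.pi / 2),
      ((fun x : ℝ => 2 ^ l * (x * (1 - x)) ^ (u - 1)) ∘ fun τ => (1 + Real.sin τ) / 2) τ *
        (Real.cos τ / 2) = Real.cos τ ^ l := by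
    intro τ hτ
    rw [uIcc_of_le (by linarith [Real.pi_pos])] at hτ
    have hc := Real.cos_nonneg_of_mem_Icc hτ
    simp only [Function.comp_apply]
    rcases hc.eq_or_lt with h | h
    · rw [← h, Real.zero_rpow (by linarith), zero_div, mul_zero]
    · have h3 : (1 + Real.sin τ) / 2 * (1 - (1 + Real.sin τ) / 2) = (Real.cos τ / 2) ^ (2 : ℝ) := by
        rw [Real.rpow_two]
        linear_combination (-1 / 4) * Real.sin_sq_add_cos_sq τ
      have h2 : 0 < Real.cos τ / 2 := by positivity
      rw [h3, ← Real.rpow_mul h2.le, mul_assoc, ← Real.rpow_add_one h2.ne',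
        show 2 * (u - 1) + 1 = l by rw [hu]; ring, Real.div_rpow hc zero_le_two]
      field_simp
  rw [intervalIntegral.integral_congr e1] at hsub
  rw [hsub, Real.sin_neg, Real.sin_pi_div_two]
  norm_num
  have hb : Complex.betaIntegral (u : ℂ) (u : ℂ) =
      ((∫ x in (0 : ℝ)..1, (x * (1 - x)) ^ (u - 1) : ℝ) : ℂ) := by
    rw [Complex.betaIntegral, ← intervalIntegral.integral_ofReal]
    refine intervalIntegral.integral_congr fun x hx => ?_
    rw [uIcc_of_le zero_le_one] at hx
    have h1 : 0 ≤ 1 - x := by linarith [hx.2]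
    rw [Real.mul_rpow hx.1 h1]
    push_cast
    rw [Complex.ofReal_cpow hx.1, Complex.ofReal_cpow h1]
    push_cast
    rfl
  have hG := Complex.Gamma_mul_Gamma_eq_betaIntegral (s := (u : ℂ)) (t := (u : ℂ))
    (by simpa using hu0) (by simpa using hu0)
  rw [hb, ← Complex.ofReal_add, Complex.Gamma_ofReal, Complex.Gamma_ofReal,
    show u + u = l + 1 by rw [hu]; ring] at hG
  have hG' : Real.Gamma u * Real.Gamma u = Real.Gamma (l + 1) *
      ∫ x in (0 : ℝ)..1, (x * (1 - x)) ^ (u - 1) := by exact_mod_cast hG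
  have hne := (Real.Gamma_pos_of_pos (by linarith : 0 < l + 1)).ne'
  rw [eq_div_iff hne]
  linear_combination (-(2 : ℝ) ^ l) * hG'

/-- The value at zero of the continued power `l` of the gap on the exponential of
frequency `ω`. -/
def gapValue (ω l : ℝ) : ℝ :=
  Real.pi * 2 ^ (-l) * (Real.Gamma (1 + (l + ω) / 2))⁻¹ * (Real.Gamma (1 + (l - ω) / 2))⁻¹

theorem gapValue_lower (ω l : ℝ) : gapValue ω l = ((l + 2) ^ 2 - ω ^ 2) * gapValue ω (l + 2) := by
  unfold gapValue
  rw [Gamma_inv_eq (1 + (l + ω) / 2), Gamma_inv_eq (1 + (l - ω) / 2),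
    show 1 + (l + ω) / 2 + 1 = 1 + (l + 2 + ω) / 2 by ring,
    show 1 + (l - ω) / 2 + 1 = 1 + (l + 2 - ω) / 2 by ring,
    show -l = -(l + 2) + 2 by ring, Real.rpow_add two_pos]
  norm_num
  ring

theorem zero_mem_Ioo_one : (0 : ℝ) ∈ Ioo (-1 : ℝ) 1 := by norm_num

theorem modeGap_zero_lower (ω l : ℝ) :
    modeGap ω l 0 = (((l + 2) ^ 2 - ω ^ 2 : ℝ) : ℂ) * modeGap ω (l + 2) 0 := by
  rw [modeGap_lower ω l zero_mem_Ioo_one]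
  simp

theorem modeGap_zero_eq_integral {l : ℝ} (hl : -1 < l) (ω : ℝ) :
    modeGap ω l 0 = ((Real.Gamma (l + 1))⁻¹ : ℝ) *
      ∫ τ in (-(Real.pi / 2))..(Real.pi / 2), ((Real.cos τ ^ l : ℝ) : ℂ) * expMode ω τ := by
  rw [modeGap_eq (n := 0) (by push_cast; linarith) zero_mem_Ioo_one, gapFun, cutGapIntegral,
    Real.arccos_zero]
  simp only [sub_zero]

/-- The Beta integral, brought to the form of `gapValue` by Legendre's duplication formula. -/
theorem modeGap_zero_zero {l : ℝ} (hl : 1 ≤ l) : modeGap 0 l 0 = (gapValue 0 l : ℂ) := by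
  rw [modeGap_zero_eq_integral (by linarith)]
  simp only [expMode_zero, mul_one]
  rw [intervalIntegral.integral_ofReal, integral_cos_rpow hl, ← Complex.ofReal_mul]
  congr 1
  unfold gapValue
  have hdup := Real.Gamma_mul_Gamma_add_half ((l + 1) / 2)
  rw [show (l + 1) / 2 + 1 / 2 = 1 + l / 2 by ring, show 2 * ((l + 1) / 2) = l + 1 by ring,
    show 1 - (l + 1) = -l by ring] at hdup
  have h1 := (Real.Gamma_pos_of_pos (by linarith : 0 < l + 1)).ne'
  have h2 := (Real.Gamma_pos_of_pos (by linarith : 0 < 1 + l / 2)).ne'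
  rw [add_zero, sub_zero]
  have hsq : √Real.pi ^ 2 = Real.pi := Real.sq_sqrt Real.pi_pos.le
  have h3 : Real.Gamma ((l + 1) / 2) = Real.Gamma (l + 1) * 2 ^ (-l) * √Real.pi *
      (Real.Gamma (1 + l / 2))⁻¹ := by
    rw [← hdup]; field_simp
  rw [h3, Real.rpow_neg zero_le_two]
  field_simp
  rw [hsq]

/-- cos^l concentrates at τ = 0. One has |exp(−iωτ) − 1| ≤ |ωτ| ≤ η + (ωτ)²/η and τ² ≤ (π²/4)(1 −
cos² τ), and the integral of cos^l − cos^(l+2) is 1/(l + 2) times that of cos^l. -/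
theorem norm_modeGap_zero_sub_le {l : ℝ} (hl : 1 ≤ l) (ω : ℝ) {η : ℝ} (hη : 0 < η) :
    ‖modeGap ω l 0 - modeGap 0 l 0‖ ≤
      (η + ω ^ 2 * (Real.pi ^ 2 / 4) / (η * (l + 2))) * gapValue 0 l := by
  have hG := Real.Gamma_pos_of_pos (by linarith : 0 < l + 1)
  have hle : -(Real.pi / 2) ≤ Real.pi / 2 := by linarith [Real.pi_pos]
  have hc : ∀ r : ℝ, 0 ≤ r → Continuous fun τ => Real.cos τ ^ r := fun r hr =>
    Continuous.rpow_const Real.continuous_cos fun _ => Or.inr hr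
  have hci : ∀ a r : ℝ, 0 ≤ r → Continuous fun τ => a * Real.cos τ ^ r := fun a r hr =>
    continuous_const.mul (hc r hr)
  have hcc : ∀ w : ℝ, Continuous fun τ => ((Real.cos τ ^ l : ℝ) : ℂ) * expMode w τ := fun w =>
    (Complex.continuous_ofReal.comp (hc l (by linarith))).mul (isSmooth_expMode w).continuous
  have h1 : ∀ m : ℝ, 1 ≤ m → (∫ τ in (-(Real.pi / 2))..(Real.pi / 2), Real.cos τ ^ m) =
      Real.Gamma (m + 1) * gapValue 0 m := fun m hm => by
    have h := modeGap_zero_zero hm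
    have hG := (Real.Gamma_pos_of_pos (by linarith : 0 < m + 1)).ne'
    rw [modeGap_zero_eq_integral (by linarith)] at h
    simp only [expMode_zero, mul_one] at h
    rw [intervalIntegral.integral_ofReal, ← Complex.ofReal_mul, Complex.ofReal_inj] at h
    rw [← h, mul_inv_cancel_left₀ hG]
  rw [modeGap_zero_eq_integral (by linarith), modeGap_zero_eq_integral (by linarith), ← mul_sub,
    ← intervalIntegral.integral_sub ((hcc ω).intervalIntegrable _ _)
      ((hcc 0).intervalIntegrable _ _), norm_mul, Complex.norm_real, Real.norm_eq_abs,
    abs_of_pos (inv_pos.2 hG)]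
  have hb : ‖∫ τ in (-(Real.pi / 2))..(Real.pi / 2), (((Real.cos τ ^ l : ℝ) : ℂ) * expMode ω τ -
      ((Real.cos τ ^ l : ℝ) : ℂ) * expMode 0 τ)‖ ≤ ∫ τ in (-(Real.pi / 2))..(Real.pi / 2),
      ((η + ω ^ 2 * (Real.pi ^ 2 / 4) / η) * Real.cos τ ^ l -
        ω ^ 2 * (Real.pi ^ 2 / 4) / η * Real.cos τ ^ (l + 2)) := by
    refine intervalIntegral.norm_integral_le_of_norm_le hle
      (ae_of_all _ fun τ hτ => ?_)
      (((hci _ l (by linarith)).sub (hci _ (l + 2) (by linarith))).intervalIntegrable _ _)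
    have hcos : 0 ≤ Real.cos τ := Real.cos_nonneg_of_mem_Icc ⟨hτ.1.le, hτ.2⟩
    have h2 : Real.cos τ ^ (l + 2) = Real.cos τ ^ l * Real.cos τ ^ 2 := by
      rw [Real.rpow_add' hcos (by linarith), Real.rpow_two]
    have h3 : ‖expMode ω τ - 1‖ ≤ |ω * τ| := by
      have := Real.norm_exp_I_mul_ofReal_sub_one_le (x := -(ω * τ))
      unfold expMode
      rw [Real.norm_eq_abs, abs_neg] at this
      refine le_trans (le_of_eq ?_) this
      congr 3
      push_cast; ring
    have h4 : |τ| ≤ Real.pi / 2 * |Real.sin τ| := by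
      have := Real.mul_abs_le_abs_sin (x := τ) (abs_le.2 ⟨by linarith [hτ.1], hτ.2⟩)
      calc |τ| = Real.pi / 2 * (2 / Real.pi * |τ|) := by field_simp
        _ ≤ _ := by gcongr
    have h5 : |ω * τ| ≤ η + ω ^ 2 * (Real.pi ^ 2 / 4) / η * (1 - Real.cos τ ^ 2) := by
      have h6 : |ω * τ| ^ 2 ≤ ω ^ 2 * (Real.pi ^ 2 / 4) * (1 - Real.cos τ ^ 2) := by
        rw [sq_abs, mul_pow, ← Real.sin_sq, ← sq_abs τ, ← sq_abs (Real.sin τ), mul_assoc]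
        refine mul_le_mul_of_nonneg_left ?_ (sq_nonneg _)
        calc |τ| ^ 2 ≤ (Real.pi / 2 * |Real.sin τ|) ^ 2 := by gcongr
          _ = _ := by ring
      have h7 : |ω * τ| ≤ η + |ω * τ| ^ 2 / η := by
        rw [← sub_nonneg]
        have : η + |ω * τ| ^ 2 / η - |ω * τ| =
            ((η - |ω * τ|) ^ 2 + η * |ω * τ|) / η := by field_simp; ring
        rw [this]; positivity
      have h8 : |ω * τ| ^ 2 / η ≤ ω ^ 2 * (Real.pi ^ 2 / 4) * (1 - Real.cos τ ^ 2) / η := by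
        gcongr
      rw [div_mul_eq_mul_div]; linarith
    rw [expMode_zero, mul_one, ← mul_sub_one, norm_mul, Complex.norm_real, Real.norm_eq_abs,
      abs_of_nonneg (Real.rpow_nonneg hcos l), h2]
    calc _ ≤ Real.cos τ ^ l * (η + ω ^ 2 * (Real.pi ^ 2 / 4) / η * (1 - Real.cos τ ^ 2)) :=
          mul_le_mul_of_nonneg_left (h3.trans h5) (Real.rpow_nonneg hcos l)
      _ = _ := by ring
  rw [intervalIntegral.integral_sub
    ((hci _ l (by linarith)).intervalIntegrable _ _)
    ((hci _ (l + 2) (by linarith)).intervalIntegrable _ _),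
    intervalIntegral.integral_const_mul, intervalIntegral.integral_const_mul, h1 l hl,
    h1 (l + 2) (by linarith)] at hb
  have hG2 : Real.Gamma (l + 2 + 1) = (l + 2) * ((l + 1) * Real.Gamma (l + 1)) := by
    rw [Real.Gamma_add_one (by linarith), show l + 2 = l + 1 + 1 by ring,
      Real.Gamma_add_one (by linarith)]
  have hv := gapValue_lower 0 l
  have hl2 : l + 2 ≠ 0 := by linarith
  have hv' : gapValue 0 (l + 2) = gapValue 0 l / (l + 2) ^ 2 := by
    rw [hv]; field_simp; ring
  rw [hG2, hv'] at hb
  refine (mul_le_mul_of_nonneg_left hb (inv_pos.2 hG).le).trans (le_of_eq ?_)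
  field_simp
  ring

theorem modeGap_zero_iterate (ω l : ℝ) (n : ℕ) :
    modeGap ω l 0 = ((4 ^ n * (ascPochhammer ℝ n).eval (1 + (l + ω) / 2) *
      (ascPochhammer ℝ n).eval (1 + (l - ω) / 2) : ℝ) : ℂ) * modeGap ω (l + 2 * n) 0 := by
  induction n with
  | zero => simp
  | succ n ih =>
    rw [ih, modeGap_zero_lower ω (l + 2 * n), ascPochhammer_succ_eval, ascPochhammer_succ_eval,
      show l + 2 * (n : ℝ) + 2 = l + 2 * ((n + 1 : ℕ) : ℝ) by push_cast; ring]
    push_cast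
    ring

theorem gapValue_zero_pos {l : ℝ} (hl : 0 < l) : 0 < gapValue 0 l := by
  unfold gapValue
  have h1 := Real.Gamma_pos_of_pos (by linarith : 0 < 1 + (l + 0) / 2)
  have h2 := Real.Gamma_pos_of_pos (by linarith : 0 < 1 + (l - 0) / 2)
  have h3 := Real.pi_pos
  positivity

theorem tendsto_modeGap_ratio {l : ℝ} (hl : 1 ≤ l) (ω : ℝ) :
    Tendsto (fun n : ℕ => modeGap ω (l + 2 * (n + 1 : ℕ)) 0 / modeGap 0 (l + 2 * (n + 1 : ℕ)) 0)
      atTop (𝓝 1) := by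
  set C := 1 + ω ^ 2 * (Real.pi ^ 2 / 4) with hC
  have hη : Tendsto (fun n : ℕ => (√(l + 2 * (n + 1 : ℕ) + 2))⁻¹ * C) atTop (𝓝 0) := by
    have h1 : Tendsto (fun n : ℕ => l + 2 * ((n + 1 : ℕ) : ℝ) + 2) atTop atTop :=
      tendsto_atTop_add_const_right _ _ (tendsto_atTop_add_const_left _ _
        ((tendsto_natCast_atTop_atTop.comp (tendsto_add_atTop_nat 1)).const_mul_atTop two_pos))
    have := (tendsto_inv_atTop_zero.comp (Real.tendsto_sqrt_atTop.comp h1)).mul_const C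
    rwa [zero_mul] at this
  rw [tendsto_iff_norm_sub_tendsto_zero]
  refine squeeze_zero (fun _ => norm_nonneg _) (fun n => ?_) hη
  set m := l + 2 * ((n + 1 : ℕ) : ℝ) with hm
  have hm1 : 1 ≤ m := by rw [hm]; push_cast; linarith [(Nat.cast_nonneg n : (0 : ℝ) ≤ n)]
  have hpos := gapValue_zero_pos (by linarith : 0 < m)
  have hne : modeGap 0 m 0 ≠ 0 := by
    rw [modeGap_zero_zero hm1]; exact_mod_cast hpos.ne'
  have hs : 0 < √(m + 2) := Real.sqrt_pos.2 (by linarith)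
  -- The choice η = (m + 2)^(−1/2) balances the two error terms.
  have hb := norm_modeGap_zero_sub_le hm1 ω (inv_pos.2 hs)
  rw [div_sub_one hne, norm_div]
  have hn : ‖modeGap 0 m 0‖ = gapValue 0 m := by
    rw [modeGap_zero_zero hm1, Complex.norm_real, Real.norm_eq_abs, abs_of_pos hpos]
  rw [hn, div_le_iff₀ hpos]
  refine hb.trans (le_of_eq ?_)
  congr 1
  have hsq : √(m + 2) ^ 2 = m + 2 := Real.sq_sqrt (by linarith)
  rw [hC]
  generalize √(m + 2) = w at hs hsq ⊢
  rw [← hsq]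
  field_simp

/-- Cauchy's cosine integral without evaluating an oscillating integral. The two-step recursion
carries l to infinity both for ω and for frequency 0. The ratio of the remote values tends to 1, and
the Pochhammer products tend to reciprocal Gamma functions, their powers of n cancelling because a +
b = 2c. -/
theorem modeGap_zero_of_one_le {l : ℝ} (hl : 1 ≤ l) (ω : ℝ) :
    modeGap ω l 0 = (gapValue ω l : ℂ) := by
  set a := 1 + (l + ω) / 2 with ha
  set b := 1 + (l - ω) / 2 with hb
  set c := 1 + (l + 0) / 2 with hc
  have hof : ∀ {u : ℕ → ℝ} {x : ℝ}, Tendsto u atTop (𝓝 x) →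
      Tendsto (fun n => (u n : ℂ)) atTop (𝓝 (x : ℂ)) := fun h =>
    (Complex.continuous_ofReal.tendsto _).comp h
  have ta := hof (tendsto_ascPochhammer_div a)
  have tb := hof (tendsto_ascPochhammer_div b)
  have tc := hof (tendsto_ascPochhammer_div c)
  have t1 := ((tc.mul tc).const_mul (modeGap ω l 0))
  have t2 := (((ta.mul tb).mul (tendsto_modeGap_ratio hl ω)).mul_const (modeGap 0 l 0))
  have he := tendsto_nhds_unique_of_eventuallyEq t1 t2 (by
    filter_upwards [eventually_gt_atTop 0] with n hn
    set m := l + 2 * ((n + 1 : ℕ) : ℝ) with hm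
    have hm1 : 1 ≤ m := by rw [hm]; push_cast; linarith [(Nat.cast_nonneg n : (0 : ℝ) ≤ n)]
    have hne : modeGap 0 m 0 ≠ 0 := by
      rw [modeGap_zero_zero hm1]; exact_mod_cast (gapValue_zero_pos (by linarith : 0 < m)).ne'
    have e1 := modeGap_zero_iterate ω l (n + 1)
    have e2 := modeGap_zero_iterate 0 l (n + 1)
    rw [sub_zero, ← hm, show 1 + l / 2 = c by rw [hc, add_zero]] at e2
    rw [← hm, ← ha, ← hb] at e1
    rw [add_zero, show 1 + l / 2 = c by rw [hc, add_zero]] at e2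
    rw [e1, e2]
    have hn' : (0 : ℝ) < n := by exact_mod_cast hn
    have hpow : (n : ℝ) ^ a * (n : ℝ) ^ b = (n : ℝ) ^ c * (n : ℝ) ^ c := by
      rw [← Real.rpow_add hn', ← Real.rpow_add hn']
      congr 1; rw [ha, hb, hc]; ring
    have hpow' : (((n : ℝ) ^ a : ℝ) : ℂ) * (((n : ℝ) ^ b : ℝ) : ℂ) =
        (((n : ℝ) ^ c : ℝ) : ℂ) * (((n : ℝ) ^ c : ℝ) : ℂ) := by exact_mod_cast hpow
    have pa : (((n : ℝ) ^ a : ℝ) : ℂ) ≠ 0 := by exact_mod_cast (Real.rpow_pos_of_pos hn' a).ne'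
    have pb : (((n : ℝ) ^ b : ℝ) : ℂ) ≠ 0 := by exact_mod_cast (Real.rpow_pos_of_pos hn' b).ne'
    have pc : (((n : ℝ) ^ c : ℝ) : ℂ) ≠ 0 := by exact_mod_cast (Real.rpow_pos_of_pos hn' c).ne'
    have pf : (((n.factorial : ℕ) : ℝ) : ℂ) ≠ 0 := by exact_mod_cast n.factorial_ne_zero
    simp only [Complex.ofReal_mul, Complex.ofReal_div]
    field_simp
    linear_combination (((ascPochhammer ℝ (n + 1)).eval a : ℝ) : ℂ) *
      (((ascPochhammer ℝ (n + 1)).eval b : ℝ) : ℂ) * modeGap ω m 0 *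
      (((ascPochhammer ℝ (n + 1)).eval c : ℝ) : ℂ) ^ 2 * hpow')
  have hcne : (Real.Gamma c : ℂ) ≠ 0 := by
    exact_mod_cast (Real.Gamma_pos_of_pos (by rw [hc]; linarith)).ne'
  rw [modeGap_zero_zero hl] at he
  unfold gapValue at he ⊢
  rw [← ha, ← hb]
  rw [sub_zero, show 1 + l / 2 = c by rw [hc, add_zero], add_zero,
    show 1 + l / 2 = c by rw [hc, add_zero]] at he
  simp only [Complex.ofReal_mul, Complex.ofReal_inv] at he ⊢
  have h2 := congrArg (· * ((Real.Gamma c : ℂ) * (Real.Gamma c : ℂ))) he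
  beta_reduce at h2
  field_simp at h2 ⊢
  linear_combination h2

theorem modeGap_zero (ω l : ℝ) : modeGap ω l 0 = (gapValue ω l : ℂ) := by
  obtain ⟨n, hn⟩ := exists_nat_gt (1 - l)
  have hn : 1 - (n : ℝ) ≤ l := by linarith
  clear * - hn
  induction n generalizing l with
  | zero => exact modeGap_zero_of_one_le (by simpa using hn) ω
  | succ n ih =>
    push_cast at hn
    rw [modeGap_zero_lower, gapValue_lower, ih _ (by linarith)]
    push_cast
    ring

/-! ### The power series -/

/-- The Taylor coefficients of the continued power `l` of the gap on an exponential. -/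
def gapCoeff (ω l : ℝ) (k : ℕ) : ℝ := (-1) ^ k * gapValue ω (l - k) / k.factorial

theorem gapCoeff_succ_succ (ω l : ℝ) (k : ℕ) :
    (k + 1) * (k + 2) * gapCoeff ω l (k + 2) = ((k - l) ^ 2 - ω ^ 2) * gapCoeff ω l k := by
  unfold gapCoeff
  have h := gapValue_lower ω (l - (k + 2 : ℕ))
  rw [show l - ((k + 2 : ℕ) : ℝ) + 2 = l - k by push_cast; ring] at h
  rw [h, Nat.factorial_succ, Nat.factorial_succ]
  push_cast
  field_simp
  ring

theorem unitSummable_gapCoeff (ω l : ℝ) : UnitSummable (gapCoeff ω l) := by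
  refine unitSummable_of_ratio (j := 2) two_pos fun q hq => ?_
  have hlim : Tendsto (fun k : ℕ => ((k - l) ^ 2 - ω ^ 2) / (((k : ℝ) + 1) * (k + 2))) atTop
      (𝓝 1) := by
    have h0 : Tendsto (fun k : ℕ => (k : ℝ)⁻¹) atTop (𝓝 0) :=
      tendsto_inv_atTop_zero.comp tendsto_natCast_atTop_atTop
    have h1 : Tendsto (fun k : ℕ => ((1 - l * (k : ℝ)⁻¹) ^ 2 - ω ^ 2 * ((k : ℝ)⁻¹) ^ 2) /
        ((1 + (k : ℝ)⁻¹) * (1 + 2 * (k : ℝ)⁻¹))) atTop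
        (𝓝 (((1 - l * 0) ^ 2 - ω ^ 2 * 0 ^ 2) / ((1 + 0) * (1 + 2 * 0)))) := by
      refine ((((h0.const_mul l).const_sub 1).pow 2).sub ((h0.pow 2).const_mul _)).div
        ((h0.const_add 1).mul ((h0.const_mul 2).const_add 1)) (by norm_num)
    rw [show ((1 - l * 0) ^ 2 - ω ^ 2 * 0 ^ 2) / ((1 + 0) * (1 + 2 * 0)) = (1 : ℝ) by norm_num] at h1
    refine h1.congr' ?_
    filter_upwards [eventually_gt_atTop 0] with k hk
    have hk' : (0 : ℝ) < k := by exact_mod_cast hk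
    field_simp
  have habs := hlim.abs
  rw [abs_one] at habs
  filter_upwards [habs.eventually (gt_mem_nhds hq)] with k hk
  have hpos : (0 : ℝ) < (k + 1) * (k + 2) := by positivity
  have h := gapCoeff_succ_succ ω l k
  have h2 : gapCoeff ω l (k + 2) = ((k - l) ^ 2 - ω ^ 2) / ((k + 1) * (k + 2)) * gapCoeff ω l k := by
    rw [div_mul_eq_mul_div, eq_div_iff hpos.ne', ← h]; ring
  rw [h2, abs_mul]
  exact mul_le_mul_of_nonneg_right hk.le (abs_nonneg _)

theorem powSum_gapCoeff_equation (ω l : ℝ) {z : ℝ} (hz : |z| < 1) :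
    (1 - z ^ 2) * powSum (derivCoeff (derivCoeff (gapCoeff ω l))) z +
      (2 * l - 1) * z * powSum (derivCoeff (gapCoeff ω l)) z -
      (l ^ 2 - ω ^ 2) * powSum (gapCoeff ω l) z = 0 := by
  have hp := unitSummable_gapCoeff ω l
  have h0 := hasSum_powSum hp hz
  have h1z := hasSum_mul_powSum_derivCoeff hp hz
  have h2 := hasSum_powSum hp.derivCoeff.derivCoeff hz
  have h2zz : HasSum (fun k : ℕ => k * (k - 1) * gapCoeff ω l k * z ^ k)
      (z * (z * powSum (derivCoeff (derivCoeff (gapCoeff ω l))) z)) := by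
    have h := (hasSum_mul_powSum_derivCoeff hp.derivCoeff hz).mul_left z
    rw [← hasSum_nat_add_iff' 1]
    simp only [Finset.range_one, Finset.sum_singleton, Nat.cast_zero, zero_mul, sub_zero]
    refine h.congr_fun fun k => ?_
    unfold derivCoeff; push_cast; ring
  have key := ((h2.sub h2zz).add (h1z.mul_left (2 * l - 1))).sub (h0.mul_left (l ^ 2 - ω ^ 2))
  have hzero : ∀ k : ℕ, derivCoeff (derivCoeff (gapCoeff ω l)) k * z ^ k -
      k * (k - 1) * gapCoeff ω l k * z ^ k + (2 * l - 1) * (k * gapCoeff ω l k * z ^ k) -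
      (l ^ 2 - ω ^ 2) * (gapCoeff ω l k * z ^ k) = 0 := by
    intro k
    have := gapCoeff_succ_succ ω l k
    unfold derivCoeff
    push_cast
    linear_combination z ^ k * this
  simp only [hzero] at key
  linear_combination key.unique hasSum_zero

/-- Both sides solve (1 − s²) G'' + (2l − 1) s G' − (l² − ω²) G = 0 with the same G(0) and G'(0).
For the left side this combines the derivative shift with the lowering relation at l − 2. Uniqueness
holds on each (−r, r) with r < 1, where the first-order system is Lipschitz. -/
theorem modeGap_eq_powSum (ω l : ℝ) {s : ℝ} (hs : s ∈ Ioo (-1 : ℝ) 1) :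
    modeGap ω l s = (powSum (gapCoeff ω l) s : ℂ) := by
  have hp := unitSummable_gapCoeff ω l
  obtain ⟨r, hr, hr1⟩ := exists_between (abs_lt.2 hs)
  have hr0 : 0 < r := lt_of_le_of_lt (abs_nonneg s) hr
  have hin : ∀ t ∈ Ioo (-r) r, t ∈ Ioo (-1 : ℝ) 1 := fun t ht =>
    ⟨by linarith [ht.1], by linarith [ht.2]⟩
  set v : ℝ → ℂ × ℂ → ℂ × ℂ := fun t p => (p.2, (((1 - t ^ 2)⁻¹ : ℝ) : ℂ) *
    (((l ^ 2 - ω ^ 2 : ℝ) : ℂ) * p.1 - (((2 * l - 1) * t : ℝ) : ℂ) * p.2)) with hv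
  set K : ℝ := 1 + (1 - r ^ 2)⁻¹ * (|l ^ 2 - ω ^ 2| + |2 * l - 1|) with hK
  have hr2 : 0 < 1 - r ^ 2 := one_sub_sq_pos ⟨by linarith, hr1⟩
  have hK0 : 0 ≤ K := by rw [hK]; positivity
  have hlip : ∀ t ∈ Ioo (-r) r, LipschitzOnWith (Real.toNNReal K) (v t) univ := by
    intro t ht
    refine LipschitzOnWith.of_dist_le_mul fun x _ y _ => ?_
    rw [Real.coe_toNNReal _ hK0, dist_eq_norm, dist_eq_norm]
    have htr : |t| ≤ r := abs_le.2 ⟨ht.1.le, ht.2.le⟩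
    have ht2 : 1 - r ^ 2 ≤ 1 - t ^ 2 := by
      have := sq_le_sq' (by linarith [ht.1]) ht.2.le; linarith
    have hx1 : ‖x.1 - y.1‖ ≤ ‖x - y‖ := norm_fst_le (x - y)
    have hx2 : ‖x.2 - y.2‖ ≤ ‖x - y‖ := norm_snd_le (x - y)
    have hxy : 0 ≤ ‖x - y‖ := norm_nonneg _
    refine max_le ?_ ?_
    · refine hx2.trans (le_mul_of_one_le_left hxy ?_)
      rw [hK]; exact le_add_of_nonneg_right (by positivity)
    · simp only [hv, Prod.snd_sub]
      have e : (((1 - t ^ 2)⁻¹ : ℝ) : ℂ) * (((l ^ 2 - ω ^ 2 : ℝ) : ℂ) * x.1 -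
          (((2 * l - 1) * t : ℝ) : ℂ) * x.2) - (((1 - t ^ 2)⁻¹ : ℝ) : ℂ) *
          (((l ^ 2 - ω ^ 2 : ℝ) : ℂ) * y.1 - (((2 * l - 1) * t : ℝ) : ℂ) * y.2) =
          (((1 - t ^ 2)⁻¹ : ℝ) : ℂ) * (((l ^ 2 - ω ^ 2 : ℝ) : ℂ) * (x.1 - y.1) -
          (((2 * l - 1) * t : ℝ) : ℂ) * (x.2 - y.2)) := by ring
      rw [e, norm_mul, Complex.norm_real, Real.norm_eq_abs, abs_of_pos (inv_pos.2 (hr2.trans_le ht2))]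
      calc _ ≤ (1 - r ^ 2)⁻¹ * (|l ^ 2 - ω ^ 2| * ‖x - y‖ + |2 * l - 1| * ‖x - y‖) := by
            refine mul_le_mul (inv_anti₀ hr2 ht2) ?_ (norm_nonneg _) (inv_pos.2 hr2).le
            refine (norm_sub_le _ _).trans (add_le_add ?_ ?_)
            · rw [norm_mul, Complex.norm_real, Real.norm_eq_abs]
              exact mul_le_mul_of_nonneg_left hx1 (abs_nonneg _)
            · rw [norm_mul, Complex.norm_real, Real.norm_eq_abs, abs_mul]
              refine mul_le_mul ?_ hx2 (norm_nonneg _) (abs_nonneg _)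
              exact mul_le_of_le_one_right (abs_nonneg _) (htr.trans hr1.le)
        _ ≤ _ := by rw [hK]; nlinarith
  have hz : (0 : ℝ) ∈ Ioo (-r) r := ⟨by linarith, hr0⟩
  have hcl : ∀ t ∈ Ioo (-r) r, |t| < 1 := fun t ht => abs_lt.2 (hin t ht)
  have hsol := ODE_solution_unique_of_mem_Ioo (v := v) (s := fun _ => univ)
    (f := fun t => (modeGap ω l t, -modeGap ω (l - 1) t))
    (g := fun t => ((powSum (gapCoeff ω l) t : ℂ), (powSum (derivCoeff (gapCoeff ω l)) t : ℂ)))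
    hlip hz
    (fun t ht => ⟨by
      have h1 := hasDerivAt_modeGap l ω (hin t ht)
      have h2 := (hasDerivAt_modeGap (l - 1) ω (hin t ht)).neg
      rw [neg_neg, modeGap_lower ω (l - 1 - 1) (hin t ht),
        show l - 1 - 1 + 2 = l by ring, show l - 1 - 1 + 1 = l - 1 by ring] at h2
      refine (h1.prodMk h2).congr_deriv ?_
      simp only [hv, Prod.mk.injEq, true_and]
      push_cast
      ring, mem_univ _⟩)
    (fun t ht => ⟨by
      have h1 := (hasDerivAt_powSum hp (hcl t ht)).ofReal_comp
      have h2 := (hasDerivAt_powSum hp.derivCoeff (hcl t ht)).ofReal_comp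
      refine (h1.prodMk h2).congr_deriv ?_
      simp only [hv, Prod.mk.injEq, true_and]
      have he := powSum_gapCoeff_equation ω l (hcl t ht)
      have hne := (one_sub_sq_pos (hin t ht)).ne'
      rw [← Complex.ofReal_mul, ← Complex.ofReal_mul, ← Complex.ofReal_sub, ← Complex.ofReal_mul]
      congr 1
      rw [eq_inv_mul_iff_mul_eq₀ hne]
      linear_combination he, mem_univ _⟩)
    (by
      simp only [modeGap_zero, powSum_zero, Prod.mk.injEq]
      refine ⟨by simp [gapCoeff], ?_⟩
      rw [← Complex.ofReal_neg]
      congr 1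
      simp [derivCoeff, gapCoeff])
  have := hsol (abs_lt.1 hr)
  simp only [Prod.mk.injEq] at this
  exact this.1

/-! ### Gaussian integrals of polynomials -/

section Gaussian

open MvPolynomial

variable {d : ℕ}

/-- The value of a complex polynomial at a real vector. -/
def polyVal (p : MvPolynomial (Fin d) ℂ) (y : EuclideanSpace ℝ (Fin d)) : ℂ :=
  eval (fun i => ((y i : ℝ) : ℂ)) p

/-- The Gaussian weight. -/
def gaussWeight (y : EuclideanSpace ℝ (Fin d)) : ℝ := Real.exp (-(1 / 2) * ‖y‖ ^ 2)

/-- The Gaussian integral of a polynomial. -/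
def gaussInt (p : MvPolynomial (Fin d) ℂ) : ℂ := ∫ y, polyVal p y * (gaussWeight y : ℂ)

theorem norm_polyVal_le (p : MvPolynomial (Fin d) ℂ) :
    ∃ (C : ℝ) (N : ℕ), 0 ≤ C ∧ ∀ y, ‖polyVal p y‖ ≤ C * (1 + ‖y‖) ^ N := by
  induction p using MvPolynomial.induction_on with
  | C a => exact ⟨‖a‖, 0, norm_nonneg _, fun y => by simp [polyVal]⟩
  | add p q hp hq =>
    obtain ⟨C1, N1, h1, b1⟩ := hp
    obtain ⟨C2, N2, h2, b2⟩ := hq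
    refine ⟨C1 + C2, max N1 N2, by positivity, fun y => ?_⟩
    have hy : 1 ≤ 1 + ‖y‖ := by linarith [norm_nonneg y]
    have e : polyVal (p + q) y = polyVal p y + polyVal q y := by simp [polyVal]
    rw [e, add_mul]
    refine (norm_add_le _ _).trans (add_le_add ((b1 y).trans ?_) ((b2 y).trans ?_))
    · exact mul_le_mul_of_nonneg_left (pow_le_pow_right₀ hy (le_max_left _ _)) h1
    · exact mul_le_mul_of_nonneg_left (pow_le_pow_right₀ hy (le_max_right _ _)) h2
  | mul_X p i hp =>
    obtain ⟨C1, N1, h1, b1⟩ := hp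
    refine ⟨C1, N1 + 1, h1, fun y => ?_⟩
    have e : polyVal (p * X i) y = polyVal p y * ((y i : ℝ) : ℂ) := by simp [polyVal]
    have hi : ‖y i‖ ≤ 1 + ‖y‖ := (PiLp.norm_apply_le y i).trans (by linarith)
    rw [e, norm_mul, Complex.norm_real, pow_succ, ← mul_assoc]
    exact mul_le_mul (b1 y) hi (norm_nonneg _) (by positivity)

theorem continuous_polyVal (p : MvPolynomial (Fin d) ℂ) : Continuous (polyVal p) := by
  have h1 : Continuous fun y : EuclideanSpace ℝ (Fin d) => fun i => ((y i : ℝ) : ℂ) :=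
    continuous_pi fun i => Complex.continuous_ofReal.comp (EuclideanSpace.proj i).continuous
  exact (MvPolynomial.continuous_eval p).comp h1

theorem continuous_gaussWeight : Continuous (gaussWeight (d := d)) := by
  unfold gaussWeight; fun_prop

theorem integrable_polyVal_gauss (p : MvPolynomial (Fin d) ℂ) :
    Integrable fun y => polyVal p y * (gaussWeight y : ℂ) := by
  obtain ⟨C, N, hC, hb⟩ := norm_polyVal_le p
  have h0 := (GaussianFourier.integrable_cexp_neg_mul_sq_norm_add (b := (1 / 4 : ℂ))
    (V := EuclideanSpace ℝ (Fin d)) (by norm_num) 0 0).norm.const_mul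
    (C * (N.factorial * Real.exp 2))
  refine h0.mono' ((continuous_polyVal p).mul
    (Complex.continuous_ofReal.comp continuous_gaussWeight)).aestronglyMeasurable
    (Eventually.of_forall fun y => ?_)
  have hw : ‖(gaussWeight y : ℂ)‖ = Real.exp (-(1 / 2) * ‖y‖ ^ 2) := by
    rw [Complex.norm_real, Real.norm_eq_abs, gaussWeight, abs_of_pos (Real.exp_pos _)]
  have he : ‖Complex.exp (-(1 / 4 : ℂ) * (‖y‖ : ℂ) ^ 2 + 0 * ((inner ℝ 0 y : ℝ) : ℂ))‖ =
      Real.exp (-(1 / 4) * ‖y‖ ^ 2) := by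
    rw [zero_mul, add_zero, Complex.norm_exp]
    congr 1
    rw [show -(1 / 4 : ℂ) * (‖y‖ : ℂ) ^ 2 = ((-(1 / 4) * ‖y‖ ^ 2 : ℝ) : ℂ) by push_cast; ring]
    exact Complex.ofReal_re _
  rw [norm_mul, hw, he]
  -- From x^N / N! ≤ e^x at x = 1 + ‖y‖, and 1 + ‖y‖ ≤ 2 + ‖y‖²/4. This leaves a Gaussian of
  -- exponent 1/4.
  have h1 : (1 + ‖y‖) ^ N ≤ N.factorial * Real.exp (2 + 1 / 4 * ‖y‖ ^ 2) := by
    have h2 := Real.pow_div_factorial_le_exp (1 + ‖y‖) (by positivity) N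
    rw [div_le_iff₀ (by positivity)] at h2
    refine h2.trans ?_
    rw [mul_comm]
    refine mul_le_mul_of_nonneg_left (Real.exp_le_exp.2 ?_) (by positivity)
    nlinarith [sq_nonneg (‖y‖ - 2)]
  calc _ ≤ C * (N.factorial * Real.exp (2 + 1 / 4 * ‖y‖ ^ 2)) * Real.exp (-(1 / 2) * ‖y‖ ^ 2) := by
        refine mul_le_mul_of_nonneg_right ((hb y).trans ?_) (Real.exp_pos _).le
        exact mul_le_mul_of_nonneg_left h1 hC
    _ = C * (N.factorial * Real.exp 2) * Real.exp (-(1 / 4) * ‖y‖ ^ 2) := by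
        have he2 : Real.exp (2 + 1 / 4 * ‖y‖ ^ 2) * Real.exp (-(1 / 2) * ‖y‖ ^ 2) =
            Real.exp 2 * Real.exp (-(1 / 4) * ‖y‖ ^ 2) := by
          rw [← Real.exp_add, ← Real.exp_add]
          congr 1
          ring
        linear_combination C * N.factorial * he2

theorem gaussInt_add (p q : MvPolynomial (Fin d) ℂ) :
    gaussInt (p + q) = gaussInt p + gaussInt q := by
  unfold gaussInt
  rw [← integral_add (integrable_polyVal_gauss p) (integrable_polyVal_gauss q)]
  congr 1
  funext y
  simp [polyVal, add_mul]

theorem gaussInt_smul (c : ℂ) (p : MvPolynomial (Fin d) ℂ) :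
    gaussInt (c • p) = c * gaussInt p := by
  unfold gaussInt
  rw [← integral_const_mul]
  congr 1
  funext y
  simp [polyVal, mul_assoc, smul_eval]

/-- The Gaussian integral as a linear map. -/
def gaussIntL : MvPolynomial (Fin d) ℂ →ₗ[ℂ] ℂ where
  toFun := gaussInt
  map_add' := gaussInt_add
  map_smul' := gaussInt_smul

theorem exists_hasFDerivAt_polyVal (p : MvPolynomial (Fin d) ℂ) (y : EuclideanSpace ℝ (Fin d)) :
    ∃ L : EuclideanSpace ℝ (Fin d) →L[ℝ] ℂ, HasFDerivAt (polyVal p) L y ∧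
      ∀ i, L (EuclideanSpace.single i 1) = polyVal (pderiv i p) y := by
  induction p using MvPolynomial.induction_on with
  | C a =>
    refine ⟨0, ?_, fun i => by simp [polyVal]⟩
    have : polyVal (d := d) (C a) = fun _ => a := by funext z; simp [polyVal]
    rw [this]
    exact hasFDerivAt_const _ _
  | add p q hp hq =>
    obtain ⟨L1, h1, e1⟩ := hp
    obtain ⟨L2, h2, e2⟩ := hq
    refine ⟨L1 + L2, ?_, fun i => ?_⟩
    · have : polyVal (p + q) = fun z => polyVal p z + polyVal q z := by funext z; simp [polyVal]
      rw [this]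
      exact h1.add h2
    · rw [add_apply, e1, e2]; simp [polyVal]
  | mul_X p j hp =>
    obtain ⟨L1, h1, e1⟩ := hp
    have h2 : HasFDerivAt (fun z : EuclideanSpace ℝ (Fin d) => ((z j : ℝ) : ℂ))
        (Complex.ofRealCLM.comp (EuclideanSpace.proj j)) y :=
      (Complex.ofRealCLM.comp (EuclideanSpace.proj j)).hasFDerivAt
    have : polyVal (p * X j) = fun z => polyVal p z * ((z j : ℝ) : ℂ) := by
      funext z; simp [polyVal]
    refine ⟨_, by rw [this]; exact h1.mul h2, fun i => ?_⟩
    rw [add_apply, smul_apply,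
      smul_apply, e1, Derivation.leibniz, pderiv_X]
    simp only [polyVal, ContinuousLinearMap.comp_apply, PiLp.proj_apply, smul_eq_mul,
      map_add, map_mul, eval_X, Complex.ofRealCLM_apply]
    rcases eq_or_ne i j with rfl | hij
    · simp
    · simp [Ne.symm hij]

theorem hasFDerivAt_gaussWeight (y : EuclideanSpace ℝ (Fin d)) :
    HasFDerivAt (fun y => (gaussWeight y : ℂ))
      (Complex.ofRealCLM.comp (-(gaussWeight y) • innerSL ℝ y)) y := by
  have h1 : HasFDerivAt (fun y : EuclideanSpace ℝ (Fin d) => ‖y‖ ^ 2) (2 • innerSL ℝ y) y :=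
    (hasStrictFDerivAt_norm_sq y).hasFDerivAt
  have h2 := (h1.const_mul (-(1 / 2) : ℝ)).exp
  have h3 := Complex.ofRealCLM.hasFDerivAt.comp y h2
  refine h3.congr_fderiv ?_
  ext v
  simp [gaussWeight]

/-- Gaussian integration by parts. -/
theorem gaussInt_X_mul (i : Fin d) (p : MvPolynomial (Fin d) ℂ) :
    gaussInt (X i * p) = gaussInt (pderiv i p) := by
  have hf : ∀ y, fderiv ℝ (polyVal p) y (EuclideanSpace.single i 1) = polyVal (pderiv i p) y :=
    fun y => by
      obtain ⟨L, hL, e⟩ := exists_hasFDerivAt_polyVal p y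
      rw [hL.fderiv, e]
  have hg : ∀ y : EuclideanSpace ℝ (Fin d), fderiv ℝ (fun y => (gaussWeight y : ℂ)) y
      (EuclideanSpace.single i 1) = -(((y i : ℝ) : ℂ) * (gaussWeight y : ℂ)) := fun y => by
    rw [(hasFDerivAt_gaussWeight y).fderiv]
    have hi : inner ℝ y (EuclideanSpace.single i (1 : ℝ)) = y i := by
      rw [EuclideanSpace.inner_single_right]; simp
    simp only [ContinuousLinearMap.comp_apply, smul_apply, innerSL_apply_apply, hi, smul_eq_mul,
      Complex.ofRealCLM_apply]
    push_cast
    ring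
  have hX : ∀ y, polyVal (X i * p) y = ((y i : ℝ) : ℂ) * polyVal p y := fun y => by simp [polyVal]
  have h := integral_mul_fderiv_eq_neg_fderiv_mul_of_integrable (𝕜 := ℂ)
    (μ := (volume : Measure (EuclideanSpace ℝ (Fin d))))
    (f := polyVal p) (g := fun y => (gaussWeight y : ℂ)) (v := EuclideanSpace.single i 1)
    (by simp only [hf]; exact integrable_polyVal_gauss _)
    (by
      simp only [hg]
      refine (integrable_polyVal_gauss (X i * p)).neg.congr (Eventually.of_forall fun y => ?_)
      simp only [Pi.neg_apply, hX]; ring)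
    (integrable_polyVal_gauss p)
    (fun y _ => by
      obtain ⟨L, hL, _⟩ := exists_hasFDerivAt_polyVal p y
      exact hL.differentiableAt)
    (fun y _ => (hasFDerivAt_gaussWeight y).differentiableAt)
  simp only [hf, hg] at h
  unfold gaussInt
  rw [← neg_eq_iff_eq_neg.2 h, ← integral_neg]
  congr 1
  funext y
  rw [hX]; ring

/-- The linear form of the vector `x`. -/
def linForm (x : Fin d → ℂ) : MvPolynomial (Fin d) ℂ := ∑ i, x i • X i

/-- The derivative in the direction `x`. -/
def dirDeriv (x : Fin d → ℂ) : Derivation ℂ (MvPolynomial (Fin d) ℂ) (MvPolynomial (Fin d) ℂ) :=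
  ∑ i, x i • pderiv i

theorem dirDeriv_apply (x : Fin d → ℂ) (p : MvPolynomial (Fin d) ℂ) :
    dirDeriv x p = ∑ i, x i • pderiv i p := by
  unfold dirDeriv
  rw [← Derivation.coeFnAddMonoidHom_apply, map_sum, Finset.sum_apply]
  rfl

theorem gaussInt_linForm_mul (x : Fin d → ℂ) (p : MvPolynomial (Fin d) ℂ) :
    gaussInt (linForm x * p) = gaussInt (dirDeriv x p) := by
  have e1 : linForm x * p = ∑ i, x i • (X i * p) := by
    unfold linForm
    rw [Finset.sum_mul]
    simp only [smul_mul_assoc]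
  rw [e1, dirDeriv_apply]
  change gaussIntL _ = gaussIntL _
  rw [map_sum, map_sum]
  refine Finset.sum_congr rfl fun i _ => ?_
  rw [map_smul, map_smul]
  congr 1
  exact gaussInt_X_mul i p

theorem dirDeriv_linForm (x : Fin d → ℂ) : dirDeriv x (linForm x) = C (∑ i, x i ^ 2) := by
  rw [dirDeriv_apply]
  have h : ∀ i, pderiv i (linForm x) = C (x i) := fun i => by
    unfold linForm
    rw [map_sum, Finset.sum_eq_single i]
    · rw [Derivation.map_smul, pderiv_X_self, smul_eq_C_mul, mul_one]
    · intro j _ hj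
      rw [Derivation.map_smul, pderiv_X_of_ne hj, smul_zero]
    · simp
  simp only [h, smul_eq_C_mul, ← C_mul, ← map_sum, pow_two]

/-- The Laplace operator on polynomials. -/
def polyLaplace (p : MvPolynomial (Fin d) ℂ) : MvPolynomial (Fin d) ℂ :=
  ∑ i, pderiv i (pderiv i p)

/-- The commutator is itself a derivation, and it kills the variables because both derivations send
them to constants. -/
theorem pderiv_dirDeriv (i : Fin d) (x : Fin d → ℂ) (p : MvPolynomial (Fin d) ℂ) :
    pderiv i (dirDeriv x p) = dirDeriv x (pderiv i p) := by
  have hcomm : ⁅(pderiv i : Derivation ℂ (MvPolynomial (Fin d) ℂ) (MvPolynomial (Fin d) ℂ)), dirDeriv x⁆ = (0 : Derivation ℂ (MvPolynomial (Fin d) ℂ) _) := by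
    refine derivation_ext fun j => ?_
    have h1 : pderiv i (X j : MvPolynomial (Fin d) ℂ) = C (if j = i then 1 else 0) := by
      rcases eq_or_ne j i with rfl | h
      · simp
      · simp [pderiv_X_of_ne h, h]
    have h2 : dirDeriv x (X j : MvPolynomial (Fin d) ℂ) = C (x j) := by
      rw [dirDeriv_apply, Finset.sum_eq_single j]
      · rw [pderiv_X_self, smul_eq_C_mul, mul_one]
      · intro k _ hk
        rw [pderiv_X_of_ne hk.symm, smul_zero]
      · simp
    rw [Derivation.commutator_apply, h1, h2]
    split_ifs <;> simp
  have := congrArg (fun D : Derivation ℂ (MvPolynomial (Fin d) ℂ) _ => D p) hcomm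
  simp only [Derivation.commutator_apply, Derivation.zero_apply] at this
  exact sub_eq_zero.1 this

theorem polyLaplace_dirDeriv {p : MvPolynomial (Fin d) ℂ} (hp : polyLaplace p = 0)
    (x : Fin d → ℂ) : polyLaplace (dirDeriv x p) = 0 := by
  unfold polyLaplace at *
  simp only [pderiv_dirDeriv]
  rw [← map_sum, hp, map_zero]

/-- Euler's identity writes l p as the sum of the X_i ∂_i p; integration by parts turns this into
the Laplacian. -/
theorem gaussInt_harmonic {l : ℕ} (hl : l ≠ 0) {p : MvPolynomial (Fin d) ℂ}
    (hp : p.IsHomogeneous l) (hh : polyLaplace p = 0) : gaussInt p = 0 := by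
  have h := congrArg gaussIntL hp.sum_X_mul_pderiv
  rw [map_sum] at h
  have e : ∀ i, gaussIntL (X i * pderiv i p) = gaussIntL (pderiv i (pderiv i p)) := fun i =>
    gaussInt_X_mul i _
  simp only [e] at h
  rw [← map_sum, show ∑ i, pderiv i (pderiv i p) = 0 from hh, map_zero, map_nsmul] at h
  exact ((smul_eq_zero.1 h.symm).resolve_left hl)

theorem IsHomogeneous.dirDeriv {l : ℕ} {p : MvPolynomial (Fin d) ℂ} (hp : p.IsHomogeneous l)
    (x : Fin d → ℂ) : (dirDeriv x p).IsHomogeneous (l - 1) := by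
  rw [dirDeriv_apply]
  refine MvPolynomial.IsHomogeneous.sum _ _ _ fun i _ => ?_
  rw [smul_eq_C_mul]
  exact hp.pderiv.C_mul _

theorem eval_dirDeriv_self {l : ℕ} {p : MvPolynomial (Fin d) ℂ} (hp : p.IsHomogeneous l)
    (x : Fin d → ℂ) : eval x (dirDeriv x p) = l * eval x p := by
  have h := congrArg (eval x) hp.sum_X_mul_pderiv
  rw [map_sum, map_nsmul, nsmul_eq_mul] at h
  rw [← h, dirDeriv_apply, map_sum]
  refine Finset.sum_congr rfl fun i _ => ?_
  rw [smul_eval, map_mul, eval_X]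

/-- The coefficient of `(x · y) ^ k` against a harmonic polynomial of degree `l`. -/
def momentCoeff (l k : ℕ) : ℝ :=
  if l ≤ k ∧ Even (k - l) then k.factorial / (((k - l) / 2).factorial * 2 ^ ((k - l) / 2)) else 0

theorem momentCoeff_add (l m : ℕ) :
    momentCoeff l (l + 2 * m) = (l + 2 * m).factorial / (m.factorial * 2 ^ m) := by
  unfold momentCoeff
  rw [if_pos ⟨by omega, by simp⟩, show (l + 2 * m - l) / 2 = m by omega]

theorem momentCoeff_of_ne {l k : ℕ} (h : ∀ m, k ≠ l + 2 * m) : momentCoeff l k = 0 := by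
  unfold momentCoeff
  rw [if_neg]
  rintro ⟨h1, m, hm⟩
  exact h m (by omega)

theorem gaussInt_one : gaussInt (1 : MvPolynomial (Fin d) ℂ) =
    (((2 * Real.pi) ^ ((d : ℝ) / 2) : ℝ) : ℂ) := by
  unfold gaussInt
  have h := GaussianFourier.integral_rexp_neg_mul_sq_norm (V := EuclideanSpace ℝ (Fin d))
    (b := 1 / 2) (by norm_num)
  rw [finrank_euclideanSpace_fin, show Real.pi / (1 / 2) = 2 * Real.pi by ring] at h
  rw [← h, ← integral_complex_ofReal]
  congr 1
  funext y
  simp [polyVal, gaussWeight]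

/-- Integrating one factor x·y by parts gives k |x|² times the moment of order k − 1 plus the moment
of order k of ∂_x p. The latter is again harmonic, of degree l − 1, with value l p(x) at x. The
coefficients satisfy the matching recursion: k k₁ + l k₂ with the coefficients k₁ at (l, k − 1) and
k₂ at (l − 1, k). For l = 0 the second term has the factor 0, so truncated subtraction does no harm.
-/
theorem gaussInt_linForm_pow_mul {l : ℕ} {p : MvPolynomial (Fin d) ℂ} (hp : p.IsHomogeneous l)
    (hh : polyLaplace p = 0) (x : Fin d → ℂ) (k : ℕ) :
    gaussInt (linForm x ^ k * p) = (((2 * Real.pi) ^ ((d : ℝ) / 2) : ℝ) : ℂ) *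
      ((momentCoeff l k : ℝ) : ℂ) * (∑ i, x i ^ 2) ^ ((k - l) / 2) * eval x p := by
  induction k using Nat.strong_induction_on generalizing l p with
  | _ k ih =>
    rcases Nat.eq_zero_or_pos k with rfl | hk
    · rw [pow_zero, one_mul]
      rcases Nat.eq_zero_or_pos l with rfl | hl
      · have hC : p = C (coeff 0 p) := totalDegree_eq_zero_iff_eq_C.1
          (Nat.le_zero.1 hp.totalDegree_le)
        rw [hC, show (C (coeff 0 p) : MvPolynomial (Fin d) ℂ) = coeff 0 p • 1 by
          rw [smul_eq_C_mul, mul_one], gaussInt_smul, gaussInt_one]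
        simp [momentCoeff, smul_eval]
        ring
      · rw [gaussInt_harmonic hl.ne' hp hh, momentCoeff_of_ne fun m => by omega]
        simp
    · obtain ⟨k, rfl⟩ := Nat.exists_eq_succ_of_ne_zero hk.ne'
      have hD : dirDeriv x (linForm x ^ k * p) =
          ((k : ℂ) * ∑ i, x i ^ 2) • (linForm x ^ (k - 1) * p) + linForm x ^ k * dirDeriv x p := by
        rw [Derivation.leibniz, Derivation.leibniz_pow, dirDeriv_linForm]
        simp only [smul_eq_mul, nsmul_eq_mul, smul_eq_C_mul, map_mul, map_natCast]
        ring
      have hE := eval_dirDeriv_self hp x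
      rw [Nat.succ_eq_add_one, pow_succ', mul_assoc, gaussInt_linForm_mul, hD, gaussInt_add,
        gaussInt_smul, ih k (by omega) (IsHomogeneous.dirDeriv hp x) (polyLaplace_dirDeriv hh x),
        ih (k - 1) (by omega) hp hh, hE]
      by_cases hex : ∃ m, k + 1 = l + 2 * m
      · obtain ⟨m, hm⟩ := hex
        have e0 : (k + 1 - l) / 2 = m := by omega
        rw [hm, momentCoeff_add, ← hm, e0]
        have hfac : (((k + 1).factorial : ℕ) : ℂ) = ((k : ℂ) + 1) * (k.factorial : ℂ) := by
          rw [Nat.factorial_succ]; push_cast; ring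
        rcases Nat.eq_zero_or_pos l with rfl | hl
        · obtain ⟨m, rfl⟩ : ∃ m', m = m' + 1 := ⟨m - 1, by omega⟩
          have hk1 : k = 2 * m + 1 := by omega
          have e1 := momentCoeff_add 0 m
          have e2 : (k - 1 - 0) / 2 = m := by omega
          rw [zero_add] at e1
          rw [e2, show k - 1 = 2 * m by omega, e1, Nat.factorial_succ m]
          rw [hk1]
          rw [hk1, Nat.factorial_succ (2 * m)] at hfac
          push_cast at hfac ⊢
          rw [hfac, pow_succ, pow_succ]
          have : (m : ℂ) + 1 ≠ 0 := by exact_mod_cast Nat.succ_ne_zero m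
          field_simp
          ring
        · have e1 := momentCoeff_add (l - 1) m
          have e2 : (k - (l - 1)) / 2 = m := by omega
          rw [show l - 1 + 2 * m = k by omega] at e1
          rw [e2, e1]
          rcases Nat.eq_zero_or_pos m with rfl | hm0
          · rw [momentCoeff_of_ne fun m => by omega]
            have hl' : (l : ℂ) = k + 1 := by exact_mod_cast (by omega : l = k + 1)
            push_cast
            rw [hfac, hl']
            simp
            ring
          · obtain ⟨m, rfl⟩ : ∃ m', m = m' + 1 := ⟨m - 1, by omega⟩
            have e3 := momentCoeff_add l m
            obtain ⟨k', rfl⟩ : ∃ k', k = k' + 1 := ⟨k - 1, by omega⟩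
            rw [show l + 2 * m = k' by omega] at e3
            rw [Nat.add_sub_cancel, show (k' - l) / 2 = m by omega, e3, Nat.factorial_succ m]
            rw [Nat.factorial_succ k'] at hfac ⊢
            have hl' : (l : ℂ) = k' - 2 * m := by
              rw [eq_sub_iff_add_eq]; exact_mod_cast (by omega : l + 2 * m = k')
            push_cast at hfac ⊢
            rw [hfac, hl', pow_succ, pow_succ]
            have : (m : ℂ) + 1 ≠ 0 := by exact_mod_cast Nat.succ_ne_zero m
            field_simp
            ring
      · push Not at hex
        rw [momentCoeff_of_ne hex]
        rcases Nat.eq_zero_or_pos k with rfl | hk0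
        · rcases Nat.eq_zero_or_pos l with rfl | hl
          · simp
          · rw [momentCoeff_of_ne (l := l - 1) (k := 0) fun m hm => hex m (by omega)]
            simp
        · rw [momentCoeff_of_ne (l := l) (k := k - 1) fun m hm => hex (m + 1) (by omega)]
          rcases Nat.eq_zero_or_pos l with rfl | hl
          · simp
          · rw [momentCoeff_of_ne (l := l - 1) (k := k) fun m hm => hex m (by omega)]
            simp

end Gaussian

/-! ### Moments of spherical harmonics -/

section Moments

open MvPolynomial

variable {d : ℕ}

theorem integral_eq_sphere_mul_radial (hd : 1 ≤ d) {f : EuclideanSpace ℝ (Fin d) → ℂ}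
    {g : Sph d → ℂ} {h : ℝ → ℂ} (hf : ∀ r : ℝ, 0 < r → ∀ Ω : Sph d, f (r • Ω.1) = g Ω * h r) :
    ∫ y, f y = (∫ Ω, g Ω ∂(sphereMeasure d)) * ∫ r in Ioi (0 : ℝ), ((r ^ (d - 1) : ℝ) : ℂ) * h r := by
  have : Nonempty (Fin d) := ⟨⟨0, hd⟩⟩
  have h1 : ∫ y, f y = ∫ y : ({(0)}ᶜ : Set (EuclideanSpace ℝ (Fin d))), f y.1
      ∂(volume.comap Subtype.val) := by
    rw [integral_subtype_comap (measurableSet_singleton _).compl f, restrict_compl_singleton]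
  have h2 := (volume : Measure (EuclideanSpace ℝ (Fin d))).measurePreserving_homeomorphUnitSphereProd.integral_comp
    (Homeomorph.measurableEmbedding _) (fun p : Sph d × Ioi (0 : ℝ) => f (p.2.1 • p.1.1))
  have h3 : ∀ y : ({(0)}ᶜ : Set (EuclideanSpace ℝ (Fin d))),
      f (((homeomorphUnitSphereProd (EuclideanSpace ℝ (Fin d))) y).2.1 •
        ((homeomorphUnitSphereProd (EuclideanSpace ℝ (Fin d))) y).1.1) = f y.1 := fun y => by
    congr 1
    have hy : ‖y.1‖ ≠ 0 := norm_ne_zero_iff.2 y.2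
    simpa using smul_inv_smul₀ hy y.1
  simp only [h3] at h2
  rw [h1, h2]
  have h4 : ∀ p : Sph d × Ioi (0 : ℝ), f (p.2.1 • p.1.1) = g p.1 * h p.2.1 := fun p =>
    hf _ p.2.2 _
  simp only [h4]
  rw [integral_prod_mul (fun Ω => g Ω) (fun r : Ioi (0 : ℝ) => h r.1)]
  congr 1
  rw [finrank_euclideanSpace_fin]
  simp only [Measure.volumeIoiPow, ENNReal.ofReal]
  rw [integral_withDensity_eq_integral_smul, integral_subtype_comap measurableSet_Ioi
    fun a : ℝ => Real.toNNReal (a ^ (d - 1)) • h a]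
  · refine setIntegral_congr_fun measurableSet_Ioi fun r hr => ?_
    have : (0 : ℝ) ≤ r ^ (d - 1) := pow_nonneg (le_of_lt hr) _
    simp only [NNReal.smul_def, Real.coe_toNNReal _ this, Complex.real_smul]
  · exact (measurable_subtype_coe.pow_const _).real_toNNReal

theorem IsHomogeneous.eval_smul {n : ℕ} {p : MvPolynomial (Fin d) ℂ} (hp : p.IsHomogeneous n)
    (c : ℂ) (x : Fin d → ℂ) : eval (fun i => c * x i) p = c ^ n * eval x p := by
  rw [eval_eq, eval_eq, Finset.mul_sum]
  refine Finset.sum_congr rfl fun m hm => ?_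
  simp only [mul_pow, Finset.prod_mul_distrib]
  rw [Finset.prod_pow_eq_pow_sum, hp.degree_eq_sum_deg_support hm]
  ring

/-- For homogeneous p the Gaussian integral splits into the spherical integral and the integral of
r^(d−1+n) exp(−r²/2). Moments on the sphere are thus traded for Gaussian ones, where integration by
parts is available. -/
theorem gaussInt_eq_sphere (hd : 1 ≤ d) {n : ℕ} {p : MvPolynomial (Fin d) ℂ}
    (hp : p.IsHomogeneous n) :
    gaussInt p = (∫ Ω, polyVal p Ω.1 ∂(sphereMeasure d)) *
      ((2 ^ (((d : ℝ) + n) / 2 - 1) * Real.Gamma (((d : ℝ) + n) / 2) : ℝ) : ℂ) := by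
  unfold gaussInt
  rw [integral_eq_sphere_mul_radial hd (g := fun Ω => polyVal p Ω.1)
    (h := fun r => ((r ^ n * Real.exp (-(1 / 2) * r ^ 2) : ℝ) : ℂ))]
  · congr 1
    have h1 := integral_rpow_mul_exp_neg_mul_rpow (p := 2) (q := (d - 1 : ℝ) + n) (b := 1 / 2)
      (by norm_num) (by
        have : (1 : ℝ) ≤ d := by exact_mod_cast hd
        have : (0 : ℝ) ≤ n := by positivity
        linarith) (by norm_num)
    have h2 : ((d : ℝ) - 1 + n + 1) / 2 = ((d : ℝ) + n) / 2 := by ring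
    rw [h2, neg_div, h2] at h1
    have h3 : (2 : ℝ) ^ (((d : ℝ) + n) / 2 - 1) * Real.Gamma (((d : ℝ) + n) / 2) =
        (1 / 2 : ℝ) ^ (-(((d : ℝ) + n) / 2)) * (1 / 2) * Real.Gamma (((d : ℝ) + n) / 2) := by
      rw [Real.rpow_sub (by norm_num), Real.rpow_neg (by norm_num), one_div,
        Real.inv_rpow (by norm_num), inv_inv, Real.rpow_one]
      ring
    rw [h3, ← h1, ← integral_complex_ofReal]
    refine setIntegral_congr_fun measurableSet_Ioi fun r hr => ?_
    have hr' : (0 : ℝ) < r := hr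
    rw [← Complex.ofReal_mul, Real.rpow_add hr', ← Real.rpow_natCast, ← Real.rpow_natCast r n,
      Nat.cast_sub hd, Nat.cast_one, ← Real.rpow_natCast r 2]
    push_cast
    ring_nf
  · intro r hr Ω
    have h1 : polyVal p (r • Ω.1) = ((r : ℝ) : ℂ) ^ n * polyVal p Ω.1 := by
      unfold polyVal
      rw [← IsHomogeneous.eval_smul hp]
      simp
    have h2 : ‖r • Ω.1‖ = r := by
      rw [norm_smul, norm_eq_of_mem_sphere Ω, mul_one, Real.norm_of_nonneg hr.le]
    rw [h1, gaussWeight, h2]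
    push_cast
    ring

theorem isHomogeneous_linForm (x : Fin d → ℂ) : (linForm x).IsHomogeneous 1 := by
  unfold linForm
  refine MvPolynomial.IsHomogeneous.sum _ _ _ fun i _ => ?_
  rw [smul_eq_C_mul]
  exact (isHomogeneous_X _ _).C_mul _

/-- The moment `∫ (Ω · x) ^ k Y(Ω) dΩ` for `x = s Ω'`. -/
theorem integral_inner_pow_mul (hd : 1 ≤ d) {l : ℕ} {Y : Sph d → ℂ}
    (hY : IsSphericalHarmonic d l Y) (s : ℝ) (Ω' : Sph d) (k : ℕ) :
    ∫ Ω, (((s * inner ℝ Ω.1 Ω'.1) ^ k : ℝ) : ℂ) * Y Ω ∂(sphereMeasure d) =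
      (((2 * Real.pi) ^ ((d : ℝ) / 2) * momentCoeff l k /
        (2 ^ (((d : ℝ) + (k + l : ℕ)) / 2 - 1) * Real.Gamma (((d : ℝ) + (k + l : ℕ)) / 2)) *
          s ^ k : ℝ) : ℂ) * Y Ω' := by
  obtain ⟨p, hp, hh, hpY⟩ := hY
  have hpos : (0 : ℝ) < 2 ^ (((d : ℝ) + (k + l : ℕ)) / 2 - 1) *
      Real.Gamma (((d : ℝ) + (k + l : ℕ)) / 2) := by
    refine mul_pos (by positivity) (Real.Gamma_pos_of_pos ?_)
    have : (1 : ℝ) ≤ d := by exact_mod_cast hd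
    positivity
  set x : Fin d → ℂ := fun i => (s : ℂ) * ((Ω'.1 i : ℝ) : ℂ) with hx
  have h1 := gaussInt_linForm_pow_mul hp hh x k
  have hhom := ((isHomogeneous_linForm x).pow k).mul hp
  rw [one_mul] at hhom
  rw [gaussInt_eq_sphere hd hhom] at h1
  have hlin : ∀ Ω : Sph d, polyVal (linForm x ^ k * p) Ω.1 =
      (((s * inner ℝ Ω.1 Ω'.1) ^ k : ℝ) : ℂ) * Y Ω := fun Ω => by
    unfold polyVal
    rw [map_mul, map_pow, ← hpY]
    congr 1
    push_cast
    congr 1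
    unfold linForm
    rw [map_sum, PiLp.inner_apply]
    push_cast
    rw [Finset.mul_sum]
    refine Finset.sum_congr rfl fun i _ => ?_
    simp [hx]
    ring
  simp only [hlin] at h1
  have hx2 : ∑ i, x i ^ 2 = (s : ℂ) ^ 2 := by
    have h3 : ∑ i, (Ω'.1 i) ^ 2 = 1 := by
      rw [← EuclideanSpace.real_norm_sq_eq, norm_eq_of_mem_sphere Ω', one_pow]
    simp only [hx, mul_pow]
    rw [← Finset.mul_sum]
    have h4 : ∑ i, ((Ω'.1 i : ℝ) : ℂ) ^ 2 = 1 := by exact_mod_cast h3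
    rw [h4, mul_one]
  have hxe : eval x p = (s : ℂ) ^ l * Y Ω' := by
    rw [hx, IsHomogeneous.eval_smul hp, ← hpY]
  rw [hx2, hxe] at h1
  have hne : (((2 ^ (((d : ℝ) + (k + l : ℕ)) / 2 - 1) *
      Real.Gamma (((d : ℝ) + (k + l : ℕ)) / 2)) : ℝ) : ℂ) ≠ 0 := by
    exact_mod_cast hpos.ne'
  rw [← mul_right_inj' hne, mul_comm, h1]
  set G : ℝ := 2 ^ (((d : ℝ) + (k + l : ℕ)) / 2 - 1) * Real.Gamma (((d : ℝ) + (k + l : ℕ)) / 2)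
    with hG
  by_cases hk : l ≤ k ∧ Even (k - l)
  · obtain ⟨m, hm⟩ := hk.2
    have hk' : k = l + 2 * m := by omega
    have : (k - l) / 2 = m := by omega
    rw [this]
    have h5 : s ^ k = (s ^ 2) ^ m * s ^ l := by rw [hk', ← pow_mul, ← pow_add, add_comm]
    rw [h5]
    push_cast
    field_simp
  · have : momentCoeff l k = 0 := if_neg hk
    rw [this]; simp

end Moments

/-! ### The kernel on modes -/

theorem IsSphericalHarmonic.continuous {d l : ℕ} {Y : Sph d → ℂ} (hY : IsSphericalHarmonic d l Y) :
    Continuous Y := by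
  obtain ⟨p, _, _, hp⟩ := hY
  rw [funext hp]
  exact (continuous_polyVal p).comp continuous_subtype_val

theorem IsSphericalHarmonic.exists_norm_le {d l : ℕ} {Y : Sph d → ℂ}
    (hY : IsSphericalHarmonic d l Y) : ∃ B, 0 ≤ B ∧ ∀ Ω, ‖Y Ω‖ ≤ B := by
  obtain ⟨B, hB⟩ := isCompact_univ.exists_bound_of_continuousOn hY.continuous.continuousOn
  exact ⟨max B 0, le_max_right _ _, fun Ω => (hB Ω (mem_univ _)).trans (le_max_left _ _)⟩

/-- The factor of `s ^ k` in the moment `∫ (s Ω · Ω') ^ k Y(Ω) dΩ`. -/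
def sphereMoment (d l k : ℕ) : ℝ :=
  (2 * Real.pi) ^ ((d : ℝ) / 2) * momentCoeff l k /
    (2 ^ (((d : ℝ) + (k + l : ℕ)) / 2 - 1) * Real.Gamma (((d : ℝ) + (k + l : ℕ)) / 2))

theorem integral_coneCos_pow_mul {d : ℕ} (hd : 1 ≤ d) {l : ℕ} {Y : Sph d → ℂ}
    (hY : IsSphericalHarmonic d l Y) (ρ' : ℝ) (Ω' : Sph d) (k : ℕ) :
    ∫ Ω, ((coneCos ρ' Ω' Ω ^ k : ℝ) : ℂ) * Y Ω ∂(sphereMeasure d) =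
      ((sphereMoment d l k * Real.sin ρ' ^ k : ℝ) : ℂ) * Y Ω' :=
  integral_inner_pow_mul hd hY (Real.sin ρ') Ω' k

theorem sphereMoment_succ {d : ℕ} (hd : 1 ≤ d) (l m : ℕ) :
    4 * ((m : ℝ) + 1) * (paramC d l + m) * sphereMoment d l (l + 2 * (m + 1)) =
      ((l + 2 * m : ℕ) + 1) * ((l + 2 * m : ℕ) + 2) * sphereMoment d l (l + 2 * m) := by
  have hc := paramC_pos hd l
  have e1 : ∀ m : ℕ, ((d : ℝ) + (l + 2 * m + l : ℕ)) / 2 = paramC d l + m := fun m => by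
    unfold paramC; push_cast; ring
  have hcm : 0 < paramC d l + m := by positivity
  have hG := Real.Gamma_pos_of_pos hcm
  unfold sphereMoment
  rw [momentCoeff_add, momentCoeff_add, e1, e1]
  push_cast
  rw [← add_assoc, Real.Gamma_add_one hcm.ne', show paramC d l + m + 1 - 1 = paramC d l + m - 1 + 1 by ring,
    Real.rpow_add_one two_ne_zero, show l + 2 * (m + 1) = l + 2 * m + 1 + 1 by ring,
    Nat.factorial_succ, Nat.factorial_succ, Nat.factorial_succ]
  have hp : (0 : ℝ) < 2 ^ (paramC d l + m - 1) := by positivity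
  push_cast
  field_simp
  ring

/-- At k = l + 2m the Taylor recursion contributes 4 (a + m)(b + m) with the parameters at −ν, and
the moment recursion contributes 1/(4 (m + 1)(c + m)); the common factor (k + 1)(k + 2) cancels.
What is left is the hypergeometric recursion. -/
theorem gapCoeff_mul_sphereMoment {d : ℕ} (hd : 1 ≤ d) (ν ω : ℝ) (l m : ℕ) :
    gapCoeff ω (ν - d / 2) (l + 2 * m) * sphereMoment d l (l + 2 * m) =
      gapCoeff ω (ν - d / 2) l * sphereMoment d l l *
        hypCoeff (paramA d (-ν) l ω) (paramB d (-ν) l ω) (paramC d l) m := by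
  induction m with
  | zero => simp
  | succ m ih =>
    have hc := paramC_pos hd l
    have hcm : 0 < paramC d l + m := by positivity
    have hm : (0 : ℝ) < m + 1 := by positivity
    have h1 := gapCoeff_succ_succ ω (ν - d / 2) (l + 2 * m)
    have h2 := sphereMoment_succ hd l m
    have h3 := hypCoeff_succ hc (paramA d (-ν) l ω) (paramB d (-ν) l ω) m
    have hk1 : (0 : ℝ) < (l + 2 * m : ℕ) + 1 := by positivity
    have hk2 : (0 : ℝ) < (l + 2 * m : ℕ) + 2 := by positivity
    rw [show l + 2 * (m + 1) = l + 2 * m + 2 by ring] at h2 ⊢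
    have h4 : (((l + 2 * m : ℕ) : ℝ) - (ν - d / 2)) ^ 2 - ω ^ 2 =
        4 * (paramA d (-ν) l ω + m) * (paramB d (-ν) l ω + m) := by
      unfold paramA paramB weight; push_cast; ring
    rw [h4] at h1
    set g := gapCoeff ω (ν - d / 2) (l + 2 * m)
    set g' := gapCoeff ω (ν - d / 2) (l + 2 * m + 2)
    set M := sphereMoment d l (l + 2 * m)
    set M' := sphereMoment d l (l + 2 * m + 2)
    set K := ((l + 2 * m : ℕ) : ℝ)
    have hne : 4 * ((m : ℝ) + 1) * (paramC d l + m) * ((K + 1) * (K + 2)) ≠ 0 := by positivity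
    refine mul_left_cancel₀ hne ?_
    linear_combination h1 * (4 * ((m : ℝ) + 1) * (paramC d l + m) * M') +
      (4 * (paramA d (-ν) l ω + m) * (paramB d (-ν) l ω + m)) * g * h2 +
      (4 * (paramA d (-ν) l ω + m) * (paramB d (-ν) l ω + m)) * ((K + 1) * (K + 2)) * ih -
      4 * ((K + 1) * (K + 2)) * (gapCoeff ω (ν - d / 2) l * sphereMoment d l l) * h3

/-- The Taylor series is integrated term by term, dominated by its absolute series at sin ρ' < 1.
Only the orders l + 2m survive, and they form the series in sin² ρ'. -/
theorem integral_modeGap_coneCos {d : ℕ} (hd : 1 ≤ d) (ν ω : ℝ) {l : ℕ} {Y : Sph d → ℂ}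
    (hY : IsSphericalHarmonic d l Y) {ρ' : ℝ} (h0 : 0 ≤ ρ') (h1 : ρ' < Real.pi / 2) (Ω' : Sph d) :
    ∫ Ω, modeGap ω (ν - d / 2) (coneCos ρ' Ω' Ω) * Y Ω ∂(sphereMeasure d) =
      ((gapCoeff ω (ν - d / 2) l * sphereMoment d l l * (Real.sin ρ' ^ l *
        hyp (paramA d (-ν) l ω) (paramB d (-ν) l ω) (paramC d l) (Real.sin ρ' ^ 2)) : ℝ) : ℂ) *
        Y Ω' := by
  have hs := sin_mem_Ico h0 h1
  obtain ⟨B, hB0, hB⟩ := hY.exists_norm_le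
  set g := gapCoeff ω (ν - d / 2) with hg
  have hgs := unitSummable_gapCoeff ω (ν - d / 2)
  have hσ : ∀ Ω, |coneCos ρ' Ω' Ω| ≤ Real.sin ρ' := fun Ω => by
    have := abs_coneCos_le ρ' Ω' Ω
    rwa [abs_of_nonneg hs.1] at this
  have hsum1 : HasSum (fun k => ∫ Ω, ((g k : ℝ) : ℂ) * (((coneCos ρ' Ω' Ω ^ k : ℝ) : ℂ) * Y Ω)
      ∂(sphereMeasure d))
      (∫ Ω, modeGap ω (ν - d / 2) (coneCos ρ' Ω' Ω) * Y Ω ∂(sphereMeasure d)) := by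
    refine hasSum_integral_of_dominated_convergence (fun k _ => |g k| * Real.sin ρ' ^ k * B)
      (fun k => ?_) (fun k => Eventually.of_forall fun Ω => ?_) (Eventually.of_forall fun Ω => ?_)
      (integrable_const _) (Eventually.of_forall fun Ω => ?_)
    · exact (continuous_const.mul ((Complex.continuous_ofReal.comp
        ((continuous_coneCos ρ' Ω').pow k)).mul hY.continuous)).aestronglyMeasurable
    · rw [norm_mul, norm_mul, Complex.norm_real, Complex.norm_real, Real.norm_eq_abs,
        Real.norm_eq_abs, abs_pow, ← mul_assoc]
      exact mul_le_mul (mul_le_mul_of_nonneg_left (pow_le_pow_left₀ (abs_nonneg _) (hσ Ω) k)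
        (abs_nonneg _)) (hB Ω) (norm_nonneg _) (mul_nonneg (abs_nonneg _) (pow_nonneg hs.1 k))
    · exact (hgs _ hs.1 hs.2).mul_right B
    · rw [modeGap_eq_powSum ω _ (coneCos_mem h0 h1 Ω' Ω)]
      have h := (hasSum_powSum hgs ((hσ Ω).trans_lt hs.2)).mapL Complex.ofRealCLM
      refine (h.mul_right (Y Ω)).congr_fun fun k => ?_
      simp [hg, mul_assoc]
  have hterm : ∀ k, ∫ Ω, ((g k : ℝ) : ℂ) * (((coneCos ρ' Ω' Ω ^ k : ℝ) : ℂ) * Y Ω)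
      ∂(sphereMeasure d) = ((g k * sphereMoment d l k * Real.sin ρ' ^ k : ℝ) : ℂ) * Y Ω' := fun k => by
    rw [integral_const_mul, integral_coneCos_pow_mul hd hY]
    push_cast; ring
  simp only [hterm] at hsum1
  have hinj : Function.Injective fun m : ℕ => l + 2 * m := fun a b h => by
    simp only at h; omega
  rw [← hinj.hasSum_iff] at hsum1
  · refine hsum1.unique ?_
    have h2 : |Real.sin ρ' ^ 2| < 1 := by
      rw [abs_of_nonneg (sq_nonneg _)]
      nlinarith [hs.1, hs.2]
    have h := (((hasSum_powSum (unitSummable_hypCoeff (paramA d (-ν) l ω) (paramB d (-ν) l ω)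
      (paramC d l)) h2).mul_left (g l * sphereMoment d l l * Real.sin ρ' ^ l)).mapL
        Complex.ofRealCLM).mul_right (Y Ω')
    rw [hyp, ← mul_assoc]
    refine h.congr_fun fun m => ?_
    simp only [Function.comp_apply, Complex.ofRealCLM_apply]
    rw [hg, gapCoeff_mul_sphereMoment hd]
    push_cast
    ring
  · intro k hk
    have : momentCoeff l k = 0 := momentCoeff_of_ne fun m hm => hk ⟨m, hm.symm⟩
    simp [sphereMoment, this]

/-- The value of the kernel on a mode relative to the regular radial solution. -/
def kernelFactor (d : ℕ) (ν : ℝ) (l : ℕ) (ω : ℝ) : ℝ :=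
  (-1) ^ (l + (d - 1) / 2) * Real.pi * Real.Gamma (1 + ν) * (Real.Gamma (paramC d l))⁻¹ *
    ((Real.Gamma (1 - paramA d (-ν) l ω))⁻¹ * (Real.Gamma (1 - paramB d (-ν) l ω))⁻¹)

theorem kernelScale_mul (d : ℕ) (ν : ℝ) (l : ℕ) (ω : ℝ) :
    kernelScale d ν * (gapCoeff ω (ν - d / 2) l * sphereMoment d l l) = kernelFactor d ν l ω := by
  unfold kernelScale gapCoeff sphereMoment kernelFactor gapValue
  have e0 := momentCoeff_add l 0
  rw [mul_zero, add_zero, Nat.factorial_zero, Nat.cast_one, pow_zero] at e0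
  have hA : 1 - paramA d (-ν) l ω = 1 + (ν - d / 2 - l + ω) / 2 := by
    unfold paramA weight; ring
  have hB : 1 - paramB d (-ν) l ω = 1 + (ν - d / 2 - l - ω) / 2 := by
    unfold paramB weight; ring
  have hC : ((d : ℝ) + (l + l : ℕ)) / 2 = paramC d l := by unfold paramC; push_cast; ring
  rw [e0, hA, hB, hC, add_comm ν 1]
  have hfac : (l.factorial : ℝ) ≠ 0 := by exact_mod_cast l.factorial_ne_zero
  have hpi : Real.pi ^ ((d : ℝ) / 2) ≠ 0 := (Real.rpow_pos_of_pos Real.pi_pos _).ne'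
  have h2 : (2 : ℝ) ^ (ν - d / 2 - 1) * 2 ^ (-(ν - d / 2 - l)) * 2 ^ ((d : ℝ) / 2) =
      2 ^ (paramC d l - 1) := by
    rw [← Real.rpow_add two_pos, ← Real.rpow_add two_pos]
    congr 1
    unfold paramC; ring
  have p1 : (0 : ℝ) < 2 ^ (ν - d / 2 - 1) := by positivity
  have p2 : (0 : ℝ) < 2 ^ (-(ν - d / 2 - l)) := by positivity
  have p3 : (0 : ℝ) < 2 ^ ((d : ℝ) / 2) := by positivity
  rw [Real.mul_rpow two_pos.le Real.pi_pos.le, pow_add, ← h2]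
  generalize (2 : ℝ) ^ (ν - d / 2 - 1) = X1 at *
  generalize (2 : ℝ) ^ (-(ν - d / 2 - l)) = X2 at *
  generalize (2 : ℝ) ^ ((d : ℝ) / 2) = X3 at *
  generalize Real.pi ^ ((d : ℝ) / 2) = P at *
  generalize Real.Gamma (1 + (ν - d / 2 - l + ω) / 2) = G1
  generalize Real.Gamma (1 + (ν - d / 2 - l - ω) / 2) = G2
  field_simp

/-- The computation produces the regular solution at −ν: the prefactor is the power Δ₋ of cos ρ',
with parameters at −ν. This is the regular solution at ν by `regularRadial_neg`. No condition on the
frequency is needed. -/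
theorem contKernel_boundaryMode {d : ℕ} (hd : 1 ≤ d) {ν : ℝ} (hν : -1 < ν) (ω : ℝ) {l : ℕ}
    {Y : Sph d → ℂ} (hY : IsSphericalHarmonic d l Y) (t' : ℝ) {ρ' : ℝ} (h0 : 0 ≤ ρ')
    (h1 : ρ' < Real.pi / 2) (Ω' : Sph d) :
    contKernel d ν t' ρ' Ω' (boundaryMode ω Y) =
      ((kernelFactor d ν l ω * regularRadial d ν l ω ρ' : ℝ) : ℂ) * boundaryMode ω Y t' Ω' := by
  have hc := cos_pos_of_bulk h0 h1
  unfold contKernel sphereGap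
  have hd0 : (0 : ℝ) ≤ d := by positivity
  have hl : -(((d + 2 : ℕ) : ℝ) + 1) < ν - d / 2 := by push_cast; linarith
  have e : ∀ Ω, gapFun (d + 2) (ν - d / 2) (coneCos ρ' Ω' Ω)
      (fun τ => boundaryMode ω Y (t' + τ) Ω) =
      expMode ω t' * (modeGap ω (ν - d / 2) (coneCos ρ' Ω' Ω) * Y Ω) := fun Ω => by
    have : (fun τ => boundaryMode ω Y (t' + τ) Ω) =
        fun τ => (expMode ω t' * Y Ω) * expMode ω τ := by
      funext τ
      change expMode ω (t' + τ) * Y Ω = _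
      rw [expMode_add]; ring
    rw [this, gapFun_const_mul, modeGap_eq hl (coneCos_mem h0 h1 Ω' Ω)]
    ring
  simp only [e]
  rw [integral_const_mul, integral_modeGap_coneCos hd ν ω hY h0 h1, regularRadial_neg hd ν l ω h0 h1,
    regularRadial_eq, ← kernelScale_mul, show -(ν - (d : ℝ) / 2) = weight d (-ν) by unfold weight; ring]
  change _ = _ * (expMode ω t' * Y Ω')
  push_cast
  ring

/-! ### Normalisation of the kernel -/

theorem Gamma_inv_mul_Gamma_inv (x : ℝ) :
    (Real.Gamma x)⁻¹ * (Real.Gamma (1 - x))⁻¹ = Real.sin (Real.pi * x) / Real.pi := by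
  rw [← mul_inv, Real.Gamma_mul_Gamma_one_sub, inv_div]

/-- For odd d the parameter c is half an odd integer. Its sign is exactly the one in `kernelFactor`;
this is how the parity of d enters the normalisation. -/
theorem sin_pi_mul_paramC {d : ℕ} (hd : Odd d) (l : ℕ) :
    Real.sin (Real.pi * paramC d l) = (-1) ^ (l + (d - 1) / 2) := by
  obtain ⟨k, rfl⟩ := hd
  rw [show (2 * k + 1 - 1) / 2 = k by omega, show Real.pi * paramC (2 * k + 1) l =
    Real.pi / 2 + (l + k : ℕ) * Real.pi by unfold paramC; push_cast; ring,
    Real.sin_add_nat_mul_pi, Real.sin_pi_div_two, mul_one]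

theorem cos_pi_mul_paramC {d : ℕ} (hd : Odd d) (l : ℕ) : Real.cos (Real.pi * paramC d l) = 0 := by
  have h := Real.sin_sq_add_cos_sq (Real.pi * paramC d l)
  rw [sin_pi_mul_paramC hd, ← pow_mul, mul_comm, pow_mul] at h
  simpa using h

theorem ascPochhammer_mul_Gamma {x : ℝ} (hx : 0 < x) (n : ℕ) :
    (ascPochhammer ℝ n).eval x * Real.Gamma x = Real.Gamma (x + n) := by
  induction n with
  | zero => simp
  | succ n ih =>
    rw [ascPochhammer_succ_eval, mul_right_comm, ih]
    push_cast
    rw [← add_assoc, Real.Gamma_add_one (by positivity)]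
    ring

/-- At a Dirichlet frequency the two Gamma arguments are 1 + ν + n and 1 − (c + n), in either order.
The reflection formula moves the second to the numerator as Γ(c + n), and the Pochhammer ratio
cancels everything but a squared sign. -/
theorem kernelFactor_mul_dirichletRatio {d : ℕ} (hd : Odd d) {ν : ℝ} (hν : -1 < ν) (s : ℤˣ)
    (n l : ℕ) :
    kernelFactor d ν l (dirichletFrequency d ν s n l) * dirichletRatio d ν n l = 1 := by
  have hc := paramC_pos hd.pos l
  have h1 : (Real.Gamma (1 - paramA d (-ν) l (dirichletFrequency d ν s n l)))⁻¹ *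
      (Real.Gamma (1 - paramB d (-ν) l (dirichletFrequency d ν s n l)))⁻¹ =
      (Real.Gamma (1 + ν + n))⁻¹ * (Real.Gamma (1 - (paramC d l + n)))⁻¹ := by
    rcases Int.units_eq_one_or s with rfl | rfl
    · congr 3 <;>
      · simp only [paramA, paramB, paramC, dirichletFrequency, weight]; push_cast; ring
    · rw [mul_comm]
      congr 3 <;>
      · simp only [paramA, paramB, paramC, dirichletFrequency, weight]; push_cast; ring
  have hν' : 0 < 1 + ν := by linarith
  have g1 := Real.Gamma_pos_of_pos hν'
  have g2 := Real.Gamma_pos_of_pos hc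
  have g3 := Real.Gamma_pos_of_pos (by positivity : 0 < 1 + ν + n)
  have g4 := Real.Gamma_pos_of_pos (by positivity : 0 < paramC d l + n)
  have e1 := ascPochhammer_mul_Gamma hν' n
  have e2 := ascPochhammer_mul_Gamma hc n
  have e3 := Gamma_inv_mul_Gamma_inv (paramC d l + n)
  have e4 : Real.sin (Real.pi * (paramC d l + n)) = (-1) ^ n * (-1) ^ (l + (d - 1) / 2) := by
    rw [mul_add, mul_comm Real.pi (n : ℝ), Real.sin_add_nat_mul_pi, sin_pi_mul_paramC hd]
  have hone : ((-1 : ℝ) ^ n * (-1) ^ (l + (d - 1) / 2)) ^ 2 = 1 := by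
    rw [← pow_add, ← pow_mul, mul_comm, pow_mul]; simp
  have hp2 := ascPochhammer_pos n (paramC d l) hc
  have hpi := Real.pi_ne_zero
  rw [e4] at e3
  have e5 : (Real.Gamma (1 - (paramC d l + n)))⁻¹ =
      (-1) ^ n * (-1) ^ (l + (d - 1) / 2) / Real.pi * Real.Gamma (paramC d l + n) := by
    rw [← e3]; field_simp
  unfold kernelFactor dirichletRatio
  rw [h1, e5, ← e1, ← e2]
  have hp1 := ascPochhammer_pos n (1 + ν) hν'
  field_simp
  linear_combination hone

/-- The heart of the Robin case, valid at every frequency. The Gamma functions pair off by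
reflection into sin πa sin πb − sin π(c − a) sin π(c − b) = sin πc sin πν over sin πν, and the
remaining sin πc cancels the sign of `kernelFactor`. -/
theorem connection_kernelFactor {d : ℕ} (hd : Odd d) {ν : ℝ} (h0 : 0 < ν) (h1 : ν < 1) (l : ℕ)
    (ω : ℝ) {A B : ℝ} (h : ∀ ρ ∈ Ioo 0 (Real.pi / 2),
      regularRadial d ν l ω ρ = A * neumannRadial d ν l ω ρ + B * dirichletRadial d ν l ω ρ) :
    B * kernelFactor d ν l ω + A * kernelFactor d (-ν) l ω = 1 := by
  obtain ⟨rfl, rfl⟩ := radial_connection hd.pos h0 h1 l ω h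
  have g2 := Real.Gamma_pos_of_pos (paramC_pos hd.pos l)
  have hsum := paramA_add_paramB_sub d ν l ω
  unfold kernelFactor
  rw [neg_neg, paramA_neg, paramB_neg, ← sub_eq_add_neg]
  set c := paramC d l with hc
  set a := paramA d ν l ω
  set b := paramB d ν l ω
  set ε : ℝ := (-1) ^ (l + (d - 1) / 2) with hε
  have hε2 : ε * ε = 1 := by
    rw [hε, ← pow_add, ← two_mul, pow_mul]; simp
  have sa := Gamma_inv_mul_Gamma_inv a
  have sb := Gamma_inv_mul_Gamma_inv b
  have sca := Gamma_inv_mul_Gamma_inv (c - a)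
  have scb := Gamma_inv_mul_Gamma_inv (c - b)
  have hsin : 0 < Real.sin (Real.pi * ν) :=
    Real.sin_pos_of_pos_of_lt_pi (by positivity) (by nlinarith [Real.pi_pos])
  have hpi := Real.pi_ne_zero
  have gν : Real.Gamma ν * Real.Gamma (1 - ν) = Real.pi / Real.sin (Real.pi * ν) :=
    Real.Gamma_mul_Gamma_one_sub ν
  have gν' : Real.Gamma (-ν) * Real.Gamma (1 + ν) = -(Real.pi / Real.sin (Real.pi * ν)) := by
    have := Real.Gamma_mul_Gamma_one_sub (-ν)
    rw [sub_neg_eq_add, mul_neg, Real.sin_neg, div_neg] at this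
    exact this
  have key : Real.sin (Real.pi * a) * Real.sin (Real.pi * b) -
      Real.sin (Real.pi * (c - a)) * Real.sin (Real.pi * (c - b)) = ε * Real.sin (Real.pi * ν) := by
    have hs := sin_pi_mul_paramC hd l
    have hcos := cos_pi_mul_paramC hd l
    rw [← hc] at hs hcos
    have hb : b = c + ν - a := by linarith
    have e1 : Real.pi * b = Real.pi * c + (Real.pi * ν - Real.pi * a) := by rw [hb]; ring
    have e2 : Real.pi * (c - b) = Real.pi * a - Real.pi * ν := by rw [hb]; ring
    rw [e1, e2, mul_sub, Real.sin_add, Real.sin_sub (Real.pi * c), hs, hcos, Real.cos_sub,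
      Real.sin_sub (Real.pi * a), zero_mul, zero_mul, add_zero, sub_zero]
    have := Real.sin_sq_add_cos_sq (Real.pi * a)
    linear_combination ε * Real.sin (Real.pi * ν) * this
  have hfin : ε * Real.pi * (Real.pi / Real.sin (Real.pi * ν)) *
      ((Real.sin (Real.pi * a) / Real.pi) * (Real.sin (Real.pi * b) / Real.pi) -
      (Real.sin (Real.pi * (c - a)) / Real.pi) * (Real.sin (Real.pi * (c - b)) / Real.pi)) = 1 := by
    field_simp
    rw [key, ← mul_assoc, hε2, one_mul]
  rw [← sa, ← sb, ← sca, ← scb] at hfin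
  have gc : Real.Gamma c * (Real.Gamma c)⁻¹ = 1 := mul_inv_cancel₀ g2.ne'
  set P := (Real.Gamma (c - a))⁻¹ * (Real.Gamma (1 - (c - a)))⁻¹ *
    ((Real.Gamma (c - b))⁻¹ * (Real.Gamma (1 - (c - b)))⁻¹) with hP
  set Q := (Real.Gamma a)⁻¹ * (Real.Gamma (1 - a))⁻¹ *
    ((Real.Gamma b)⁻¹ * (Real.Gamma (1 - b))⁻¹) with hQ
  have l1 : Real.Gamma c * Real.Gamma (-ν) * ((Real.Gamma (c - a))⁻¹ * (Real.Gamma (c - b))⁻¹) *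
      (ε * Real.pi * Real.Gamma (1 + ν) * (Real.Gamma c)⁻¹ *
        ((Real.Gamma (1 - (c - b)))⁻¹ * (Real.Gamma (1 - (c - a)))⁻¹)) =
      (Real.Gamma c * (Real.Gamma c)⁻¹) * ε * Real.pi * (Real.Gamma (-ν) * Real.Gamma (1 + ν)) * P := by
    rw [hP]; ring
  have l2 : Real.Gamma c * Real.Gamma ν * ((Real.Gamma a)⁻¹ * (Real.Gamma b)⁻¹) *
      (ε * Real.pi * Real.Gamma (1 - ν) * (Real.Gamma c)⁻¹ *
        ((Real.Gamma (1 - a))⁻¹ * (Real.Gamma (1 - b))⁻¹)) =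
      (Real.Gamma c * (Real.Gamma c)⁻¹) * ε * Real.pi * (Real.Gamma ν * Real.Gamma (1 - ν)) * Q := by
    rw [hQ]; ring
  rw [l1, l2, gν, gν', gc]
  linear_combination hfin

/-! ### Boundary fields -/

section BoundaryField

variable {d : ℕ} {ι : Type} {l : ι → ℕ} {ω : ι → ℝ} {Y : ι → Sph d → ℂ}

theorem norm_boundaryMode (ω : ℝ) (Y : Sph d → ℂ) (t : ℝ) (Ω : Sph d) :
    ‖boundaryMode ω Y t Ω‖ = ‖Y Ω‖ := by
  change ‖expMode ω t * Y Ω‖ = _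
  rw [norm_mul, norm_expMode, one_mul]

theorem IsRapidlyDecreasing.freq_mul (h : IsRapidlyDecreasing (fun i => |ω i| + (l i : ℝ)) Y) (k : ℕ) :
    IsRapidlyDecreasing (fun i => |ω i| + (l i : ℝ)) fun i Ω => (-Complex.I * ω i) ^ k * Y i Ω := by
  intro m
  obtain ⟨b, hb, hb'⟩ := h (m + k)
  refine ⟨b, hb, fun i Ω => le_trans ?_ (hb' i Ω)⟩
  have h0 : 0 ≤ (l i : ℝ) := by positivity
  rw [norm_mul, norm_pow, norm_mul, norm_neg, Complex.norm_I, one_mul, Complex.norm_real,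
    Real.norm_eq_abs, ← mul_assoc, pow_add]
  gcongr
  linarith [abs_nonneg (ω i)]

theorem IsRapidlyDecreasing.bound {w : ι → ℝ} (h : IsRapidlyDecreasing w Y) :
    ∃ b : ι → ℝ, Summable b ∧ ∀ i Ω, ‖Y i Ω‖ ≤ b i := by
  obtain ⟨b, hb, hb'⟩ := h 0
  exact ⟨b, hb, fun i Ω => by simpa using hb' i Ω⟩

theorem IsRapidlyDecreasing.summable_boundaryMode {w : ι → ℝ} (h : IsRapidlyDecreasing w Y)
    (ω : ι → ℝ) (t : ℝ) (Ω : Sph d) : Summable fun i => boundaryMode (ω i) (Y i) t Ω := by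
  obtain ⟨b, hb, hb'⟩ := h.bound
  exact hb.of_norm_bounded fun i => by rw [norm_boundaryMode]; exact hb' i Ω

theorem hasDerivAt_boundaryField (h : IsRapidlyDecreasing (fun i => |ω i| + (l i : ℝ)) Y) (t : ℝ)
    (Ω : Sph d) : HasDerivAt (fun t => boundaryField ω Y t Ω)
      (boundaryField ω (fun i Ω => (-Complex.I * ω i) * Y i Ω) t Ω) t := by
  have h1 := h.freq_mul 1
  simp only [pow_one] at h1
  obtain ⟨b, hb, hb'⟩ := h1.bound
  refine hasDerivAt_tsum (g := fun i t => boundaryMode (ω i) (Y i) t Ω)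
    (g' := fun i t => boundaryMode (ω i) (fun Ω => (-Complex.I * ω i) * Y i Ω) t Ω) hb
    (fun i t => ?_) (fun i t => ?_) (h.summable_boundaryMode ω 0 Ω) t
  · have h2 := (hasDerivAt_expMode (ω i) t).mul_const (Y i Ω)
    refine h2.congr_deriv ?_
    change _ = expMode (ω i) t * _
    ring
  · rw [norm_boundaryMode]; exact hb' i Ω

theorem iteratedDeriv_boundaryField (h : IsRapidlyDecreasing (fun i => |ω i| + (l i : ℝ)) Y) (k : ℕ)
    (Ω : Sph d) : iteratedDeriv k (fun t => boundaryField ω Y t Ω) =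
      fun t => boundaryField ω (fun i Ω => (-Complex.I * ω i) ^ k * Y i Ω) t Ω := by
  induction k with
  | zero => simp
  | succ k ih =>
    rw [iteratedDeriv_succ, ih]
    funext t
    rw [(hasDerivAt_boundaryField (h.freq_mul k) t Ω).deriv]
    congr 2
    funext i Ω
    rw [pow_succ]; ring

theorem continuous_boundaryField (hY : ∀ i, Continuous (Y i)) {w : ι → ℝ}
    (h : IsRapidlyDecreasing w Y) :
    Continuous fun p : ℝ × Sph d => boundaryField ω Y p.1 p.2 := by
  obtain ⟨b, hb, hb'⟩ := h.bound
  refine continuous_tsum (fun i => ?_) hb fun i p => by rw [norm_boundaryMode]; exact hb' i p.2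
  exact ((isSmooth_expMode (ω i)).continuous.comp continuous_fst).mul ((hY i).comp continuous_snd)

theorem isBoundaryFunction_boundaryField (hY : ∀ i, Continuous (Y i))
    (h : IsRapidlyDecreasing (fun i => |ω i| + (l i : ℝ)) Y) :
    IsBoundaryFunction (boundaryField ω Y) := by
  refine ⟨fun Ω => contDiff_of_differentiable_iteratedDeriv fun m _ t => ?_, fun k => ?_⟩
  · rw [iteratedDeriv_boundaryField h]
    exact (hasDerivAt_boundaryField (h.freq_mul m) t Ω).differentiableAt
  · simp only [iteratedDeriv_boundaryField h]
    exact continuous_boundaryField (fun i => continuous_const.mul (hY i)) (h.freq_mul k)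

theorem isBoundaryFunction_boundaryMode {ω : ℝ} {Y : Sph d → ℂ} (hY : Continuous Y) :
    IsBoundaryFunction (boundaryMode ω Y) := by
  refine ⟨fun Ω => (isSmooth_expMode ω).mul contDiff_const, fun k => ?_⟩
  have : ∀ Ω, iteratedDeriv k (fun t => boundaryMode ω Y t Ω) =
      fun t => (-Complex.I * ω) ^ k * expMode ω t * Y Ω := fun Ω => by
    have h := iteratedDeriv_expMode k ω
    funext t
    change iteratedDeriv k (fun t => expMode ω t * Y Ω) t = _
    simp only [mul_comm (expMode ω _)]
    rw [iteratedDeriv_const_mul_field, h]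
    ring
  simp only [this]
  exact (continuous_const.mul ((isSmooth_expMode ω).continuous.comp continuous_fst)).mul
    (hY.comp continuous_snd)

/-- The tail is expressed as a field over the same index type with some amplitudes set to zero, so
that estimates for fields apply to tails. -/
theorem boundaryField_eq_sum_add (h : IsRapidlyDecreasing (fun i => |ω i| + (l i : ℝ)) Y)
    (s : Finset ι) :
    boundaryField ω Y = fun t Ω => ∑ i ∈ s, boundaryMode (ω i) (Y i) t Ω +
      boundaryField ω ((s : Set ι)ᶜ.indicator Y) t Ω := by
  funext t Ω
  unfold boundaryField
  rw [← (h.summable_boundaryMode ω t Ω).sum_add_tsum_compl (s := s),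
    tsum_subtype ((s : Set ι)ᶜ) fun i => boundaryMode (ω i) (Y i) t Ω]
  congr 2
  funext i
  by_cases hi : i ∈ s <;> simp [hi, boundaryMode]

theorem IsRapidlyDecreasing.indicator {w : ι → ℝ} (h : IsRapidlyDecreasing w Y)
    (s : Set ι) : IsRapidlyDecreasing w (s.indicator Y) := by
  intro k
  obtain ⟨b, hb, hb'⟩ := h k
  refine ⟨fun i => |b i|, hb.abs, fun i Ω => ?_⟩
  by_cases hi : i ∈ s
  · rw [indicator_of_mem hi]; exact (hb' i Ω).trans (le_abs_self _)
  · rw [indicator_of_notMem hi]; simp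

end BoundaryField

/-! ### The kernel on boundary fields -/

theorem rpow_le_inv_pow {c x : ℝ} {n : ℕ} (hc : 0 < c) (hc1 : c ≤ 1) (hx : -x ≤ n) :
    c ^ x ≤ c⁻¹ ^ n := by
  rw [← Real.rpow_natCast, Real.inv_rpow hc.le, ← Real.rpow_neg hc.le]
  exact Real.rpow_le_rpow_of_exponent_ge hc hc1 (by linarith)

section Kernel

variable {d : ℕ} {ν : ℝ}

theorem contKernel_gap_pos (hν : -1 < ν) : 0 < ν - (d : ℝ) / 2 + (d + 2 : ℕ) := by
  have : (0 : ℝ) ≤ d := by positivity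
  push_cast; linarith

theorem contKernel_gap_lt (hν : -1 < ν) : -(((d + 2 : ℕ) : ℝ) + 1) < ν - (d : ℝ) / 2 := by
  have := contKernel_gap_pos (d := d) hν; linarith

theorem contKernel_add (hν : -1 < ν) (t' : ℝ) {ρ' : ℝ} (h0 : 0 ≤ ρ') (h1 : ρ' < Real.pi / 2)
    (Ω' : Sph d) {f g : ℝ → Sph d → ℂ} (hf : IsBoundaryFunction f) (hg : IsBoundaryFunction g) :
    contKernel d ν t' ρ' Ω' (fun t Ω => f t Ω + g t Ω) =
      contKernel d ν t' ρ' Ω' f + contKernel d ν t' ρ' Ω' g := by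
  have hσ := coneCos_mem h0 h1 Ω'
  unfold contKernel sphereGap
  rw [← mul_add, ← integral_add
    (integrable_gapFun (contKernel_gap_pos hν) (continuous_coneCos ρ' Ω') hσ (hf.shift t'))
    (integrable_gapFun (contKernel_gap_pos hν) (continuous_coneCos ρ' Ω') hσ (hg.shift t'))]
  congr 2
  funext Ω
  exact gapFun_add (contKernel_gap_lt hν) (hσ Ω) ((hf.shift t').isSmooth Ω)
    ((hg.shift t').isSmooth Ω)

theorem contKernel_zero (t' ρ' : ℝ) (Ω' : Sph d) :
    contKernel d ν t' ρ' Ω' (fun _ _ => 0) = 0 := by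
  have h : ∀ s : ℝ, gapFun (d + 2) (ν - d / 2) s (fun _ => 0) = 0 := fun s => by
    have := gapFun_const_mul (d + 2) (ν - d / 2) s 0 fun _ => 0
    simpa using this
  simp [contKernel, sphereGap, h]

theorem isBoundaryFunction_sum {ι : Type} {f : ι → ℝ → Sph d → ℂ}
    (hf : ∀ i, IsBoundaryFunction (f i)) (s : Finset ι) :
    IsBoundaryFunction fun t Ω => ∑ i ∈ s, f i t Ω := by
  classical
  induction s using Finset.induction_on with
  | empty =>
    have := (isBoundaryFunction_one d).const_mul (c := fun _ => 0) continuous_const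
    simpa using this
  | insert i s hi ih =>
    simp only [Finset.sum_insert hi]
    exact (hf i).add ih

theorem contKernel_sum (hν : -1 < ν) (t' : ℝ) {ρ' : ℝ} (h0 : 0 ≤ ρ') (h1 : ρ' < Real.pi / 2)
    (Ω' : Sph d) {ι : Type} {f : ι → ℝ → Sph d → ℂ} (hf : ∀ i, IsBoundaryFunction (f i))
    (s : Finset ι) : contKernel d ν t' ρ' Ω' (fun t Ω => ∑ i ∈ s, f i t Ω) =
      ∑ i ∈ s, contKernel d ν t' ρ' Ω' (f i) := by
  classical
  induction s using Finset.induction_on with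
  | empty => simp only [Finset.sum_empty]; exact contKernel_zero t' ρ' Ω'
  | insert i s hi ih =>
    simp only [Finset.sum_insert hi]
    rw [contKernel_add hν t' h0 h1 Ω' (hf i) (isBoundaryFunction_sum hf s), ih]

/-- The continued kernel is bounded by finitely many time derivatives. -/
theorem norm_contKernel_le (d : ℕ) (hν : -1 < ν) :
    ∃ (C : ℝ) (P : ℕ), 0 ≤ C ∧ ∀ (t' ρ' : ℝ), 0 ≤ ρ' → ρ' < Real.pi / 2 → ∀ (Ω' : Sph d)
      (f : ℝ → Sph d → ℂ), IsBoundaryFunction f → ∀ B : ℝ,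
      (∀ k ≤ d + 2, ∀ t Ω, ‖iteratedDeriv (2 * k) (fun t => f t Ω) t‖ ≤ B) →
      ‖contKernel d ν t' ρ' Ω' f‖ ≤ C * (Real.cos ρ')⁻¹ ^ P * B := by
  obtain ⟨C, hC, h⟩ := norm_gapFun_le (d + 2) (contKernel_gap_pos (d := d) hν)
  obtain ⟨p, hp⟩ := exists_nat_ge (ν - (d : ℝ) / 2)
  refine ⟨|kernelScale d ν| * C * (sphereMeasure d).real univ, p + 2 * (d + 2), by positivity, ?_⟩
  intro t' ρ' h0 h1 Ω' f hf B hB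
  have hc := cos_pos_of_bulk h0 h1
  have hσ := coneCos_mem h0 h1 Ω'
  have hB0 : 0 ≤ B := (norm_nonneg _).trans (hB 0 (Nat.zero_le _) 0 Ω')
  have hder : ∀ Ω (k : ℕ), iteratedDeriv k (fun τ => f (t' + τ) Ω) =
      fun τ => iteratedDeriv k (fun t => f t Ω) (t' + τ) := fun Ω k =>
    iteratedDeriv_comp_const_add k (fun t => f t Ω) t'
  have hgap : ∀ Ω, ‖gapFun (d + 2) (ν - d / 2) (coneCos ρ' Ω' Ω) (fun τ => f (t' + τ) Ω)‖ ≤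
      C * (Real.cos ρ')⁻¹ ^ (2 * (d + 2)) * B := fun Ω => by
    refine (h _ (hσ Ω) _ ((hf.shift t').isSmooth Ω) B fun k hk τ _ => ?_).trans ?_
    · rw [hder]; exact hB k hk _ Ω
    -- As |s| ≤ sin ρ', each factor 1/(1 − s²) costs at most cos^(−2) ρ', uniformly in Ω.
    · have hsq : Real.cos ρ' ^ 2 ≤ 1 - coneCos ρ' Ω' Ω ^ 2 := by
        have h2 : coneCos ρ' Ω' Ω ^ 2 ≤ Real.sin ρ' ^ 2 := sq_le_sq.2 (abs_coneCos_le ρ' Ω' Ω)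
        nlinarith [Real.sin_sq_add_cos_sq ρ']
      have hinv : (1 - coneCos ρ' Ω' Ω ^ 2)⁻¹ ≤ (Real.cos ρ')⁻¹ ^ 2 := by
        rw [inv_pow]; exact inv_anti₀ (by positivity) hsq
      rw [pow_mul (Real.cos ρ')⁻¹]
      refine mul_le_mul_of_nonneg_right (mul_le_mul_of_nonneg_left ?_ hC) hB0
      exact pow_le_pow_left₀ (inv_nonneg.2 (one_sub_sq_pos (hσ Ω)).le) hinv _
  have hint := norm_integral_le_of_norm_le_const (μ := sphereMeasure d)
    (Eventually.of_forall hgap)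
  unfold contKernel sphereGap
  rw [norm_mul, Complex.norm_real, Real.norm_eq_abs, abs_mul,
    abs_of_pos (Real.rpow_pos_of_pos hc _)]
  have hpow : Real.cos ρ' ^ (-(ν - (d : ℝ) / 2)) ≤ (Real.cos ρ')⁻¹ ^ p :=
    rpow_le_inv_pow hc (Real.cos_le_one _) (by linarith)
  calc _ ≤ (|kernelScale d ν| * (Real.cos ρ')⁻¹ ^ p) *
        (C * (Real.cos ρ')⁻¹ ^ (2 * (d + 2)) * B * (sphereMeasure d).real univ) := by
        refine mul_le_mul (mul_le_mul_of_nonneg_left hpow (abs_nonneg _)) hint (norm_nonneg _) ?_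
        positivity
    _ = _ := by rw [pow_add]; ring

/-- The bound on a superposition of modes. -/
theorem norm_contKernel_boundaryField_le (d : ℕ) (hν : -1 < ν) :
    ∃ (C : ℝ) (P : ℕ), 0 ≤ C ∧ ∀ (t' ρ' : ℝ), 0 ≤ ρ' → ρ' < Real.pi / 2 → ∀ (Ω' : Sph d)
      (ι : Type) (l : ι → ℕ) (ω : ι → ℝ) (Y : ι → Sph d → ℂ) (β : ι → ℝ), (∀ i, Continuous (Y i)) →
      IsRapidlyDecreasing (fun i => |ω i| + (l i : ℝ)) Y → Summable β →
      (∀ i Ω, (1 + (|ω i| + l i)) ^ (2 * (d + 2)) * ‖Y i Ω‖ ≤ β i) →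
      ‖contKernel d ν t' ρ' Ω' (boundaryField ω Y)‖ ≤ C * (Real.cos ρ')⁻¹ ^ P * ∑' i, β i := by
  obtain ⟨C, P, hC, h⟩ := norm_contKernel_le d hν
  refine ⟨C, P, hC, ?_⟩
  intro t' ρ' h0 h1 Ω' ι l ω Y β hY hR hβ hb
  refine h t' ρ' h0 h1 Ω' _ (isBoundaryFunction_boundaryField hY hR) _ fun k hk t Ω => ?_
  rw [iteratedDeriv_boundaryField hR]
  refine tsum_of_norm_bounded hβ.hasSum fun i => ?_
  rw [norm_boundaryMode, norm_mul, norm_pow, norm_mul, norm_neg, Complex.norm_I, one_mul,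
    Complex.norm_real, Real.norm_eq_abs]
  refine le_trans ?_ (hb i Ω)
  have hl : (0 : ℝ) ≤ l i := by positivity
  have ha := abs_nonneg (ω i)
  refine mul_le_mul_of_nonneg_right ?_ (norm_nonneg _)
  exact (pow_le_pow_left₀ ha (by linarith) _).trans (pow_le_pow_right₀ (by linarith) (by omega))

theorem norm_contKernel_boundaryMode_le (d : ℕ) (hν : -1 < ν) :
    ∃ (C : ℝ) (P : ℕ), 0 ≤ C ∧ ∀ (t' ρ' : ℝ), 0 ≤ ρ' → ρ' < Real.pi / 2 → ∀ (Ω' : Sph d)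
      (ω N : ℝ) (Y : Sph d → ℂ) (β : ℝ), Continuous Y → 1 + |ω| ≤ N →
      (∀ Ω, N ^ (2 * (d + 2)) * ‖Y Ω‖ ≤ β) →
      ‖contKernel d ν t' ρ' Ω' (boundaryMode ω Y)‖ ≤ C * (Real.cos ρ')⁻¹ ^ P * β := by
  obtain ⟨C, P, hC, h⟩ := norm_contKernel_le d hν
  refine ⟨C, P, hC, ?_⟩
  intro t' ρ' h0 h1 Ω' ω N Y β hY hN hb
  refine h t' ρ' h0 h1 Ω' _ (isBoundaryFunction_boundaryMode hY) _ fun k hk t Ω => ?_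
  have e : iteratedDeriv (2 * k) (fun t => boundaryMode ω Y t Ω) t =
      (-Complex.I * ω) ^ (2 * k) * expMode ω t * Y Ω := by
    change iteratedDeriv (2 * k) (fun t => expMode ω t * Y Ω) t = _
    simp only [mul_comm (expMode ω _)]
    rw [iteratedDeriv_const_mul_field, iteratedDeriv_expMode]
    ring
  rw [e, norm_mul, norm_mul, norm_expMode, norm_pow, norm_mul, norm_neg, Complex.norm_I, one_mul,
    Complex.norm_real, Real.norm_eq_abs, mul_one]
  refine le_trans ?_ (hb Ω)
  have ha := abs_nonneg ω
  refine mul_le_mul_of_nonneg_right ?_ (norm_nonneg _)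
  exact (pow_le_pow_left₀ ha (by linarith) _).trans (pow_le_pow_right₀ (by linarith) (by omega))

/-- Finite additivity leaves the kernel of a tail, which the derivative bound controls by the tail
of a summable series. -/
theorem hasSum_contKernel (hν : -1 < ν) (t' : ℝ) {ρ' : ℝ} (h0 : 0 ≤ ρ') (h1 : ρ' < Real.pi / 2)
    (Ω' : Sph d) {ι : Type} {l : ι → ℕ} {ω : ι → ℝ} {Y : ι → Sph d → ℂ}
    (hY : ∀ i, Continuous (Y i)) (hR : IsRapidlyDecreasing (fun i => |ω i| + (l i : ℝ)) Y) :
    HasSum (fun i => contKernel d ν t' ρ' Ω' (boundaryMode (ω i) (Y i)))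
      (contKernel d ν t' ρ' Ω' (boundaryField ω Y)) := by
  obtain ⟨C, P, hC, h⟩ := norm_contKernel_boundaryField_le d hν
  obtain ⟨b, hb, hb'⟩ := hR (2 * (d + 2))
  have hb0 : ∀ i, 0 ≤ b i := fun i => by
    have hl : (0 : ℝ) ≤ l i := by positivity
    have ha := abs_nonneg (ω i)
    exact le_trans (by positivity) (hb' i Ω')
  have hmode : ∀ i, IsBoundaryFunction (boundaryMode (ω i) (Y i)) := fun i =>
    isBoundaryFunction_boundaryMode (hY i)
  have hind : ∀ s : Set ι, ∀ i, Continuous (s.indicator Y i) := fun s i => by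
    by_cases hi : i ∈ s
    · rw [indicator_of_mem hi]; exact hY i
    · rw [indicator_of_notMem hi]; exact continuous_const
  have hdiff : ∀ s : Finset ι, ‖∑ i ∈ s, contKernel d ν t' ρ' Ω' (boundaryMode (ω i) (Y i)) -
      contKernel d ν t' ρ' Ω' (boundaryField ω Y)‖ ≤
      C * (Real.cos ρ')⁻¹ ^ P * ∑' i : {x // x ∉ s}, b i := fun s => by
    have e : contKernel d ν t' ρ' Ω' (boundaryField ω Y) =
        ∑ i ∈ s, contKernel d ν t' ρ' Ω' (boundaryMode (ω i) (Y i)) +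
        contKernel d ν t' ρ' Ω' (boundaryField ω ((s : Set ι)ᶜ.indicator Y)) := by
      conv_lhs => rw [boundaryField_eq_sum_add hR s]
      rw [contKernel_add hν t' h0 h1 Ω' (isBoundaryFunction_sum hmode s)
        (isBoundaryFunction_boundaryField (hind _) (hR.indicator _)),
        contKernel_sum hν t' h0 h1 Ω' hmode]
    rw [e, sub_add_cancel_left, norm_neg]
    have e2 : ∑' i : {x // x ∉ s}, b i = ∑' i, (s : Set ι)ᶜ.indicator b i :=
      tsum_subtype ((s : Set ι)ᶜ) b
    rw [e2]
    refine h t' ρ' h0 h1 Ω' ι l ω _ _ (hind _) (hR.indicator _) (hb.indicator _) fun i Ω => ?_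
    by_cases hi : i ∈ (s : Set ι)ᶜ
    · rw [indicator_of_mem hi, indicator_of_mem hi]; exact hb' i Ω
    · rw [indicator_of_notMem hi, indicator_of_notMem hi]; simp
  have hlim : Tendsto (fun s : Finset ι => C * (Real.cos ρ')⁻¹ ^ P * ∑' i : {x // x ∉ s}, b i)
      atTop (𝓝 0) := by
    simpa using (tendsto_tsum_compl_atTop_zero b).const_mul (C * (Real.cos ρ')⁻¹ ^ P)
  exact tendsto_iff_norm_sub_tendsto_zero.2
    (squeeze_zero (fun _ => norm_nonneg _) hdiff hlim)

end Kernel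

/-! ### Bulk modes -/

theorem bulkMode_dirichletRadial {d : ℕ} (hd : Odd d) {ν : ℝ} (hν : -1 < ν) (s : ℤˣ) (n : ℕ) {l : ℕ}
    {Y : Sph d → ℂ} (hY : IsSphericalHarmonic d l Y) (t : ℝ) {ρ : ℝ} (h0 : 0 ≤ ρ)
    (h1 : ρ < Real.pi / 2) (Ω : Sph d) :
    bulkMode (dirichletRadial d ν) l (dirichletFrequency d ν s n l) Y t ρ Ω =
      contKernel d ν t ρ Ω (boundaryMode (dirichletFrequency d ν s n l) Y) := by
  rw [contKernel_boundaryMode hd.pos hν _ hY t h0 h1,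
    regularRadial_dirichletFrequency hd.pos hν, ← mul_assoc,
    kernelFactor_mul_dirichletRatio hd hν, one_mul]
  unfold bulkMode boundaryMode
  ring

/-- The combined kernel gives (cos γ k(ν) + sin γ k(−ν))(A Φ₄ + B Φ₃) with k the kernel factor. By A
cos γ = B sin γ and B k(ν) + A k(−ν) = 1 this is cos γ Φ₃ + sin γ Φ₄. The connection formula is
assumed for ρ > 0 only, whence the restriction. -/
theorem bulkMode_robinRadial {d : ℕ} (hd : Odd d) {ν γ : ℝ} (hν : 0 < ν) (hν1 : ν < 1) {l : ℕ}
    {ω : ℝ} (hω : IsRobinFrequency d ν γ l ω) {Y : Sph d → ℂ} (hY : IsSphericalHarmonic d l Y)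
    (t : ℝ) {ρ : ℝ} (h0 : 0 < ρ) (h1 : ρ < Real.pi / 2) (Ω : Sph d) :
    bulkMode (robinRadial d ν γ) l ω Y t ρ Ω =
      (Real.cos γ : ℂ) * contKernel d ν t ρ Ω (boundaryMode ω Y) +
      (Real.sin γ : ℂ) * contKernel d (-ν) t ρ Ω (boundaryMode ω Y) := by
  obtain ⟨A, B, hAB, hγ⟩ := hω
  have hxy := connection_kernelFactor hd hν hν1 l ω hAB
  rw [contKernel_boundaryMode hd.pos (by linarith) _ hY t h0.le h1,
    contKernel_boundaryMode hd.pos (by linarith : -1 < -ν) _ hY t h0.le h1,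
    ← regularRadial_neg hd.pos ν l ω h0.le h1, hAB ρ ⟨h0, h1⟩]
  have key : robinRadial d ν γ l ω ρ = Real.cos γ * (kernelFactor d ν l ω *
      (A * neumannRadial d ν l ω ρ + B * dirichletRadial d ν l ω ρ)) +
      Real.sin γ * (kernelFactor d (-ν) l ω *
        (A * neumannRadial d ν l ω ρ + B * dirichletRadial d ν l ω ρ)) := by
    unfold robinRadial
    linear_combination (-(Real.cos γ * dirichletRadial d ν l ω ρ +
        Real.sin γ * neumannRadial d ν l ω ρ)) * hxy +
      (kernelFactor d (-ν) l ω * dirichletRadial d ν l ω ρ -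
        kernelFactor d ν l ω * neumannRadial d ν l ω ρ) * hγ
  unfold bulkMode
  change _ = _ * (_ * (Complex.exp _ * Y Ω)) + _ * (_ * (Complex.exp _ * Y Ω))
  rw [key]
  push_cast
  ring

/-! ### Limits of mode sums at the boundary -/

theorem tendsto_cos_nhdsLT : Tendsto Real.cos (𝓝[<] (Real.pi / 2)) (𝓝 0) := by
  rw [← Real.cos_pi_div_two]
  exact Real.continuous_cos.continuousAt.mono_left nhdsWithin_le_nhds

/-- A dominated convergence criterion at the boundary: terms are close to their limits when
`N i * cos ρ` is small, and grow polynomially otherwise. -/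
theorem tendsto_tsum_boundary {d : ℕ} {ι : Type} {w : ι → ℝ} (hw : ∀ i, 0 ≤ w i)
    {Y : ι → Sph d → ℂ} (hR : IsRapidlyDecreasing w Y) (Ω' : Sph d) {F : ι → ℝ → ℂ} {L : ι → ℂ}
    {C₀ C₁ C₂ C₃ δ : ℝ} {P q : ℕ} (hC₀ : 0 < C₀) (hC₁ : 0 ≤ C₁) (hC₂ : 0 ≤ C₂)
    (hδ : 0 < δ) (hL : ∀ i, ‖L i‖ ≤ C₁ * ‖Y i Ω'‖)
    (hfar : ∀ i, ∀ ρ ∈ Ioo 0 (Real.pi / 2), ∀ β : ℝ, (∀ Ω, (1 + w i) ^ q * ‖Y i Ω‖ ≤ β) →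
      ‖F i ρ‖ ≤ C₂ * (Real.cos ρ)⁻¹ ^ P * β)
    (hnear : ∀ i, ∀ ρ ∈ Ioo 0 (Real.pi / 2),
      (C₀ * (1 + w i)) ^ 2 * Real.cos ρ ^ 2 ≤ 1 / 2 →
      ‖F i ρ - L i‖ ≤ C₃ * ((1 + w i) ^ 2 * Real.cos ρ ^ δ) * ‖Y i Ω'‖) :
    Tendsto (fun ρ => ∑' i, F i ρ) (𝓝[<] (Real.pi / 2)) (𝓝 (∑' i, L i)) := by
  have hIoo : ∀ᶠ ρ in 𝓝[<] (Real.pi / 2), ρ ∈ Ioo 0 (Real.pi / 2) :=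
    Ioo_mem_nhdsLT (by positivity)
  -- The exponents pay for three things: q for the hypothesis of `hfar`, P for replacing 1/cos ρ by
  -- a multiple of 1 + w, and 2 for the error in `hnear`.
  obtain ⟨b, hb, hb'⟩ := hR (P + q + 2)
  refine tendsto_tsum_of_dominated_convergence
    (bound := fun i => (C₁ + |C₃| + C₂ * (2 * C₀) ^ P) * b i) (hb.mul_left _) (fun i => ?_) ?_
  · rw [tendsto_iff_norm_sub_tendsto_zero]
    have hsmall : ∀ᶠ ρ in 𝓝[<] (Real.pi / 2),
        (C₀ * (1 + w i)) ^ 2 * Real.cos ρ ^ 2 ≤ 1 / 2 := by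
      have h1 := (tendsto_cos_nhdsLT.pow 2).const_mul ((C₀ * (1 + w i)) ^ 2)
      rw [zero_pow two_ne_zero, mul_zero] at h1
      exact h1.eventually (eventually_le_nhds (by norm_num))
    have h2 : Tendsto (fun ρ => C₃ * ((1 + w i) ^ 2 * Real.cos ρ ^ δ) * ‖Y i Ω'‖)
        (𝓝[<] (Real.pi / 2)) (𝓝 0) := by
      have h3 := tendsto_cos_nhdsLT.rpow_const (p := δ) (Or.inr hδ.le)
      rw [Real.zero_rpow hδ.ne'] at h3
      simpa using ((h3.const_mul ((1 + w i) ^ 2)).const_mul C₃).mul_const ‖Y i Ω'‖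
    refine squeeze_zero' (Eventually.of_forall fun _ => norm_nonneg _) ?_ h2
    filter_upwards [hIoo, hsmall] with ρ hρ hs
    exact hnear i ρ hρ hs
  · filter_upwards [hIoo] with ρ hρ i
    have hc : 0 < Real.cos ρ := cos_pos_of_bulk hρ.1.le hρ.2
    have hN : 1 ≤ 1 + w i := by linarith [hw i]
    have hN0 : 0 < 1 + w i := by linarith
    have hbΩ := hb' i Ω'
    have hb0 : 0 ≤ b i := le_trans (by positivity) hbΩ
    have hmono : ∀ m ≤ P + q + 2, ∀ Ω, (1 + w i) ^ m * ‖Y i Ω‖ ≤ b i := fun m hm Ω =>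
      (mul_le_mul_of_nonneg_right (pow_le_pow_right₀ hN hm) (norm_nonneg _)).trans (hb' i Ω)
    have hpos : 0 ≤ C₂ * (2 * C₀) ^ P := by positivity
    rcases le_or_gt ((C₀ * (1 + w i)) ^ 2 * Real.cos ρ ^ 2) (1 / 2) with hs | hs
    · have h1 := hnear i ρ hρ hs
      have hY0 : ‖Y i Ω'‖ ≤ b i := by simpa using hmono 0 (by omega) Ω'
      have hY2 := hmono 2 (by omega) Ω'
      have hcδ : Real.cos ρ ^ δ ≤ 1 := Real.rpow_le_one hc.le (Real.cos_le_one _) hδ.le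
      have hcδ0 : 0 < Real.cos ρ ^ δ := Real.rpow_pos_of_pos hc _
      calc ‖F i ρ‖ ≤ ‖F i ρ - L i‖ + ‖L i‖ := by
            simpa using norm_add_le (F i ρ - L i) (L i)
        _ ≤ C₃ * ((1 + w i) ^ 2 * Real.cos ρ ^ δ) * ‖Y i Ω'‖ + C₁ * ‖Y i Ω'‖ :=
            add_le_add h1 (hL i)
        _ ≤ |C₃| * b i + C₁ * b i := by
            refine add_le_add ?_ (mul_le_mul_of_nonneg_left hY0 hC₁)
            have h4 : 0 ≤ (1 + w i) ^ 2 * ‖Y i Ω'‖ := by positivity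
            calc C₃ * ((1 + w i) ^ 2 * Real.cos ρ ^ δ) * ‖Y i Ω'‖
                = C₃ * (Real.cos ρ ^ δ * ((1 + w i) ^ 2 * ‖Y i Ω'‖)) := by ring
              _ ≤ |C₃| * (1 * b i) := by
                  refine mul_le_mul (le_abs_self _) (mul_le_mul hcδ hY2 h4 zero_le_one)
                    (by positivity) (abs_nonneg _)
              _ = _ := by ring
        _ ≤ _ := by nlinarith [mul_nonneg hpos hb0]
    · have h1 := hfar i ρ hρ (b i / (1 + w i) ^ P) fun Ω => by
        rw [le_div_iff₀ (by positivity)]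
        have := hmono (P + q) (by omega) Ω
        rw [pow_add] at this
        linarith
      -- Where the expansion near the boundary fails, 1/cos ρ is bounded by the scale of the mode,
      -- so rapid decrease of the amplitudes compensates its powers.
      have h2 : (Real.cos ρ)⁻¹ ≤ 2 * C₀ * (1 + w i) := by
        rw [inv_le_comm₀ hc (by positivity), inv_le_iff_one_le_mul₀ (by positivity)]
        by_contra hlt
        push Not at hlt
        have h3 : 0 ≤ Real.cos ρ * (2 * C₀ * (1 + w i)) := by positivity
        nlinarith
      calc ‖F i ρ‖ ≤ C₂ * (Real.cos ρ)⁻¹ ^ P * (b i / (1 + w i) ^ P) := h1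
        _ ≤ C₂ * (2 * C₀ * (1 + w i)) ^ P * (b i / (1 + w i) ^ P) := by gcongr
        _ = C₂ * (2 * C₀) ^ P * b i := by rw [mul_pow]; field_simp
        _ ≤ _ := by
            have : 0 ≤ (C₁ + |C₃|) * b i := by positivity
            linarith

theorem abs_dirichletRadial_near {d : ℕ} {ν : ℝ} (hν : -1 < ν) (l : ℕ) (ω : ℝ) {ρ : ℝ}
    (hρ : ρ ∈ Ioo 0 (Real.pi / 2))
    (hs : ((1 + d + |ν|) * (1 + (|ω| + l))) ^ 2 * Real.cos ρ ^ 2 ≤ 1 / 2) :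
    |dirichletRadial d ν l ω ρ / Real.cos ρ ^ weight d ν - 1| ≤
      3 * hyp 1 1 (1 + ν) (1 / 2) * (1 + d + |ν|) ^ 2 *
        ((1 + (|ω| + l)) ^ 2 * Real.cos ρ ^ (2 : ℝ)) := by
  have hl : (0 : ℝ) ≤ l := by positivity
  have hd : (0 : ℝ) ≤ d := by positivity
  have hω := abs_nonneg ω
  have hνa := abs_nonneg ν
  have hM : 1 + d + |ν| + (|ω| + l) ≤ (1 + d + |ν|) * (1 + (|ω| + l)) := by nlinarith
  have hω1 := neg_abs_le ω
  have hω2 := le_abs_self ω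
  have hν1 := neg_abs_le ν
  have hν2 := le_abs_self ν
  refine (abs_dirichletRadial_div_sub_one_le hν hρ.1.le hρ.2 (by linarith) ?_ ?_ (by linarith)
    hs).trans (le_of_eq ?_)
  · unfold paramA weight
    rw [abs_le]; constructor <;> linarith
  · unfold paramB weight
    rw [abs_le]; constructor <;> linarith
  · rw [show (2 : ℝ) = ((2 : ℕ) : ℝ) by norm_num, Real.rpow_natCast]
    ring

/-! ### Dirichlet fields -/

theorem IsAmplitude.rapid {d : ℕ} {Y : ModeLabel → Sph d → ℂ} (hY : IsAmplitude d Y) (ν : ℝ) :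
    IsRapidlyDecreasing (fun i : ModeLabel => |dirichletFreq d ν i| + ((i.2.2 : ℕ) : ℝ)) Y := by
  intro k
  obtain ⟨b, hb, hb'⟩ := hY.2 k
  refine ⟨fun i => (3 + d + |ν|) ^ k * b i, hb.mul_left _, fun i Ω => ?_⟩
  refine le_trans ?_ (mul_le_mul_of_nonneg_left (hb' i Ω) (by positivity))
  rw [← mul_assoc, ← mul_pow]
  refine mul_le_mul_of_nonneg_right (pow_le_pow_left₀ (by positivity) ?_ k) (norm_nonneg _)
  have h1 : |dirichletFreq d ν i| ≤ d + |ν| + i.2.2 + 2 * i.2.1 := by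
    unfold dirichletFreq dirichletFrequency weight
    have hu : |((i.1 : ℤ) : ℝ)| = 1 := by
      rcases Int.units_eq_one_or i.1 with h | h <;> rw [h] <;> simp
    rw [abs_mul, hu, one_mul]
    have hν1 := neg_abs_le ν
    have hν2 := le_abs_self ν
    have : (0 : ℝ) ≤ d := by positivity
    have : (0 : ℝ) ≤ i.2.2 := by positivity
    have : (0 : ℝ) ≤ i.2.1 := by positivity
    rw [abs_le]; constructor <;> linarith
  have h2 : (0 : ℝ) ≤ i.2.2 := by positivity
  have h3 : (0 : ℝ) ≤ i.2.1 := by positivity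
  have h4 : (0 : ℝ) ≤ d + |ν| := by positivity
  nlinarith [mul_nonneg h4 h2, mul_nonneg h4 h3]

theorem IsAmplitude.isBoundaryFunction {d : ℕ} {Y : ModeLabel → Sph d → ℂ} (hY : IsAmplitude d Y)
    (ν : ℝ) : IsBoundaryFunction (boundaryField (dirichletFreq d ν) Y) :=
  isBoundaryFunction_boundaryField (l := fun i : ModeLabel => i.2.2) (fun i => (hY.1 i).continuous)
    (hY.rapid ν)

theorem hasSum_dirichletField {d : ℕ} (hd : Odd d) {ν : ℝ} (hν : -1 < ν)
    {Y : ModeLabel → Sph d → ℂ} (hY : IsAmplitude d Y) (t' : ℝ) {ρ' : ℝ} (h0 : 0 ≤ ρ')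
    (h1 : ρ' < Real.pi / 2) (Ω' : Sph d) :
    HasSum (fun i : ModeLabel => bulkMode (dirichletRadial d ν) i.2.2 (dirichletFreq d ν i) (Y i)
      t' ρ' Ω') (contKernel d ν t' ρ' Ω' (boundaryField (dirichletFreq d ν) Y)) := by
  refine (hasSum_contKernel hν t' h0 h1 Ω' (l := fun i : ModeLabel => i.2.2)
    (fun i => (hY.1 i).continuous) (hY.rapid ν)).congr_fun fun i => ?_
  exact bulkMode_dirichletRadial hd hν i.1 i.2.1 (hY.1 i) t' h0 h1 Ω'

/-- Away from the boundary the modes need a bound polynomial in frequency and degree. As each mode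
is the kernel applied to its boundary mode, the kernel estimate provides it, and no estimate of the
hypergeometric polynomials is needed. -/
theorem tendsto_dirichletField {d : ℕ} (hd : Odd d) {ν : ℝ} (hν : -1 < ν)
    {Y : ModeLabel → Sph d → ℂ} (hY : IsAmplitude d Y) (t' : ℝ) (Ω' : Sph d) :
    Tendsto (fun ρ => dirichletField d Y ν t' ρ Ω' / ((Real.cos ρ ^ weight d ν : ℝ) : ℂ))
      (𝓝[<] (Real.pi / 2)) (𝓝 (boundaryField (dirichletFreq d ν) Y t' Ω')) := by
  obtain ⟨C, P, hC, h⟩ := norm_contKernel_boundaryMode_le d hν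
  obtain ⟨p, hp⟩ := exists_nat_ge (weight d ν)
  have e : ∀ ρ, dirichletField d Y ν t' ρ Ω' / ((Real.cos ρ ^ weight d ν : ℝ) : ℂ) =
      ∑' i : ModeLabel, bulkMode (dirichletRadial d ν) i.2.2 (dirichletFreq d ν i) (Y i)
        t' ρ Ω' / ((Real.cos ρ ^ weight d ν : ℝ) : ℂ) := fun ρ => tsum_div_const.symm
  simp only [e]
  have hd0 : (0 : ℝ) ≤ d := by positivity
  refine tendsto_tsum_boundary (C₀ := 1 + d + |ν|) (C₁ := 1) (C₂ := C)
    (C₃ := 3 * hyp 1 1 (1 + ν) (1 / 2) * (1 + d + |ν|) ^ 2) (δ := 2) (P := P + p)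
    (q := 2 * (d + 2)) (fun i => by positivity) (hY.rapid ν) Ω' (by positivity)
    zero_le_one hC two_pos (fun i => by rw [norm_boundaryMode, one_mul]) ?_ ?_
  · intro i ρ hρ β hβ
    have hc := cos_pos_of_bulk hρ.1.le hρ.2
    have hN : 1 + |dirichletFreq d ν i| ≤ 1 + (|dirichletFreq d ν i| + (i.2.2 : ℝ)) := by
      have : (0 : ℝ) ≤ i.2.2 := by positivity
      linarith
    have h2 := h t' ρ hρ.1.le hρ.2 Ω' _ _ (Y i) β (hY.1 i).continuous hN hβ
    have hβ0 : 0 ≤ β := le_trans (by positivity) (hβ Ω')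
    have h3 : (Real.cos ρ ^ weight d ν)⁻¹ ≤ (Real.cos ρ)⁻¹ ^ p := by
      rw [← Real.rpow_neg hc.le]
      exact rpow_le_inv_pow hc (Real.cos_le_one _) (by linarith)
    have hm := bulkMode_dirichletRadial hd hν i.1 i.2.1 (hY.1 i) t' hρ.1.le hρ.2 Ω'
    change bulkMode _ _ (dirichletFreq d ν i) _ _ _ _ = _ at hm
    rw [hm, norm_div, Complex.norm_real, Real.norm_of_nonneg (Real.rpow_nonneg hc.le _),
      div_eq_mul_inv]
    calc _ ≤ C * (Real.cos ρ)⁻¹ ^ P * β * (Real.cos ρ)⁻¹ ^ p := by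
          refine mul_le_mul h2 h3 (by positivity) (by positivity)
      _ = _ := by rw [pow_add]; ring
  · intro i ρ hρ hs
    have hc := cos_pos_of_bulk hρ.1.le hρ.2
    have h1 := abs_dirichletRadial_near hν i.2.2 (dirichletFreq d ν i) hρ hs
    have e2 : bulkMode (dirichletRadial d ν) i.2.2 (dirichletFreq d ν i) (Y i) t' ρ Ω' /
        ((Real.cos ρ ^ weight d ν : ℝ) : ℂ) - boundaryMode (dirichletFreq d ν i) (Y i) t' Ω' =
        ((dirichletRadial d ν i.2.2 (dirichletFreq d ν i) ρ / Real.cos ρ ^ weight d ν - 1 : ℝ) : ℂ) *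
          boundaryMode (dirichletFreq d ν i) (Y i) t' Ω' := by
      unfold bulkMode boundaryMode
      push_cast
      ring
    rw [e2, norm_mul, norm_boundaryMode, Complex.norm_real, Real.norm_eq_abs]
    exact mul_le_mul_of_nonneg_right h1 (norm_nonneg _)

/-! ### Robin fields -/

section Robin

variable {d : ℕ} {ν γ : ℝ} {ι : Type} {l : ι → ℕ} {ω : ι → ℝ} {Y : ι → Sph d → ℂ}

theorem IsRobinAmplitude.isBoundaryFunction (hY : IsRobinAmplitude d ν γ l ω Y) :
    IsBoundaryFunction (boundaryField ω Y) :=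
  isBoundaryFunction_boundaryField (fun i => (hY.2.1 i).continuous) hY.2.2

theorem hasSum_robinField (hd : Odd d) (hν : 0 < ν) (hν1 : ν < 1)
    (hY : IsRobinAmplitude d ν γ l ω Y) (t' : ℝ) {ρ' : ℝ} (h0 : 0 < ρ') (h1 : ρ' < Real.pi / 2)
    (Ω' : Sph d) :
    HasSum (fun i => bulkMode (robinRadial d ν γ) (l i) (ω i) (Y i) t' ρ' Ω')
      (robinKernel (contKernel d) γ ν t' ρ' Ω' (boundaryField ω Y)) := by
  have hc : ∀ i, Continuous (Y i) := fun i => (hY.2.1 i).continuous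
  have s1 := (hasSum_contKernel (by linarith : -1 < ν) t' h0.le h1 Ω' hc hY.2.2).mul_left
    (Real.cos γ : ℂ)
  have s2 := (hasSum_contKernel (by linarith : -1 < -ν) t' h0.le h1 Ω' hc hY.2.2).mul_left
    (Real.sin γ : ℂ)
  exact (s1.add s2).congr_fun fun i =>
    bulkMode_robinRadial hd hν hν1 (hY.1 i) (hY.2.1 i) t' h0 h1 Ω'

theorem bulkField_robinRadial {t' ρ' : ℝ} {Ω' : Sph d}
    (h1 : Summable fun i => bulkMode (dirichletRadial d ν) (l i) (ω i) (Y i) t' ρ' Ω')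
    (h2 : Summable fun i => bulkMode (neumannRadial d ν) (l i) (ω i) (Y i) t' ρ' Ω') :
    bulkField (robinRadial d ν γ) l ω Y t' ρ' Ω' =
      (Real.cos γ : ℂ) * bulkField (dirichletRadial d ν) l ω Y t' ρ' Ω' +
      (Real.sin γ : ℂ) * bulkField (neumannRadial d ν) l ω Y t' ρ' Ω' := by
  refine (((h1.hasSum.mul_left _).add (h2.hasSum.mul_left _)).congr_fun fun i => ?_).tsum_eq
  unfold bulkMode robinRadial
  push_cast
  ring

/-- The Robin solutions Φ₃ and Φ₄ need not be regular at the origin, but the kernel on a mode is a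
multiple of Φ₁, which is continuous there. For ρ < π/3 one has cos ρ ≥ 1/2, so the kernel bounds are
uniform. -/
theorem tendsto_contKernel_zero (hd : 1 ≤ d) (hν : -1 < ν)
    (hY : ∀ i, IsSphericalHarmonic d (l i) (Y i))
    (hR : IsRapidlyDecreasing (fun i => |ω i| + (l i : ℝ)) Y) (t' : ℝ) (Ω' : Sph d) :
    Tendsto (fun ρ => contKernel d ν t' ρ Ω' (boundaryField ω Y)) (𝓝[>] 0)
      (𝓝 (contKernel d ν t' 0 Ω' (boundaryField ω Y))) := by
  have hpi := Real.pi_pos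
  have hc : ∀ i, Continuous (Y i) := fun i => (hY i).continuous
  have hIoo : ∀ᶠ ρ in 𝓝[>] (0 : ℝ), ρ ∈ Ioo 0 (Real.pi / 3) := Ioo_mem_nhdsGT (by positivity)
  rw [← (hasSum_contKernel hν t' le_rfl (by positivity) Ω' hc hR).tsum_eq]
  have hev : (fun ρ => ∑' i, contKernel d ν t' ρ Ω' (boundaryMode (ω i) (Y i))) =ᶠ[𝓝[>] 0]
      fun ρ => contKernel d ν t' ρ Ω' (boundaryField ω Y) := by
    filter_upwards [hIoo] with ρ hρ
    exact (hasSum_contKernel hν t' hρ.1.le (by linarith [hρ.2]) Ω' hc hR).tsum_eq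
  refine Tendsto.congr' hev ?_
  obtain ⟨C, P, hC, h⟩ := norm_contKernel_boundaryMode_le d hν
  obtain ⟨b, hb, hb'⟩ := hR (2 * (d + 2))
  refine tendsto_tsum_of_dominated_convergence (bound := fun i => C * 2 ^ P * b i)
    (hb.mul_left _) (fun i => ?_) ?_
  · rw [contKernel_boundaryMode hd hν (ω i) (hY i) t' le_rfl (by positivity)]
    have hev2 : (fun ρ => ((kernelFactor d ν (l i) (ω i) * regularRadial d ν (l i) (ω i) ρ : ℝ) : ℂ) *
        boundaryMode (ω i) (Y i) t' Ω') =ᶠ[𝓝[>] 0]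
        fun ρ => contKernel d ν t' ρ Ω' (boundaryMode (ω i) (Y i)) := by
      filter_upwards [hIoo] with ρ hρ
      rw [contKernel_boundaryMode hd hν (ω i) (hY i) t' hρ.1.le (by linarith [hρ.2])]
    refine Tendsto.congr' hev2 (Tendsto.mul_const _ ?_)
    refine (Complex.continuous_ofReal.tendsto _).comp (Tendsto.const_mul _ ?_)
    rw [funext (regularRadial_eq d ν (l i) (ω i))]
    refine Tendsto.mono_left ?_ nhdsWithin_le_nhds
    have h1 : ContinuousAt (fun ρ : ℝ => Real.sin ρ ^ l i) 0 := by fun_prop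
    have h2 : ContinuousAt (fun ρ : ℝ => Real.cos ρ ^ weight d ν) 0 :=
      Real.continuous_cos.continuousAt.rpow_const (Or.inl (by simp))
    have h3 : ContinuousAt (fun ρ : ℝ => hyp (paramA d ν (l i) (ω i)) (paramB d ν (l i) (ω i))
        (paramC d (l i)) (Real.sin ρ ^ 2)) 0 :=
      ContinuousAt.comp (f := fun ρ : ℝ => Real.sin ρ ^ 2)
        (hasDerivAt_hyp _ _ _ (by simp)).continuousAt (by fun_prop)
    exact (h1.mul h2).mul h3
  · filter_upwards [hIoo] with ρ hρ i
    have hcos : 1 / 2 ≤ Real.cos ρ := by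
      rw [← Real.cos_pi_div_three]
      exact Real.cos_le_cos_of_nonneg_of_le_pi hρ.1.le (by linarith) hρ.2.le
    have hN : 1 + |ω i| ≤ 1 + (|ω i| + (l i : ℝ)) := by
      have : (0 : ℝ) ≤ l i := by positivity
      linarith
    refine (h t' ρ hρ.1.le (by linarith [hρ.2]) Ω' _ _ (Y i) (b i) (hc i) hN (hb' i)).trans ?_
    have hb0 : 0 ≤ b i := le_trans (by positivity) (hb' i Ω')
    have hinv : (Real.cos ρ)⁻¹ ≤ 2 := by
      rw [inv_le_comm₀ (by linarith) two_pos]; linarith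
    have hinv0 : 0 ≤ (Real.cos ρ)⁻¹ := inv_nonneg.2 (by linarith)
    gcongr

/-- The relative error of the Neumann part is of order cos². Measured against the power Δ₊ it
becomes cos^(2−2ν), which vanishes at the boundary just because ν < 1; so subtracting the leading
power is enough. The bound far from the boundary again comes from the kernels at ν and −ν. -/
theorem tendsto_robinField (hd : Odd d) (hν : 0 < ν) (hν1 : ν < 1)
    (hY : IsRobinAmplitude d ν γ l ω Y) (t' : ℝ) (Ω' : Sph d) :
    Tendsto (fun ρ => (bulkField (robinRadial d ν γ) l ω Y t' ρ Ω' -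
        ((Real.cos ρ ^ weight d (-ν) : ℝ) : ℂ) * ((Real.sin γ : ℂ) * boundaryField ω Y t' Ω')) /
        ((Real.cos ρ ^ weight d ν : ℝ) : ℂ))
      (𝓝[<] (Real.pi / 2)) (𝓝 ((Real.cos γ : ℂ) * boundaryField ω Y t' Ω')) := by
  obtain ⟨C, P, hC, h⟩ := norm_contKernel_boundaryMode_le d (by linarith : -1 < ν)
  obtain ⟨C', P', hC', h'⟩ := norm_contKernel_boundaryMode_le d (by linarith : -1 < -ν)
  obtain ⟨p, hp⟩ := exists_nat_ge (weight d ν)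
  have hsum := hY.2.2.summable_boundaryMode ω t' Ω'
  have hev : (fun ρ => ∑' i, (bulkMode (robinRadial d ν γ) (l i) (ω i) (Y i) t' ρ Ω' -
      ((Real.cos ρ ^ weight d (-ν) : ℝ) : ℂ) * ((Real.sin γ : ℂ) *
        boundaryMode (ω i) (Y i) t' Ω')) / ((Real.cos ρ ^ weight d ν : ℝ) : ℂ))
      =ᶠ[𝓝[<] (Real.pi / 2)] fun ρ => (bulkField (robinRadial d ν γ) l ω Y t' ρ Ω' -
        ((Real.cos ρ ^ weight d (-ν) : ℝ) : ℂ) * ((Real.sin γ : ℂ) * boundaryField ω Y t' Ω')) /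
        ((Real.cos ρ ^ weight d ν : ℝ) : ℂ) := by
    filter_upwards [Ioo_mem_nhdsLT (by positivity : (0 : ℝ) < Real.pi / 2)] with ρ hρ
    rw [tsum_div_const]
    congr 1
    exact ((hasSum_robinField hd hν hν1 hY t' hρ.1 hρ.2 Ω').summable.hasSum.sub
      ((hsum.hasSum.mul_left _).mul_left _)).tsum_eq
  refine Tendsto.congr' hev ?_
  rw [show (Real.cos γ : ℂ) * boundaryField ω Y t' Ω' =
    ∑' i, (Real.cos γ : ℂ) * boundaryMode (ω i) (Y i) t' Ω' from tsum_mul_left.symm]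
  have hcγ : ‖(Real.cos γ : ℂ)‖ ≤ 1 := by
    rw [Complex.norm_real]; exact Real.abs_cos_le_one γ
  have hsγ : ‖(Real.sin γ : ℂ)‖ ≤ 1 := by
    rw [Complex.norm_real]; exact Real.abs_sin_le_one γ
  have hd0 : (0 : ℝ) ≤ d := by positivity
  refine tendsto_tsum_boundary (C₀ := 1 + d + |ν|) (C₁ := 1) (C₂ := C + C' + 1)
    (C₃ := (3 * hyp 1 1 (1 + ν) (1 / 2) + 3 * hyp 1 1 (1 - ν) (1 / 2)) * (1 + d + |ν|) ^ 2)
    (δ := 2 - 2 * ν) (P := P + P' + p + 2) (q := 2 * (d + 2)) (fun i => by positivity)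
    hY.2.2 Ω' (by positivity) zero_le_one (by positivity) (by linarith)
    (fun i => by
      rw [norm_mul, norm_boundaryMode]
      exact mul_le_mul_of_nonneg_right hcγ (norm_nonneg _)) ?_ ?_
  · intro i ρ hρ β hβ
    have hc := cos_pos_of_bulk hρ.1.le hρ.2
    have hN : 1 + |ω i| ≤ 1 + (|ω i| + (l i : ℝ)) := by
      have : (0 : ℝ) ≤ l i := by positivity
      linarith
    have hYc := (hY.2.1 i).continuous
    have b1 := h t' ρ hρ.1.le hρ.2 Ω' _ _ (Y i) β hYc hN hβ
    have b2 := h' t' ρ hρ.1.le hρ.2 Ω' _ _ (Y i) β hYc hN hβ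
    have hβ0 : 0 ≤ β := le_trans (by positivity) (hβ Ω')
    have hYβ : ‖Y i Ω'‖ ≤ β := by
      refine le_trans ?_ (hβ Ω')
      refine le_mul_of_one_le_left (norm_nonneg _) (one_le_pow₀ ?_)
      linarith [abs_nonneg (ω i)]
    have hi1 : 1 ≤ (Real.cos ρ)⁻¹ := (one_le_inv₀ hc).2 (Real.cos_le_one _)
    set x := (Real.cos ρ)⁻¹ with hx
    have h3 : (Real.cos ρ ^ weight d ν)⁻¹ ≤ x ^ p := by
      rw [← Real.rpow_neg hc.le]
      exact rpow_le_inv_pow hc (Real.cos_le_one _) (by linarith)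
    have h4 : Real.cos ρ ^ weight d (-ν) * (Real.cos ρ ^ weight d ν)⁻¹ ≤ x ^ 2 := by
      rw [← Real.rpow_neg hc.le, ← Real.rpow_add hc]
      refine rpow_le_inv_pow hc (Real.cos_le_one _) ?_
      unfold weight; push_cast; linarith
    have hx1 : ∀ {m n : ℕ}, m ≤ n → x ^ m ≤ x ^ n := fun h => pow_le_pow_right₀ hi1 h
    have hbulk : ‖bulkMode (robinRadial d ν γ) (l i) (ω i) (Y i) t' ρ Ω'‖ ≤
        C * x ^ P * β + C' * x ^ P' * β := by
      rw [bulkMode_robinRadial hd hν hν1 (hY.1 i) (hY.2.1 i) t' hρ.1 hρ.2 Ω']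
      refine (norm_add_le _ _).trans (add_le_add ?_ ?_)
      · rw [norm_mul]
        exact (mul_le_of_le_one_left (norm_nonneg _) hcγ).trans b1
      · rw [norm_mul]
        exact (mul_le_of_le_one_left (norm_nonneg _) hsγ).trans b2
    rw [norm_div, Complex.norm_real, Real.norm_of_nonneg (Real.rpow_nonneg hc.le _), div_eq_mul_inv]
    have hbm : ‖((Real.cos ρ ^ weight d (-ν) : ℝ) : ℂ) * ((Real.sin γ : ℂ) *
        boundaryMode (ω i) (Y i) t' Ω')‖ ≤ Real.cos ρ ^ weight d (-ν) * β := by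
      rw [norm_mul, norm_mul, norm_boundaryMode, Complex.norm_real,
        Real.norm_of_nonneg (Real.rpow_nonneg hc.le _)]
      refine mul_le_mul_of_nonneg_left ?_ (Real.rpow_nonneg hc.le _)
      exact (mul_le_of_le_one_left (norm_nonneg _) hsγ).trans hYβ
    have hinv0 : 0 ≤ (Real.cos ρ ^ weight d ν)⁻¹ := inv_nonneg.2 (Real.rpow_nonneg hc.le _)
    have hx0 : 0 ≤ x := by linarith
    calc _ ≤ (C * x ^ P * β + C' * x ^ P' * β + Real.cos ρ ^ weight d (-ν) * β) *
          (Real.cos ρ ^ weight d ν)⁻¹ :=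
          mul_le_mul_of_nonneg_right ((norm_sub_le _ _).trans (add_le_add hbulk hbm)) hinv0
      _ = (C * x ^ P + C' * x ^ P') * β * (Real.cos ρ ^ weight d ν)⁻¹ +
          (Real.cos ρ ^ weight d (-ν) * (Real.cos ρ ^ weight d ν)⁻¹) * β := by ring
      _ ≤ (C * x ^ P + C' * x ^ P') * β * x ^ p + x ^ 2 * β := by gcongr
      _ = C * x ^ (P + p) * β + C' * x ^ (P' + p) * β + x ^ 2 * β := by
          rw [pow_add, pow_add]; ring
      _ ≤ C * x ^ (P + P' + p + 2) * β + C' * x ^ (P + P' + p + 2) * β +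
          x ^ (P + P' + p + 2) * β := by
          gcongr C * ?_ * β + C' * ?_ * β + ?_ * β
          · exact hx1 (by omega)
          · exact hx1 (by omega)
          · exact hx1 (by omega)
      _ = _ := by ring
  · intro i ρ hρ hs
    have hc := cos_pos_of_bulk hρ.1.le hρ.2
    have h1 := abs_dirichletRadial_near (by linarith : -1 < ν) (l i) (ω i) hρ hs
    have h2 := abs_dirichletRadial_near (d := d) (by linarith : -1 < -ν) (l i) (ω i) hρ
      (by rwa [abs_neg])
    rw [abs_neg, ← sub_eq_add_neg, ← neumannRadial_eq] at h2
    set c := Real.cos ρ with hcdef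
    set E := (1 + d + |ν|) ^ 2 * (1 + (|ω i| + (l i : ℝ))) ^ 2 with hE
    have hE0 : 0 ≤ E := by positivity
    have hw1 : 0 < c ^ weight d ν := Real.rpow_pos_of_pos hc _
    have hw2 : 0 < c ^ weight d (-ν) := Real.rpow_pos_of_pos hc _
    have hr : c ^ weight d (-ν) / c ^ weight d ν = c ^ (-(2 * ν)) := by
      rw [← Real.rpow_sub hc]; congr 1; unfold weight; ring
    have hr2 : c ^ (2 : ℝ) * c ^ (-(2 * ν)) = c ^ (2 - 2 * ν) := by
      rw [← Real.rpow_add hc]; congr 1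
    have hr3 : c ^ (2 : ℝ) ≤ c ^ (2 - 2 * ν) :=
      Real.rpow_le_rpow_of_exponent_ge hc (Real.cos_le_one _) (by linarith)
    have e2 : (bulkMode (robinRadial d ν γ) (l i) (ω i) (Y i) t' ρ Ω' -
        ((c ^ weight d (-ν) : ℝ) : ℂ) * ((Real.sin γ : ℂ) * boundaryMode (ω i) (Y i) t' Ω')) /
        ((c ^ weight d ν : ℝ) : ℂ) - (Real.cos γ : ℂ) * boundaryMode (ω i) (Y i) t' Ω' =
        ((Real.cos γ * (dirichletRadial d ν (l i) (ω i) ρ / c ^ weight d ν - 1) +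
          Real.sin γ * ((neumannRadial d ν (l i) (ω i) ρ / c ^ weight d (-ν) - 1) *
            c ^ (-(2 * ν))) : ℝ) : ℂ) * boundaryMode (ω i) (Y i) t' Ω' := by
      have hw1' : ((c ^ weight d ν : ℝ) : ℂ) ≠ 0 := by exact_mod_cast hw1.ne'
      have hw2' : ((c ^ weight d (-ν) : ℝ) : ℂ) ≠ 0 := by exact_mod_cast hw2.ne'
      rw [← hr]
      unfold bulkMode boundaryMode robinRadial
      simp only [Complex.ofReal_add, Complex.ofReal_mul, Complex.ofReal_sub, Complex.ofReal_div,
        Complex.ofReal_one]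
      field_simp
      ring
    rw [e2, norm_mul, norm_boundaryMode, Complex.norm_real, Real.norm_eq_abs]
    refine mul_le_mul_of_nonneg_right ?_ (norm_nonneg _)
    have k1 := one_le_hyp_one_one (by linarith : 0 < 1 + ν)
    have k2 := one_le_hyp_one_one (by linarith : 0 < 1 - ν)
    set H1 := hyp 1 1 (1 + ν) (1 / 2)
    set H2 := hyp 1 1 (1 - ν) (1 / 2)
    have hcν : 0 ≤ c ^ (-(2 * ν)) := (Real.rpow_pos_of_pos hc _).le
    calc _ ≤ |dirichletRadial d ν (l i) (ω i) ρ / c ^ weight d ν - 1| +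
          |neumannRadial d ν (l i) (ω i) ρ / c ^ weight d (-ν) - 1| * c ^ (-(2 * ν)) := by
          refine (abs_add_le _ _).trans (add_le_add ?_ ?_)
          · rw [abs_mul]
            exact mul_le_of_le_one_left (abs_nonneg _) (Real.abs_cos_le_one γ)
          · rw [abs_mul, abs_mul, abs_of_nonneg hcν]
            exact mul_le_of_le_one_left (by positivity) (Real.abs_sin_le_one γ)
      _ ≤ 3 * H1 * (1 + d + |ν|) ^ 2 * ((1 + (|ω i| + (l i : ℝ))) ^ 2 * c ^ (2 : ℝ)) +
          3 * H2 * (1 + d + |ν|) ^ 2 * ((1 + (|ω i| + (l i : ℝ))) ^ 2 * c ^ (2 : ℝ)) *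
            c ^ (-(2 * ν)) := add_le_add h1 (mul_le_mul_of_nonneg_right h2 hcν)
      _ = 3 * H1 * E * c ^ (2 : ℝ) + 3 * H2 * E * (c ^ (2 : ℝ) * c ^ (-(2 * ν))) := by
          rw [hE]; ring
      _ ≤ 3 * H1 * E * c ^ (2 - 2 * ν) + 3 * H2 * E * c ^ (2 - 2 * ν) := by
          rw [hr2]
          refine add_le_add (mul_le_mul_of_nonneg_left hr3 ?_) le_rfl
          positivity
      _ = _ := by rw [hE]; ring

end Robin

/-! ### The Neumann field as the Dirichlet field at −ν -/

theorem neumannFreq_eq (d : ℕ) (ν : ℝ) (i : ModeLabel) :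
    neumannFreq d ν i = dirichletFreq d (-ν) i := neumannFrequency_eq d ν _ _ _

theorem neumannField_eq (d : ℕ) (Y : ModeLabel → Sph d → ℂ) (ν : ℝ) :
    neumannField d Y ν = dirichletField d Y (-ν) := by
  unfold neumannField dirichletField
  rw [funext (neumannFreq_eq d ν), funext fun l => funext fun ω => funext (neumannRadial_eq d ν l ω)]

end AdS

end

/-! ### Assembly of the theorem -/

theorem mainTheorem5 (d : ℕ) (hd : 1 ≤ d) :
    -- the two radial solutions, and the Dirichlet and Neumann modes
    (∀ ν : ℝ, 0 < ν → ν < 1 → ∀ l : ℕ,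
      (∀ ω : ℝ, AdS.SolvesRadialKleinGordon d ν l ω (AdS.dirichletRadial d ν l ω) ∧
        AdS.SolvesRadialKleinGordon d ν l ω (AdS.neumannRadial d ν l ω)) ∧
      (∀ (s : ℤˣ) (n : ℕ),
        AdS.IsRobinFrequency d ν 0 l (AdS.dirichletFrequency d ν s n l) ∧
        AdS.IsRobinFrequency d ν (Real.pi / 2) l (AdS.neumannFrequency d ν s n l))) ∧
    -- the Neumann field is the Dirichlet field at `-ν`
    (∀ ν : ℝ, 0 < ν → ν < 1 →
      (∀ (l : ℕ) (ω ρ : ℝ),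
        AdS.neumannRadial d ν l ω ρ = AdS.dirichletRadial d (-ν) l ω ρ) ∧
      (∀ (s : ℤˣ) (n l : ℕ),
        AdS.neumannFrequency d ν s n l = AdS.dirichletFrequency d (-ν) s n l) ∧
      ∀ Y : AdS.ModeLabel → AdS.Sph d → ℂ,
        AdS.neumannField d Y ν = AdS.dirichletField d Y (-ν)) ∧
    -- the kernels in even bulk dimension `d + 1`
    (Odd d →
      -- for `ν > d / 2 - 1` the Dirichlet kernel is integrable against boundary functions
      (∀ (t' ρ' : ℝ) (Ω' : AdS.Sph d), 0 ≤ ρ' → ρ' < Real.pi / 2 →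
        ∀ f : ℝ → AdS.Sph d → ℂ, AdS.IsBoundaryFunction f →
          ∀ ν : ℝ, (d : ℝ) / 2 - 1 < ν →
            Integrable (fun p : ℝ × AdS.Sph d =>
                ((AdS.dirichletKernel d ν p.1 p.2 t' ρ' Ω' : ℝ) : ℂ) * f p.1 p.2)
              ((volume : Measure ℝ).prod (AdS.sphereMeasure d))) ∧
      -- the analytic continuation exists
      (∃ K : AdS.KernelFamily d, AdS.IsContinuedDirichletKernel d K) ∧
      ∀ K : AdS.KernelFamily d, AdS.IsContinuedDirichletKernel d K →
        -- regulated integrals, support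
        (∀ (t' ρ' : ℝ) (Ω' : AdS.Sph d), 0 ≤ ρ' → ρ' < Real.pi / 2 →
          ∀ f : ℝ → AdS.Sph d → ℂ, AdS.IsBoundaryFunction f →
            -- Dirichlet: `(d - 1) / 2` regulating terms
            (∀ ν : ℝ, 0 < ν → (∀ j < (d - 1) / 2, AdS.weight d ν - d + 1 + (j : ℝ) ≠ 0) →
              AdS.IsRegulatedIntegral (AdS.weight d ν) ((d - 1) / 2) t' ρ' Ω' f
                (K ν t' ρ' Ω' f)) ∧
            -- Neumann: one more regulating term; further ones do no harm
            (∀ ν : ℝ, 0 < ν → ν < 1 → ν ≠ 1 / 2 → ∀ N : ℕ, (d - 1) / 2 + 1 ≤ N →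
              AdS.IsRegulatedIntegral (AdS.weight d (-ν)) N t' ρ' Ω' f
                (K (-ν) t' ρ' Ω' f)) ∧
            -- spacelike support of all kernels
            ((∀ (t : ℝ) (Ω : AdS.Sph d), AdS.IsSpacelike t Ω t' ρ' Ω' → f t Ω = 0) →
              ∀ ν : ℝ, -1 < ν → K ν t' ρ' Ω' f = 0)) ∧
        -- Dirichlet and Neumann fields
        (∀ Y : AdS.ModeLabel → AdS.Sph d → ℂ, AdS.IsAmplitude d Y →
          (∀ ν : ℝ, 0 < ν →
            AdS.IsBoundaryFunction (AdS.boundaryField (AdS.dirichletFreq d ν) Y) ∧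
            (∀ (t' : ℝ) (Ω' : AdS.Sph d),
              Tendsto (fun ρ => AdS.dirichletField d Y ν t' ρ Ω' /
                  ((Real.cos ρ ^ AdS.weight d ν : ℝ) : ℂ))
                (𝓝[<] (Real.pi / 2))
                (𝓝 (AdS.boundaryField (AdS.dirichletFreq d ν) Y t' Ω'))) ∧
            ∀ (t' ρ' : ℝ) (Ω' : AdS.Sph d), 0 ≤ ρ' → ρ' < Real.pi / 2 →
              Summable (fun i : AdS.ModeLabel => AdS.bulkMode (AdS.dirichletRadial d ν) i.2.2
                (AdS.dirichletFreq d ν i) (Y i) t' ρ' Ω') ∧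
              AdS.dirichletField d Y ν t' ρ' Ω' =
                K ν t' ρ' Ω' (AdS.boundaryField (AdS.dirichletFreq d ν) Y)) ∧
          (∀ ν : ℝ, 0 < ν → ν < 1 →
            AdS.IsBoundaryFunction (AdS.boundaryField (AdS.neumannFreq d ν) Y) ∧
            (∀ (t' : ℝ) (Ω' : AdS.Sph d),
              Tendsto (fun ρ => AdS.neumannField d Y ν t' ρ Ω' /
                  ((Real.cos ρ ^ AdS.weight d (-ν) : ℝ) : ℂ))
                (𝓝[<] (Real.pi / 2))
                (𝓝 (AdS.boundaryField (AdS.neumannFreq d ν) Y t' Ω'))) ∧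
            ∀ (t' ρ' : ℝ) (Ω' : AdS.Sph d), 0 ≤ ρ' → ρ' < Real.pi / 2 →
              Summable (fun i : AdS.ModeLabel => AdS.bulkMode (AdS.neumannRadial d ν) i.2.2
                (AdS.neumannFreq d ν i) (Y i) t' ρ' Ω') ∧
              AdS.neumannField d Y ν t' ρ' Ω' =
                K (-ν) t' ρ' Ω' (AdS.boundaryField (AdS.neumannFreq d ν) Y))) ∧
        -- Robin fields
        (∀ ν γ : ℝ, 0 < ν → ν < 1 → 0 ≤ γ → γ < Real.pi →
          ∀ (ι : Type) (l : ι → ℕ) (ω : ι → ℝ) (Y : ι → AdS.Sph d → ℂ),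
            AdS.IsRobinAmplitude d ν γ l ω Y →
            AdS.IsBoundaryFunction (AdS.boundaryField ω Y) ∧
            -- the field is `cos γ Φ_D + sin γ Φ_N` with Robin frequencies
            (∀ (t' ρ' : ℝ) (Ω' : AdS.Sph d), 0 < ρ' → ρ' < Real.pi / 2 →
              Summable (fun i => AdS.bulkMode (AdS.dirichletRadial d ν) (l i) (ω i) (Y i)
                t' ρ' Ω') →
              Summable (fun i => AdS.bulkMode (AdS.neumannRadial d ν) (l i) (ω i) (Y i)
                t' ρ' Ω') →
              AdS.bulkField (AdS.robinRadial d ν γ) l ω Y t' ρ' Ω' =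
                (Real.cos γ : ℂ) * AdS.bulkField (AdS.dirichletRadial d ν) l ω Y t' ρ' Ω' +
                (Real.sin γ : ℂ) * AdS.bulkField (AdS.neumannRadial d ν) l ω Y t' ρ' Ω') ∧
            -- its boundary data are `φ_- = sin γ φ` and `φ_+ = cos γ φ`
            (∀ (t' : ℝ) (Ω' : AdS.Sph d),
              Tendsto (fun ρ => (AdS.bulkField (AdS.robinRadial d ν γ) l ω Y t' ρ Ω' -
                  ((Real.cos ρ ^ AdS.weight d (-ν) : ℝ) : ℂ) *
                    ((Real.sin γ : ℂ) * AdS.boundaryField ω Y t' Ω')) /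
                  ((Real.cos ρ ^ AdS.weight d ν : ℝ) : ℂ))
                (𝓝[<] (Real.pi / 2))
                (𝓝 ((Real.cos γ : ℂ) * AdS.boundaryField ω Y t' Ω'))) ∧
            -- it is reproduced by the Robin kernel
            (∀ (t' ρ' : ℝ) (Ω' : AdS.Sph d), 0 < ρ' → ρ' < Real.pi / 2 →
              Summable (fun i => AdS.bulkMode (AdS.robinRadial d ν γ) (l i) (ω i) (Y i)
                t' ρ' Ω') ∧
              AdS.bulkField (AdS.robinRadial d ν γ) l ω Y t' ρ' Ω' =
                AdS.robinKernel K γ ν t' ρ' Ω' (AdS.boundaryField ω Y)) ∧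
            ∀ (t' : ℝ) (Ω' : AdS.Sph d),
              Tendsto (fun ρ => AdS.bulkField (AdS.robinRadial d ν γ) l ω Y t' ρ Ω')
                (𝓝[>] 0)
                (𝓝 (AdS.robinKernel K γ ν t' 0 Ω' (AdS.boundaryField ω Y))))) := by 
  have hcont := AdS.isContinuedDirichletKernel_contKernel d
  refine ⟨fun ν h0 h1 l => ⟨fun ω => ⟨AdS.solvesRadialKleinGordon_dirichletRadial d (by linarith) l ω,
      ?_⟩, fun s n => ⟨AdS.isRobinFrequency_dirichlet hd h0 s n l,
      AdS.isRobinFrequency_neumann hd h1 s n l⟩⟩, fun ν _ _ => ⟨AdS.neumannRadial_eq d ν,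
      AdS.neumannFrequency_eq d ν, fun Y => ?_⟩, fun hodd => ⟨?_, ⟨AdS.contKernel d, hcont⟩,
      fun K hK => ⟨fun t' ρ' Ω' hρ0 hρ1 f hf => ⟨?_, ?_, ?_⟩, fun Y hY => ?_, ?_⟩⟩⟩
  -- The radial equation involves ν only through ν², so the Dirichlet solution at −ν solves the
  -- equation at ν.
  · have h := AdS.solvesRadialKleinGordon_dirichletRadial d (by linarith : -1 < -ν) l ω
    rw [← funext (AdS.neumannRadial_eq d ν l ω)] at h
    unfold AdS.SolvesRadialKleinGordon at h ⊢
    rwa [neg_sq] at h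
  · exact AdS.neumannField_eq d Y ν
  · intro t' ρ' Ω' hρ0 hρ1 f hf ν hν
    exact (AdS.contKernel_eq_integral hν t' hρ0 hρ1 Ω' hf).1
  · exact fun ν hν hne => AdS.isRegulatedIntegral_dirichlet hodd hK t' hρ0 hρ1 Ω' hf hν hne
  · exact fun ν hν hν1 hν2 N hN =>
      AdS.isRegulatedIntegral_neumann hodd hK t' hρ0 hρ1 Ω' hf hν hν1 hν2 hN
  · exact fun h ν hν => hK.eq_zero t' hρ0 hρ1 Ω' hf h hν
  -- Proved on the whole range ν > −1, so that the Neumann statements are the instance −ν with 0 < ν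
  -- < 1.
  · have main : ∀ ν : ℝ, -1 < ν →
        AdS.IsBoundaryFunction (AdS.boundaryField (AdS.dirichletFreq d ν) Y) ∧
        (∀ (t' : ℝ) (Ω' : AdS.Sph d), Tendsto (fun ρ => AdS.dirichletField d Y ν t' ρ Ω' /
            ((Real.cos ρ ^ AdS.weight d ν : ℝ) : ℂ)) (𝓝[<] (Real.pi / 2))
            (𝓝 (AdS.boundaryField (AdS.dirichletFreq d ν) Y t' Ω'))) ∧
        ∀ (t' ρ' : ℝ) (Ω' : AdS.Sph d), 0 ≤ ρ' → ρ' < Real.pi / 2 →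
          Summable (fun i : AdS.ModeLabel => AdS.bulkMode (AdS.dirichletRadial d ν) i.2.2
            (AdS.dirichletFreq d ν i) (Y i) t' ρ' Ω') ∧
          AdS.dirichletField d Y ν t' ρ' Ω' =
            K ν t' ρ' Ω' (AdS.boundaryField (AdS.dirichletFreq d ν) Y) := by
      intro ν hν
      refine ⟨hY.isBoundaryFunction ν, AdS.tendsto_dirichletField hodd hν hY,
        fun t' ρ' Ω' h0 h1 => ?_⟩
      have hs := AdS.hasSum_dirichletField hodd hν hY t' h0 h1 Ω'
      exact ⟨hs.summable, hs.tsum_eq.trans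
        (hcont.eq hK hν t' h0 h1 Ω' (hY.isBoundaryFunction ν))⟩
    refine ⟨fun ν hν => main ν (by linarith), fun ν hν hν1 => ?_⟩
    have h := main (-ν) (by linarith)
    rw [← AdS.neumannField_eq, ← funext (AdS.neumannFreq_eq d ν),
      ← funext fun l => funext fun ω => funext (AdS.neumannRadial_eq d ν l ω)] at h
    exact h
  · intro ν γ hν hν1 _ _ ι l ω Y hY
    have hBF := hY.isBoundaryFunction
    have hrob : ∀ (t' ρ' : ℝ) (Ω' : AdS.Sph d), 0 ≤ ρ' → ρ' < Real.pi / 2 →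
        AdS.robinKernel (AdS.contKernel d) γ ν t' ρ' Ω' (AdS.boundaryField ω Y) =
        AdS.robinKernel K γ ν t' ρ' Ω' (AdS.boundaryField ω Y) := fun t' ρ' Ω' h0 h1 => by
      unfold AdS.robinKernel
      rw [hcont.eq hK (by linarith : -1 < ν) t' h0 h1 Ω' hBF,
        hcont.eq hK (by linarith : -1 < -ν) t' h0 h1 Ω' hBF]
    have hpi := Real.pi_pos
    refine ⟨hBF, fun t' ρ' Ω' _ _ h1 h2 => AdS.bulkField_robinRadial h1 h2,
      AdS.tendsto_robinField hodd hν hν1 hY, fun t' ρ' Ω' h0 h1 => ?_, fun t' Ω' => ?_⟩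
    · have hs := AdS.hasSum_robinField hodd hν hν1 hY t' h0 h1 Ω'
      exact ⟨hs.summable, hs.tsum_eq.trans (hrob t' ρ' Ω' h0.le h1)⟩
    -- The kernel is meaningful at ρ' = 0 and continuous there from the right; for ρ' > 0 it equals
    -- the field.
    · rw [← hrob t' 0 Ω' le_rfl (by positivity)]
      refine Tendsto.congr' ?_
        (((AdS.tendsto_contKernel_zero hd (by linarith : -1 < ν) hY.2.1 hY.2.2 t' Ω').const_mul
          (Real.cos γ : ℂ)).add
        ((AdS.tendsto_contKernel_zero hd (by linarith : -1 < -ν) hY.2.1 hY.2.2 t' Ω').const_mul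
          (Real.sin γ : ℂ)))
      filter_upwards [Ioo_mem_nhdsGT (by positivity : (0 : ℝ) < Real.pi / 2)] with ρ hρ
      exact (AdS.hasSum_robinField hodd hν hν1 hY t' hρ.1 hρ.2 Ω').tsum_eq.symm
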